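/- **Setting.** Let $f:(\mathbb C^d,0)\to(\mathbb C^d,0)$ be a holomorphic germ. It is *contracting* if every eigenvalue $\lambda$ of $df_0$ satisfies $|\lambda|<1$ ($\lambda=0$ allowed). Its generalized critical set is $\mathcal C_\infty(f)=\bigcup_{n\ge0}f^{-n}(\operatorname{crit} f)$, regarded as a germ at $0$. The germ $f$ is *rigid* if $\mathcal C_\infty(f)$ has simple normal crossings at $0$: it is the union of $q\ge 0$ irreducible components $W^k=\{w_k=0\}$, $1\le k\le q$, where the $w_k$ are holomorphic, $w_k(0)=0$, and $dw_1(0),\dots,dw_q(0)$ are linearly independent. Writing $f^*W^k=\sum_l a_l^kW^l$ with $a_l^k\in\mathbb N$, the *internal action* is the matrix $A=(a^k_l)\in M_q(\mathbb N)$; it is *injective* if it is injective on $\mathbb Z^q$. The component $W^k$ is *periodic* if $(f^*)^\eta W^k=W^k$ for some $\eta\ge1$. For a matrix $M=(m_l^k)\in M_{s\times p}(\mathbb N)$ and $x\in\mathbb C^s$, $x^M\in\mathbb C^p$ has $k$-th coordinate $\prod_l x_l^{m_l^k}$; products of vectors of the same length are taken coordinatewise. **Theorem.** (1) Let $f:(\mathbb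 C^d,0)\to(\mathbb C^d,0)$ be a contracting rigid germ with injective internal action. Let $s$ be the number of nonzero eigenvalues of $df_0$, counted with multiplicity, let $p$ be the number of non-periodic components of $\mathcal C_\infty(f)$, and suppose $s+p=d-1$. Then $f$ is analytically conjugate (by a local biholomorphism fixing $0$) to a map of the form $$F:(x,y,z)\mapsto\Big(\gamma x^P+\sigma(x),\ \beta x^Ey^D\big(1+g(x)\big),\ \nu x^ly^mz+\omega(x,y)\Big),\qquad x\in\mathbb C^s,\ y\in\mathbb C^p,\ z\in\mathbb C,$$ so that the last coordinate is affine in $z$, where, for some $0\le r\le s$ and with $x=(u,v)$, $u=(x_1,\dots,x_r)$, $v=(x_{r+1},\dots,x_s)$: * $\gamma\in(\mathbb C^*)^s$, $\beta\in(\mathbb C^*)^p$, $\nu\in\mathbb C^*$, and the eigenvalues of the linear map $x\mapsto\gamma x^P$ are the nonzero eigenvalues of $dF_0$ (equivalently, of $df_0$), counted with multiplicity; * $P=\begin{pmatrix}B&0\\0&\mathrm{Id}\end{pmatrix}\in M_s(\mathbb N)$ with $B$ an $r\times r$ permutation matrix; $E=\begin{pmatrix}C\\0\end{pmatrix}\in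 M_{s\times p}(\mathbb N)$ with $C\in M_{r\times p}(\mathbb N)$; $D\in M_p(\mathbb N)$ with $\det D\ne0$; and $(l,m)\in\mathbb N^s\times\mathbb N^p\setminus\{(0,0)\}$; * $\mathcal C_\infty(F)=\{u_1\cdots u_r\,y_1\cdots y_p=0\}$; in particular $\{y_1\cdots y_p=0\}\subseteq\mathcal C_\infty(F)\subseteq\{x_1\cdots x_s\,y_1\cdots y_p=0\}$; * $\sigma=(0,\rho):(\mathbb C^s,0)\to(\mathbb C^r\times\mathbb C^{s-r},0)$ is a polynomial map with only primary resonant monomials; * $g:(\mathbb C^s,0)\to(\mathbb C^p,0)$ is a polynomial map with only secondary resonant monomials; * $\omega:(\mathbb C^{d-1},0)\to(\mathbb C,0)$ is analytic. Here resonances are defined as follows. Let $\eta\ge1$ be the order of $P$, and let $\tau_i$ be the number such that the $\eta$-th iterate of $x\mapsto\gamma x^P$ is $x\mapsto(\tau_1x_1,\dots,\tau_sx_s)$ (so $\tau_i=\lambda_i^\eta$ for the vector $\lambda$ of nonzero eigenvalues, numbered compatibly with the cycles of $P$). A monomial $x^n$ in the $k$-th coordinate of $\sigma$ is *primary resonant*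 if $\tau^n=\tau_k$, i.e. $\lambda^{\eta n}=\lambda_k^\eta$; a monomial $x^n$ is *secondary resonant* if $\tau^n=\lambda^{\eta n}$ is an eigenvalue of $D^\eta$. (2) For $d\ge3$ one cannot in general take $\omega$ polynomial: for every $d\ge3$ there is a germ $f$ satisfying the hypotheses of (1) that is not analytically conjugate to any map $F$ as in (1) with $\omega$ polynomial. -/

import Mathlib

open Filter Topology

noncomputable section

/-! ### Holomorphic germs fixing the origin

A germ at `0` is represented by a total function; only its values near `0` matter. -/

section Germs

variable {E : Type*} [NormedAddCommGroup E] [NormedSpace ℂ E]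
variable {E' : Type*} [NormedAddCommGroup E'] [NormedSpace ℂ E']

/-- `f : (E, 0) → (E, 0)` is a contracting holomorphic germ: it is holomorphic at `0`, fixes `0`,
and every eigenvalue of `df₀` has modulus `< 1` (the eigenvalue `0` is allowed). -/
structure IsContractingGerm (f : E → E) : Prop where
  analytic : AnalyticAt ℂ f 0
  map_zero : f 0 = 0
  contracting : ∀ c : ℂ,
    Module.End.HasEigenvalue (fderiv ℂ f 0 : E →ₗ[ℂ] E) c → ‖c‖ < 1

/-- The critical set of `f`. -/
def critSet (f : E → E) : Set E :=
  {x | LinearMap.det (fderiv ℂ f x : E →ₗ[ℂ] E) = 0}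

/-- The generalized critical set `⋃ₙ f⁻ⁿ(crit f)`. For a contracting germ, `0` has arbitrarily
small forward invariant neighbourhoods, so the germ at `0` of this set depends only on the germ
of `f`. -/
def critInf (f : E → E) : Set E :=
  {x | ∃ n : ℕ, f^[n] x ∈ critSet f}

/-- The germ at `0` of the set `S` has simple normal crossings, with irreducible components
`W k = {w k = 0}`: the `w k` are holomorphic functions vanishing at `0` whose differentials at `0`
are linearly independent, and `S` is the union of the `W k` near `0`. (For `q = 0` the germ of `S`
is empty.) -/
structure IsSNC (S : Set E) {q : ℕ} (w : Fin q → E → ℂ) : Prop where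
  analytic : ∀ k, AnalyticAt ℂ (w k) 0
  map_zero : ∀ k, w k 0 = 0
  transverse : LinearIndependent ℂ (fun k => fderiv ℂ (w k) 0)
  eq_union : ∀ᶠ x in 𝓝 (0 : E), x ∈ S ↔ ∃ k, w k x = 0

/-- `f` is a contracting rigid germ, and `w` is a family of local equations of the irreducible
components of its generalized critical set. -/
structure IsContractingRigid (f : E → E) {q : ℕ} (w : Fin q → E → ℂ) : Prop where
  contracting : IsContractingGerm f
  rigid : IsSNC (critInf f) w

/-- The multiplicity of the divisor of the germ `φ` along the smooth hypersurface `{w = 0}`: the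
largest `n` such that `w ^ n` divides `φ` among germs of holomorphic functions. -/
def multAlong (w φ : E → ℂ) : ℕ :=
  sSup {n : ℕ | ∃ ψ : E → ℂ, AnalyticAt ℂ ψ 0 ∧ φ =ᶠ[𝓝 0] fun x => w x ^ n * ψ x}

/-- The internal action of `f`: the matrix `A = (a l k)` with `f^* W k = ∑ l, a l k • W l`. -/
def internalAction (f : E → E) {q : ℕ} (w : Fin q → E → ℂ) : Matrix (Fin q) (Fin q) ℕ :=
  fun l k => multAlong (w l) (w k ∘ f)

/-- The internal action of `f` is injective (as an endomorphism of `ℤ^q`). -/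
def HasInjectiveInternalAction (f : E → E) {q : ℕ} (w : Fin q → E → ℂ) : Prop :=
  Function.Injective ((internalAction f w).map (Nat.cast : ℕ → ℤ)).mulVec

/-- The component `W k` is periodic: `(f^*)^η W k = W k` for some `η ≥ 1`. -/
def IsPeriodicComponent (f : E → E) {q : ℕ} (w : Fin q → E → ℂ) (k : Fin q) : Prop :=
  ∃ η : ℕ, 0 < η ∧ (internalAction f w ^ η).mulVec (Pi.single k 1) = Pi.single k 1

/-- The number of non-periodic components of the generalized critical set. -/
def numNonPeriodic (f : E → E) {q : ℕ} (w : Fin q → E → ℂ) : ℕ :=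
  Nat.card {k : Fin q // ¬ IsPeriodicComponent f w k}

open Classical in
/-- The nonzero eigenvalues of `df₀`, counted with (algebraic) multiplicity. -/
def nonzeroEigenvalues [FiniteDimensional ℂ E] (f : E → E) : Multiset ℂ :=
  (LinearMap.charpoly (fderiv ℂ f 0 : E →ₗ[ℂ] E)).roots.filter (fun c => c ≠ 0)

/-- The germs `f` and `F` at `0` are analytically conjugate: `Φ ∘ f = F ∘ Φ` near `0` for a local
biholomorphism `Φ` with `Φ 0 = 0`. -/
def AnalyticallyConjugate (f : E → E) (F : E' → E') : Prop :=
  ∃ Φ : E → E', AnalyticAt ℂ Φ 0 ∧ Φ 0 = 0 ∧ Function.Bijective (fderiv ℂ Φ 0) ∧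
    Φ ∘ f =ᶠ[𝓝 0] F ∘ Φ

end Germs

/-! ### The normal form -/

/-- The monomial map `x ↦ x^M`, with `k`-th coordinate `∏ l, x l ^ M l k`. -/
def monomialMap {s p : ℕ} (M : Matrix (Fin s) (Fin p) ℕ) (x : Fin s → ℂ) : Fin p → ℂ :=
  fun k => ∏ l, x l ^ M l k

/-- The data of a map of the form
`(x, y, z) ↦ (γ x^P + σ(x), β x^E y^D (1 + g(x)), ν x^l y^m z + ω(x, y))`
on `ℂ^s × ℂ^p × ℂ`, with `σ` and `g` polynomial maps. The coordinates `x` are split as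
`x = (u, v)`, where `u` consists of the first `r` coordinates and `v` of the others. -/
structure AffineForm (s p : ℕ) where
  r : ℕ
  γ : Fin s → ℂ
  β : Fin p → ℂ
  ν : ℂ
  P : Matrix (Fin s) (Fin s) ℕ
  E : Matrix (Fin s) (Fin p) ℕ
  D : Matrix (Fin p) (Fin p) ℕ
  l : Fin s → ℕ
  m : Fin p → ℕ
  σ : Fin s → MvPolynomial (Fin s) ℂ
  g : Fin p → MvPolynomial (Fin s) ℂ
  ω : (Fin s → ℂ) × (Fin p → ℂ) → ℂ

namespace AffineForm

variable {s p : ℕ} (N : AffineForm s p)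

/-- The map `(x, y, z) ↦ (γ x^P + σ(x), β x^E y^D (1 + g(x)), ν x^l y^m z + ω(x, y))`. -/
def toMap (v : (Fin s → ℂ) × (Fin p → ℂ) × ℂ) : (Fin s → ℂ) × (Fin p → ℂ) × ℂ :=
  let x := v.1
  let y := v.2.1
  let z := v.2.2
  (fun k => N.γ k * monomialMap N.P x k + MvPolynomial.eval x (N.σ k),
    fun k => N.β k * monomialMap N.E x k * monomialMap N.D y k *
      (1 + MvPolynomial.eval x (N.g k)),
    N.ν * (∏ i, x i ^ N.l i) * (∏ j, y j ^ N.m j) * z + N.ω (x, y))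

/-- The matrix of the linear map `x ↦ γ x^P`, for a permutation matrix `P`. -/
def linMatrix : Matrix (Fin s) (Fin s) ℂ :=
  Matrix.diagonal N.γ * (N.P.map (Nat.cast : ℕ → ℂ)).transpose

/-- The order of the permutation matrix `P`. -/
def η : ℕ := orderOf N.P

/-- The `η`-th iterate of `x ↦ γ x^P` is the diagonal map `x i ↦ ev i * x i`. So `ev i` is the
`η`-th power of each of the eigenvalues of `x ↦ γ x^P` coming from the cycle of `P` containing
`i`; in other words `ev i = (λ i)^η`, where `λ` is the vector of eigenvalues of `x ↦ γ x^P`,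
numbered cycle by cycle as the coordinates. -/
def ev (i : Fin s) : ℂ := (N.linMatrix ^ N.η) i i

/-- `x^n` is primary resonant with respect to the `k`-th coordinate: `λ^(η n) = (λ k)^η`. -/
def IsPrimaryResonant (k : Fin s) (n : Fin s →₀ ℕ) : Prop :=
  ∏ i, N.ev i ^ n i = N.ev k

/-- `x^n` is secondary resonant: `λ^(η n)` is an eigenvalue of `D^η`. -/
def IsSecondaryResonant (n : Fin s →₀ ℕ) : Prop :=
  ∏ i, N.ev i ^ n i ∈ spectrum ℂ ((N.D ^ N.η).map (Nat.cast : ℕ → ℂ))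

/-- The conditions on the data of a normal form. -/
structure IsNormalForm : Prop where
  r_le : N.r ≤ s
  γ_ne : ∀ k, N.γ k ≠ 0
  β_ne : ∀ k, N.β k ≠ 0
  ν_ne : N.ν ≠ 0
  /-- `P` is a permutation matrix -/
  P_perm : ∃ π : Equiv.Perm (Fin s), N.P = π.permMatrix ℕ
  /-- `P` acts trivially on the coordinates `v`: it is block diagonal with blocks `B` and `1` -/
  P_v : ∀ i : Fin s, N.r ≤ (i : ℕ) → N.P i i = 1
  /-- `x^E` involves only the coordinates `u`: `E` consists of a block `C` above a zero block -/
  E_v : ∀ i : Fin s, N.r ≤ (i : ℕ) → ∀ k, N.E i k = 0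
  det_D : (N.D.map (Nat.cast : ℕ → ℤ)).det ≠ 0
  lm_ne : (N.l, N.m) ≠ (0, 0)
  /-- the eigenvalues of `x ↦ γ x^P` are the nonzero eigenvalues of the differential at `0` -/
  eigenvalues : nonzeroEigenvalues N.toMap = N.linMatrix.charpoly.roots
  /-- the generalized critical set is `{u₁ ⋯ u_r y₁ ⋯ y_p = 0}` -/
  critInf_eq : ∀ᶠ v in 𝓝 (0 : (Fin s → ℂ) × (Fin p → ℂ) × ℂ),
    v ∈ critInf N.toMap ↔ (∃ i : Fin s, (i : ℕ) < N.r ∧ v.1 i = 0) ∨ ∃ k, v.2.1 k = 0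
  /-- `σ = (0, ρ)` vanishes in the coordinates `u` -/
  σ_u : ∀ k : Fin s, (k : ℕ) < N.r → N.σ k = 0
  σ_zero : ∀ k, MvPolynomial.constantCoeff (N.σ k) = 0
  σ_resonant : ∀ k, ∀ n ∈ (N.σ k).support, N.IsPrimaryResonant k n
  g_zero : ∀ k, MvPolynomial.constantCoeff (N.g k) = 0
  g_resonant : ∀ k, ∀ n ∈ (N.g k).support, N.IsSecondaryResonant n
  ω_analytic : AnalyticAt ℂ N.ω 0
  ω_zero : N.ω 0 = 0

/-- `ω` is (the germ of) a polynomial in `(x, y)`. -/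
def PolynomialTail : Prop :=
  ∃ Q : MvPolynomial (Fin s ⊕ Fin p) ℂ,
    N.ω =ᶠ[𝓝 0] fun v => MvPolynomial.eval (Sum.elim v.1 v.2) Q

end AffineForm

end

open scoped Pointwise

/-! ### Osgood's lemma through the Cauchy integral on a polydisc -/

section Osgood

open MeasureTheory Metric

variable {F : Type*} [NormedAddCommGroup F] [NormedSpace ℂ F] [CompleteSpace F]

/-! Part (1) rests on one analytic fact. A contracting germ shrinks a neighbourhood of `0` at a
geometric rate `Λ`, so the operator `g ↦ g ∘ f - M g` is bijective on germs vanishing to order `N`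
as soon as `‖M⁻¹‖ Λ^N < 1`: injective by iteration (`ContractsAtRate.eq_zero_of_comp_eq`),
surjective by a Neumann series (`ContractsAtRate.exists_comp_eq`), whose sum is analytic by Osgood's
lemma. Each cohomological equation is thereby reduced to finitely many Taylor coefficients, and
resonances are the obstructions met there.

The coordinates of the normal form have several sources. The set `C_∞` is backward invariant, so the
zeros of `w_k ∘ f` lie in it and `w_k ∘ f` is a unit times a monomial in the `w_l`. Injectivity of
the internal action forces it to permute the periodic components, and multiplying their equations by
suitable units makes the unit factors constant: this gives `u`. On the cotangent space, the
transpose of `df₀` permutes the differentials of the periodic components up to nonzero constants and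
is nilpotent on those of the non-periodic ones. The other forms with nonzero eigenvalues lift to
generalized eigenfunctions of the `η`-th iterate, which are the `v`. Composition with `f` commutes
with composition with its iterate, so it preserves generalized eigenfunctions and their eigenvalues;
by `exists_resonant_polynomial` the result is a polynomial in `x` with resonant monomials only.
Finally, in the coordinates `y_j = w_j exp φ_j` the units obey an additive equation twisted by `D`;
what cannot be solved away has the form `log (1 + g(x))` with `g` secondary resonant
(`exists_secondary_normal_form`).

Since `s + p = d - 1`, one coordinate `z` is left. The `x` and `y` components do not involve it, so
wherever the `z`-derivative of the last component vanishes the germ is critical; this derivative is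
thus a unit `U` times a monomial `μ` in `x` and `y`. Solve `U · (G ∘ F) = U(0) · G` and let `ζ` be
the primitive of `G` in the direction `z`. Then `ζ ∘ F - U(0) μ ζ` has zero `z`-derivative: it is
`ω(x, y)`, and the map is affine in `ζ` (`SemiNormalForm.exists_last_coordinate`).

For part (2) take `(z, y) ↦ (y₁ z + y₂² sin y₂, y²)`, squares being coordinatewise. Conjugacies from
it to a normal form are very rigid: comparing multiplicities along the coordinate hyperplanes and
using contraction, the `y` coordinates are permuted up to constants
(`sineGerm.exists_base_coordinates`) and the last one becomes `K z + b(y)` with `K ≠ 0`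
(`sineGerm.exists_last_coordinate`). On the axis `y = (0, t, 0, …)`, `z = 0`, the conjugacy shows
that `ω` equals `K t² sin t + b(t²)`. The odd part in `t` is `K t² sin t`, so `ω` is not a
polynomial. -/

lemma torusMap_mem_closedBall {n : ℕ} {r : ℝ} (hr : 0 ≤ r) (θ : Fin n → ℝ) :
    torusMap 0 (fun _ => r) θ ∈ closedBall (0 : Fin n → ℂ) r := by
  rw [mem_closedBall_zero_iff, pi_norm_le_iff_of_nonneg hr]
  intro i
  simp [torusMap, Complex.norm_exp_ofReal_mul_I, abs_of_nonneg hr]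

lemma torusMap_sub_ne {n : ℕ} {r : ℝ} (hr : 0 < r) {z : Fin n → ℂ} (hz : z ∈ ball 0 r)
    (θ : Fin n → ℝ) (i : Fin n) : torusMap 0 (fun _ => r) θ i - z i ≠ 0 := by
  intro h
  have h1 : ‖z i‖ = r := by
    rw [← sub_eq_zero.1 h]
    simp [torusMap, Complex.norm_exp_ofReal_mul_I, abs_of_pos hr]
  have h2 : ‖z i‖ < r := (norm_le_pi_norm z i).trans_lt (mem_ball_zero_iff.1 hz)
  linarith

lemma continuous_torusMap {n : ℕ} {r : ℝ} :
    Continuous (torusMap (0 : Fin n → ℂ) (fun _ => r)) := by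
  unfold torusMap; fun_prop

/-- The iterated Cauchy integral formula on a polydisc. -/
theorem torusIntegral_cauchy {r : ℝ} (hr : 0 < r) : ∀ {n : ℕ} {f : (Fin n → ℂ) → F},
    ContinuousOn f (closedBall 0 r) →
    (∀ x ∈ closedBall (0 : Fin n → ℂ) r, ∀ i,
      DifferentiableOn ℂ (fun t => f (Function.update x i t)) (ball 0 r)) →
    ∀ {z : Fin n → ℂ}, z ∈ ball 0 r →
    torusIntegral (fun ζ => (∏ i, (ζ i - z i)⁻¹) • f ζ) 0 (fun _ => r) =
      ((2 * Real.pi * Complex.I : ℂ) ^ n) • f z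
  | 0, f, _, _, z, _ => by
    simp [Subsingleton.elim z 0]
  | n + 1, f, hc, hd, z, hz => by
    have hcons : ∀ (x : ℂ) (y : Fin n → ℂ), ‖x‖ ≤ r → ‖y‖ ≤ r →
        (Fin.cons x y : Fin (n + 1) → ℂ) ∈ closedBall (0 : Fin (n + 1) → ℂ) r := by
      intro x y hx hy
      rw [mem_closedBall_zero_iff, pi_norm_le_iff_of_nonneg hr.le]
      intro i
      refine Fin.cases ?_ (fun j => ?_) i
      · simpa using hx
      · simpa using (norm_le_pi_norm y j).trans hy
    have hint : TorusIntegrable (fun ζ => (∏ i, (ζ i - z i)⁻¹) • f ζ) 0 (fun _ => r) := by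
      refine ContinuousOn.integrableOn_compact isCompact_Icc (Continuous.continuousOn ?_)
      refine Continuous.smul (continuous_finsetProd _ fun i _ => ?_) ?_
      · exact Continuous.inv₀
          (((continuous_apply i).comp continuous_torusMap).sub continuous_const)
          fun θ => torusMap_sub_ne hr hz θ i
      · exact hc.comp_continuous continuous_torusMap fun θ => torusMap_mem_closedBall hr.le θ
    have hz0 : ‖z 0‖ < r := (norm_le_pi_norm z 0).trans_lt (mem_ball_zero_iff.1 hz)
    have hz' : (fun i => z (Fin.succ i)) ∈ ball (0 : Fin n → ℂ) r := by
      rw [mem_ball_zero_iff, pi_norm_lt_iff hr]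
      exact fun i => (norm_le_pi_norm z _).trans_lt (mem_ball_zero_iff.1 hz)
    rw [torusIntegral_succ hint]
    -- The integral over the last `n` circles is given by induction, with the first variable frozen
    -- on its circle. What remains is Cauchy's formula in one variable.
    have key : ∀ x ∈ sphere (0 : ℂ) r,
        (torusIntegral (fun y : Fin n → ℂ =>
          (∏ i, ((Fin.cons x y : Fin (n + 1) → ℂ) i - z i)⁻¹) • f (Fin.cons x y))
          ((0 : Fin (n + 1) → ℂ) ∘ Fin.succ) ((fun _ => r) ∘ Fin.succ)) =
        (x - z 0)⁻¹ • (((2 * Real.pi * Complex.I : ℂ) ^ n) •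
          f (Fin.cons x fun i => z (Fin.succ i))) := by
      intro x hx
      have hx' : ‖x‖ ≤ r := (mem_sphere_zero_iff_norm.1 hx).le
      have IH := torusIntegral_cauchy hr (n := n) (f := fun y => f (Fin.cons x y))
        (z := fun i => z (Fin.succ i)) ?_ ?_ hz'
      · rw [← IH, ← torusIntegral_smul]
        simp only [Fin.prod_univ_succ, smul_smul, Function.comp_def, Fin.cons_zero, Fin.cons_succ]
        rfl
      · refine hc.comp (Continuous.continuousOn ?_) fun y hy =>
          hcons x y hx' (mem_closedBall_zero_iff.1 hy)
        exact Continuous.finCons continuous_const continuous_id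
      · intro y hy i
        have := hd (Fin.cons x y) (hcons x y hx' (mem_closedBall_zero_iff.1 hy)) i.succ
        simpa [Fin.cons_update] using this
    have h1 := circleIntegral.integral_congr (c := 0) hr.le key
    simp only [Pi.zero_apply] at h1 ⊢
    rw [h1]
    have hz0c : z 0 ∈ ball (0 : ℂ) r := mem_ball_zero_iff.2 hz0
    have hdc : DiffContOnCl ℂ (fun x => f (Fin.cons x fun i => z (Fin.succ i))) (ball 0 r) := by
      refine ⟨?_, ?_⟩
      · have := hd z (ball_subset_closedBall hz) 0
        have e : ∀ t : ℂ, Function.update z 0 t = Fin.cons t fun i => z (Fin.succ i) := by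
          intro t
          rw [← Fin.cons_self_tail z, Fin.update_cons_zero]
          rfl
        simpa [e] using this
      · rw [closure_ball _ hr.ne']
        refine hc.comp (Continuous.continuousOn ?_) fun x hx =>
          hcons x _ (mem_closedBall_zero_iff.1 hx) (mem_ball_zero_iff.1 hz').le
        exact Continuous.finCons continuous_id continuous_const
    have h2 := hdc.circleIntegral_sub_inv_smul hz0c
    simp only [smul_comm _ (((2 * Real.pi * Complex.I : ℂ) ^ n))]
    rw [circleIntegral.integral_smul, h2, smul_smul, pow_succ]
    congr 2
    exact Fin.cons_self_tail z

/-- **Osgood's lemma** at the centre of a polydisc. -/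
theorem analyticAt_of_separately {n : ℕ} {f : (Fin n → ℂ) → F} {r : ℝ} (hr : 0 < r)
    (hc : ContinuousOn f (closedBall 0 r))
    (hd : ∀ x ∈ closedBall (0 : Fin n → ℂ) r, ∀ i,
      DifferentiableOn ℂ (fun t => f (Function.update x i t)) (ball 0 r)) :
    AnalyticAt ℂ f 0 := by
  -- The Cauchy kernel is viewed as a map `k` into the Banach algebra of continuous functions on the
  -- parameter cube `K` of the torus. It is analytic because inversion is analytic at units, and
  -- integration against the boundary values of `f` is a bounded linear functional `ℓ`. So `f` is a
  -- constant times `ℓ ∘ k`, and no power series has to be expanded.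
  let K : Type := Set.Icc (0 : Fin n → ℝ) (fun _ => 2 * Real.pi)
  let ζ : Fin n → C(K, ℂ) := fun i =>
    ⟨fun θ => torusMap 0 (fun _ => r) θ.1 i,
      (continuous_apply i).comp (continuous_torusMap.comp continuous_subtype_val)⟩
  let k : (Fin n → ℂ) → C(K, ℂ) := fun z =>
    ∏ i, Ring.inverse (ζ i - algebraMap ℂ C(K, ℂ) (z i))
  have hunit : ∀ z ∈ ball (0 : Fin n → ℂ) r, ∀ i,
      IsUnit (ζ i - algebraMap ℂ C(K, ℂ) (z i)) := by
    intro z hz i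
    rw [ContinuousMap.isUnit_iff_forall_ne_zero]
    exact fun θ => torusMap_sub_ne hr hz θ.1 i
  have h0 : (0 : Fin n → ℂ) ∈ ball (0 : Fin n → ℂ) r := mem_ball_self hr
  have hk : AnalyticAt ℂ k 0 := by
    refine Finset.analyticAt_fun_prod _ fun i _ => ?_
    obtain ⟨u, hu⟩ := hunit 0 h0 i
    have h1 : AnalyticAt ℂ (fun z : Fin n → ℂ => ζ i - algebraMap ℂ C(K, ℂ) (z i)) 0 := by
      refine analyticAt_const.sub ?_
      exact ((Algebra.linearMap ℂ C(K, ℂ)).toContinuousLinearMap.comp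
        (ContinuousLinearMap.proj (R := ℂ) (φ := fun _ : Fin n => ℂ) i)).analyticAt 0
    exact AnalyticAt.comp (g := Ring.inverse) (hu ▸ analyticAt_inverse u) h1
  have hkval : ∀ z ∈ ball (0 : Fin n → ℂ) r, ∀ θ : K,
      k z θ = ∏ i, (torusMap 0 (fun _ => r) θ.1 i - z i)⁻¹ := by
    intro z hz θ
    simp only [k, ContinuousMap.coe_prod, Finset.prod_apply]
    refine Finset.prod_congr rfl fun i _ => ?_
    have h1 := Ring.mul_inverse_cancel _ (hunit z hz i)
    have h2 := congrArg (fun g : C(K, ℂ) => g θ) h1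
    exact eq_inv_of_mul_eq_one_right h2
  let w : K → F := fun θ => (∏ i : Fin n, (r * Complex.exp (θ.1 i * Complex.I) * Complex.I : ℂ)) •
    f (torusMap 0 (fun _ => r) θ.1)
  have hw : Continuous w := by
    refine Continuous.smul ?_ ?_
    · refine continuous_finsetProd _ fun i _ => ?_
      have h1 : Continuous fun θ : K => θ.1 i := (continuous_apply i).comp continuous_subtype_val
      exact (continuous_const.mul (Complex.continuous_exp.comp
        ((Complex.continuous_ofReal.comp h1).mul continuous_const))).mul continuous_const
    · exact hc.comp_continuous (continuous_torusMap.comp continuous_subtype_val)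
        fun θ => torusMap_mem_closedBall hr.le θ.1
  obtain ⟨C, hC⟩ : ∃ C, ∀ θ : K, ‖w θ‖ ≤ C := by
    obtain ⟨C, hC⟩ := (isCompact_range hw).isBounded.exists_norm_le
    exact ⟨C, fun θ => hC _ ⟨θ, rfl⟩⟩
  let μ : Measure K := Measure.comap Subtype.val volume
  have hμ : IsFiniteMeasure μ := by
    constructor
    rw [Measure.comap_apply _ Subtype.val_injective (fun s hs =>
      measurableSet_Icc.subtype_image hs) _ MeasurableSet.univ]
    rw [Set.image_univ, Subtype.range_coe]
    exact isCompact_Icc.measure_lt_top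
  have hintk : ∀ g : C(K, ℂ), Integrable (fun θ => g θ • w θ) μ := fun g => by
    have : Continuous fun θ => g θ • w θ := g.continuous.smul hw
    obtain ⟨C', hC'⟩ := (isCompact_range this).isBounded.exists_norm_le
    exact Integrable.of_bound this.aestronglyMeasurable C' (ae_of_all _ fun θ => hC' _ ⟨θ, rfl⟩)
  let ℓ : C(K, ℂ) →L[ℂ] F := LinearMap.mkContinuous
    { toFun := fun g => ∫ θ, g θ • w θ ∂μ
      map_add' := fun g h => by
        simp only [ContinuousMap.add_apply, add_smul]
        exact integral_add (hintk g) (hintk h)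
      map_smul' := fun c g => by
        simp only [ContinuousMap.smul_apply, smul_assoc, integral_smul, RingHom.id_apply] }
    (C * μ.real Set.univ) (fun g => by
      refine (norm_integral_le_of_norm_le_const (C := ‖g‖ * C) (ae_of_all _ fun θ => ?_)).trans_eq
        (by ring)
      rw [norm_smul]
      exact mul_le_mul (g.norm_coe_le_norm θ) (hC θ) (norm_nonneg _) (norm_nonneg _))
  have hfin : f =ᶠ[𝓝 0] fun z => ((2 * Real.pi * Complex.I : ℂ) ^ n)⁻¹ • ℓ (k z) := by
    filter_upwards [ball_mem_nhds (0 : Fin n → ℂ) hr] with z hz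
    have h1 := torusIntegral_cauchy hr hc hd hz
    have hpi : ((2 * Real.pi * Complex.I : ℂ) ^ n) ≠ 0 := pow_ne_zero _ Complex.two_pi_I_ne_zero
    rw [eq_inv_smul_iff₀ hpi, ← h1]
    change _ = ∫ θ, k z θ • w θ ∂μ
    rw [torusIntegral, ← integral_subtype_comap measurableSet_Icc]
    refine integral_congr_ae (ae_of_all _ fun θ => ?_)
    simp only [hkval z hz θ, w]
    rw [smul_comm]
  refine AnalyticAt.congr ?_ hfin.symm
  exact ((ℓ.analyticAt _).comp hk).const_smul

/-- **Osgood's lemma**: a continuous function on a neighbourhood of `0` which is complex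
differentiable along every complex line is analytic at `0`. -/
theorem analyticAt_of_lines {E : Type*} [NormedAddCommGroup E] [NormedSpace ℂ E]
    [FiniteDimensional ℂ E] {f : E → F} {s : Set E} (hs : s ∈ 𝓝 (0 : E)) (hc : ContinuousOn f s)
    (hd : ∀ x ∈ s, ∀ v, DifferentiableAt ℂ (fun t : ℂ => f (x + t • v)) 0) : AnalyticAt ℂ f 0 := by
  let e : E ≃L[ℂ] (Fin (Module.finrank ℂ E) → ℂ) :=
    ContinuousLinearEquiv.ofFinrankEq (by simp)
  have hs' : e.symm ⁻¹' s ∈ 𝓝 (0 : Fin (Module.finrank ℂ E) → ℂ) :=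
    e.symm.continuous.continuousAt.preimage_mem_nhds (by simpa using hs)
  obtain ⟨r, hr, hrs⟩ := nhds_basis_closedBall.mem_iff.1 hs'
  have h : AnalyticAt ℂ (fun x => f (e.symm x)) 0 := by
    refine analyticAt_of_separately hr
      (hc.comp e.symm.continuous.continuousOn fun x hx => hrs hx) ?_
    intro x hx i t ht
    have hmem : Function.update x i t ∈ closedBall (0 : Fin (Module.finrank ℂ E) → ℂ) r := by
      rw [mem_closedBall_zero_iff, pi_norm_le_iff_of_nonneg hr.le]
      intro j
      rcases eq_or_ne j i with rfl | hj
      · simpa using (mem_ball_zero_iff.1 ht).le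
      · simpa [hj] using (norm_le_pi_norm x j).trans (mem_closedBall_zero_iff.1 hx)
    have h1 := hd (e.symm (Function.update x i t)) (hrs hmem) (e.symm (Pi.single i 1))
    refine DifferentiableAt.differentiableWithinAt ?_
    have h2 : (fun t' => f (e.symm (Function.update x i t'))) = (fun τ : ℂ =>
        f (e.symm (Function.update x i t) + τ • e.symm (Pi.single i 1))) ∘ fun t' => t' - t := by
      funext t'
      simp only [Function.comp]
      congr 1
      rw [← map_smul, ← map_add]
      congr 1
      ext j
      rcases eq_or_ne j i with rfl | hj <;> simp [*]
    rw [h2]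
    refine DifferentiableAt.comp t ?_ (by fun_prop)
    simpa using h1
  have h3 := AnalyticAt.comp (g := fun x => f (e.symm x)) (f := e.toContinuousLinearMap) (x := 0) (by simpa using h)
    (e.toContinuousLinearMap.analyticAt 0)
  simpa [Function.comp_def] using h3

end Osgood

/-! ### Analyticity from differentiability; averages of germs -/

section Analytic

open MeasureTheory Metric

variable {E : Type*} [NormedAddCommGroup E] [NormedSpace ℂ E] [FiniteDimensional ℂ E]
variable {F : Type*} [NormedAddCommGroup F] [NormedSpace ℂ F] [CompleteSpace F]

/-- Differentiability near `0` gives both continuity and differentiability along complex lines,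
which is what Osgood's lemma needs. -/
theorem analyticAt_of_eventually_differentiableAt {f : E → F}
    (h : ∀ᶠ x in 𝓝 (0 : E), DifferentiableAt ℂ f x) : AnalyticAt ℂ f 0 := by
  refine analyticAt_of_lines h (fun x hx => (DifferentiableAt.continuousAt hx).continuousWithinAt) ?_
  intro x hx v
  refine DifferentiableAt.comp (0 : ℂ) (g := f) ?_ (by fun_prop)
  simpa using hx

/-- Averages of an analytic germ along a continuous path of linear substitutions are analytic. -/
theorem analyticAt_integral_comp_linear {G : E → F} (hG : AnalyticAt ℂ G 0) {L : ℝ → E →L[ℂ] E}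
    (hL : Continuous L) : AnalyticAt ℂ (fun x => ∫ t in (0 : ℝ)..1, G (L t x)) 0 := by
  have : ProperSpace E := FiniteDimensional.proper ℂ E
  obtain ⟨R, hR, hGR⟩ := hG.exists_ball_analyticOnNhd
  obtain ⟨B, hB⟩ := isCompact_uIcc.exists_bound_of_continuousOn (s := Set.uIcc (0 : ℝ) 1) hL.continuousOn
  have hfd : ContinuousOn (fderiv ℂ G) (ball 0 R) := hGR.fderiv.continuousOn
  obtain ⟨K, hK⟩ := (isCompact_closedBall (0 : E) (R / 2)).exists_bound_of_continuousOn
    (hfd.mono (closedBall_subset_ball (by linarith)))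
  set B' := max B 1
  have hB' : 0 < B' := by positivity
  -- The radius keeps every `L t x` in a compact ball on which the derivative of `G` is bounded, so
  -- that differentiation under the integral sign is dominated by a constant.
  have hmem : ∀ t ∈ Set.uIcc (0 : ℝ) 1, ∀ x ∈ ball (0 : E) (R / 2 / B'),
      L t x ∈ closedBall (0 : E) (R / 2) := by
    intro t ht x hx
    rw [mem_closedBall_zero_iff]
    refine ((L t).le_opNorm x).trans ?_
    have h1 : ‖L t‖ ≤ B' := (hB t ht).trans (le_max_left _ _)
    have h2 := (mem_ball_zero_iff.1 hx).le
    calc ‖L t‖ * ‖x‖ ≤ B' * (R / 2 / B') := by gcongr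
      _ = R / 2 := by field_simp
  have hsub : closedBall (0 : E) (R / 2) ⊆ ball 0 R := closedBall_subset_ball (by linarith)
  have hr : 0 < R / 2 / B' := by positivity
  have hcont : ∀ x ∈ ball (0 : E) (R / 2 / B'),
      ContinuousOn (fun t => G (L t x)) (Set.uIcc (0 : ℝ) 1) := by
    intro x hx
    refine hGR.continuousOn.comp (hL.clm_apply continuous_const).continuousOn fun t ht =>
      hsub (hmem t ht x hx)
  refine analyticAt_of_eventually_differentiableAt ?_
  filter_upwards [ball_mem_nhds (0 : E) hr] with x₀ hx₀
  refine (intervalIntegral.hasFDerivAt_integral_of_dominated_of_fderiv_le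
    (F := fun x t => G (L t x)) (F' := fun x t => (fderiv ℂ G (L t x)).comp (L t))
    (bound := fun _ => K * B') (isOpen_ball.mem_nhds hx₀) ?_ ?_ ?_ ?_ ?_ ?_).differentiableAt
  · filter_upwards [isOpen_ball.mem_nhds hx₀] with x hx
    exact ((hcont x hx).mono Set.uIoc_subset_uIcc).aestronglyMeasurable measurableSet_uIoc
  · exact (hcont x₀ hx₀).intervalIntegrable
  · have : ContinuousOn (fun t => (fderiv ℂ G (L t x₀)).comp (L t)) (Set.uIcc (0 : ℝ) 1) :=
      (hfd.comp (hL.clm_apply continuous_const).continuousOn fun t ht =>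
        hsub (hmem t ht x₀ hx₀)).clm_comp hL.continuousOn
    exact (this.mono Set.uIoc_subset_uIcc).aestronglyMeasurable measurableSet_uIoc
  · refine ae_of_all _ fun t ht x hx => ?_
    have ht' := Set.uIoc_subset_uIcc ht
    refine (ContinuousLinearMap.opNorm_comp_le _ _).trans ?_
    exact mul_le_mul (hK _ (hmem t ht' x hx)) ((hB t ht').trans (le_max_left _ _)) (norm_nonneg _)
      ((norm_nonneg _).trans (hK _ (hmem t ht' x hx)))
  · exact intervalIntegrable_const
  · refine ae_of_all _ fun t ht x hx => ?_
    have ht' := Set.uIoc_subset_uIcc ht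
    exact ((hGR _ (hsub (hmem t ht' x hx))).differentiableAt.hasFDerivAt).comp x (L t).hasFDerivAt

end Analytic

/-! ### Geometric contraction and the operator `g ↦ g ∘ f - M g` -/

section Contraction

open Metric

variable {E : Type*} [NormedAddCommGroup E] [NormedSpace ℂ E] [FiniteDimensional ℂ E]
variable {F : Type*} [NormedAddCommGroup F] [NormedSpace ℂ F] [CompleteSpace F]

/-- By Gelfand's formula the norms of the powers decay geometrically, since the spectral radius is
less than `1`. The value `1 / 4` leaves room below the factor `1 / 2` wanted for the nonlinear
iterate. -/
lemma exists_norm_pow_le_of_eigenvalues {A : E →L[ℂ] E}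
    (h : ∀ c : ℂ, Module.End.HasEigenvalue (A : E →ₗ[ℂ] E) c → ‖c‖ < 1) :
    ∃ m : ℕ, 0 < m ∧ ‖A ^ m‖ ≤ 1 / 4 := by
  rcases subsingleton_or_nontrivial E with hE | hE
  · refine ⟨1, one_pos, ?_⟩
    rw [Subsingleton.elim (A ^ 1) 0]; norm_num
  have : CompleteSpace E := FiniteDimensional.complete ℂ E
  have hspec : ∀ c ∈ spectrum ℂ A, ‖c‖₊ < 1 := by
    intro c hc
    have h1 : c ∈ spectrum ℂ (A : E →ₗ[ℂ] E) := by
      have := AlgEquiv.spectrum_eq (Module.End.toContinuousLinearMap (𝕜 := ℂ) E) (A : E →ₗ[ℂ] E)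
      rw [← this]
      exact hc
    exact_mod_cast h c (Module.End.hasEigenvalue_iff_mem_spectrum.2 h1)
  have hr : spectralRadius ℂ A < 1 := by
    simpa using spectrum.spectralRadius_lt_of_forall_lt_of_nonempty (spectrum.nonempty A) hspec
  obtain ⟨ρ, hρ1, hρ2⟩ := ENNReal.lt_iff_exists_nnreal_btwn.1 hr
  have hlim := spectrum.pow_nnnorm_pow_one_div_tendsto_nhds_spectralRadius A
  have hev := hlim.eventually (gt_mem_nhds hρ1)
  have hρ3 : (ρ : ℝ) < 1 := by exact_mod_cast hρ2
  have hpow : ∀ᶠ n : ℕ in atTop, (ρ : ℝ) ^ n < 1 / 4 :=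
    (tendsto_pow_atTop_nhds_zero_of_lt_one ρ.2 hρ3).eventually (gt_mem_nhds (by norm_num))
  obtain ⟨m, h1, h2, h3⟩ := (hev.and (hpow.and (eventually_gt_atTop 0))).exists
  refine ⟨m, h3, le_trans ?_ h2.le⟩
  have h4 : (‖A ^ m‖₊ : ENNReal) ≤ (ρ : ENNReal) ^ m := by
    have := ENNReal.rpow_le_rpow h1.le (z := (m : ℝ)) (by positivity)
    rw [← ENNReal.rpow_mul, one_div, inv_mul_cancel₀ (by positivity), ENNReal.rpow_one,
      ENNReal.rpow_natCast] at this
    exact this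
  have h5 : ‖A ^ m‖₊ ≤ ρ ^ m := by exact_mod_cast h4
  exact_mod_cast h5

/-- The iterates of `f` contract a neighbourhood of `0` at the geometric rate `Λ`. -/
structure ContractsAtRate {E : Type*} [NormedAddCommGroup E] (f : E → E) (C Λ : ℝ) : Prop where
  C_pos : 0 < C
  rate_pos : 0 < Λ
  rate_lt : Λ < 1
  bound : ∀ s ∈ 𝓝 (0 : E), ∃ r > 0, ∀ x ∈ ball (0 : E) r, ∀ n : ℕ,
    f^[n] x ∈ s ∧ ‖f^[n] x‖ ≤ C * Λ ^ n * ‖x‖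

omit [FiniteDimensional ℂ E] in
lemma eventually_norm_le_of_hasFDerivAt {g : E → E} {A : E →L[ℂ] E} (hg : HasFDerivAt g A 0)
    (h0 : g 0 = 0) {K : ℝ} (hK : ‖A‖ < K) : ∀ᶠ x in 𝓝 (0 : E), ‖g x‖ ≤ K * ‖x‖ := by
  have h1 := (hasFDerivAt_iff_isLittleO_nhds_zero.1 hg).bound (sub_pos.2 hK)
  filter_upwards [h1] with x hx
  simp only [zero_add, h0, sub_zero] at hx
  calc ‖g x‖ = ‖(g x - A x) + A x‖ := by simp
    _ ≤ ‖g x - A x‖ + ‖A x‖ := norm_add_le _ _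
    _ ≤ (K - ‖A‖) * ‖x‖ + ‖A‖ * ‖x‖ := add_le_add hx (A.le_opNorm x)
    _ = K * ‖x‖ := by ring

omit [FiniteDimensional ℂ E] in
lemma hasFDerivAt_iterate_zero {f : E → E} {A : E →L[ℂ] E} (hf : HasFDerivAt f A 0)
    (h0 : f 0 = 0) (n : ℕ) : HasFDerivAt f^[n] (A ^ n) 0 := by
  simpa using HasFDerivAt.iterate (x := (0 : E)) hf h0 n

/-- Some iterate `f^[m]` halves norms near `0`, and the iterates before it lose at most a factor
`K`. Hence `Λ` is the `m`-th root of `1 / 2`, and the `2` in the constant `2 * K` pays for the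
incomplete block of length `n % m`. -/
theorem IsContractingGerm.exists_contractsAtRate {f : E → E} (hf : IsContractingGerm f) :
    ∃ C Λ, ContractsAtRate f C Λ := by
  set A := fderiv ℂ f 0
  have hA : HasFDerivAt f A 0 := hf.analytic.differentiableAt.hasFDerivAt
  have hit : ∀ n, f^[n] 0 = 0 := fun n => Function.iterate_fixed hf.map_zero n
  obtain ⟨m, hm, hAm⟩ := exists_norm_pow_le_of_eigenvalues hf.contracting
  have h1 : ∀ᶠ x in 𝓝 (0 : E), ‖f^[m] x‖ ≤ 1 / 2 * ‖x‖ :=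
    eventually_norm_le_of_hasFDerivAt (hasFDerivAt_iterate_zero hA hf.map_zero m) (hit m)
      (by linarith)
  set K : ℝ := ∑ j ∈ Finset.range m, ‖A ^ j‖ + 1
  have hK : ∀ j < m, ‖A ^ j‖ < K := by
    intro j hj
    have := Finset.single_le_sum (f := fun j => ‖A ^ j‖) (fun i _ => norm_nonneg _)
      (Finset.mem_range.2 hj)
    simp only [K]
    linarith
  have hKpos : 0 < K := (norm_nonneg _).trans_lt (hK 0 hm)
  have h2 : ∀ᶠ x in 𝓝 (0 : E), ∀ j < m, ‖f^[j] x‖ ≤ K * ‖x‖ := by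
    have : ∀ᶠ x in 𝓝 (0 : E), ∀ j ∈ Finset.range m, ‖f^[j] x‖ ≤ K * ‖x‖ := by
      rw [eventually_all_finset]
      intro j hj
      exact eventually_norm_le_of_hasFDerivAt (hasFDerivAt_iterate_zero hA hf.map_zero j) (hit j)
        (hK j (Finset.mem_range.1 hj))
    simpa using this
  obtain ⟨r₀, hr₀, hball⟩ := eventually_nhds_iff_ball.1 (h1.and h2)
  set Λ : ℝ := (1 / 2 : ℝ) ^ (1 / m : ℝ)
  have hm' : (m : ℝ) ≠ 0 := by positivity
  have hΛm : Λ ^ m = 1 / 2 := by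
    rw [← Real.rpow_natCast, ← Real.rpow_mul (by norm_num), one_div_mul_cancel hm', Real.rpow_one]
  have hΛ0 : 0 < Λ := by positivity
  have hΛ1 : Λ < 1 := Real.rpow_lt_one (by norm_num) (by norm_num) (by positivity)
  have hq : ∀ x ∈ ball (0 : E) r₀, ∀ q : ℕ, ‖f^[m * q] x‖ ≤ (1 / 2) ^ q * ‖x‖ := by
    intro x hx q
    induction q with
    | zero => simp
    | succ q ih =>
      have hmem : f^[m * q] x ∈ ball (0 : E) r₀ := by
        rw [mem_ball_zero_iff] at hx ⊢
        refine ih.trans_lt (lt_of_le_of_lt ?_ hx)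
        exact mul_le_of_le_one_left (norm_nonneg _) (pow_le_one₀ (by norm_num) (by norm_num))
      rw [Nat.mul_succ, Nat.add_comm, Function.iterate_add_apply]
      calc _ ≤ 1 / 2 * ‖f^[m * q] x‖ := (hball _ hmem).1
        _ ≤ 1 / 2 * ((1 / 2) ^ q * ‖x‖) := by gcongr
        _ = _ := by ring
  have hmain : ∀ x ∈ ball (0 : E) r₀, ∀ n : ℕ, ‖f^[n] x‖ ≤ 2 * K * Λ ^ n * ‖x‖ := by
    intro x hx n
    have hmem : f^[m * (n / m)] x ∈ ball (0 : E) r₀ := by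
      rw [mem_ball_zero_iff] at hx ⊢
      refine (hq x (mem_ball_zero_iff.2 hx) _).trans_lt (lt_of_le_of_lt ?_ hx)
      exact mul_le_of_le_one_left (norm_nonneg _) (pow_le_one₀ (by norm_num) (by norm_num))
    have hlt := Nat.mod_lt n hm
    have h3 := (hball _ hmem).2 _ hlt
    rw [← Function.iterate_add_apply, Nat.mod_add_div] at h3
    have h4 : (1 / 2 : ℝ) ^ (n / m) ≤ 2 * Λ ^ n := by
      have h5 : Λ ^ n = (1 / 2) ^ (n / m) * Λ ^ (n % m) := by
        rw [← hΛm, ← pow_mul, ← pow_add, Nat.div_add_mod]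
      have h6 : (1 / 2 : ℝ) ≤ Λ ^ (n % m) := by
        rw [← hΛm]
        exact pow_le_pow_of_le_one hΛ0.le hΛ1.le hlt.le
      rw [h5]
      have h7 : (0 : ℝ) < (1 / 2) ^ (n / m) := by positivity
      nlinarith
    calc ‖f^[n] x‖ ≤ K * ‖f^[m * (n / m)] x‖ := h3
      _ ≤ K * ((1 / 2) ^ (n / m) * ‖x‖) := by gcongr; exact hq x hx _
      _ ≤ K * ((2 * Λ ^ n) * ‖x‖) := by gcongr
      _ = _ := by ring
  refine ⟨2 * K, Λ, by positivity, hΛ0, hΛ1, fun s hs => ?_⟩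
  obtain ⟨ε, hε, hεs⟩ := nhds_basis_ball.mem_iff.1 hs
  refine ⟨min r₀ (ε / (2 * K)), by positivity, fun x hx n => ?_⟩
  have hx1 := hmain x (ball_subset_ball (min_le_left _ _) hx) n
  refine ⟨hεs ?_, hx1⟩
  rw [mem_ball_zero_iff]
  have hx2 : ‖x‖ < ε / (2 * K) := mem_ball_zero_iff.1 (ball_subset_ball (min_le_right _ _) hx)
  calc _ ≤ 2 * K * Λ ^ n * ‖x‖ := hx1
    _ ≤ 2 * K * 1 * ‖x‖ := by gcongr; exact pow_le_one₀ hΛ0.le hΛ1.le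
    _ < 2 * K * 1 * (ε / (2 * K)) := by gcongr
    _ = ε := by field_simp

variable {f : E → E} {C Λ : ℝ}

omit [NormedSpace ℂ E] [FiniteDimensional ℂ E] [CompleteSpace F] in
/-- The twisted composition operator `g ↦ g ∘ f - M g` is injective on germs of high order. -/
theorem ContractsAtRate.eq_zero_of_comp_eq (hf : ContractsAtRate f C Λ) (M : F ≃L[ℂ] F) {N : ℕ}
    (hN : ‖(M.symm : F →L[ℂ] F)‖ * Λ ^ N < 1) {g : E → F} (hg : g =O[𝓝 0] fun x => ‖x‖ ^ N)
    (he : ∀ᶠ x in 𝓝 0, g (f x) = M (g x)) : g =ᶠ[𝓝 0] 0 := by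
  obtain ⟨K, hK⟩ := hg.bound
  obtain ⟨r, hr, hb⟩ := hf.bound _ (hK.and he)
  set b := ‖(M.symm : F →L[ℂ] F)‖
  filter_upwards [ball_mem_nhds (0 : E) hr] with x hx
  -- Iterating `g = M⁻¹ (g ∘ f)` costs a factor `b ^ n`, while the order of vanishing gains `Λ ^ (n
  -- N)` along the orbit.
  have h1 : ∀ n : ℕ, ‖g x‖ ≤ b ^ n * ‖g (f^[n] x)‖ := by
    intro n
    induction n with
    | zero => simp
    | succ n ih =>
      have h2 : g (f^[n] x) = M.symm (g (f^[n + 1] x)) := by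
        rw [Function.iterate_succ_apply', (hb x hx n).1.2]; simp
      calc _ ≤ b ^ n * ‖g (f^[n] x)‖ := ih
        _ ≤ b ^ n * (b * ‖g (f^[n + 1] x)‖) := by
          gcongr; rw [h2]; exact (M.symm : F →L[ℂ] F).le_opNorm _
        _ = _ := by ring
  have hb0 : 0 ≤ b := norm_nonneg _
  have hΛ := hf.rate_pos
  have hC := hf.C_pos
  have h3 : ∀ n : ℕ, ‖g x‖ ≤ |K| * (C * ‖x‖) ^ N * (b * Λ ^ N) ^ n := by
    intro n
    calc _ ≤ b ^ n * ‖g (f^[n] x)‖ := h1 n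
      _ ≤ b ^ n * (|K| * ‖f^[n] x‖ ^ N) := by
        gcongr
        refine (hb x hx n).1.1.trans ?_
        simp only [norm_pow, norm_norm]
        gcongr; exact le_abs_self K
      _ ≤ b ^ n * (|K| * (C * Λ ^ n * ‖x‖) ^ N) := by gcongr; exact (hb x hx n).2
      _ = _ := by ring
  have h4 : Tendsto (fun n : ℕ => |K| * (C * ‖x‖) ^ N * (b * Λ ^ N) ^ n) atTop (𝓝 0) := by
    simpa using (tendsto_pow_atTop_nhds_zero_of_lt_one (by positivity) hN).const_mul
      (|K| * (C * ‖x‖) ^ N)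
  have h5 := ge_of_tendsto' h4 h3
  simpa using h5

/-- The twisted composition operator `g ↦ g ∘ f - M g` is surjective on germs of high order. -/
theorem ContractsAtRate.exists_comp_eq (hf : ContractsAtRate f C Λ) (hfa : AnalyticAt ℂ f 0)
    (M : F ≃L[ℂ] F) {N : ℕ} (hN : ‖(M.symm : F →L[ℂ] F)‖ * Λ ^ N < 1) {R : E → F}
    (hR : AnalyticAt ℂ R 0) (hRN : R =O[𝓝 0] fun x => ‖x‖ ^ N) :
    ∃ g : E → F, AnalyticAt ℂ g 0 ∧ (g =O[𝓝 0] fun x => ‖x‖ ^ N) ∧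
      ∀ᶠ x in 𝓝 0, g (f x) = M (g x) + R x := by
  obtain ⟨K, hK⟩ := hRN.bound
  have hdf : ∀ᶠ x in 𝓝 (0 : E), DifferentiableAt ℂ f x :=
    hfa.eventually_analyticAt.mono fun x hx => hx.differentiableAt
  have hdR : ∀ᶠ x in 𝓝 (0 : E), DifferentiableAt ℂ R x :=
    hR.eventually_analyticAt.mono fun x hx => hx.differentiableAt
  obtain ⟨r, hr, hb⟩ := hf.bound _ (hK.and (hdf.and hdR))
  set b := ‖(M.symm : F →L[ℂ] F)‖
  have hb0 : 0 ≤ b := norm_nonneg _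
  have hΛ := hf.rate_pos
  have hC := hf.C_pos
  -- The terms of the Neumann series `-∑ M^{-(n+1)} (R ∘ f^[n])`; applying `M` shifts the index,
  -- which yields the equation.
  let u : ℕ → E → F := fun n x => ((M.symm : F →L[ℂ] F) ^ (n + 1)) (R (f^[n] x))
  have hu : ∀ n, ∀ x ∈ ball (0 : E) r, ‖u n x‖ ≤ (b * |K| * C ^ N) * (b * Λ ^ N) ^ n * ‖x‖ ^ N := by
    intro n x hx
    calc _ ≤ ‖(M.symm : F →L[ℂ] F) ^ (n + 1)‖ * ‖R (f^[n] x)‖ := ContinuousLinearMap.le_opNorm _ _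
      _ ≤ b ^ (n + 1) * (|K| * ‖f^[n] x‖ ^ N) := by
        gcongr
        · exact norm_pow_le' _ (Nat.succ_pos n)
        · refine (hb x hx n).1.1.trans ?_
          simp only [norm_pow, norm_norm]
          gcongr; exact le_abs_self K
      _ ≤ b ^ (n + 1) * (|K| * (C * Λ ^ n * ‖x‖) ^ N) := by gcongr; exact (hb x hx n).2
      _ = _ := by ring
  have hu' : ∀ n, ∀ x ∈ ball (0 : E) r, ‖u n x‖ ≤ (b * |K| * C ^ N) * (b * Λ ^ N) ^ n * r ^ N := by
    intro n x hx
    refine (hu n x hx).trans ?_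
    gcongr
    exact (mem_ball_zero_iff.1 hx).le
  have hgeo : Summable fun n : ℕ => (b * Λ ^ N) ^ n :=
    summable_geometric_of_lt_one (by positivity) hN
  have hsum : Summable fun n : ℕ => (b * |K| * C ^ N) * (b * Λ ^ N) ^ n * r ^ N :=
    (hgeo.mul_left _).mul_right _
  have hdit : ∀ n, ∀ x ∈ ball (0 : E) r, DifferentiableAt ℂ f^[n] x := by
    intro n x hx
    induction n with
    | zero => simp
    | succ n ih =>
      rw [Function.iterate_succ']
      exact DifferentiableAt.comp x (hb x hx n).1.2.1 ih
  have hdu : ∀ n, ∀ x ∈ ball (0 : E) r, DifferentiableAt ℂ (u n) x := by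
    intro n x hx
    refine (ContinuousLinearMap.differentiableAt _).comp x ?_
    exact DifferentiableAt.comp x (hb x hx n).1.2.2 (hdit n x hx)
  have hsx : ∀ x ∈ ball (0 : E) r, Summable fun n => u n x := fun x hx =>
    Summable.of_norm_bounded hsum fun n => hu' n x hx
  refine ⟨fun x => -∑' n, u n x, ?_, ?_, ?_⟩
  -- Along a complex line the sum is holomorphic by the one-variable theorem on uniformly convergent
  -- series; Osgood's lemma does the rest.
  · refine AnalyticAt.neg (analyticAt_of_lines (ball_mem_nhds (0 : E) hr) ?_ ?_)
    · exact continuousOn_tsum (fun n x hx => (hdu n x hx).continuousAt.continuousWithinAt) hsum hu'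
    · intro x hx v
      have hc : Continuous fun t : ℂ => x + t • v := by fun_prop
      have hU : IsOpen ((fun t : ℂ => x + t • v) ⁻¹' ball (0 : E) r) := isOpen_ball.preimage hc
      have h1 := Complex.differentiableOn_tsum_of_summable_norm
        (F := fun n (t : ℂ) => u n (x + t • v)) hsum
        (fun n t ht => (DifferentiableAt.comp t (hdu n _ ht) (by fun_prop)).differentiableWithinAt)
        hU (fun n t ht => hu' n _ ht)
      have h2 : (0 : ℂ) ∈ (fun t : ℂ => x + t • v) ⁻¹' ball (0 : E) r := by
        simpa [Set.mem_preimage] using hx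
      exact (h1 0 h2).differentiableAt (hU.mem_nhds h2)
  · refine Asymptotics.IsBigO.neg_left (Asymptotics.IsBigO.of_bound
      (∑' n : ℕ, (b * |K| * C ^ N) * (b * Λ ^ N) ^ n) ?_)
    filter_upwards [ball_mem_nhds (0 : E) hr] with x hx
    simp only [norm_pow, norm_norm]
    rw [← tsum_mul_right]
    exact tsum_of_norm_bounded ((hgeo.mul_left _).mul_right _).hasSum fun n => hu n x hx
  · have hfr : ∀ᶠ x in 𝓝 (0 : E), f x ∈ ball (0 : E) r := by
      obtain ⟨r', hr', hb'⟩ := hf.bound _ (ball_mem_nhds (0 : E) hr)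
      filter_upwards [ball_mem_nhds (0 : E) hr'] with x hx
      exact (hb' x hx 1).1
    filter_upwards [ball_mem_nhds (0 : E) hr, hfr] with x hx hfx
    have h1 : ∀ n, M (u (n + 1) x) = u n (f x) := by
      intro n
      simp only [u, Function.iterate_succ_apply]
      rw [pow_succ']
      simp
    have h2 := (hsx x hx).tsum_eq_zero_add
    have h3 : M (∑' n, u (n + 1) x) = ∑' n, u n (f x) := by
      rw [M.map_tsum]
      exact tsum_congr h1
    have h0 : M (u 0 x) = R x := by simp [u]
    simp only [map_neg]
    rw [h2, map_add, h0, h3]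
    abel

end Contraction

/-! ### The algebra of analytic germs, filtered by order of vanishing -/

section GermAlgebra

variable {E : Type*} [NormedAddCommGroup E] [NormedSpace ℂ E]

variable (E) in
/-- Scalar functions analytic at `0`. -/
def analyticFun : Subalgebra ℂ (E → ℂ) where
  carrier := {g | AnalyticAt ℂ g 0}
  mul_mem' := fun h1 h2 => AnalyticAt.mul h1 h2
  add_mem' := fun h1 h2 => AnalyticAt.add h1 h2
  algebraMap_mem' := fun _ => analyticAt_const

/-- Composition with `f` on functions analytic at the fixed point `0` of `f`. -/
def pullback (f : E → E) (hf : AnalyticAt ℂ f 0) (h0 : f 0 = 0) :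
    analyticFun E →ₐ[ℂ] analyticFun E where
  toFun g := ⟨fun x => g.1 (f x), AnalyticAt.comp (g := g.1) (by rw [h0]; exact g.2) hf⟩
  map_one' := rfl
  map_mul' _ _ := rfl
  map_zero' := rfl
  map_add' _ _ := rfl
  commutes' _ := rfl

variable (E) in
/-- Functions analytic at `0` and vanishing there to order `k`. -/
def vanishingOrder (k : ℕ) : Submodule ℂ (analyticFun E) where
  carrier := {g | (g : E → ℂ) =O[𝓝 0] fun x => ‖x‖ ^ k}
  zero_mem' := Asymptotics.isBigO_zero _ _
  add_mem' := fun h1 h2 => Asymptotics.IsBigO.add h1 h2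
  smul_mem' := fun c _ h => Asymptotics.IsBigO.const_smul_left h c

variable (E) in
/-- Functions vanishing near `0`. -/
def nullGerms : Submodule ℂ (analyticFun E) where
  carrier := {g | (g : E → ℂ) =ᶠ[𝓝 0] 0}
  zero_mem' := EventuallyEq.rfl
  add_mem' := fun {a b} h1 h2 => by
    have := EventuallyEq.add h1 h2
    simpa using this
  smul_mem' := fun c g h => by
    have := EventuallyEq.const_smul h c
    simpa using this

lemma mem_vanishingOrder {k : ℕ} {g : analyticFun E} :
    g ∈ vanishingOrder E k ↔ (g : E → ℂ) =O[𝓝 0] fun x => ‖x‖ ^ k := Iff.rfl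

lemma mem_nullGerms {g : analyticFun E} : g ∈ nullGerms E ↔ (g : E → ℂ) =ᶠ[𝓝 0] 0 := Iff.rfl

lemma vanishingOrder_zero : vanishingOrder E 0 = ⊤ := by
  refine eq_top_iff.2 fun g _ => ?_
  rw [mem_vanishingOrder]
  simpa using g.2.continuousAt.norm.isBoundedUnder_le.isBigO_one ℝ

lemma vanishingOrder_anti {j k : ℕ} (h : j ≤ k) : vanishingOrder E k ≤ vanishingOrder E j := by
  intro g hg
  refine Asymptotics.IsBigO.trans hg (Asymptotics.IsBigO.of_bound 1 ?_)
  filter_upwards [Metric.ball_mem_nhds (0 : E) one_pos] with x hx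
  have hx1 : ‖x‖ ≤ 1 := (mem_ball_zero_iff.1 hx).le
  simpa using pow_le_pow_of_le_one (norm_nonneg x) hx1 h

lemma mul_mem_vanishingOrder {j k : ℕ} {g h : analyticFun E} (hg : g ∈ vanishingOrder E j)
    (hh : h ∈ vanishingOrder E k) : g * h ∈ vanishingOrder E (j + k) := by
  exact (Asymptotics.IsBigO.mul hg hh).congr_right fun x => (pow_add ‖x‖ j k).symm

lemma nullGerms_le {k : ℕ} : nullGerms E ≤ vanishingOrder E k := fun _ hg =>
  (EventuallyEq.isBigO hg).trans (Asymptotics.isBigO_zero _ _)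

lemma mul_mem_nullGerms (g : analyticFun E) {h : analyticFun E} (hh : h ∈ nullGerms E) :
    g * h ∈ nullGerms E := by
  rw [mem_nullGerms] at *
  filter_upwards [hh] with x hx
  simp [hx]

lemma mem_vanishingOrder_one {g : analyticFun E} :
    g ∈ vanishingOrder E 1 ↔ (g : E → ℂ) 0 = 0 := by
  rw [mem_vanishingOrder]
  constructor
  · intro h
    obtain ⟨K, hK⟩ := h.bound
    simpa using hK.self_of_nhds
  · intro h
    have h1 := g.2.differentiableAt.isBigO_sub
    simpa [h] using h1.norm_right

lemma mem_vanishingOrder_two {g : analyticFun E} :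
    g ∈ vanishingOrder E 2 ↔ (g : E → ℂ) 0 = 0 ∧ fderiv ℂ (g : E → ℂ) 0 = 0 := by
  constructor
  · intro h
    have h0 : (g : E → ℂ) 0 = 0 := mem_vanishingOrder_one.1 (vanishingOrder_anti one_le_two h)
    refine ⟨h0, HasFDerivAt.fderiv ?_⟩
    rw [hasFDerivAt_iff_isLittleO_nhds_zero]
    simp only [zero_add, h0, sub_zero, zero_apply]
    refine Asymptotics.IsBigO.trans_isLittleO h ?_
    have := Asymptotics.isLittleO_norm_pow_id (E' := E) one_lt_two
    simpa using this
  · rintro ⟨h0, h1⟩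
    obtain ⟨p, hp⟩ := g.2
    have h2 := hp.isBigO_sub_partialSum_pow 2
    simp only [zero_add] at h2
    rw [mem_vanishingOrder]
    refine h2.congr_left fun y => ?_
    have e1 : p.partialSum 2 y = (g : E → ℂ) 0 + fderiv ℂ (g : E → ℂ) 0 y := by
      rw [hp.fderiv_eq]
      simp [FormalMultilinearSeries.partialSum, Finset.sum_range_succ, hp.coeff_zero]
      exact congrArg _ (funext fun i => by fin_cases i; rfl)
    rw [e1, h0, h1]
    simp

/-- The value and derivative at `0` determine a function modulo order two. -/
lemma sub_mem_vanishingOrder_two {g h : analyticFun E} (h0 : (g : E → ℂ) 0 = (h : E → ℂ) 0)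
    (h1 : fderiv ℂ (g : E → ℂ) 0 = fderiv ℂ (h : E → ℂ) 0) : g - h ∈ vanishingOrder E 2 := by
  rw [mem_vanishingOrder_two]
  refine ⟨by simp [h0], ?_⟩
  change fderiv ℂ ((g : E → ℂ) - (h : E → ℂ)) 0 = 0
  rw [fderiv_sub g.2.differentiableAt h.2.differentiableAt, h1, sub_self]

/-- A continuous linear functional as an analytic function. -/
noncomputable def linearGerm (φ : E →L[ℂ] ℂ) : analyticFun E := ⟨φ, φ.analyticAt 0⟩

variable {ι : Type*} [Fintype ι]

/-- The functions `ξ i` vanish at `0` and their differentials span the cotangent space. -/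
structure IsCoordinateSystem (ξ : ι → analyticFun E) : Prop where
  map_zero : ∀ i, (ξ i : E → ℂ) 0 = 0
  span_eq : Submodule.span ℂ (Set.range fun i => fderiv ℂ (ξ i : E → ℂ) 0) = ⊤

variable [FiniteDimensional ℂ E]

/-- The Taylor terms of degree below `k` vanish, each in turn being negligible before itself. The
term of degree `k`, expanded in a basis, is a combination of products of `k` linear forms. -/
lemma vanishingOrder_le_linear_pow (k : ℕ) :
    vanishingOrder E k ≤ Submodule.span ℂ (Set.range (linearGerm (E := E))) ^ k ⊔
      vanishingOrder E (k + 1) := by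
  intro g hg
  obtain ⟨p, hp⟩ := g.2
  have hlow : ∀ j ≤ k, ∀ i < j, ∀ y, p i (fun _ => y) = 0 := by
    intro j
    induction j with
    | zero => intro _ i hi; omega
    | succ j ih =>
      intro hj i hi y
      rcases Nat.lt_succ_iff_lt_or_eq.1 hi with h | rfl
      · exact ih (by omega) i h y
      · have h1 := hp.isBigO_sub_partialSum_pow (i + 1)
        simp only [zero_add] at h1
        have h2 : (fun y => (g : E → ℂ) y - p i (fun _ => y)) =O[𝓝 0] fun y => ‖y‖ ^ (i + 1) := by
          refine h1.congr_left fun y => ?_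
          rw [FormalMultilinearSeries.partialSum, Finset.sum_range_succ,
            Finset.sum_eq_zero fun l hl => ih (by omega) l (Finset.mem_range.1 hl) y, zero_add]
        have h3 : (fun y => p i (fun _ => y)) =O[𝓝 0] fun y => ‖y‖ ^ (i + 1) := by
          have h4 : (g : E → ℂ) =O[𝓝 0] fun y => ‖y‖ ^ (i + 1) := vanishingOrder_anti hj hg
          simpa using h4.sub h2
        exact h3.continuousMultilinearMap_apply_eq_zero y
  let P : analyticFun E := ⟨fun y => p k (fun _ => y), by
    have : AnalyticAt ℂ (fun y : E => fun _ : Fin k => y) 0 := by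
      rw [analyticAt_pi_iff]; exact fun _ => analyticAt_id
    exact AnalyticAt.comp (g := p k) (p k).analyticAt this⟩
  have h1 : g - P ∈ vanishingOrder E (k + 1) := by
    have h2 := hp.isBigO_sub_partialSum_pow (k + 1)
    simp only [zero_add] at h2
    refine h2.congr_left fun y => ?_
    rw [FormalMultilinearSeries.partialSum, Finset.sum_range_succ,
      Finset.sum_eq_zero fun l hl => hlow k le_rfl l (Finset.mem_range.1 hl) y, zero_add]
    rfl
  have h3 : P ∈ Submodule.span ℂ (Set.range (linearGerm (E := E))) ^ k := by
    let b := Module.finBasis ℂ E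
    have h4 : P = ∑ r : Fin k → Fin (Module.finrank ℂ E), (p k fun i => b (r i)) •
        ∏ i, linearGerm (b.coord (r i)).toContinuousLinearMap := by
      ext y
      have h5 : (P : E → ℂ) y = p k fun _ => ∑ j, b.repr y j • b j := by
        simp only [b.sum_repr, P]
      rw [h5]
      have h6 := (p k).toMultilinearMap.map_sum fun (_ : Fin k) j => b.repr y j • b j
      simp only [ContinuousMultilinearMap.coe_coe] at h6
      rw [h6]
      simp only [AddSubmonoidClass.coe_finsetSum, Finset.sum_apply]
      refine Finset.sum_congr rfl fun r _ => ?_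
      have h7 := (p k).toMultilinearMap.map_smul_univ (fun i => b.repr y (r i)) fun i => b (r i)
      simp only [ContinuousMultilinearMap.coe_coe] at h7
      rw [h7, smul_eq_mul, mul_comm]
      simp [linearGerm]
    rw [h4]
    refine Submodule.sum_mem _ fun r _ => Submodule.smul_mem _ _ ?_
    have : ∀ s : Finset (Fin k), ∏ i ∈ s, linearGerm (b.coord (r i)).toContinuousLinearMap ∈
        Submodule.span ℂ (Set.range (linearGerm (E := E))) ^ s.card := by
      intro s
      induction s using Finset.cons_induction with
      | empty =>
        rw [Finset.prod_empty, Finset.card_empty, pow_zero]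
        exact Submodule.one_le.1 le_rfl
      | cons a s ha ih =>
        rw [Finset.prod_cons, Finset.card_cons, pow_succ']
        exact Submodule.mul_mem_mul (Submodule.subset_span ⟨_, rfl⟩) ih
    simpa using this Finset.univ
  rw [← add_sub_cancel P g]
  exact Submodule.add_mem_sup h3 h1

omit [FiniteDimensional ℂ E] in
lemma monomial_mem_vanishingOrder {ξ : ι → analyticFun E} (hξ : ∀ i, (ξ i : E → ℂ) 0 = 0)
    (n : ι → ℕ) : ∏ i, ξ i ^ n i ∈ vanishingOrder E (∑ i, n i) := by
  have hp : ∀ i (m : ℕ), ξ i ^ m ∈ vanishingOrder E m := by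
    intro i m
    induction m with
    | zero => rw [vanishingOrder_zero]; trivial
    | succ m ih =>
      rw [pow_succ]
      exact mul_mem_vanishingOrder ih (mem_vanishingOrder_one.2 (hξ i))
  have : ∀ s : Finset ι, ∏ i ∈ s, ξ i ^ n i ∈ vanishingOrder E (∑ i ∈ s, n i) := by
    intro s
    induction s using Finset.cons_induction with
    | empty => rw [Finset.sum_empty, vanishingOrder_zero]; trivial
    | cons a s ha ih =>
      rw [Finset.prod_cons, Finset.sum_cons]
      exact mul_mem_vanishingOrder (hp a _) ih
  exact this _

omit [FiniteDimensional ℂ E] in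
lemma vanishingOrder_mul_le (j k : ℕ) :
    vanishingOrder E j * vanishingOrder E k ≤ vanishingOrder E (j + k) :=
  Submodule.mul_le.2 fun _ hg _ hh => mul_mem_vanishingOrder hg hh

/-- Functions vanishing to order `k` are combinations of monomials of degree `k` in any coordinate
system, modulo order `k + 1`. -/
theorem IsCoordinateSystem.vanishingOrder_le {ξ : ι → analyticFun E} (hξ : IsCoordinateSystem ξ)
    {k : ℕ} {S : Submodule ℂ (analyticFun E)} (h1 : vanishingOrder E (k + 1) ≤ S)
    (h2 : ∀ n : ι → ℕ, ∑ i, n i = k → ∏ i, ξ i ^ n i ∈ S) : vanishingOrder E k ≤ S := by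
  classical
  set X := Submodule.span ℂ (Set.range ξ)
  have hX1 : X ≤ vanishingOrder E 1 := by
    rw [Submodule.span_le]
    rintro _ ⟨i, rfl⟩
    exact mem_vanishingOrder_one.2 (hξ.map_zero i)
  have hlin : Submodule.span ℂ (Set.range (linearGerm (E := E))) ≤ X ⊔ vanishingOrder E 2 := by
    rw [Submodule.span_le]
    rintro _ ⟨φ, rfl⟩
    have hφ : φ ∈ Submodule.span ℂ (Set.range fun i => fderiv ℂ (ξ i : E → ℂ) 0) := by
      rw [hξ.span_eq]; trivial
    obtain ⟨c, hc⟩ := (Submodule.mem_span_range_iff_exists_fun ℂ).1 hφ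
    have h3 : linearGerm φ - ∑ i, c i • ξ i ∈ vanishingOrder E 2 := by
      have hcoe : ((∑ i, c i • ξ i : analyticFun E) : E → ℂ) = fun x => ∑ i, c i • (ξ i : E → ℂ) x := by
        funext x; simp
      refine sub_mem_vanishingOrder_two ?_ ?_
      · rw [hcoe]; simp [linearGerm, hξ.map_zero]
      · have hd : HasFDerivAt (fun x => ∑ i, c i • (ξ i : E → ℂ) x)
            (∑ i, c i • fderiv ℂ (ξ i : E → ℂ) 0) 0 :=
          HasFDerivAt.fun_sum fun i _ => ((ξ i).2.differentiableAt.hasFDerivAt).const_smul (c i)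
        rw [hcoe, hd.fderiv, hc]
        exact φ.hasFDerivAt.fderiv
    rw [SetLike.mem_coe, ← sub_add_cancel (linearGerm φ) (∑ i, c i • ξ i), add_comm]
    exact Submodule.add_mem_sup (Submodule.sum_mem _ fun i _ =>
      Submodule.smul_mem _ _ (Submodule.subset_span ⟨i, rfl⟩)) h3
  have hXk : ∀ k, X ^ k ≤ vanishingOrder E k := by
    intro k
    induction k with
    | zero => rw [vanishingOrder_zero]; exact le_top
    | succ k ih =>
      rw [pow_succ]
      exact (mul_le_mul' ih hX1).trans (vanishingOrder_mul_le _ _)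
  -- An error of order two in one of the `k` factors raises the order of the product to at least `k
  -- + 1`.
  have hpow : ∀ k, (X ⊔ vanishingOrder E 2) ^ k ≤ X ^ k ⊔ vanishingOrder E (k + 1) := by
    intro k
    induction k with
    | zero => rw [pow_zero, pow_zero]; exact le_sup_left
    | succ k ih =>
      rw [pow_succ]
      refine (mul_le_mul' ih le_rfl).trans ?_
      rw [Submodule.sup_mul, Submodule.mul_sup, Submodule.mul_sup]
      refine sup_le (sup_le ?_ ?_) (sup_le ?_ ?_)
      · rw [← pow_succ]; exact le_sup_left
      · exact le_sup_of_le_right ((mul_le_mul' (hXk k) le_rfl).trans (vanishingOrder_mul_le _ _))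
      · exact le_sup_of_le_right ((mul_le_mul' le_rfl hX1).trans (vanishingOrder_mul_le _ _))
      · exact le_sup_of_le_right ((vanishingOrder_mul_le _ _).trans (vanishingOrder_anti (by omega)))
  have hmon : ∀ k, ∀ g ∈ Set.range ξ ^ k, ∃ n : ι → ℕ, ∑ i, n i = k ∧ g = ∏ i, ξ i ^ n i := by
    intro k
    induction k with
    | zero =>
      intro g hg
      rw [pow_zero, Set.mem_one] at hg
      exact ⟨0, by simp, by simp [hg]⟩
    | succ k ih =>
      intro g hg
      rw [pow_succ] at hg
      obtain ⟨a, ha, _, ⟨i, rfl⟩, rfl⟩ := Set.mem_mul.1 hg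
      obtain ⟨n, hn, rfl⟩ := ih a ha
      refine ⟨n + Pi.single i 1, ?_, ?_⟩
      · simp [Finset.sum_add_distrib, hn]
      · have e : ∀ x, ξ x ^ (n + Pi.single i 1 : ι → ℕ) x = ξ x ^ n x * if x = i then ξ x else 1 := by
          intro x
          rcases eq_or_ne x i with rfl | hx
          · simp [pow_succ]
          · simp [hx]
        simp only [e, Finset.prod_mul_distrib, Finset.prod_ite_eq', Finset.mem_univ, if_true]
  refine (vanishingOrder_le_linear_pow k).trans (sup_le ?_ h1)
  refine (pow_le_pow_left' hlin k).trans ((hpow k).trans (sup_le ?_ h1))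
  rw [Submodule.span_pow, Submodule.span_le]
  intro g hg
  obtain ⟨n, hn, rfl⟩ := hmon k g hg
  exact h2 n hn

end GermAlgebra

/-! ### Generalized eigenvectors modulo a submodule -/

section GeneralizedEigen

variable {R : Type*} [AddCommGroup R] [Module ℂ R]

/-- `g` is a generalized eigenvector of `T` modulo the submodule `B`. -/
def IsGenEig (T : Module.End ℂ R) (B : Submodule ℂ R) (a : ℂ) (g : R) : Prop :=
  ∃ M : ℕ, ((T - algebraMap ℂ _ a) ^ M) g ∈ B

variable {T : Module.End ℂ R} {B : Submodule ℂ R}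

lemma aeval_mem_of_mem (hB : ∀ g ∈ B, T g ∈ B) (q : Polynomial ℂ) {g : R} (hg : g ∈ B) :
    Polynomial.aeval T q g ∈ B := by
  induction q using Polynomial.induction_on with
  | C a => simpa [Module.algebraMap_end_apply] using B.smul_mem a hg
  | add p q hp hq => simpa using B.add_mem hp hq
  | monomial n a ih =>
    rw [pow_succ', ← mul_assoc, mul_comm (Polynomial.C a), mul_assoc]
    simpa using hB _ ih

lemma aeval_X_sub_C_pow (a : ℂ) (M : ℕ) :
    Polynomial.aeval T ((Polynomial.X - Polynomial.C a) ^ M) = (T - algebraMap ℂ _ a) ^ M := by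
  simp

lemma sub_algebraMap_pow_mem (hB : ∀ g ∈ B, T g ∈ B) (a : ℂ) (M : ℕ) {g : R} (hg : g ∈ B) :
    ((T - algebraMap ℂ _ a) ^ M) g ∈ B := by
  rw [← aeval_X_sub_C_pow]
  exact aeval_mem_of_mem hB _ hg

lemma sub_algebraMap_pow_mem_of_le (hB : ∀ g ∈ B, T g ∈ B) {a : ℂ} {M M' : ℕ} (h : M ≤ M') {g : R}
    (hg : ((T - algebraMap ℂ _ a) ^ M) g ∈ B) : ((T - algebraMap ℂ _ a) ^ M') g ∈ B := by
  obtain ⟨j, rfl⟩ := Nat.exists_eq_add_of_le h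
  rw [add_comm, pow_add, Module.End.mul_apply]
  exact sub_algebraMap_pow_mem hB a j hg

/-- Coprime polynomials in `T` cannot both push `g` into an invariant submodule, unless `g` belongs
to it. -/
lemma mem_of_coprime (hB : ∀ g ∈ B, T g ∈ B) {p q : Polynomial ℂ} (hpq : IsCoprime p q) {g : R}
    (hp : Polynomial.aeval T p g ∈ B) (hq : Polynomial.aeval T q g ∈ B) : g ∈ B := by
  obtain ⟨a, b, hab⟩ := hpq
  have h : g = Polynomial.aeval T a (Polynomial.aeval T p g) +
      Polynomial.aeval T b (Polynomial.aeval T q g) := by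
    rw [← Module.End.mul_apply, ← Module.End.mul_apply, ← map_mul, ← map_mul, ← LinearMap.add_apply,
      ← map_add, hab]
    simp
  rw [h]
  exact B.add_mem (aeval_mem_of_mem hB a hp) (aeval_mem_of_mem hB b hq)

lemma isCoprime_X_sub_C_pow {q : Polynomial ℂ} {c : ℂ} (h : q.eval c ≠ 0) (M : ℕ) :
    IsCoprime ((Polynomial.X - Polynomial.C c) ^ M) q := by
  refine IsCoprime.pow_left ?_
  refine (Irreducible.coprime_iff_not_dvd (Polynomial.irreducible_X_sub_C c)).2 ?_
  rwa [Polynomial.dvd_iff_isRoot]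

/-- In the quotient by `B` the vector is killed by a power of `X - c` and by `q`, which are coprime.
-/
lemma IsGenEig.mem_of_aeval_mem (hB : ∀ g ∈ B, T g ∈ B) {c : ℂ} {g : R} (hg : IsGenEig T B c g)
    {q : Polynomial ℂ} (hq : q.eval c ≠ 0) (h : Polynomial.aeval T q g ∈ B) : g ∈ B := by
  obtain ⟨M, hM⟩ := hg
  rw [← aeval_X_sub_C_pow] at hM
  exact mem_of_coprime hB (isCoprime_X_sub_C_pow hq M) hM h

variable (T B) in
/-- The submodule of generalized eigenvectors modulo an invariant submodule. -/
def genEigSubmodule (hB : ∀ g ∈ B, T g ∈ B) (a : ℂ) : Submodule ℂ R where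
  carrier := {g | IsGenEig T B a g}
  zero_mem' := ⟨0, by simp⟩
  add_mem' := by
    rintro g h ⟨M, hM⟩ ⟨M', hM'⟩
    refine ⟨max M M', ?_⟩
    rw [map_add]
    exact B.add_mem (sub_algebraMap_pow_mem_of_le hB (le_max_left _ _) hM)
      (sub_algebraMap_pow_mem_of_le hB (le_max_right _ _) hM')
  smul_mem' := by
    rintro c g ⟨M, hM⟩
    exact ⟨M, by rw [map_smul]; exact B.smul_mem c hM⟩

lemma IsGenEig.mono {B' : Submodule ℂ R} (h : B ≤ B') {a : ℂ} {g : R} (hg : IsGenEig T B a g) :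
    IsGenEig T B' a g := hg.imp fun _ hM => h hM

/-- A generalized eigenvector of `T` is one of `T ^ η`. -/
lemma IsGenEig.pow (hB : ∀ g ∈ B, T g ∈ B) {a : ℂ} {g : R} (hg : IsGenEig T B a g) (η : ℕ) :
    IsGenEig (T ^ η) B (a ^ η) g := by
  obtain ⟨M, hM⟩ := hg
  refine ⟨M, ?_⟩
  have h1 : (T ^ η - algebraMap ℂ _ (a ^ η)) ^ M = Polynomial.aeval T
      ((Polynomial.X ^ η - Polynomial.C (a ^ η)) ^ M : Polynomial ℂ) := by simp
  obtain ⟨q, hq⟩ : (Polynomial.X - Polynomial.C a : Polynomial ℂ) ∣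
      Polynomial.X ^ η - Polynomial.C (a ^ η) := by
    rw [map_pow]; exact sub_dvd_pow_sub_pow _ _ _
  rw [h1, hq, mul_pow, mul_comm, map_mul, Module.End.mul_apply, aeval_X_sub_C_pow]
  exact aeval_mem_of_mem hB _ hM

end GeneralizedEigen

/-! ### Multiplicativity of generalized eigenvalues -/

section GeneralizedEigenAlgebra

variable {R : Type*} [CommRing R] [Algebra ℂ R] {T : R →ₐ[ℂ] R}

/-- Products of generalized eigenvectors of an algebra endomorphism are generalized eigenvectors. -/
lemma IsGenEig.mul {A₁ B₁ A₂ B₂ C : Submodule ℂ R} (hA₁ : ∀ g ∈ A₁, T g ∈ A₁)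
    (hA₂ : ∀ g ∈ A₂, T g ∈ A₂) (hB₂ : ∀ g ∈ B₂, T g ∈ B₂) (hC : ∀ g ∈ C, T g ∈ C)
    (h₁ : ∀ g ∈ B₁, ∀ h ∈ A₂, g * h ∈ C) (h₂ : ∀ g ∈ A₁, ∀ h ∈ B₂, g * h ∈ C) {a b : ℂ} {g h : R}
    (hgA : g ∈ A₁) (hhA : h ∈ A₂) (hg : IsGenEig T.toLinearMap B₁ a g)
    (hh : IsGenEig T.toLinearMap B₂ b h) : IsGenEig T.toLinearMap C (a * b) (g * h) := by
  have hC' : ∀ g ∈ C, T.toLinearMap g ∈ C := hC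
  have key : ∀ K M M' : ℕ, M + M' = K → ∀ g ∈ A₁, ∀ h ∈ A₂,
      ((T.toLinearMap - algebraMap ℂ (Module.End ℂ R) a) ^ M) g ∈ B₁ →
      ((T.toLinearMap - algebraMap ℂ (Module.End ℂ R) b) ^ M') h ∈ B₂ →
      ((T.toLinearMap - algebraMap ℂ (Module.End ℂ R) (a * b)) ^ K) (g * h) ∈ C := by
    intro K
    induction K with
    | zero =>
      rintro M M' hMM g hg h hh h1 h2
      obtain rfl : M = 0 := by omega
      exact h₁ _ h1 _ hh
    | succ K ih =>
      rintro M M' hMM g hg h hh h1 h2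
      rcases M with _ | M
      · exact sub_algebraMap_pow_mem hC' _ _ (h₁ _ h1 _ hh)
      rcases M' with _ | M'
      · exact sub_algebraMap_pow_mem hC' _ _ (h₂ _ hg _ h2)
      rw [pow_succ, Module.End.mul_apply]
      -- A twisted Leibniz rule. Each of its two terms lowers by one the exponent needed for one
      -- factor, so the total exponent is a sum.
      have e : (T.toLinearMap - algebraMap ℂ (Module.End ℂ R) (a * b)) (g * h) =
          (T.toLinearMap - algebraMap ℂ (Module.End ℂ R) a) g * T h +
            a • (g * (T.toLinearMap - algebraMap ℂ (Module.End ℂ R) b) h) := by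
        simp only [LinearMap.sub_apply, AlgHom.toLinearMap_apply, map_mul,
          Module.algebraMap_end_apply, Module.End.mul_apply, Algebra.smul_def]
        ring
      rw [e, map_add, map_smul]
      rw [pow_succ, Module.End.mul_apply] at h1 h2
      refine C.add_mem (ih M (M' + 1) (by omega) _ ?_ _ (hA₂ _ hh) h1 ?_) (C.smul_mem _
        (ih (M + 1) M' (by omega) _ hg _ ?_ ?_ h2))
      · simp only [LinearMap.sub_apply, Module.algebraMap_end_apply]
        exact A₁.sub_mem (hA₁ _ hg) (A₁.smul_mem _ hg)
      · have hc : Commute ((T.toLinearMap - algebraMap ℂ (Module.End ℂ R) b) ^ (M' + 1))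
            T.toLinearMap := ((Commute.refl _).sub_left (Algebra.commute_algebraMap_left b _)).pow_left _
        have h3 := congrArg (fun L : Module.End ℂ R => L h) hc.eq
        simp only [Module.End.mul_apply, AlgHom.toLinearMap_apply] at h3
        rw [h3]
        refine hB₂ _ ?_
        rw [pow_succ, Module.End.mul_apply]
        exact h2
      · simp only [LinearMap.sub_apply, Module.algebraMap_end_apply]
        exact A₂.sub_mem (hA₂ _ hh) (A₂.smul_mem _ hh)
      · rw [pow_succ, Module.End.mul_apply]; exact h1
  obtain ⟨M, hM⟩ := hg
  obtain ⟨M', hM'⟩ := hh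
  exact ⟨M + M', key _ M M' rfl g hgA h hhA hM hM'⟩

end GeneralizedEigenAlgebra

/-! ### Resonant monomials and corrections order by order -/

section Resonance

variable {E : Type*} [NormedAddCommGroup E] [NormedSpace ℂ E]
variable {ι : Type*} [Fintype ι]

/-- The endomorphism `T` of the algebra of analytic functions respects the order of vanishing and
the null germs. -/
structure IsLocalEnd (T : analyticFun E →ₐ[ℂ] analyticFun E) : Prop where
  order : ∀ k, ∀ g ∈ vanishingOrder E k, T.toLinearMap g ∈ vanishingOrder E k
  null : ∀ g ∈ nullGerms E, T.toLinearMap g ∈ nullGerms E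

variable {T : analyticFun E →ₐ[ℂ] analyticFun E}

lemma isGenEig_one (B : Submodule ℂ (analyticFun E)) : IsGenEig T.toLinearMap B 1 1 :=
  ⟨1, by simp⟩

/-- Eigenvalues multiply in the associated graded algebra: an error of order one more in a factor is
an error of order one more in the product. -/
lemma monomial_isGenEig (hT : IsLocalEnd T) {ξ : ι → analyticFun E} {a : ι → ℂ}
    (h0 : ∀ i, (ξ i : E → ℂ) 0 = 0)
    (hξ : ∀ i, IsGenEig T.toLinearMap (vanishingOrder E 2) (a i) (ξ i)) (n : ι → ℕ) :
    IsGenEig T.toLinearMap (vanishingOrder E (∑ i, n i + 1)) (∏ i, a i ^ n i)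
      (∏ i, ξ i ^ n i) := by
  classical
  have hmul : ∀ {j k : ℕ} {b c : ℂ} {g h : analyticFun E}, g ∈ vanishingOrder E j →
      h ∈ vanishingOrder E k → IsGenEig T.toLinearMap (vanishingOrder E (j + 1)) b g →
      IsGenEig T.toLinearMap (vanishingOrder E (k + 1)) c h →
      IsGenEig T.toLinearMap (vanishingOrder E (j + k + 1)) (b * c) (g * h) := by
    intro j k b c g h hg hh h1 h2
    refine IsGenEig.mul (hT.order j) (hT.order k) (hT.order _) (hT.order _) ?_ ?_ hg hh h1 h2
    · intro g hg h hh
      have := mul_mem_vanishingOrder hg hh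
      rwa [add_right_comm] at this
    · intro g hg h hh
      have := mul_mem_vanishingOrder hg hh
      exact this
  have hm1 : ∀ i, ξ i ∈ vanishingOrder E 1 := fun i => mem_vanishingOrder_one.2 (h0 i)
  have hp : ∀ i (m : ℕ), ξ i ^ m ∈ vanishingOrder E m ∧
      IsGenEig T.toLinearMap (vanishingOrder E (m + 1)) (a i ^ m) (ξ i ^ m) := by
    intro i m
    induction m with
    | zero => exact ⟨by rw [vanishingOrder_zero]; trivial, by simpa using isGenEig_one _⟩
    | succ m ih =>
      rw [pow_succ, pow_succ]
      exact ⟨mul_mem_vanishingOrder ih.1 (hm1 i), hmul ih.1 (hm1 i) ih.2 (hξ i)⟩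
  have : ∀ s : Finset ι, ∏ i ∈ s, ξ i ^ n i ∈ vanishingOrder E (∑ i ∈ s, n i) ∧
      IsGenEig T.toLinearMap (vanishingOrder E (∑ i ∈ s, n i + 1)) (∏ i ∈ s, a i ^ n i)
        (∏ i ∈ s, ξ i ^ n i) := by
    intro s
    induction s using Finset.cons_induction with
    | empty =>
      refine ⟨?_, by simpa using isGenEig_one _⟩
      rw [Finset.sum_empty, vanishingOrder_zero]; trivial
    | cons i s hi ih =>
      simp only [Finset.prod_cons, Finset.sum_cons]
      exact ⟨mul_mem_vanishingOrder (hp i _).1 ih.1, hmul (hp i _).1 ih.1 (hp i _).2 ih.2⟩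
  exact (this Finset.univ).2

/-- The exact counterpart, for eigenfunctions modulo null germs: these germs form an ideal, so no
order of vanishing has to be tracked. -/
lemma monomial_isGenEig_null (hT : IsLocalEnd T) {x : ι → analyticFun E} {a : ι → ℂ}
    (hx : ∀ i, IsGenEig T.toLinearMap (nullGerms E) (a i) (x i)) (n : ι → ℕ) :
    IsGenEig T.toLinearMap (nullGerms E) (∏ i, a i ^ n i) (∏ i, x i ^ n i) := by
  classical
  have hmul : ∀ {b c : ℂ} {g h : analyticFun E}, IsGenEig T.toLinearMap (nullGerms E) b g →
      IsGenEig T.toLinearMap (nullGerms E) c h →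
      IsGenEig T.toLinearMap (nullGerms E) (b * c) (g * h) := by
    intro b c g h h1 h2
    refine IsGenEig.mul (A₁ := ⊤) (A₂ := ⊤) (fun _ _ => trivial) (fun _ _ => trivial) hT.null
      hT.null ?_ ?_ trivial trivial h1 h2
    · intro g hg h _
      rw [mul_comm]
      exact mul_mem_nullGerms h hg
    · intro g _ h hh
      exact mul_mem_nullGerms g hh
  have hp : ∀ i (m : ℕ), IsGenEig T.toLinearMap (nullGerms E) (a i ^ m) (x i ^ m) := by
    intro i m
    induction m with
    | zero => simpa using isGenEig_one _
    | succ m ih => rw [pow_succ, pow_succ]; exact hmul ih (hx i)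
  have : ∀ s : Finset ι, IsGenEig T.toLinearMap (nullGerms E) (∏ i ∈ s, a i ^ n i)
        (∏ i ∈ s, x i ^ n i) := by
    intro s
    induction s using Finset.cons_induction with
    | empty => simpa using isGenEig_one _
    | cons i s hi ih =>
      simp only [Finset.prod_cons]
      exact hmul (hp i _) ih
  exact this Finset.univ

variable [FiniteDimensional ℂ E]

/-- Splitting of the leading part of `g` into its resonant and nonresonant parts. -/
theorem exists_resonant_splitting (hT : IsLocalEnd T) {ξ : ι → analyticFun E} {a : ι → ℂ}
    (hξ : IsCoordinateSystem ξ)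
    (he : ∀ i, IsGenEig T.toLinearMap (vanishingOrder E 2) (a i) (ξ i)) (c : ℂ) {k : ℕ}
    {g : analyticFun E} (hg : g ∈ vanishingOrder E k) :
    ∃ g₁ ∈ Submodule.span ℂ {m : analyticFun E | ∃ n : ι → ℕ, ∑ i, n i = k ∧
        ∏ i, a i ^ n i = c ∧ m = ∏ i, ξ i ^ n i},
      ∃ h ∈ vanishingOrder E k, g = g₁ + h ∧ ∃ q : Polynomial ℂ, q.eval c ≠ 0 ∧
        Polynomial.aeval T.toLinearMap q h ∈ vanishingOrder E (k + 1) := by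
  -- The nonresonant part: germs killed, modulo order `k + 1`, by a polynomial in `T` that does not
  -- vanish at `c`. A monomial with eigenvalue different from `c` belongs to it.
  let W : Submodule ℂ (analyticFun E) :=
    { carrier := {h | h ∈ vanishingOrder E k ∧ ∃ q : Polynomial ℂ, q.eval c ≠ 0 ∧
        Polynomial.aeval T.toLinearMap q h ∈ vanishingOrder E (k + 1)}
      zero_mem' := ⟨Submodule.zero_mem _, 1, by simp, by simp⟩
      add_mem' := by
        rintro g h ⟨h1, q, hq, h2⟩ ⟨h3, q', hq', h4⟩
        refine ⟨Submodule.add_mem _ h1 h3, q * q', by simp [hq, hq'], ?_⟩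
        rw [map_add]
        refine Submodule.add_mem _ ?_ ?_
        · rw [mul_comm, map_mul, Module.End.mul_apply]
          exact aeval_mem_of_mem (hT.order _) _ h2
        · rw [map_mul, Module.End.mul_apply]
          exact aeval_mem_of_mem (hT.order _) _ h4
      smul_mem' := by
        rintro b h ⟨h1, q, hq, h2⟩
        exact ⟨Submodule.smul_mem _ _ h1, q, hq, by rw [map_smul]; exact Submodule.smul_mem _ _ h2⟩ }
  set V := Submodule.span ℂ {m : analyticFun E | ∃ n : ι → ℕ, ∑ i, n i = k ∧
        ∏ i, a i ^ n i = c ∧ m = ∏ i, ξ i ^ n i}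
  have hle : vanishingOrder E k ≤ V ⊔ W := by
    refine hξ.vanishingOrder_le ?_ ?_
    · refine le_sup_of_le_right fun h hh => ⟨vanishingOrder_anti (Nat.le_succ k) hh, 1, by simp, ?_⟩
      simpa using hh
    · intro n hn
      by_cases hc : ∏ i, a i ^ n i = c
      · exact Submodule.mem_sup_left (Submodule.subset_span ⟨n, hn, hc, rfl⟩)
      · refine Submodule.mem_sup_right ⟨?_, ?_⟩
        · rw [← hn]; exact monomial_mem_vanishingOrder hξ.map_zero n
        · obtain ⟨M, hM⟩ := monomial_isGenEig hT hξ.map_zero he n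
          refine ⟨(Polynomial.X - Polynomial.C (∏ i, a i ^ n i)) ^ M, ?_, ?_⟩
          · simp only [Polynomial.eval_pow, Polynomial.eval_sub, Polynomial.eval_X,
              Polynomial.eval_C]
            exact pow_ne_zero _ (sub_ne_zero.2 (Ne.symm hc))
          · rw [aeval_X_sub_C_pow, ← hn]; exact hM
  obtain ⟨g₁, h1, h, h2, rfl⟩ := Submodule.mem_sup.1 (hle hg)
  exact ⟨g₁, h1, h, h2.1, rfl, h2.2⟩

/-- An approximate generalized eigenfunction can be corrected to any finite order. -/
theorem exists_lift_to_order (hT : IsLocalEnd T) {ξ : ι → analyticFun E} {a : ι → ℂ}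
    (hξ : IsCoordinateSystem ξ)
    (he : ∀ i, IsGenEig T.toLinearMap (vanishingOrder E 2) (a i) (ξ i)) {c : ℂ}
    {l : analyticFun E} (hl : IsGenEig T.toLinearMap (vanishingOrder E 2) c l) (k : ℕ) :
    ∃ v, v - l ∈ vanishingOrder E 2 ∧ IsGenEig T.toLinearMap (vanishingOrder E (k + 2)) c v := by
  induction k with
  | zero => exact ⟨l, by simp, hl⟩
  | succ k ih =>
    obtain ⟨v, hv, M, hM⟩ := ih
    obtain ⟨g₁, hg₁, h, hh, hsum, q, hq, hqh⟩ := exists_resonant_splitting hT hξ he c hM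
    -- The Bézout relation inverts `(T - c) ^ M` on the nonresonant part `h` of the error, so
    -- subtracting `α(T) h` from `v` removes it to leading order. The resonant part needs no
    -- removal, being itself a generalized eigenvector for `c`.
    obtain ⟨α, β, hαβ⟩ := isCoprime_X_sub_C_pow hq M
    have hg₁' : IsGenEig T.toLinearMap (vanishingOrder E (k + 2 + 1)) c g₁ := by
      change g₁ ∈ genEigSubmodule T.toLinearMap (vanishingOrder E (k + 2 + 1)) (hT.order _) c
      refine (Submodule.span_le.2 ?_) hg₁
      rintro _ ⟨n, hn, hc, rfl⟩
      rw [← hn, ← hc]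
      exact monomial_isGenEig hT hξ.map_zero he n
    refine ⟨v - Polynomial.aeval T.toLinearMap α h, ?_, ?_⟩
    · rw [sub_right_comm]
      exact Submodule.sub_mem _ hv (vanishingOrder_anti (by omega)
        (aeval_mem_of_mem (hT.order _) α hh))
    · have h1 : h = ((T.toLinearMap - algebraMap ℂ _ c) ^ M) (Polynomial.aeval T.toLinearMap α h) +
          Polynomial.aeval T.toLinearMap β (Polynomial.aeval T.toLinearMap q h) := by
        rw [← aeval_X_sub_C_pow, ← Module.End.mul_apply, ← Module.End.mul_apply, ← map_mul,
          ← map_mul, ← LinearMap.add_apply, ← map_add, mul_comm _ α, hαβ]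
        simp
      have h2 : IsGenEig T.toLinearMap (vanishingOrder E (k + 2 + 1)) c
          (((T.toLinearMap - algebraMap ℂ _ c) ^ M) (v - Polynomial.aeval T.toLinearMap α h)) := by
        have h3 : ((T.toLinearMap - algebraMap ℂ _ c) ^ M)
            (v - Polynomial.aeval T.toLinearMap α h) = g₁ +
              Polynomial.aeval T.toLinearMap β (Polynomial.aeval T.toLinearMap q h) := by
          rw [map_sub, hsum, sub_eq_iff_eq_add]
          conv_lhs => rw [h1]
          abel
        rw [h3]
        exact (genEigSubmodule T.toLinearMap (vanishingOrder E (k + 2 + 1)) (hT.order _) c).add_mem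
          hg₁' ⟨0, by simpa using aeval_mem_of_mem (hT.order _) β hqh⟩
      obtain ⟨M', hM'⟩ := h2
      refine ⟨M' + M, ?_⟩
      rw [pow_add, Module.End.mul_apply]
      exact hM'

/-- A generalized eigenfunction with nonzero eigenvalue is a resonant polynomial in the
generalized eigencoordinates with nonzero eigenvalues, modulo functions of high order. -/
theorem exists_resonant_polynomial_of_order {κ κ' : Type*} [Fintype κ] [Fintype κ']
    (hT : IsLocalEnd T) {x : κ → analyticFun E} {t : κ' → analyticFun E} {τ : κ → ℂ}
    (hξ : IsCoordinateSystem (Sum.elim x t))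
    (hx : ∀ i, IsGenEig T.toLinearMap (nullGerms E) (τ i) (x i))
    (ht : ∀ i, IsGenEig T.toLinearMap (vanishingOrder E 2) 0 (t i)) {c : ℂ} (hc : c ≠ 0)
    {g : analyticFun E} (hg : IsGenEig T.toLinearMap (nullGerms E) c g) (k : ℕ) :
    ∃ Q : MvPolynomial κ ℂ, (∀ n ∈ Q.support, ∏ i, τ i ^ n i = c) ∧
      g - MvPolynomial.aeval x Q ∈ vanishingOrder E k ∧
      IsGenEig T.toLinearMap (nullGerms E) c (g - MvPolynomial.aeval x Q) := by
  set s : Set (κ →₀ ℕ) := {n | ∏ i, τ i ^ n i = c}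
  have hpoly : ∀ Q ∈ MvPolynomial.restrictSupport ℂ s,
      IsGenEig T.toLinearMap (nullGerms E) c (MvPolynomial.aeval x Q) := by
    intro Q hQ
    have hQ' : (Q.support : Set (κ →₀ ℕ)) ⊆ s := (MvPolynomial.mem_restrictSupport_iff ℂ).1 hQ
    change _ ∈ genEigSubmodule T.toLinearMap (nullGerms E) hT.null c
    rw [Q.as_sum, map_sum]
    refine Submodule.sum_mem _ fun n hn => ?_
    rw [MvPolynomial.aeval_monomial, ← Algebra.smul_def, Finsupp.prod_fintype _ _ (by simp)]
    refine Submodule.smul_mem _ _ ?_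
    have h1 := monomial_isGenEig_null hT hx n
    rw [show ∏ i, τ i ^ n i = c from hQ' hn] at h1
    exact h1
  suffices h : ∃ Q ∈ MvPolynomial.restrictSupport ℂ s,
      g - MvPolynomial.aeval x Q ∈ vanishingOrder E k by
    obtain ⟨Q, hQ, h⟩ := h
    refine ⟨Q, fun n hn => (MvPolynomial.mem_restrictSupport_iff ℂ).1 hQ hn, h, ?_⟩
    exact (genEigSubmodule T.toLinearMap (nullGerms E) hT.null c).sub_mem hg (hpoly Q hQ)
  induction k with
  | zero => exact ⟨0, Submodule.zero_mem _, by rw [vanishingOrder_zero]; trivial⟩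
  | succ k ih =>
    obtain ⟨Q, hQ, hk⟩ := ih
    have he : ∀ i, IsGenEig T.toLinearMap (vanishingOrder E 2) (Sum.elim τ (fun _ => 0) i)
        (Sum.elim x t i) := by
      rintro (i | i)
      · exact (hx i).mono nullGerms_le
      · exact ht i
    obtain ⟨g₁, hg₁, h, hh, hsum, q, hq, hqh⟩ := exists_resonant_splitting hT hξ he c hk
    obtain ⟨Q₁, hQ₁, rfl⟩ : ∃ Q₁ ∈ MvPolynomial.restrictSupport ℂ s,
        g₁ = MvPolynomial.aeval x Q₁ := by
      have : g₁ ∈ (MvPolynomial.restrictSupport ℂ s).map (MvPolynomial.aeval x).toLinearMap := by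
        refine (Submodule.span_le.2 ?_) hg₁
        rintro _ ⟨n, hn, hnc, rfl⟩
        rw [Fintype.prod_sum_type] at hnc
        simp only [Sum.elim_inl, Sum.elim_inr] at hnc
        -- A monomial involving some `t i` has eigenvalue `0`, hence is not resonant with `c ≠ 0`.
        have hzero : ∀ i, n (Sum.inr i) = 0 := by
          intro i
          by_contra hi
          refine hc ?_
          rw [← hnc, Finset.prod_eq_zero (Finset.mem_univ i) (zero_pow hi), mul_zero]
        refine ⟨MvPolynomial.monomial (Finsupp.equivFunOnFinite.symm fun i => n (Sum.inl i)) 1,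
          ?_, ?_⟩
        · rw [SetLike.mem_coe, MvPolynomial.mem_restrictSupport_iff]
          intro m hm
          have := MvPolynomial.support_monomial_subset hm
          rw [Finset.mem_singleton] at this
          subst this
          simpa [hzero, s] using hnc
        · rw [AlgHom.toLinearMap_apply, MvPolynomial.aeval_monomial,
            Finsupp.prod_fintype _ _ (by simp), Fintype.prod_sum_type]
          simp [hzero]
      obtain ⟨Q₁, h1, h2⟩ := this
      exact ⟨Q₁, h1, h2.symm⟩
    refine ⟨Q + Q₁, Submodule.add_mem _ hQ hQ₁, ?_⟩
    have e : g - MvPolynomial.aeval x (Q + Q₁) = h := by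
      rw [map_add, ← sub_sub, hsum]; abel
    rw [e]
    -- The remainder `h` is nonresonant to leading order, yet also a generalized eigenfunction for
    -- `c`, as a difference of such; so its leading part vanishes.
    refine IsGenEig.mem_of_aeval_mem (hT.order _) ?_ hq hqh
    have h3 : IsGenEig T.toLinearMap (nullGerms E) c h := by
      rw [← e]
      exact (genEigSubmodule T.toLinearMap (nullGerms E) hT.null c).sub_mem hg
        (hpoly _ (Submodule.add_mem _ hQ hQ₁))
    exact h3.mono nullGerms_le

end Resonance

/-! ### Generalized eigenfunctions of composition with a contracting germ -/

section PullbackResonance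

variable {E : Type*} [NormedAddCommGroup E] [NormedSpace ℂ E]

lemma pullback_isLocalEnd {f : E → E} (hf : AnalyticAt ℂ f 0) (h0 : f 0 = 0) :
    IsLocalEnd (pullback f hf h0) := by
  have ht : Tendsto f (𝓝 0) (𝓝 0) := by simpa [h0] using hf.continuousAt.tendsto
  constructor
  · intro k g hg
    have h1 := Asymptotics.IsBigO.comp_tendsto hg ht
    refine Asymptotics.IsBigO.trans h1 (Asymptotics.IsBigO.pow ?_ k)
    have h2 := hf.differentiableAt.isBigO_sub
    simpa [h0] using h2.norm_norm
  · intro g hg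
    exact ht.eventually hg

variable {f : E → E} {C Λ : ℝ}

omit [NormedSpace ℂ E] in
lemma exists_order_of_ne_zero (hf : ContractsAtRate f C Λ) (b : ℝ) :
    ∃ N : ℕ, ∀ N' ≥ N, b * Λ ^ N' < 1 := by
  have h1 := (tendsto_pow_atTop_nhds_zero_of_lt_one hf.rate_pos.le hf.rate_lt).const_mul b
  rw [mul_zero] at h1
  exact eventually_atTop.1 (h1.eventually (gt_mem_nhds one_pos))

/-- Multiplication by a nonzero scalar. -/
noncomputable def scalarEquiv {c : ℂ} (hc : c ≠ 0) : ℂ ≃L[ℂ] ℂ :=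
  ContinuousLinearEquiv.unitsEquivAut ℂ (Units.mk0 c hc)

/-- On germs of order `N` the operator `T - c` is injective modulo null germs, so the factors of `(T
- c) ^ M` are peeled off one at a time. -/
lemma IsGenEig.mem_nullGerms_of_order (hf : ContractsAtRate f C Λ) (hfa : AnalyticAt ℂ f 0)
    (h0 : f 0 = 0) {c : ℂ} (hc : c ≠ 0) {N : ℕ}
    (hN : ‖((scalarEquiv hc).symm : ℂ →L[ℂ] ℂ)‖ * Λ ^ N < 1) {g : analyticFun E}
    (hg : g ∈ vanishingOrder E N)
    (he : IsGenEig (pullback f hfa h0).toLinearMap (nullGerms E) c g) : g ∈ nullGerms E := by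
  obtain ⟨M, hM⟩ := he
  have hT := pullback_isLocalEnd hfa h0
  induction M generalizing g with
  | zero => simpa using hM
  | succ M ih =>
    rw [pow_succ, Module.End.mul_apply] at hM
    have h1 := ih (g := ((pullback f hfa h0).toLinearMap - algebraMap ℂ _ c) g) (by
      simp only [LinearMap.sub_apply, Module.algebraMap_end_apply]
      exact Submodule.sub_mem _ (hT.order _ _ hg) (Submodule.smul_mem _ _ hg)) hM
    refine hf.eq_zero_of_comp_eq (scalarEquiv hc) hN hg ?_
    filter_upwards [h1] with x hx
    have hx' : (g : E → ℂ) (f x) - c * (g : E → ℂ) x = 0 := hx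
    simp only [scalarEquiv, ContinuousLinearEquiv.unitsEquivAut_apply, Units.val_mk0]
    linear_combination hx'

variable [FiniteDimensional ℂ E]

/-- Surjectivity of `T - c` on germs of high order, used `M` times. -/
lemma exists_sub_algebraMap_pow_eq (hf : ContractsAtRate f C Λ) (hfa : AnalyticAt ℂ f 0)
    (h0 : f 0 = 0) {c : ℂ} (hc : c ≠ 0) {N : ℕ}
    (hN : ‖((scalarEquiv hc).symm : ℂ →L[ℂ] ℂ)‖ * Λ ^ N < 1) (M : ℕ) {g : analyticFun E}
    (hg : g ∈ vanishingOrder E N) : ∃ e ∈ vanishingOrder E N,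
      (((pullback f hfa h0).toLinearMap - algebraMap ℂ _ c) ^ M) e - g ∈ nullGerms E := by
  have hT := pullback_isLocalEnd hfa h0
  induction M generalizing g with
  | zero => exact ⟨g, hg, by simp⟩
  | succ M ih =>
    obtain ⟨e, he, h1⟩ := ih hg
    obtain ⟨e', ha, hO, h2⟩ := hf.exists_comp_eq hfa (scalarEquiv hc) hN e.2 he
    refine ⟨⟨e', ha⟩, hO, ?_⟩
    have h3 : ((pullback f hfa h0).toLinearMap - algebraMap ℂ _ c) ⟨e', ha⟩ - e ∈ nullGerms E := by
      filter_upwards [h2] with x hx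
      change e' (f x) - c * e' x - (e : E → ℂ) x = 0
      rw [hx]
      simp only [scalarEquiv, ContinuousLinearEquiv.unitsEquivAut_apply, Units.val_mk0]
      ring
    rw [pow_succ, Module.End.mul_apply]
    have h4 := sub_algebraMap_pow_mem hT.null c M h3
    rw [map_sub] at h4
    have := Submodule.add_mem _ h4 h1
    simpa using this

/-- Every generalized eigenvector of the differential with nonzero eigenvalue is the leading part
of a generalized eigenfunction. -/
theorem exists_generalized_eigenfunction {ι : Type*} [Fintype ι] (hf : ContractsAtRate f C Λ)
    (hfa : AnalyticAt ℂ f 0) (h0 : f 0 = 0) {ξ : ι → analyticFun E} {a : ι → ℂ}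
    (hξ : IsCoordinateSystem ξ)
    (he : ∀ i, IsGenEig (pullback f hfa h0).toLinearMap (vanishingOrder E 2) (a i) (ξ i)) {c : ℂ}
    (hc : c ≠ 0) {l : analyticFun E}
    (hl : IsGenEig (pullback f hfa h0).toLinearMap (vanishingOrder E 2) c l) :
    ∃ v, v - l ∈ vanishingOrder E 2 ∧
      IsGenEig (pullback f hfa h0).toLinearMap (nullGerms E) c v := by
  obtain ⟨N, hN⟩ := exists_order_of_ne_zero hf ‖((scalarEquiv hc).symm : ℂ →L[ℂ] ℂ)‖
  obtain ⟨v, hv, M, hM⟩ := exists_lift_to_order (pullback_isLocalEnd hfa h0) hξ he hl N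
  -- After finitely many formal corrections the error has order `N + 2`, where it has a preimage
  -- under `(T - c) ^ M`; subtracting that preimage makes the eigenfunction exact.
  obtain ⟨e, heN, h1⟩ := exists_sub_algebraMap_pow_eq hf hfa h0 hc (hN (N + 2) (by omega)) M hM
  refine ⟨v - e, ?_, M, ?_⟩
  · rw [sub_right_comm]
    exact Submodule.sub_mem _ hv (vanishingOrder_anti (by omega) heN)
  · rw [map_sub, ← neg_sub]
    exact Submodule.neg_mem _ h1

/-- A generalized eigenfunction with nonzero eigenvalue is a resonant polynomial in the
generalized eigencoordinates with nonzero eigenvalues. -/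
theorem exists_resonant_polynomial {κ κ' : Type*} [Fintype κ] [Fintype κ']
    (hf : ContractsAtRate f C Λ) (hfa : AnalyticAt ℂ f 0) (h0 : f 0 = 0)
    {x : κ → analyticFun E} {t : κ' → analyticFun E} {τ : κ → ℂ}
    (hξ : IsCoordinateSystem (Sum.elim x t))
    (hx : ∀ i, IsGenEig (pullback f hfa h0).toLinearMap (nullGerms E) (τ i) (x i))
    (ht : ∀ i, IsGenEig (pullback f hfa h0).toLinearMap (vanishingOrder E 2) 0 (t i))
    {c : ℂ} (hc : c ≠ 0) {g : analyticFun E}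
    (hg : IsGenEig (pullback f hfa h0).toLinearMap (nullGerms E) c g) :
    ∃ Q : MvPolynomial κ ℂ, (∀ n ∈ Q.support, ∏ i, τ i ^ n i = c) ∧
      g - MvPolynomial.aeval x Q ∈ nullGerms E := by
  obtain ⟨N, hN⟩ := exists_order_of_ne_zero hf ‖((scalarEquiv hc).symm : ℂ →L[ℂ] ℂ)‖
  obtain ⟨Q, hQ, h1, h2⟩ := exists_resonant_polynomial_of_order (pullback_isLocalEnd hfa h0)
    hξ hx ht hc hg N
  exact ⟨Q, hQ, IsGenEig.mem_nullGerms_of_order hf hfa h0 hc (hN N le_rfl) h1 h2⟩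

end PullbackResonance

/-! ### Logarithms of units -/

section LogOne

variable {E : Type*} [NormedAddCommGroup E] [NormedSpace ℂ E]

/-- `log (1 + u)` for a function `u` vanishing at `0`. -/
noncomputable def logOneAdd (u : analyticFun E) (h : (u : E → ℂ) 0 = 0) : analyticFun E :=
  ⟨fun x => Complex.log (1 + (u : E → ℂ) x),
    (analyticAt_const.add u.2).clog (by simp [h])⟩

/-- Mean value inequality for `log (1 + z) - z`, whose derivative `-z / (1 + z)` is at most `2 r` in
norm because `‖1 + z‖ ≥ 1 / 2`. -/
lemma norm_log_sub_log_le {a b : ℂ} {r : ℝ} (hr : r ≤ 1 / 2) (ha : ‖a‖ ≤ r) (hb : ‖b‖ ≤ r) :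
    ‖Complex.log (1 + a) - Complex.log (1 + b) - (a - b)‖ ≤ 2 * r * ‖a - b‖ := by
  have hder : ∀ z ∈ Metric.closedBall (0 : ℂ) r,
      HasDerivWithinAt (fun z => Complex.log (1 + z) - z) (1 / (1 + z) - 1)
        (Metric.closedBall (0 : ℂ) r) z := by
    intro z hz
    have hz' : ‖z‖ ≤ r := mem_closedBall_zero_iff.1 hz
    have hs : 1 + z ∈ Complex.slitPlane :=
      Complex.mem_slitPlane_of_norm_lt_one (by linarith)
    exact ((((hasDerivAt_id z).const_add 1).clog hs).sub (hasDerivAt_id z)).hasDerivWithinAt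
  have hbd : ∀ z ∈ Metric.closedBall (0 : ℂ) r, ‖1 / (1 + z) - 1‖ ≤ 2 * r := by
    intro z hz
    have hz' : ‖z‖ ≤ r := mem_closedBall_zero_iff.1 hz
    have h1 : 1 / 2 ≤ ‖1 + z‖ := by
      have := norm_sub_norm_le (1 : ℂ) (-z)
      simp only [norm_one, norm_neg, sub_neg_eq_add] at this
      linarith
    have h2 : 1 + z ≠ 0 := norm_pos_iff.1 (by linarith)
    have h3 : 1 / (1 + z) - 1 = -z / (1 + z) := by field_simp; ring
    rw [h3, norm_div, norm_neg, div_le_iff₀ (by linarith)]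
    nlinarith [norm_nonneg z]
  have h := (convex_closedBall (0 : ℂ) r).norm_image_sub_le_of_norm_hasDerivWithin_le hder hbd
    (mem_closedBall_zero_iff.2 hb) (mem_closedBall_zero_iff.2 ha)
  refine le_trans (le_of_eq ?_) h
  congr 1; ring

/-- To first order `log (1 + ·)` is the identity, so an equation involving it can be solved order by
order as if it were linear. -/
lemma logOneAdd_sub_mem {u v : analyticFun E} (hu : (u : E → ℂ) 0 = 0)
    (hv : (v : E → ℂ) 0 = 0) {k : ℕ} (h : v - u ∈ vanishingOrder E (k + 1)) :
    logOneAdd v hv - logOneAdd u hu - (v - u) ∈ vanishingOrder E (k + 2) := by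
  have hu1 : (u : E → ℂ) =O[𝓝 0] fun x => ‖x‖ ^ 1 := mem_vanishingOrder_one.2 hu
  have hv1 : (v : E → ℂ) =O[𝓝 0] fun x => ‖x‖ ^ 1 := mem_vanishingOrder_one.2 hv
  have hsmall : ∀ᶠ x in 𝓝 (0 : E), ‖(v : E → ℂ) x‖ + ‖(u : E → ℂ) x‖ ≤ 1 / 2 := by
    have hc : ContinuousAt (fun x => ‖(v : E → ℂ) x‖ + ‖(u : E → ℂ) x‖) 0 :=
      v.2.continuousAt.norm.add u.2.continuousAt.norm
    have := hc.tendsto.eventually_lt_const (u := (1 / 2 : ℝ)) (by simp [hu, hv])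
    exact this.mono fun x hx => hx.le
  have h1 : (fun x => 2 * (‖(v : E → ℂ) x‖ + ‖(u : E → ℂ) x‖) * ‖(v : E → ℂ) x - (u : E → ℂ) x‖)
      =O[𝓝 0] fun x => ‖x‖ ^ 1 * ‖x‖ ^ (k + 1) :=
    ((hv1.norm_left.add hu1.norm_left).const_mul_left 2).mul (Asymptotics.IsBigO.norm_left h)
  have h2 : (fun x => Complex.log (1 + (v : E → ℂ) x) - Complex.log (1 + (u : E → ℂ) x) -
      ((v : E → ℂ) x - (u : E → ℂ) x)) =O[𝓝 0] fun x => ‖x‖ ^ 1 * ‖x‖ ^ (k + 1) := by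
    refine Asymptotics.IsBigO.trans (Asymptotics.IsBigO.of_bound 1 ?_) h1
    filter_upwards [hsmall] with x hx
    refine (norm_log_sub_log_le hx (le_add_of_nonneg_right (norm_nonneg _))
      (le_add_of_nonneg_left (norm_nonneg _))).trans ?_
    rw [one_mul]
    exact le_abs_self _
  exact h2.congr_right fun x => by ring

end LogOne

/-! ### The homological equation twisted by a matrix -/

section Twisted

variable {E : Type*} [NormedAddCommGroup E] [NormedSpace ℂ E]
variable {p : ℕ}

/-- The action of a matrix on row vectors with entries in a module. -/
def rowAction {R : Type*} [AddCommGroup R] [Module ℂ R] (D : Matrix (Fin p) (Fin p) ℂ) :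
    Module.End ℂ (Fin p → R) where
  toFun φ := fun j => ∑ l, D l j • φ l
  map_add' φ ψ := by ext j; simp [Finset.sum_add_distrib]
  map_smul' c φ := by
    ext j
    simp only [Pi.smul_apply, Finset.smul_sum, RingHom.id_apply]
    exact Finset.sum_congr rfl fun l _ => smul_comm _ _ _

variable {R : Type*} [AddCommGroup R] [Module ℂ R]

lemma rowAction_mul (D D' : Matrix (Fin p) (Fin p) ℂ) :
    rowAction (R := R) D * rowAction D' = rowAction (D' * D) := by
  refine LinearMap.ext fun φ => funext fun j => ?_
  change ∑ l, D l j • ∑ i, D' i l • φ i = ∑ i, (D' * D) i j • φ i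
  simp only [Finset.smul_sum, smul_smul, Matrix.mul_apply, Finset.sum_smul]
  rw [Finset.sum_comm]
  exact Finset.sum_congr rfl fun i _ => Finset.sum_congr rfl fun l _ => by rw [mul_comm]

lemma rowAction_pow (D : Matrix (Fin p) (Fin p) ℂ) (n : ℕ) :
    rowAction (R := R) D ^ n = rowAction (D ^ n) := by
  induction n with
  | zero =>
    refine LinearMap.ext fun φ => funext fun j => ?_
    change φ j = ∑ l, (1 : Matrix (Fin p) (Fin p) ℂ) l j • φ l
    simp [Matrix.one_apply]
  | succ n ih => rw [pow_succ, ih, rowAction_mul, ← pow_succ']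

lemma sub_mul_geom_sum {A B : Module.End ℂ R} (h : Commute A B) (n : ℕ) :
    (A - B) * ∑ i ∈ Finset.range n, A ^ i * B ^ (n - 1 - i) = A ^ n - B ^ n :=
  Commute.mul_geom_sum₂ h n

lemma compLeft_pow (A : Module.End ℂ R) (n : ℕ) :
    (A.compLeft (Fin p) : Module.End ℂ (Fin p → R)) ^ n = (A ^ n).compLeft (Fin p) := by
  induction n with
  | zero => rfl
  | succ n ih => rw [pow_succ, ih, pow_succ]; rfl

lemma commute_compLeft_rowAction (A : Module.End ℂ R) (D : Matrix (Fin p) (Fin p) ℂ) :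
    Commute (A.compLeft (Fin p) : Module.End ℂ (Fin p → R)) (rowAction D) := by
  refine LinearMap.ext fun φ => funext fun j => ?_
  change A (∑ l, D l j • φ l) = ∑ l, D l j • A (φ l)
  simp

/-- Tuples of functions vanishing to order `k`. -/
def vanishingOrderPi (p k : ℕ) : Submodule ℂ (Fin p → analyticFun E) :=
  Submodule.pi Set.univ fun _ => vanishingOrder E k

lemma mem_vanishingOrderPi {k : ℕ} {φ : Fin p → analyticFun E} :
    φ ∈ vanishingOrderPi p k ↔ ∀ j, φ j ∈ vanishingOrder E k := by
  simp [vanishingOrderPi, Submodule.mem_pi]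

/-- The operator `φ ↦ φ ∘ f - φ D` on tuples of functions. -/
noncomputable def twisted (T : analyticFun E →ₐ[ℂ] analyticFun E)
    (D : Matrix (Fin p) (Fin p) ℂ) : Module.End ℂ (Fin p → analyticFun E) :=
  T.toLinearMap.compLeft (Fin p) - rowAction D

lemma twisted_apply (T : analyticFun E →ₐ[ℂ] analyticFun E) (D : Matrix (Fin p) (Fin p) ℂ)
    (φ : Fin p → analyticFun E) (j : Fin p) :
    twisted T D φ j = T (φ j) - ∑ l, D l j • φ l := rfl

variable {T T' : analyticFun E →ₐ[ℂ] analyticFun E}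

/-- Composition with `f` commutes with the action of `D`, so `twisted T D` divides the difference of
their `η`-th powers, and it suffices to reach the image of that difference. There `g` behaves like
an eigenvector for `a`, up to nilpotency removed by induction on `M`, and `a - D ^ η` is invertible;
`c'` solves `c' (a - D ^ η) = c`. -/
lemma tensor_mem_of_not_mem_spectrum (hT : IsLocalEnd T) {η : ℕ}
    (hη : T'.toLinearMap = T.toLinearMap ^ η) (D : Matrix (Fin p) (Fin p) ℂ) {a : ℂ}
    (ha : a ∉ spectrum ℂ (D ^ η)) {k : ℕ} (M : ℕ) :
    ∀ g ∈ vanishingOrder E k, ((T'.toLinearMap - algebraMap ℂ _ a) ^ M) g ∈ vanishingOrder E (k + 1) →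
    ∀ c : Fin p → ℂ, (fun j => c j • g) ∈
      (vanishingOrderPi p k).map (twisted T D) ⊔ vanishingOrderPi p (k + 1) := by
  induction M with
  | zero =>
    intro g _ hg c
    exact Submodule.mem_sup_right
      (mem_vanishingOrderPi.2 fun j => Submodule.smul_mem _ _ (by simpa using hg))
  | succ M ih =>
    intro g hg hM c
    rw [spectrum.notMem_iff] at ha
    obtain ⟨c', hc'⟩ : ∃ c' : Fin p → ℂ, ∀ j, a * c' j - ∑ l, (D ^ η) l j * c' l = c j := by
      refine ⟨Matrix.vecMul c (algebraMap ℂ (Matrix (Fin p) (Fin p) ℂ) a - D ^ η)⁻¹, fun j => ?_⟩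
      set c' := Matrix.vecMul c (algebraMap ℂ (Matrix (Fin p) (Fin p) ℂ) a - D ^ η)⁻¹
      have h1 : Matrix.vecMul c' (algebraMap ℂ (Matrix (Fin p) (Fin p) ℂ) a - D ^ η) = c := by
        rw [Matrix.vecMul_vecMul, Matrix.nonsing_inv_mul _ ((Matrix.isUnit_iff_isUnit_det _).1 ha),
          Matrix.vecMul_one]
      have h2 := congrFun h1 j
      rw [Matrix.vecMul_sub, Pi.sub_apply, Matrix.algebraMap_eq_diagonal] at h2
      simp only [Matrix.vecMul_diagonal, Pi.algebraMap_apply] at h2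
      rw [← h2]
      simp only [Matrix.vecMul, dotProduct, Algebra.algebraMap_self, RingHom.id_apply]
      rw [mul_comm]
      congr 1
      exact Finset.sum_congr rfl fun l _ => mul_comm _ _
    have hTk : ∀ g ∈ vanishingOrder E k, T'.toLinearMap g ∈ vanishingOrder E k := by
      intro g hg
      rw [hη]
      have := aeval_mem_of_mem (hT.order k) (Polynomial.X ^ η) hg
      simpa using this
    have hg' : (T'.toLinearMap - algebraMap ℂ _ a) g ∈ vanishingOrder E k := by
      simp only [LinearMap.sub_apply, Module.algebraMap_end_apply]
      exact Submodule.sub_mem _ (hTk g hg) (Submodule.smul_mem _ _ hg)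
    rw [pow_succ, Module.End.mul_apply] at hM
    have h1 := ih _ hg' hM c'
    set A : Module.End ℂ (Fin p → analyticFun E) := T.toLinearMap.compLeft (Fin p)
    set B : Module.End ℂ (Fin p → analyticFun E) := rowAction D
    have hAB : Commute A B := commute_compLeft_rowAction _ _
    set G := ∑ i ∈ Finset.range η, A ^ i * B ^ (η - 1 - i)
    have hgeom : twisted T D * G = A ^ η - B ^ η := by
      rw [show twisted T D = A - B from rfl]
      exact sub_mul_geom_sum hAB η
    have hA : ∀ φ ∈ vanishingOrderPi (E := E) p k, A φ ∈ vanishingOrderPi (E := E) p k := by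
      intro φ hφ
      exact mem_vanishingOrderPi.2 fun j => hT.order k _ (mem_vanishingOrderPi.1 hφ j)
    have hB : ∀ φ ∈ vanishingOrderPi (E := E) p k, B φ ∈ vanishingOrderPi (E := E) p k := by
      intro φ hφ
      exact mem_vanishingOrderPi.2 fun j => Submodule.sum_mem _ fun l _ =>
        Submodule.smul_mem _ _ (mem_vanishingOrderPi.1 hφ l)
    have hpow : ∀ (L : Module.End ℂ (Fin p → analyticFun E)),
        (∀ φ ∈ vanishingOrderPi (E := E) p k, L φ ∈ vanishingOrderPi (E := E) p k) →
        ∀ n, ∀ φ ∈ vanishingOrderPi (E := E) p k, (L ^ n) φ ∈ vanishingOrderPi (E := E) p k := by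
      intro L hL n φ hφ
      have := aeval_mem_of_mem hL (Polynomial.X ^ n) hφ
      simpa using this
    have hG : G (fun j => c' j • g) ∈ vanishingOrderPi (E := E) p k := by
      simp only [G, LinearMap.sum_apply, Module.End.mul_apply]
      refine Submodule.sum_mem _ fun i _ => hpow A hA _ _ (hpow B hB _ _ ?_)
      exact mem_vanishingOrderPi.2 fun j => Submodule.smul_mem _ _ hg
    have h2 : (fun j => c j • g) = twisted T D (G fun j => c' j • g) -
        fun j => c' j • (T'.toLinearMap - algebraMap ℂ _ a) g := by
      rw [← Module.End.mul_apply, hgeom]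
      simp only [A, B]
      rw [compLeft_pow, rowAction_pow, ← hη]
      ext1 j
      change c j • g = T'.toLinearMap (c' j • g) - (∑ l, (D ^ η) l j • c' l • g) -
        c' j • (T'.toLinearMap g - a • g)
      rw [← hc' j, map_smul]
      simp only [smul_smul, ← Finset.sum_smul, smul_sub, sub_smul, mul_comm a]
      abel
    rw [h2]
    exact Submodule.sub_mem _ (Submodule.mem_sup_left ⟨_, hG, rfl⟩) h1

variable [FiniteDimensional ℂ E] {κ κ' : Type*} [Fintype κ] [Fintype κ']

/-- The homological equation for the leading part of the right-hand side. -/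
theorem exists_twisted_leading (hT : IsLocalEnd T) (hT' : IsLocalEnd T') {η : ℕ}
    (hη : T'.toLinearMap = T.toLinearMap ^ η) {D : Matrix (Fin p) (Fin p) ℂ} (hD : IsUnit D)
    {x : κ → analyticFun E} {t : κ' → analyticFun E} {τ : κ → ℂ}
    (hξ : IsCoordinateSystem (Sum.elim x t))
    (hx : ∀ i, IsGenEig T'.toLinearMap (vanishingOrder E 2) (τ i) (x i))
    (ht : ∀ i, IsGenEig T'.toLinearMap (vanishingOrder E 2) 0 (t i)) {k : ℕ}
    {e : Fin p → analyticFun E} (he : ∀ j, e j ∈ vanishingOrder E k) :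
    ∃ φ : Fin p → analyticFun E, (∀ j, φ j ∈ vanishingOrder E k) ∧
      ∃ g : Fin p → MvPolynomial κ ℂ,
        (∀ j, ∀ n ∈ (g j).support, ∑ i, n i = k ∧ ∏ i, τ i ^ n i ∈ spectrum ℂ (D ^ η)) ∧
        ∀ j, e j + twisted T D φ j - MvPolynomial.aeval x (g j) ∈ vanishingOrder E (k + 1) := by
  classical
  set s : Set (κ →₀ ℕ) := {n | ∑ i, n i = k ∧ ∏ i, τ i ^ n i ∈ spectrum ℂ (D ^ η)}
  set Q : Submodule ℂ (Fin p → MvPolynomial κ ℂ) :=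
    Submodule.pi Set.univ fun _ => MvPolynomial.restrictSupport ℂ s
  set ev : (Fin p → MvPolynomial κ ℂ) →ₗ[ℂ] (Fin p → analyticFun E) :=
    (MvPolynomial.aeval x).toLinearMap.compLeft (Fin p)
  set S := (vanishingOrderPi (E := E) p k).map (twisted T D) ⊔ vanishingOrderPi p (k + 1) ⊔ Q.map ev
  have hξe : ∀ i, IsGenEig T'.toLinearMap (vanishingOrder E 2) (Sum.elim τ (fun _ => 0) i)
      (Sum.elim x t i) := by
    rintro (i | i)
    · exact hx i
    · exact ht i
  -- As `D` is invertible, `0` is not an eigenvalue of `D ^ η`, so monomials involving `t` are never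
  -- resonant and only polynomials in `x` remain.
  have h0 : (0 : ℂ) ∉ spectrum ℂ (D ^ η) := spectrum.zero_notMem ℂ (hD.pow η)
  have hmem : e ∈ S := by
    rw [← Finset.univ_sum_single e]
    refine Submodule.sum_mem _ fun j _ => ?_
    have hle : vanishingOrder E k ≤ S.comap (LinearMap.single ℂ (fun _ => analyticFun E) j) := by
      refine hξ.vanishingOrder_le ?_ ?_
      · intro g hg
        refine Submodule.mem_sup_left (Submodule.mem_sup_right (mem_vanishingOrderPi.2 fun i => ?_))
        rcases eq_or_ne i j with rfl | hij
        · simpa using hg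
        · simp [hij]
      · intro n hn
        have hsing : ∀ g : analyticFun E, LinearMap.single ℂ (fun _ => analyticFun E) j g =
            fun i => (Pi.single j 1 : Fin p → ℂ) i • g := by
          intro g
          ext1 i
          rcases eq_or_ne i j with rfl | hij
          · simp
          · simp [hij]
        rw [Submodule.mem_comap]
        by_cases hsp : ∏ i, Sum.elim τ (fun _ : κ' => (0 : ℂ)) i ^ n i ∈ spectrum ℂ (D ^ η)
        · refine Submodule.mem_sup_right ?_
          rw [Fintype.prod_sum_type] at hsp
          simp only [Sum.elim_inl, Sum.elim_inr] at hsp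
          have hzero : ∀ i, n (Sum.inr i) = 0 := by
            intro i
            by_contra hi
            rw [Finset.prod_eq_zero (f := fun i : κ' => (0 : ℂ) ^ n (Sum.inr i))
              (Finset.mem_univ i) (zero_pow hi), mul_zero] at hsp
            exact h0 hsp
          rw [Fintype.sum_sum_type] at hn
          refine ⟨Pi.single j (MvPolynomial.monomial
            (Finsupp.equivFunOnFinite.symm fun i => n (Sum.inl i)) 1), ?_, ?_⟩
          · simp only [Q, SetLike.mem_coe, Submodule.mem_pi]
            intro i _
            rcases eq_or_ne i j with rfl | hij
            · rw [Pi.single_eq_same, MvPolynomial.mem_restrictSupport_iff]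
              intro m hm
              have := MvPolynomial.support_monomial_subset hm
              rw [Finset.mem_singleton] at this
              subst this
              refine ⟨?_, ?_⟩
              · simpa [hzero] using hn
              · simpa [hzero] using hsp
            · rw [Pi.single_eq_of_ne hij]; exact Submodule.zero_mem _
          · ext1 i
            change MvPolynomial.aeval x ((Pi.single j _ : Fin p → MvPolynomial κ ℂ) i) = _
            rcases eq_or_ne i j with rfl | hij
            · rw [Pi.single_eq_same, MvPolynomial.aeval_monomial,
                Finsupp.prod_fintype _ _ (by simp), Fintype.prod_sum_type]
              simp [hzero]
            · simp [hij]
        · rw [hsing]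
          obtain ⟨M, hM⟩ := monomial_isGenEig hT' hξ.map_zero hξe n
          rw [hn] at hM
          refine Submodule.mem_sup_left ?_
          exact tensor_mem_of_not_mem_spectrum hT hη D hsp M _
            (hn ▸ monomial_mem_vanishingOrder hξ.map_zero n) hM _
    exact hle (he j)
  obtain ⟨_, h1, _, ⟨g, hg, rfl⟩, rfl⟩ := Submodule.mem_sup.1 hmem
  obtain ⟨_, ⟨φ, hφ, rfl⟩, r, hr, rfl⟩ := Submodule.mem_sup.1 h1
  refine ⟨-φ, fun j => ?_, g, fun j n hn => ?_, fun j => ?_⟩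
  · exact Submodule.neg_mem _ (mem_vanishingOrderPi.1 hφ j)
  · have := (Submodule.mem_pi.1 hg) j trivial
    exact (MvPolynomial.mem_restrictSupport_iff ℂ).1 this hn
  · have h2 : (twisted T D φ + r + ev g) j + twisted T D (-φ) j -
        MvPolynomial.aeval x (g j) = r j := by
      rw [map_neg]
      simp only [Pi.add_apply, Pi.neg_apply]
      change twisted T D φ j + r j + MvPolynomial.aeval x (g j) + _ - _ = _
      abel
    rw [h2]
    exact mem_vanishingOrderPi.1 hr j

end Twisted

/-! ### Secondary resonances: normalizing the units -/

section SecondaryNormalForm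

variable {E : Type*} [NormedAddCommGroup E] [NormedSpace ℂ E]

lemma aeval_analyticFun_apply {κ : Type*} (x : κ → analyticFun E) (Q : MvPolynomial κ ℂ) (y : E) :
    (MvPolynomial.aeval x Q : analyticFun E).1 y = MvPolynomial.eval (fun i => (x i).1 y) Q := by
  have h := MvPolynomial.comp_aeval_apply (φ := (Pi.evalAlgHom ℂ (fun _ : E => ℂ) y).comp
    (analyticFun E).val) x Q
  simpa [MvPolynomial.aeval_eq_eval] using! h

lemma pullback_iterate {f : E → E} (hf : AnalyticAt ℂ f 0) (h0 : f 0 = 0) (η : ℕ)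
    (hfη : AnalyticAt ℂ f^[η] 0) (h0η : f^[η] 0 = 0) :
    (pullback f^[η] hfη h0η).toLinearMap = (pullback f hf h0).toLinearMap ^ η := by
  have key : ∀ n : ℕ, ∀ g : analyticFun E,
      (((pullback f hf h0).toLinearMap ^ n) g : E → ℂ) = fun y => (g : E → ℂ) (f^[n] y) := by
    intro n
    induction n with
    | zero => intro g; rfl
    | succ n ih =>
      intro g
      rw [pow_succ, Module.End.mul_apply, ih]
      funext y
      rw [Function.iterate_succ_apply']
      rfl
  refine LinearMap.ext fun g => Subtype.ext ?_
  rw [key]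
  rfl

lemma analyticAt_iterate {f : E → E} (hf : AnalyticAt ℂ f 0) (h0 : f 0 = 0) (n : ℕ) :
    AnalyticAt ℂ f^[n] 0 := by
  induction n with
  | zero => exact analyticAt_id
  | succ n ih =>
    rw [Function.iterate_succ']
    exact AnalyticAt.comp (by rwa [Function.iterate_fixed h0]) ih

omit [NormedSpace ℂ E] in
lemma ContractsAtRate.iterate {f : E → E} {C Λ : ℝ} (hf : ContractsAtRate f C Λ) {η : ℕ}
    (hη : 0 < η) : ContractsAtRate f^[η] C Λ := by
  refine ⟨hf.C_pos, hf.rate_pos, hf.rate_lt, fun s hs => ?_⟩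
  obtain ⟨r, hr, h⟩ := hf.bound s hs
  refine ⟨r, hr, fun x hx n => ?_⟩
  rw [← Function.iterate_mul]
  refine ⟨(h x hx _).1, (h x hx _).2.trans ?_⟩
  have h1 : Λ ^ (η * n) ≤ Λ ^ n :=
    pow_le_pow_of_le_one hf.rate_pos.le hf.rate_lt.le (Nat.le_mul_of_pos_left n hη)
  have := hf.C_pos
  gcongr

variable [FiniteDimensional ℂ E] {f : E → E} {C Λ : ℝ} {p : ℕ}

/-- At high order there is no resonance: the action of `D` on rows is the invertible map given by
its transpose on `ℂ^p`, and the Neumann series applies with this map as `M`. -/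
lemma exists_twisted_eq (hf : ContractsAtRate f C Λ) (hfa : AnalyticAt ℂ f 0) (h0 : f 0 = 0)
    {D : Matrix (Fin p) (Fin p) ℂ} (hD : IsUnit D) :
    ∃ N : ℕ, ∀ N' ≥ N, ∀ e : Fin p → analyticFun E, (∀ j, e j ∈ vanishingOrder E N') →
      ∃ φ : Fin p → analyticFun E, (∀ j, φ j ∈ vanishingOrder E N') ∧
        ∀ j, e j + twisted (pullback f hfa h0) D φ j ∈ nullGerms E := by
  have hDt : IsUnit D.transpose.det :=
    (Matrix.isUnit_iff_isUnit_det _).1 ((Matrix.isUnit_transpose D).2 hD)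
  let M : (Fin p → ℂ) ≃L[ℂ] (Fin p → ℂ) :=
    (Matrix.toLin'OfInv (M := D.transpose⁻¹) (M' := D.transpose)
      (Matrix.nonsing_inv_mul _ hDt) (Matrix.mul_nonsing_inv _ hDt)).toContinuousLinearEquiv
  have hM : ∀ (v : Fin p → ℂ) (j : Fin p), M v j = ∑ l, D l j * v l := by
    intro v j
    simp [M, Matrix.toLin'OfInv, Matrix.mulVec, dotProduct]
  obtain ⟨N, hN⟩ := exists_order_of_ne_zero hf ‖(M.symm : (Fin p → ℂ) →L[ℂ] (Fin p → ℂ))‖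
  refine ⟨N, fun N' hN' e he => ?_⟩
  obtain ⟨g, hga, hgO, hg⟩ := hf.exists_comp_eq hfa M (hN N' hN') (R := fun y j => -(e j : E → ℂ) y)
    (analyticAt_pi_iff.2 fun j => (e j).2.neg)
    (Asymptotics.isBigO_pi.2 fun j => Asymptotics.IsBigO.neg_left (he j))
  obtain ⟨G, hG⟩ : ∃ G : Fin p → analyticFun E, ∀ j y, (G j : E → ℂ) y = g y j :=
    ⟨fun j => ⟨fun y => g y j, analyticAt_pi_iff.1 hga j⟩, fun _ _ => rfl⟩
  refine ⟨G, fun j => (Asymptotics.isBigO_pi.1 hgO j).congr_left fun y => (hG j y).symm,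
    fun j => ?_⟩
  filter_upwards [hg] with y hy
  have h1 : ((∑ l, D l j • G l : analyticFun E) : E → ℂ) y = ∑ l, D l j * g y l := by simp [hG]
  have h2 := congrFun hy j
  rw [Pi.add_apply, hM] at h2
  change (e j : E → ℂ) y + ((G j : E → ℂ) (f y) - ((∑ l, D l j • G l : analyticFun E) : E → ℂ) y) = 0
  rw [h1, hG, h2]
  ring

/-- The equation `h + φ ∘ f - φ D = log (1 + g(x))` has a solution `(φ, g)` with `g` a polynomial
with secondary resonant monomials. -/
theorem exists_secondary_normal_form {κ κ' : Type*} [Fintype κ] [Fintype κ']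
    (hf : ContractsAtRate f C Λ) (hfa : AnalyticAt ℂ f 0) (h0 : f 0 = 0) {η : ℕ}
    (hfη : AnalyticAt ℂ f^[η] 0) (h0η : f^[η] 0 = 0)
    {D : Matrix (Fin p) (Fin p) ℂ} (hD : IsUnit D)
    {x : κ → analyticFun E} {t : κ' → analyticFun E} {τ : κ → ℂ}
    (hξ : IsCoordinateSystem (Sum.elim x t))
    (hx : ∀ i, IsGenEig (pullback f^[η] hfη h0η).toLinearMap (vanishingOrder E 2) (τ i) (x i))
    (ht : ∀ i, IsGenEig (pullback f^[η] hfη h0η).toLinearMap (vanishingOrder E 2) 0 (t i))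
    (h : Fin p → analyticFun E) (hh : ∀ j, (h j : E → ℂ) 0 = 0) :
    ∃ φ : Fin p → analyticFun E, (∀ j, (φ j : E → ℂ) 0 = 0) ∧
      ∃ g : Fin p → MvPolynomial κ ℂ, (∀ j, MvPolynomial.constantCoeff (g j) = 0) ∧
        (∀ j, ∀ n ∈ (g j).support, ∏ i, τ i ^ n i ∈ spectrum ℂ (D ^ η)) ∧
        ∀ j, ∀ᶠ y in 𝓝 (0 : E), Complex.exp ((h j : E → ℂ) y + (φ j : E → ℂ) (f y) -
          ∑ l, D l j * (φ l : E → ℂ) y) =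
            1 + MvPolynomial.eval (fun i => (x i : E → ℂ) y) (g j) := by
  have hT := pullback_isLocalEnd hfa h0
  have hT' := pullback_isLocalEnd hfη h0η
  have hη := pullback_iterate hfa h0 η hfη h0η
  set T := pullback f hfa h0
  have hx0 : ∀ i, (x i : E → ℂ) 0 = 0 := fun i => hξ.map_zero (Sum.inl i)
  have hev0 : ∀ Q : MvPolynomial κ ℂ, MvPolynomial.constantCoeff Q = 0 →
      (MvPolynomial.aeval x Q : analyticFun E).1 0 = 0 := by
    intro Q hQ
    rw [aeval_analyticFun_apply]
    simp only [hx0]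
    exact (congrFun (congrArg DFunLike.coe MvPolynomial.eval_zero) Q).trans hQ
  -- Successive approximation: at each order the nonresonant part of the error goes into `φ` and the
  -- resonant part into `g`. The proof `hc` is carried along because the logarithm is formed only
  -- for germs vanishing at `0`.
  have key : ∀ k : ℕ, ∃ φ : Fin p → analyticFun E, (∀ j, (φ j : E → ℂ) 0 = 0) ∧
      ∃ g : Fin p → MvPolynomial κ ℂ, ∃ hc : ∀ j, MvPolynomial.constantCoeff (g j) = 0,
        (∀ j, ∀ n ∈ (g j).support, ∏ i, τ i ^ n i ∈ spectrum ℂ (D ^ η)) ∧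
        ∀ j, h j + twisted T D φ j - logOneAdd (MvPolynomial.aeval x (g j)) (hev0 _ (hc j)) ∈
          vanishingOrder E (k + 1) := by
    intro k
    induction k with
    | zero =>
      refine ⟨0, fun _ => rfl, 0, fun _ => by simp, by simp, fun j => ?_⟩
      rw [mem_vanishingOrder_one, map_zero]
      change (h j : E → ℂ) 0 + 0 - Complex.log (1 + _) = 0
      rw [hh]
      simp
    | succ k ih =>
      obtain ⟨φ, hφ, g, hc, hres, he⟩ := ih
      obtain ⟨φ', hφ', g', hg', he'⟩ := exists_twisted_leading hT hT' hη hD hξ hx ht he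
      have hc' : ∀ j, MvPolynomial.constantCoeff (g' j) = 0 := by
        intro j
        by_contra hne
        have h1 : (0 : κ →₀ ℕ) ∈ (g' j).support := MvPolynomial.mem_support_iff.2 hne
        have := (hg' j 0 h1).1
        simp at this
      have hc'' : ∀ j, MvPolynomial.constantCoeff ((g + g') j) = 0 := fun j => by
        rw [Pi.add_apply, map_add, hc j, hc' j, add_zero]
      refine ⟨φ + φ', fun j => ?_, g + g', hc'', fun j n hn => ?_, fun j => ?_⟩
      · have h1 := mem_vanishingOrder_one.1 (vanishingOrder_anti (show 1 ≤ k + 1 by omega) (hφ' j))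
        change (φ j : E → ℂ) 0 + (φ' j : E → ℂ) 0 = 0
        rw [hφ j, h1, add_zero]
      · classical
        rcases Finset.mem_union.1 (MvPolynomial.support_add hn) with h1 | h1
        · exact hres j n h1
        · exact (hg' j n h1).2
      · have h1 : MvPolynomial.aeval x ((g + g') j) - MvPolynomial.aeval x (g j) ∈
            vanishingOrder E (k + 1) := by
          rw [Pi.add_apply, map_add, add_sub_cancel_left]
          have h2 := vanishingOrder_anti (Nat.le_succ (k + 1)) (he' j)
          have h3 : twisted T D φ' j ∈ vanishingOrder E (k + 1) :=
            Submodule.sub_mem _ (hT.order _ _ (hφ' j))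
              (Submodule.sum_mem _ fun l _ => Submodule.smul_mem _ _ (hφ' l))
          have h4 := Submodule.sub_mem _ (Submodule.add_mem _ (he j) h3) h2
          simpa using h4
        have h2 := logOneAdd_sub_mem (hev0 _ (hc j)) (hev0 _ (hc'' j)) h1
        have h3 := Submodule.sub_mem _ (he' j) h2
        have e : h j + twisted T D (φ + φ') j -
            logOneAdd (MvPolynomial.aeval x ((g + g') j)) (hev0 _ (hc'' j)) =
            h j + twisted T D φ j - logOneAdd (MvPolynomial.aeval x (g j)) (hev0 _ (hc j)) +
              twisted T D φ' j - MvPolynomial.aeval x (g' j) -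
            (logOneAdd (MvPolynomial.aeval x ((g + g') j)) (hev0 _ (hc'' j)) -
              logOneAdd (MvPolynomial.aeval x (g j)) (hev0 _ (hc j)) -
              (MvPolynomial.aeval x ((g + g') j) - MvPolynomial.aeval x (g j))) := by
          have h6 : MvPolynomial.aeval x ((g + g') j) =
              MvPolynomial.aeval x (g j) + MvPolynomial.aeval x (g' j) := by
            rw [Pi.add_apply, map_add]
          rw [map_add (twisted T D), Pi.add_apply]
          linear_combination (-1 : analyticFun E) * h6
        rw [e]
        exact h3
  obtain ⟨N, hN⟩ := exists_twisted_eq hf hfa h0 hD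
  obtain ⟨φ, hφ, g, hc, hres, he⟩ := key N
  -- Beyond order `N` the error is removed exactly by `φ'` alone; `g` is left unchanged and stays a
  -- polynomial.
  obtain ⟨φ', hφ', he'⟩ := hN (N + 1) (by omega) _ he
  refine ⟨φ + φ', fun j => ?_, g, hc, hres, fun j => ?_⟩
  · have h1 := mem_vanishingOrder_one.1 (vanishingOrder_anti (show 1 ≤ N + 1 by omega) (hφ' j))
    change (φ j : E → ℂ) 0 + (φ' j : E → ℂ) 0 = 0
    rw [hφ j, h1, add_zero]
  · have hne : ∀ᶠ y in 𝓝 (0 : E), 1 + (MvPolynomial.aeval x (g j) : analyticFun E).1 y ≠ 0 := by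
      refine (continuousAt_const.add (MvPolynomial.aeval x (g j) : analyticFun E).2.continuousAt).eventually_ne ?_
      change (1 : ℂ) + (MvPolynomial.aeval x (g j) : analyticFun E).1 0 ≠ 0
      rw [hev0 _ (hc j)]; simp
    filter_upwards [he' j, hne] with y hy hne
    have h1 : (h j : E → ℂ) y + ((φ + φ') j : E → ℂ) (f y) - ∑ l, D l j * ((φ + φ') l : E → ℂ) y =
        Complex.log (1 + (MvPolynomial.aeval x (g j) : analyticFun E).1 y) := by
      have h2 : ∀ ψ : Fin p → analyticFun E, (twisted T D ψ j : E → ℂ) y =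
          (ψ j : E → ℂ) (f y) - ∑ l, D l j * (ψ l : E → ℂ) y := by
        intro ψ
        rw [twisted_apply]
        change (ψ j : E → ℂ) (f y) - ((∑ l, D l j • ψ l : analyticFun E) : E → ℂ) y = _
        simp
      have hy' : (h j : E → ℂ) y + (twisted T D φ j : E → ℂ) y -
        Complex.log (1 + (MvPolynomial.aeval x (g j) : analyticFun E).1 y) +
          (twisted T D φ' j : E → ℂ) y = 0 := hy
      have h3 := h2 (φ + φ')
      rw [map_add] at h3
      change (twisted T D φ j : E → ℂ) y + (twisted T D φ' j : E → ℂ) y = _ at h3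
      linear_combination hy' - h3
    rw [h1, Complex.exp_log hne, aeval_analyticFun_apply]

end SecondaryNormalForm

/-! ### Division of germs by linear forms -/

section AnalyticGerms

open Metric

variable {E : Type*} [NormedAddCommGroup E] [NormedSpace ℂ E]

/-- Germs form an integral domain: near a point where `g` is nonzero `h` vanishes, hence it vanishes
on the whole ball by the identity theorem. -/
lemma eventually_eq_zero_or_of_mul {g h : E → ℂ} (hg : AnalyticAt ℂ g 0) (hh : AnalyticAt ℂ h 0)
    (hgh : ∀ᶠ x in 𝓝 0, g x * h x = 0) : g =ᶠ[𝓝 0] 0 ∨ h =ᶠ[𝓝 0] 0 := by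
  obtain ⟨r, hr, hball⟩ := eventually_nhds_iff_ball.1
    (hgh.and (hg.eventually_analyticAt.and hh.eventually_analyticAt))
  by_cases hex : ∃ x₀ ∈ ball (0 : E) r, g x₀ ≠ 0
  · obtain ⟨x₀, hx₀, hne⟩ := hex
    right
    have hh' : AnalyticOnNhd ℂ h (ball 0 r) := fun x hx => (hball x hx).2.2
    have h0 : h =ᶠ[𝓝 x₀] 0 := by
      filter_upwards [(hball x₀ hx₀).2.1.continuousAt.eventually_ne hne,
        isOpen_ball.mem_nhds hx₀] with x hx hxb
      exact (mul_eq_zero.1 (hball x hxb).1).resolve_left hx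
    have h1 := hh'.eqOn_zero_of_preconnected_of_eventuallyEq_zero
      (convex_ball (0 : E) r).isPreconnected hx₀ h0
    filter_upwards [ball_mem_nhds (0 : E) hr] with x hx using h1 hx
  · push Not at hex
    left
    filter_upwards [ball_mem_nhds (0 : E) hr] with x hx using hex x hx

lemma eventually_eq_zero_of_prod {ι : Type*} (s : Finset ι) {g : ι → E → ℂ}
    (hg : ∀ i, AnalyticAt ℂ (g i) 0) (h : ∀ᶠ x in 𝓝 0, ∏ i ∈ s, g i x = 0) :
    ∃ i ∈ s, g i =ᶠ[𝓝 0] 0 := by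
  classical
  induction s using Finset.cons_induction with
  | empty => exact absurd h.self_of_nhds (by simp)
  | cons a s ha ih =>
    simp only [Finset.prod_cons] at h
    rcases eventually_eq_zero_or_of_mul (hg a) (Finset.analyticAt_fun_prod s fun i _ => hg i) h with
      h1 | h1
    · exact ⟨a, by simp, h1⟩
    · obtain ⟨i, hi, h2⟩ := ih h1
      exact ⟨i, by simp [hi], h2⟩

lemma clm_eq_zero_of_eventually {ℓ : E →L[ℂ] ℂ} (h : (ℓ : E → ℂ) =ᶠ[𝓝 0] 0) : ℓ = 0 := by
  have h1 : fderiv ℂ (ℓ : E → ℂ) 0 = fderiv ℂ (0 : E → ℂ) 0 := h.fderiv_eq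
  rw [ℓ.fderiv] at h1
  rw [h1]
  exact (hasFDerivAt_const (0 : ℂ) (0 : E)).fderiv

/-- A germ vanishing to infinite order is zero. -/
lemma exists_not_mem_vanishingOrder {g : analyticFun E} (hg : g ∉ nullGerms E) :
    ∃ N, g ∉ vanishingOrder E N := by
  by_contra hall
  push Not at hall
  refine hg ?_
  obtain ⟨p, hp⟩ := g.2
  have hz : ∀ i y, p i (fun _ => y) = 0 := by
    intro i
    induction i using Nat.strong_induction_on with
    | _ i ih =>
      intro y
      have h1 := hp.isBigO_sub_partialSum_pow (i + 1)
      simp only [zero_add] at h1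
      have h2 : (fun y => (g : E → ℂ) y - p i (fun _ => y)) =O[𝓝 0] fun y => ‖y‖ ^ (i + 1) := by
        refine h1.congr_left fun y => ?_
        rw [FormalMultilinearSeries.partialSum, Finset.sum_range_succ,
          Finset.sum_eq_zero fun l hl => ih l (Finset.mem_range.1 hl) y, zero_add]
      have h3 : (fun y => p i (fun _ => y)) =O[𝓝 0] fun y => ‖y‖ ^ (i + 1) := by
        have h4 : (g : E → ℂ) =O[𝓝 0] fun y => ‖y‖ ^ (i + 1) := hall (i + 1)
        simpa using h4.sub h2
      exact h3.continuousMultilinearMap_apply_eq_zero y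
  obtain ⟨r, hr⟩ := hp
  filter_upwards [Metric.eball_mem_nhds (0 : E) hr.r_pos] with y hy
  have h1 := hr.hasSum hy
  simp only [hz, zero_add] at h1
  exact h1.unique hasSum_zero

variable [FiniteDimensional ℂ E]

/-- A germ vanishing on the hyperplane `ℓ = 0` is divisible by `ℓ`. -/
lemma exists_eq_mul_of_vanishing {ℓ : E →L[ℂ] ℂ} {e : E} {ψ : E → ℂ}
    (hψ : AnalyticAt ℂ ψ 0) (h : ∀ᶠ a in 𝓝 (0 : E), ψ (a - ℓ a • e) = 0) :
    ∃ ψ₁ : E → ℂ, AnalyticAt ℂ ψ₁ 0 ∧ ψ =ᶠ[𝓝 0] fun x => ℓ x * ψ₁ x := by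
  -- Hadamard's lemma: `L t` joins `x ↦ x - ℓ x • e`, after which `ψ` vanishes, to the identity.
  -- Integrating the derivative of `ψ (L t x)` produces the factor `ℓ x`, and the quotient is the
  -- average of the derivative of `ψ` along `e`.
  let L : ℝ → E →L[ℂ] E := fun t =>
    ContinuousLinearMap.id ℂ E - (1 - t : ℂ) • ℓ.smulRight e
  have hL : Continuous L := by
    have h1 : Continuous fun t : ℝ => (1 - t : ℂ) := by fun_prop
    exact continuous_const.sub (h1.smul continuous_const)
  have hLx : ∀ t x, L t x = x - ((1 - t : ℂ) * ℓ x) • e := by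
    intro t x
    simp [L, smul_smul]
  obtain ⟨r, hr, hball⟩ := eventually_nhds_iff_ball.1 (h.and hψ.eventually_analyticAt)
  refine ⟨fun x => ∫ t in (0 : ℝ)..1, fderiv ℂ ψ (L t x) e, ?_, ?_⟩
  · exact analyticAt_integral_comp_linear (G := fun x => fderiv ℂ ψ x e)
      (((ContinuousLinearMap.apply ℂ ℂ e).analyticAt _).comp hψ.fderiv) hL
  · have hr' : 0 < r / (1 + ‖ℓ‖ * ‖e‖) := by positivity
    filter_upwards [ball_mem_nhds (0 : E) hr'] with x hx
    have hmem : ∀ t ∈ Set.uIcc (0 : ℝ) 1, L t x ∈ ball (0 : E) r := by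
      intro t ht
      rw [Set.uIcc_of_le zero_le_one] at ht
      rw [mem_ball_zero_iff, lt_div_iff₀ (by positivity)] at hx
      rw [mem_ball_zero_iff, hLx]
      have h1 : ‖(1 - t : ℂ)‖ ≤ 1 := by
        rw [← Complex.ofReal_one, ← Complex.ofReal_sub, Complex.norm_real, Real.norm_eq_abs,
          abs_le]
        constructor <;> linarith [ht.1, ht.2]
      calc _ ≤ ‖x‖ + ‖((1 - t : ℂ) * ℓ x) • e‖ := norm_sub_le _ _
        _ ≤ ‖x‖ + 1 * (‖ℓ‖ * ‖x‖) * ‖e‖ := by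
          rw [norm_smul, norm_mul]
          gcongr
          exact ℓ.le_opNorm x
        _ = ‖x‖ * (1 + ‖ℓ‖ * ‖e‖) := by ring
        _ < r := hx
    have hder : ∀ t ∈ Set.uIcc (0 : ℝ) 1,
        HasDerivAt (fun t : ℝ => ψ (L t x)) (ℓ x * fderiv ℂ ψ (L t x) e) t := by
      intro t ht
      have h1 : HasDerivAt (fun t : ℝ => L t x) (ℓ x • e) t := by
        have h2 : HasDerivAt (fun t : ℝ => x - ((1 - (t : ℂ)) * ℓ x) • e)
            (-(((-1 : ℂ) * ℓ x) • e)) t := by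
          refine HasDerivAt.const_sub x ?_
          refine HasDerivAt.smul_const ?_ e
          refine HasDerivAt.mul_const ?_ _
          exact (Complex.ofRealCLM.hasDerivAt (x := t)).const_sub 1
        simp only [hLx]
        simpa using h2
      have h3 := ((hball _ (hmem t ht)).2.differentiableAt.hasFDerivAt.restrictScalars ℝ).comp_hasDerivAt t h1
      simpa [smul_eq_mul, Function.comp_def] using h3
    have hcont : ContinuousOn (fun t => ℓ x * fderiv ℂ ψ (L t x) e) (Set.uIcc (0 : ℝ) 1) := by
      refine continuousOn_const.mul ?_
      have h1 : AnalyticOnNhd ℂ ψ (ball 0 r) := fun y hy => (hball y hy).2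
      have h2 : ContinuousOn (fun y => fderiv ℂ ψ y e) (ball 0 r) :=
        h1.fderiv.continuousOn.clm_apply continuousOn_const
      exact h2.comp (hL.clm_apply continuous_const).continuousOn hmem
    have h4 := intervalIntegral.integral_eq_sub_of_hasDerivAt hder hcont.intervalIntegrable
    rw [intervalIntegral.integral_const_mul] at h4
    rw [h4, hLx, hLx]
    have hx0 : ψ (x - ℓ x • e) = 0 := by
      refine (hball x (ball_subset_ball ?_ hx)).1
      refine div_le_self hr.le ?_
      have : 0 ≤ ‖ℓ‖ * ‖e‖ := by positivity
      linarith
    simp [hx0]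

omit [FiniteDimensional ℂ E] in
/-- If the zeros of `ψ` lie on hyperplanes and `ψ 0 = 0`, then `ψ` vanishes on one of them. -/
lemma exists_vanishing_hyperplane {ι : Type*} [Fintype ι] {ℓ : ι → E →L[ℂ] ℂ}
    (hℓ : ∀ i, ℓ i ≠ 0) {ψ : E → ℂ} (hψ : AnalyticAt ℂ ψ 0) (h0 : ψ 0 = 0)
    (hnull : ¬ ψ =ᶠ[𝓝 0] 0) (hz : ∀ᶠ x in 𝓝 (0 : E), ψ x = 0 → ∃ i, ℓ i x = 0) :
    ∃ i, ∃ e, ∀ᶠ a in 𝓝 (0 : E), ψ (a - ℓ i a • e) = 0 := by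
  obtain ⟨ρ, hρ, hball⟩ := eventually_nhds_iff_ball.1 (hz.and hψ.eventually_analyticAt)
  have hψ' : AnalyticOnNhd ℂ ψ (ball 0 ρ) := fun x hx => (hball x hx).2
  -- a direction transverse to everything
  obtain ⟨v, hvρ, hψv, hℓv⟩ : ∃ v ∈ ball (0 : E) ρ, ψ v ≠ 0 ∧ ∀ i, ℓ i v ≠ 0 := by
    by_contra hno
    push Not at hno
    have h1 : ∀ᶠ x in 𝓝 (0 : E), ψ x * ∏ i, ℓ i x = 0 := by
      filter_upwards [ball_mem_nhds (0 : E) hρ] with x hx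
      by_cases hx0 : ψ x = 0
      · rw [hx0, zero_mul]
      · obtain ⟨i, hi⟩ := hno x hx hx0
        rw [Finset.prod_eq_zero (Finset.mem_univ i) hi, mul_zero]
    rcases eventually_eq_zero_or_of_mul hψ
      (Finset.analyticAt_fun_prod Finset.univ fun i _ => (ℓ i).analyticAt 0) h1 with h2 | h2
    · exact hnull h2
    · obtain ⟨i, _, h3⟩ := eventually_eq_zero_of_prod Finset.univ
        (fun i => (ℓ i).analyticAt 0) h2
      exact hℓ i (clm_eq_zero_of_eventually h3)
  have hline : AnalyticOnNhd ℂ (fun t : ℂ => ψ (t • v)) ((fun t : ℂ => t • v) ⁻¹' ball 0 ρ) := by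
    intro t ht
    refine AnalyticAt.comp (g := ψ) (hψ' _ ht) ?_
    exact analyticAt_id.smul analyticAt_const
  have hconv : IsPreconnected ((fun t : ℂ => t • v) ⁻¹' ball (0 : E) ρ) :=
    ((convex_ball (0 : E) ρ).is_linear_preimage
      (f := fun t : ℂ => t • v) ⟨fun a b => add_smul a b v, fun c a => smul_assoc c a v⟩).isPreconnected
  have h0mem : (0 : ℂ) ∈ (fun t : ℂ => t • v) ⁻¹' ball (0 : E) ρ := by
    simpa [Set.mem_preimage] using hρ
  have hne : ∀ᶠ t in 𝓝[≠] (0 : ℂ), ψ (t • v) ≠ 0 := by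
    rcases (hline 0 h0mem).eventually_eq_zero_or_eventually_ne_zero with h1 | h1
    · exfalso
      have := hline.eqOn_zero_of_preconnected_of_eventuallyEq_zero hconv h0mem h1
        (show (1 : ℂ) ∈ _ by simpa [Set.mem_preimage] using hvρ)
      simp only [one_smul] at this
      exact hψv this
    · exact h1
  rw [eventually_nhdsWithin_iff] at hne
  obtain ⟨ε₀, hε₀, hne'⟩ := eventually_nhds_iff_ball.1 hne
  set ε := min (ε₀ / 2) (ρ / 2 / (‖v‖ + 1))
  have hε : 0 < ε := by positivity
  have hεv : ε * ‖v‖ < ρ / 2 := by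
    have h1 : ε ≤ ρ / 2 / (‖v‖ + 1) := min_le_right _ _
    rw [le_div_iff₀ (by positivity)] at h1
    nlinarith
  have hsph : ∀ t ∈ sphere (0 : ℂ) ε, ψ (t • v) ≠ 0 := by
    intro t ht
    have ht' : ‖t‖ = ε := mem_sphere_zero_iff_norm.1 ht
    refine hne' t ?_ ?_
    · rw [mem_ball_zero_iff, ht']
      exact (min_le_left _ _).trans_lt (by linarith)
    · intro h
      have h' : t = 0 := h
      rw [h', norm_zero] at ht'
      exact hε.ne ht'
  have hclosed : ∀ a ∈ ball (0 : E) (ρ / 2), ∀ t : ℂ, ‖t‖ ≤ ε → a + t • v ∈ ball (0 : E) ρ := by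
    intro a ha t ht
    rw [mem_ball_zero_iff] at ha ⊢
    calc _ ≤ ‖a‖ + ‖t • v‖ := norm_add_le _ _
      _ ≤ ‖a‖ + ε * ‖v‖ := by rw [norm_smul]; gcongr
      _ < ρ := by linarith
  obtain ⟨m, hm, hmle⟩ : ∃ m > 0, ∀ t ∈ sphere (0 : ℂ) ε, m ≤ ‖ψ (t • v)‖ := by
    have hcont : ContinuousOn (fun t : ℂ => ‖ψ (t • v)‖) (sphere 0 ε) := by
      intro t ht
      have h1 : t • v ∈ ball (0 : E) ρ := by
        have := hclosed 0 (mem_ball_self (by positivity)) t (mem_sphere_zero_iff_norm.1 ht).le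
        simpa using this
      exact ((hline t h1).continuousAt.norm).continuousWithinAt
    have hnon : (sphere (0 : ℂ) ε).Nonempty := NormedSpace.sphere_nonempty.2 hε.le
    obtain ⟨t₀, ht₀, hmin⟩ := (isCompact_sphere (0 : ℂ) ε).exists_isMinOn hnon hcont
    exact ⟨‖ψ (t₀ • v)‖, norm_pos_iff.2 (hsph t₀ ht₀), fun t ht => hmin ht⟩
  have hev : ∀ᶠ a in 𝓝 (0 : E), ∀ t ∈ sphere (0 : ℂ) ε, m / 2 < ‖ψ (a + t • v)‖ := by
    refine (isCompact_sphere (0 : ℂ) ε).eventually_forall_of_forall_eventually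
      (P := fun a t => m / 2 < ‖ψ (a + t • v)‖) fun t ht => ?_
    have h1 : (0 : E) + t • v ∈ ball (0 : E) ρ :=
      hclosed 0 (mem_ball_self (by positivity)) t (mem_sphere_zero_iff_norm.1 ht).le
    have h2 : ContinuousAt (fun z : E × ℂ => ‖ψ (z.1 + z.2 • v)‖) (0, t) :=
      (ContinuousAt.comp (f := fun z : E × ℂ => z.1 + z.2 • v) (g := ψ)
        (hψ' _ h1).continuousAt (by fun_prop)).norm
    refine h2.eventually (lt_mem_nhds ?_)
    have := hmle t ht
    simp only [zero_add]
    linarith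
  have hsmall : ∀ᶠ a in 𝓝 (0 : E), ‖ψ a‖ < m / 2 := by
    refine hψ.continuousAt.norm.eventually (gt_mem_nhds ?_)
    simpa [h0] using hm
  -- On the disc `a + t • v` the germ `ψ` has a zero, where some `ℓ i` vanishes by hypothesis; this
  -- determines `t`, and the zero is the projection of `a` to the kernel of `ℓ i` along `v`. Which
  -- `i` occurs depends on `a`, but the product over all `i` vanishes identically, so one factor
  -- does.
  have hprod : ∀ᶠ a in 𝓝 (0 : E), ∏ i, ψ (a - (ℓ i a) • ((ℓ i v)⁻¹ • v)) = 0 := by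
    filter_upwards [hev, hsmall, ball_mem_nhds (0 : E) (half_pos hρ)] with a ha1 ha2 ha3
    obtain ⟨t, ht, hzero⟩ : ∃ t : ℂ, ‖t‖ ≤ ε ∧ ψ (a + t • v) = 0 := by
      by_contra hno
      push Not at hno
      -- Minimum principle: without a zero, `1 / ψ` would be holomorphic on the disc and larger at
      -- the centre than its bound on the boundary.
      have hd : ∀ t ∈ closedBall (0 : ℂ) ε, DifferentiableAt ℂ (fun t : ℂ => (ψ (a + t • v))⁻¹) t := by
        intro t ht
        have ht' : ‖t‖ ≤ ε := mem_closedBall_zero_iff.1 ht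
        refine DifferentiableAt.inv ?_ (hno t ht')
        exact DifferentiableAt.comp t (hψ' _ (hclosed a ha3 t ht')).differentiableAt (by fun_prop)
      have hdc : DiffContOnCl ℂ (fun t : ℂ => (ψ (a + t • v))⁻¹) (ball 0 ε) := by
        refine DifferentiableOn.diffContOnCl ?_
        rw [closure_ball _ hε.ne']
        exact fun t ht => (hd t ht).differentiableWithinAt
      have h1 := Complex.norm_le_of_forall_mem_frontier_norm_le isBounded_ball hdc
        (C := (m / 2)⁻¹) ?_ (subset_closure (mem_ball_self hε))
      · simp only [zero_smul, add_zero, norm_inv] at h1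
        have hpos : 0 < ‖ψ a‖ := norm_pos_iff.2 (by simpa using hno 0 (by simpa using hε.le))
        rw [inv_le_inv₀ hpos (by positivity)] at h1
        linarith
      · intro t ht
        rw [frontier_ball _ hε.ne'] at ht
        rw [norm_inv]
        exact inv_anti₀ (by positivity) (ha1 t ht).le
    obtain ⟨i, hi⟩ := (hball _ (hclosed a ha3 t ht)).1 hzero
    refine Finset.prod_eq_zero (Finset.mem_univ i) ?_
    have ht2 : t = -(ℓ i a * (ℓ i v)⁻¹) := by
      rw [map_add, map_smul, smul_eq_mul] at hi
      field_simp [hℓv i]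
      linear_combination hi
    rw [smul_smul, sub_eq_add_neg, ← neg_smul, ← ht2]
    exact hzero
  obtain ⟨i, _, hi⟩ := eventually_eq_zero_of_prod Finset.univ
    (g := fun i a => ψ (a - (ℓ i a) • ((ℓ i v)⁻¹ • v))) (fun i => by
      refine AnalyticAt.comp (g := ψ) (by simpa using hψ) ?_
      exact analyticAt_id.sub (((ℓ i).analyticAt 0).smul analyticAt_const)) hprod
  exact ⟨i, (ℓ i v)⁻¹ • v, hi⟩

/-- A germ whose zeros lie on hyperplanes is a unit times a product of powers of their
equations. -/
theorem exists_unit_mul_prod_linear {ι : Type*} [Fintype ι] {ℓ : ι → E →L[ℂ] ℂ}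
    (hℓ : ∀ i, ℓ i ≠ 0) {φ : E → ℂ} (hφ : AnalyticAt ℂ φ 0)
    (hz : ∀ᶠ x in 𝓝 (0 : E), φ x = 0 → ∃ i, ℓ i x = 0) :
    ∃ (n : ι → ℕ) (u : E → ℂ), AnalyticAt ℂ u 0 ∧ u 0 ≠ 0 ∧
      φ =ᶠ[𝓝 0] fun x => u x * ∏ i, ℓ i x ^ n i := by
  classical
  have hnull : ∀ ψ : E → ℂ, AnalyticAt ℂ ψ 0 → (∀ᶠ x in 𝓝 (0 : E), ψ x = 0 → ∃ i, ℓ i x = 0) →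
      ¬ ψ =ᶠ[𝓝 0] 0 := by
    intro ψ _ hzψ hψ0
    have h1 : ∀ᶠ x in 𝓝 (0 : E), ∏ i, ℓ i x = 0 := by
      filter_upwards [hzψ, hψ0] with x hx hx0
      obtain ⟨i, hi⟩ := hx hx0
      exact Finset.prod_eq_zero (Finset.mem_univ i) hi
    obtain ⟨i, _, h3⟩ := eventually_eq_zero_of_prod Finset.univ (fun i => (ℓ i).analyticAt 0) h1
    exact hℓ i (clm_eq_zero_of_eventually h3)
  obtain ⟨N, hN⟩ := exists_not_mem_vanishingOrder (g := ⟨φ, hφ⟩) (hnull φ hφ hz)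
  have hN' : ¬ φ =O[𝓝 0] fun x => ‖x‖ ^ N := hN
  clear hN
  -- Here `N` is an order to which the germ does not vanish. Dividing by a linear form lowers it by
  -- one, and `N = 0` is absurd since every germ is bounded.
  induction N generalizing φ with
  | zero =>
    refine absurd ?_ hN'
    simpa using hφ.continuousAt.norm.isBoundedUnder_le.isBigO_one ℝ
  | succ N ih =>
    by_cases h0 : φ 0 = 0
    · obtain ⟨i, e, hi⟩ := exists_vanishing_hyperplane hℓ hφ h0 (hnull φ hφ hz) hz
      obtain ⟨φ₁, hφ₁, heq⟩ := exists_eq_mul_of_vanishing hφ hi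
      obtain ⟨n, u, hu, hu0, h1⟩ := ih hφ₁ (by
        filter_upwards [hz, heq] with x hx hxe hx0
        exact hx (by rw [hxe, hx0, mul_zero])) (by
        intro hO
        refine hN' (Asymptotics.IsBigO.congr' ?_ heq.symm
          (EventuallyEq.of_eq (funext fun x => (pow_succ' ‖x‖ N).symm)))
        exact Asymptotics.IsBigO.mul ((ℓ i).isBigO_id _).norm_right hO)
      refine ⟨n + Pi.single i 1, u, hu, hu0, ?_⟩
      filter_upwards [heq, h1] with x hx hx1
      have e : ∀ j, ℓ j x ^ (n + Pi.single i 1 : ι → ℕ) j = ℓ j x ^ n j * if j = i then ℓ j x else 1 := by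
        intro j
        rcases eq_or_ne j i with rfl | hj
        · simp [pow_succ]
        · simp [hj]
      simp only [e, Finset.prod_mul_distrib, Finset.prod_ite_eq', Finset.mem_univ, if_true]
      rw [hx, hx1]
      ring
    · exact ⟨0, φ, hφ, h0, by simp⟩

end AnalyticGerms

/-! ### Local inverses and dual vectors -/

section LocalInverse

variable {E : Type*} [NormedAddCommGroup E] [NormedSpace ℂ E] [FiniteDimensional ℂ E]
variable {E' : Type*} [NormedAddCommGroup E'] [NormedSpace ℂ E'] [FiniteDimensional ℂ E']

/-- A germ of a biholomorphism has an analytic local inverse. -/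
theorem exists_local_inverse {Φ : E → E'} (hΦ : AnalyticAt ℂ Φ 0) (h0 : Φ 0 = 0)
    (hb : Function.Bijective (fderiv ℂ Φ 0)) :
    ∃ Ψ : E' → E, AnalyticAt ℂ Ψ 0 ∧ Ψ 0 = 0 ∧ (∀ᶠ x in 𝓝 0, Ψ (Φ x) = x) ∧
      (∀ᶠ y in 𝓝 0, Φ (Ψ y) = y) ∧ Function.Bijective (fderiv ℂ Ψ 0) := by
  have := FiniteDimensional.complete ℂ E
  have := FiniteDimensional.complete ℂ E'
  let e : E ≃L[ℂ] E' := ContinuousLinearEquiv.ofBijective (fderiv ℂ Φ 0)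
    (LinearMap.ker_eq_bot.2 hb.1) (LinearMap.range_eq_top.2 hb.2)
  have he : (e : E →L[ℂ] E') = fderiv ℂ Φ 0 := rfl
  have hs : HasStrictFDerivAt Φ (e : E →L[ℂ] E') 0 := he ▸ hΦ.hasStrictFDerivAt
  have hc : ContDiffAt ℂ ⊤ Φ 0 := hΦ.contDiffAt
  have hl := hs.eventually_left_inverse
  have hr := hs.eventually_right_inverse
  have hinv := hs.to_localInverse
  have hΨ0 : hs.localInverse Φ e 0 (Φ 0) = 0 := hl.self_of_nhds
  rw [h0] at hr hinv hΨ0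
  refine ⟨hs.localInverse Φ e 0, ?_, hΨ0, hl, hr, ?_⟩
  · have h1 := hc.to_localInverse (f' := e) (he ▸ hΦ.hasStrictFDerivAt.hasFDerivAt) (by simp)
    rw [h0] at h1
    exact h1.analyticAt
  · rw [hinv.hasFDerivAt.fderiv]
    exact e.symm.bijective

omit [FiniteDimensional ℂ E] in
/-- The linear forms of an independent family have dual vectors. -/
lemma exists_dual_vectors {ι : Type*} [Finite ι] [DecidableEq ι] {ℓ : ι → E →L[ℂ] ℂ}
    (hℓ : LinearIndependent ℂ ℓ) : ∃ e : ι → E, ∀ i j, ℓ i (e j) = if i = j then 1 else 0 := by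
  have key : ∀ j, ∃ v, ℓ j v = 1 ∧ ∀ i, i ≠ j → ℓ i v = 0 := by
    intro j
    by_contra hno
    push Not at hno
    have h1 : (ℓ j : E →ₗ[ℂ] ℂ) ∈ Submodule.span ℂ
        (Set.range fun i : {i // i ≠ j} => (ℓ i : E →ₗ[ℂ] ℂ)) := by
      refine mem_span_of_iInf_ker_le_ker fun v hv => ?_
      rw [Submodule.mem_iInf] at hv
      rw [LinearMap.mem_ker]
      by_contra hjv
      obtain ⟨i, hi, hne⟩ := hno ((ℓ j v)⁻¹ • v) (by
        rw [map_smul, smul_eq_mul]; exact inv_mul_cancel₀ hjv)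
      refine hne ?_
      have := hv ⟨i, hi⟩
      rw [LinearMap.mem_ker] at this
      rw [map_smul]
      exact smul_eq_zero_of_right _ this
    have h2 : LinearIndependent ℂ fun i => (ℓ i : E →ₗ[ℂ] ℂ) :=
      hℓ.map' (ContinuousLinearMap.coeLM ℂ)
        (LinearMap.ker_eq_bot.2 ContinuousLinearMap.coe_injective)
    refine h2.notMem_span_image (s := {i | i ≠ j}) (x := j) (by simp) ?_
    rwa [Set.image_eq_range]
  choose e he he' using key
  refine ⟨e, fun i j => ?_⟩
  split_ifs with h
  · rw [h, he]
  · exact he' j i h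

end LocalInverse

/-! ### Divisors supported on simple normal crossings -/

section Divisors

variable {E : Type*} [NormedAddCommGroup E] [NormedSpace ℂ E] [FiniteDimensional ℂ E]
variable {ι : Type*} [Fintype ι]

/-- Local equations of hypersurfaces with simple normal crossings at `0`. -/
structure IsTransverse (w : ι → E → ℂ) : Prop where
  analytic : ∀ k, AnalyticAt ℂ (w k) 0
  map_zero : ∀ k, w k 0 = 0
  transverse : LinearIndependent ℂ (fun k => fderiv ℂ (w k) 0)

/-- Germs with independent differentials can be straightened to linear forms. -/
lemma IsTransverse.exists_straightening {w : ι → E → ℂ} (hw : IsTransverse w) :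
    ∃ Ψ : E → E, AnalyticAt ℂ Ψ 0 ∧ Ψ 0 = 0 ∧
      (∀ k, ∀ᶠ y in 𝓝 0, w k (Ψ y) = fderiv ℂ (w k) 0 y) ∧
      ∃ Φ : E → E, AnalyticAt ℂ Φ 0 ∧ Φ 0 = 0 ∧ ∀ᶠ x in 𝓝 0, Ψ (Φ x) = x := by
  classical
  obtain ⟨e, he⟩ := exists_dual_vectors hw.transverse
  -- The dual vectors make the linear form `dw_k` composed with `Φ` equal to `w k`, and the
  -- differential of `Φ` at `0` is the identity; `Ψ` is its inverse.
  set Φ : E → E := fun x => x + ∑ k, (w k x - fderiv ℂ (w k) 0 x) • e k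
  have hΦ : AnalyticAt ℂ Φ 0 := analyticAt_id.add (Finset.analyticAt_fun_sum _ fun k _ =>
    ((hw.analytic k).sub ((fderiv ℂ (w k) 0).analyticAt 0)).smul analyticAt_const)
  have hΦ0 : Φ 0 = 0 := by simp [Φ, hw.map_zero]
  have hd : HasFDerivAt Φ (ContinuousLinearMap.id ℂ E) 0 := by
    have h1 : HasFDerivAt Φ (ContinuousLinearMap.id ℂ E + ∑ k,
        (fderiv ℂ (w k) 0 - fderiv ℂ (w k) 0).smulRight (e k)) 0 :=
      (hasFDerivAt_id _).add (HasFDerivAt.fun_sum fun k _ =>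
        ((hw.analytic k).differentiableAt.hasFDerivAt.sub
          (fderiv ℂ (w k) 0).hasFDerivAt).smul_const (e k))
    simpa using h1
  obtain ⟨Ψ, hΨ, hΨ0, hl, hr, -⟩ := exists_local_inverse hΦ hΦ0 (by
    rw [hd.fderiv]; exact Function.bijective_id)
  refine ⟨Ψ, hΨ, hΨ0, fun k => ?_, Φ, hΦ, hΦ0, hl⟩
  filter_upwards [hr] with y hy
  have h1 : fderiv ℂ (w k) 0 (Φ (Ψ y)) = w k (Ψ y) := by
    simp only [Φ, map_add, map_sum, map_smul, he, smul_eq_mul, mul_ite, mul_one, mul_zero,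
      Finset.sum_ite_eq, Finset.mem_univ, if_true]
    ring
  rw [← h1, hy]

/-- A germ whose zeros lie on transverse hypersurfaces is a unit times a monomial in their
equations. -/
theorem IsTransverse.exists_unit_mul_prod {w : ι → E → ℂ} (hw : IsTransverse w) {φ : E → ℂ}
    (hφ : AnalyticAt ℂ φ 0) (hz : ∀ᶠ x in 𝓝 (0 : E), φ x = 0 → ∃ i, w i x = 0) :
    ∃ (n : ι → ℕ) (u : E → ℂ), AnalyticAt ℂ u 0 ∧ u 0 ≠ 0 ∧
      φ =ᶠ[𝓝 0] fun x => u x * ∏ i, w i x ^ n i := by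
  obtain ⟨Ψ, hΨ, hΨ0, hwΨ, Φ, hΦ, hΦ0, hinv⟩ := hw.exists_straightening
  have hΨt : Tendsto Ψ (𝓝 0) (𝓝 0) := by simpa [hΨ0] using hΨ.continuousAt.tendsto
  have hΦt : Tendsto Φ (𝓝 0) (𝓝 0) := by simpa [hΦ0] using hΦ.continuousAt.tendsto
  have hwΨ' := eventually_all.2 hwΨ
  obtain ⟨n, u, hu, hu0, h⟩ := exists_unit_mul_prod_linear (φ := φ ∘ Ψ)
    (fun k => hw.transverse.ne_zero k) (AnalyticAt.comp (by rwa [hΨ0]) hΨ) (by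
      filter_upwards [hΨt.eventually hz, hwΨ'] with y hy hy' hy0
      obtain ⟨i, hi⟩ := hy hy0
      exact ⟨i, by rw [← hy' i, hi]⟩)
  refine ⟨n, u ∘ Φ, AnalyticAt.comp (by rwa [hΦ0]) hΦ, by simpa [hΦ0] using hu0, ?_⟩
  filter_upwards [hΦt.eventually h, hΦt.eventually hwΨ', hinv] with x hx hx' hinv
  simp only [Function.comp_apply, hinv] at hx ⊢
  rw [hx]
  congr 1
  refine Finset.prod_congr rfl fun i _ => ?_
  rw [← hx' i, hinv]

omit [FiniteDimensional ℂ E] [Fintype ι] in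
lemma IsTransverse.not_eventually_zero {w : ι → E → ℂ} (hw : IsTransverse w) (k : ι) :
    ¬ w k =ᶠ[𝓝 0] 0 := by
  intro h
  refine hw.transverse.ne_zero k ?_
  rw [h.fderiv_eq]
  exact (hasFDerivAt_const (0 : ℂ) (0 : E)).fderiv

/-- If a higher power of `w l` divided `φ`, cancelling `w l ^ n l` and restricting to a curve on
which `w l = 0` and every other equation equals `t` would leave `u` times a power of `t` equal to
zero, contradicting `u 0 ≠ 0`. The exponent is thus a greatest element, so the supremum defining the
multiplicity takes no default value. -/
theorem multAlong_eq {q : ℕ} {w : Fin q → E → ℂ} (hw : IsTransverse w) {φ u : E → ℂ}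
    {n : Fin q → ℕ} (hu : AnalyticAt ℂ u 0) (hu0 : u 0 ≠ 0)
    (h : φ =ᶠ[𝓝 0] fun x => u x * ∏ i, w i x ^ n i) (l : Fin q) : multAlong (w l) φ = n l := by
  classical
  refine IsGreatest.csSup_eq ⟨?_, ?_⟩
  · refine ⟨fun x => u x * ∏ i ∈ Finset.univ.erase l, w i x ^ n i,
      hu.mul (Finset.analyticAt_fun_prod _ fun i _ => (hw.analytic i).pow _), ?_⟩
    filter_upwards [h] with x hx
    rw [hx, ← Finset.mul_prod_erase _ _ (Finset.mem_univ l)]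
    ring
  · rintro m ⟨ψ, hψ, hm⟩
    by_contra hlt
    push Not at hlt
    have h1 : ∀ᶠ x in 𝓝 (0 : E), w l x ^ n l * (w l x ^ (m - n l) * ψ x -
        u x * ∏ i ∈ Finset.univ.erase l, w i x ^ n i) = 0 := by
      filter_upwards [h, hm] with x hx hmx
      rw [← Finset.mul_prod_erase _ _ (Finset.mem_univ l)] at hx
      have h2 : w l x ^ m = w l x ^ n l * w l x ^ (m - n l) := by
        rw [← pow_add]; congr 1; omega
      rw [h2] at hmx
      linear_combination hx - hmx
    have h2 := (eventually_eq_zero_or_of_mul ((hw.analytic l).pow _)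
      (((((hw.analytic l).pow _).mul hψ).sub (hu.mul (Finset.analyticAt_fun_prod _ fun i _ =>
        (hw.analytic i).pow _)))) h1).resolve_left (fun h0 => by
        refine hw.not_eventually_zero l ?_
        filter_upwards [h0] with x hx
        exact eq_zero_of_pow_eq_zero hx)
    obtain ⟨Ψ, hΨ, hΨ0, hwΨ, -⟩ := hw.exists_straightening
    obtain ⟨e, he⟩ := exists_dual_vectors hw.transverse
    let c : ℂ → E := fun t => Ψ (t • ∑ k ∈ Finset.univ.erase l, e k)
    have hlin : Tendsto (fun t : ℂ => t • ∑ k ∈ Finset.univ.erase l, e k) (𝓝 0) (𝓝 0) := by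
      have h3 : Continuous (fun t : ℂ => t • ∑ k ∈ Finset.univ.erase l, e k) := by fun_prop
      simpa using h3.tendsto 0
    have hΨt : Tendsto Ψ (𝓝 0) (𝓝 0) := by simpa [hΨ0] using hΨ.continuousAt.tendsto
    have hc : Tendsto c (𝓝 0) (𝓝 0) := hΨt.comp hlin
    have h3 : ∀ᶠ t in 𝓝 (0 : ℂ), u (c t) * t ^ (∑ i ∈ Finset.univ.erase l, n i) = 0 := by
      filter_upwards [hc.eventually h2, hlin.eventually (eventually_all.2 hwΨ)] with t ht ht'
      have hval : ∀ k, w k (c t) = if k = l then 0 else t := by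
        intro k
        simp only [c, ht', map_smul, map_sum, he, smul_eq_mul]
        rcases eq_or_ne k l with rfl | hk
        · simp
        · simp [hk]
      simp only [Pi.zero_apply, Pi.sub_apply, Pi.mul_apply, Pi.pow_apply, hval, if_true] at ht
      rw [zero_pow (by omega), zero_mul, zero_sub, neg_eq_zero] at ht
      rw [← ht, ← Finset.prod_pow_eq_pow_sum]
      congr 1
      refine Finset.prod_congr rfl fun i hi => ?_
      rw [if_neg (Finset.ne_of_mem_erase hi)]
    have h4 : ∀ᶠ t in 𝓝[≠] (0 : ℂ), u (c t) = 0 := by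
      rw [eventually_nhdsWithin_iff]
      filter_upwards [h3] with t ht ht0
      exact (mul_eq_zero.1 ht).resolve_right (pow_ne_zero _ ht0)
    have h5 : Tendsto (fun t => u (c t)) (𝓝[≠] 0) (𝓝 (u 0)) :=
      (hu.continuousAt.tendsto.comp hc).mono_left nhdsWithin_le_nhds
    exact hu0 (tendsto_nhds_unique h5
      ((tendsto_congr' (h4.mono fun t ht => ht)).2 tendsto_const_nhds))

end Divisors

/-! ### Generalized critical sets under conjugacy -/

section CriticalSets

variable {E : Type*} [NormedAddCommGroup E] [NormedSpace ℂ E] [FiniteDimensional ℂ E]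
variable {E' : Type*} [NormedAddCommGroup E'] [NormedSpace ℂ E'] [FiniteDimensional ℂ E']

lemma mem_critSet_iff {f : E → E} {x : E} :
    x ∈ critSet f ↔ ¬ Function.Injective (fderiv ℂ f x) := by
  change LinearMap.det _ = 0 ↔ _
  rw [← not_iff_not, not_not, ← ne_eq, ← isUnit_iff_ne_zero, ← LinearMap.isUnit_iff_isUnit_det,
    LinearMap.isUnit_iff_ker_eq_bot, LinearMap.ker_eq_bot]
  rfl

lemma eventually_bijective_fderiv {Φ : E → E'} (hΦ : AnalyticAt ℂ Φ 0)
    (hb : Function.Bijective (fderiv ℂ Φ 0)) :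
    ∀ᶠ x in 𝓝 0, Function.Bijective (fderiv ℂ Φ x) := by
  have := FiniteDimensional.complete ℂ E
  have := FiniteDimensional.complete ℂ E'
  let e : E ≃L[ℂ] E' := ContinuousLinearEquiv.ofBijective (fderiv ℂ Φ 0)
    (LinearMap.ker_eq_bot.2 hb.1) (LinearMap.range_eq_top.2 hb.2)
  have h1 := hΦ.fderiv.continuousAt.eventually (ContinuousLinearEquiv.nhds e)
  filter_upwards [h1] with x ⟨e', he'⟩
  have : fderiv ℂ Φ x = (e' : E →L[ℂ] E') := he'.symm
  rw [this]
  exact e'.bijective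

/-- Conjugate contracting germs have corresponding generalized critical sets. -/
theorem ContractsAtRate.mem_critInf_iff {f : E → E} {F : E' → E'} {Φ : E → E'} {C Λ : ℝ}
    (hf : ContractsAtRate f C Λ) (hfa : AnalyticAt ℂ f 0) (h0 : f 0 = 0) (hF : AnalyticAt ℂ F 0)
    (hΦ : AnalyticAt ℂ Φ 0) (hΦ0 : Φ 0 = 0) (hb : Function.Bijective (fderiv ℂ Φ 0))
    (hconj : Φ ∘ f =ᶠ[𝓝 0] F ∘ Φ) : ∀ᶠ x in 𝓝 0, Φ x ∈ critInf F ↔ x ∈ critInf f := by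
  have hft : Tendsto f (𝓝 0) (𝓝 0) := by simpa [h0] using hfa.continuousAt.tendsto
  have hΦt : Tendsto Φ (𝓝 0) (𝓝 0) := by simpa [hΦ0] using hΦ.continuousAt.tendsto
  have := FiniteDimensional.complete ℂ E
  have := FiniteDimensional.complete ℂ E'
  have hcrit : ∀ᶠ x in 𝓝 0, Φ x ∈ critSet F ↔ x ∈ critSet f := by
    filter_upwards [hfa.eventually_analyticAt, hft.eventually hΦ.eventually_analyticAt,
      hΦ.eventually_analyticAt, hΦt.eventually hF.eventually_analyticAt,
      eventually_bijective_fderiv hΦ hb, hft.eventually (eventually_bijective_fderiv hΦ hb),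
      hconj.eventuallyEq_nhds] with x h1 h2 h3 h4 h5 h6 h7
    rw [mem_critSet_iff, mem_critSet_iff, not_iff_not]
    have h8 : (fderiv ℂ Φ (f x)).comp (fderiv ℂ f x) = (fderiv ℂ F (Φ x)).comp (fderiv ℂ Φ x) := by
      rw [← fderiv_comp x h2.differentiableAt h1.differentiableAt,
        ← fderiv_comp x h4.differentiableAt h3.differentiableAt]
      exact h7.fderiv_eq
    have h9 : (fderiv ℂ Φ (f x)) ∘ (fderiv ℂ f x) = (fderiv ℂ F (Φ x)) ∘ (fderiv ℂ Φ x) :=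
      congrArg DFunLike.coe h8
    rw [← h6.1.of_comp_iff, h9, Function.Injective.of_comp_iff' _ h5]
  -- All iterates enter the generalized critical set, so the local identities are needed along
  -- entire orbits; contraction keeps these in the good neighbourhood.
  obtain ⟨r, hr, hball⟩ := hf.bound _ (hcrit.and hconj)
  filter_upwards [Metric.ball_mem_nhds (0 : E) hr] with x hx
  have hgood := fun n => (hball x hx n).1
  have hiter : ∀ n, Φ (f^[n] x) = F^[n] (Φ x) := by
    intro n
    induction n with
    | zero => rfl
    | succ n ih =>
      rw [Function.iterate_succ_apply', Function.iterate_succ_apply', ← ih]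
      exact (hgood n).2
  refine exists_congr fun n => ?_
  rw [← hiter]
  exact (hgood n).1

end CriticalSets

/-! ### Injective nonnegative integer matrices and periodic indices -/

section NonnegativeMatrices

open Matrix

variable {q : ℕ} {A : Matrix (Fin q) (Fin q) ℕ}

lemma mulVec_injective_of_cast (hA : Function.Injective (A.map (Nat.cast : ℕ → ℤ)).mulVec) :
    Function.Injective A.mulVec := by
  intro v v' h
  have hc : ∀ u : Fin q → ℕ, (A.map (Nat.cast : ℕ → ℤ)) *ᵥ (fun i => (u i : ℤ)) =
      fun i => ((A *ᵥ u) i : ℤ) := by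
    intro u
    ext i
    simp [Matrix.mulVec, dotProduct]
  have h1 := hA ((hc v).trans ((congrArg (fun u : Fin q → ℕ => fun i => (u i : ℤ)) h).trans
    (hc v').symm))
  ext i
  exact_mod_cast congrFun h1 i

lemma mulVec_injective_pow (hA : Function.Injective A.mulVec) (n : ℕ) :
    Function.Injective (A ^ n).mulVec := by
  induction n with
  | zero => intro v v' h; simpa using h
  | succ n ih =>
    intro v v' h
    rw [pow_succ, ← Matrix.mulVec_mulVec, ← Matrix.mulVec_mulVec] at h
    exact hA (ih h)

/-- No column of an injective matrix is zero, so every column sum is at least `1`. -/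
lemma sum_le_sum_mulVec (hA : Function.Injective A.mulVec) (v : Fin q → ℕ) :
    ∑ i, v i ≤ ∑ i, (A *ᵥ v) i := by
  have hcol : ∀ k, 1 ≤ ∑ i, A i k := by
    intro k
    by_contra hlt
    have h0 : ∑ i, A i k = 0 := by omega
    have h1 : A *ᵥ Pi.single k 1 = A *ᵥ 0 := by
      ext i
      simpa using (Finset.sum_eq_zero_iff.1 h0) i (Finset.mem_univ i)
    have h2 := congrFun (hA h1) k
    simp at h2
  calc ∑ i, v i ≤ ∑ k, (∑ i, A i k) * v k := Finset.sum_le_sum fun k _ =>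
        Nat.le_mul_of_pos_left _ (hcol k)
    _ = ∑ i, (A *ᵥ v) i := by
      simp only [Finset.sum_mul, Matrix.mulVec, dotProduct]
      exact Finset.sum_comm

lemma exists_eq_single_of_sum_eq_one {v : Fin q → ℕ} (h : ∑ i, v i = 1) :
    ∃ l, v = Pi.single l 1 := by
  have hne : ∃ l, v l ≠ 0 := by
    by_contra hno
    push Not at hno
    simp [hno] at h
  obtain ⟨l, hl⟩ := hne
  refine ⟨l, ?_⟩
  have h1 := Finset.add_sum_erase Finset.univ v (Finset.mem_univ l)
  rw [h] at h1
  have h2 : ∑ i ∈ Finset.univ.erase l, v i = 0 := by omega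
  ext i
  rcases eq_or_ne i l with rfl | hi
  · simp; omega
  · simpa [hi] using (Finset.sum_eq_zero_iff.1 h2) i (by simp [hi])

/-- The basis vector `k` is periodic under `A`. -/
def IsPeriodicIndex (A : Matrix (Fin q) (Fin q) ℕ) (k : Fin q) : Prop :=
  ∃ η : ℕ, 0 < η ∧ (A ^ η) *ᵥ Pi.single k 1 = Pi.single k 1

lemma isPeriodicIndex_of_mulVec_single (hA : Function.Injective A.mulVec) {k l : Fin q}
    (h : A *ᵥ Pi.single k 1 = Pi.single l 1) : IsPeriodicIndex A k ↔ IsPeriodicIndex A l := by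
  refine exists_congr fun η => and_congr_right fun _ => ?_
  rw [← h, Matrix.mulVec_mulVec, ← pow_succ, pow_succ', ← Matrix.mulVec_mulVec]
  exact hA.eq_iff.symm

/-- The sum of the entries never decreases and is `1` again after one period, so it is `1`
throughout; a vector of natural numbers with sum `1` is a basis vector. -/
lemma IsPeriodicIndex.exists_mulVec_single (hA : Function.Injective A.mulVec) {k : Fin q}
    (hk : IsPeriodicIndex A k) :
    ∃ l, IsPeriodicIndex A l ∧ A *ᵥ Pi.single k 1 = Pi.single l 1 := by
  obtain ⟨η, hη, h⟩ := id hk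
  obtain ⟨n, rfl⟩ : ∃ n, η = n + 1 := ⟨η - 1, by omega⟩
  have hmono : ∀ n (v : Fin q → ℕ), ∑ i, v i ≤ ∑ i, ((A ^ n) *ᵥ v) i := by
    intro n
    induction n with
    | zero => intro v; simp
    | succ n ih =>
      intro v
      rw [pow_succ, ← Matrix.mulVec_mulVec]
      exact (sum_le_sum_mulVec hA v).trans (ih _)
  have hsingle : ∑ i, (Pi.single k 1 : Fin q → ℕ) i = 1 := by simp
  have h1 : ∑ i, (A *ᵥ Pi.single k 1) i = 1 := by
    refine le_antisymm ?_ ?_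
    · refine (hmono n _).trans ?_
      rw [Matrix.mulVec_mulVec, ← pow_succ, h, hsingle]
    · exact hsingle.symm.le.trans (sum_le_sum_mulVec hA _)
  obtain ⟨l, hl⟩ := exists_eq_single_of_sum_eq_one h1
  exact ⟨l, (isPeriodicIndex_of_mulVec_single hA hl).1 hk, hl⟩

/-- Two basis vectors of the orbit coincide by the pigeonhole principle, and injectivity cancels the
common initial power. -/
lemma isPeriodicIndex_of_forall_single (hA : Function.Injective A.mulVec) {k : Fin q}
    (h : ∀ n, ∃ l, (A ^ n) *ᵥ Pi.single k 1 = Pi.single l 1) : IsPeriodicIndex A k := by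
  choose l hl using h
  obtain ⟨n, m, hnm, heq⟩ : ∃ n m, n < m ∧ l n = l m := by
    obtain ⟨n, m, hne, heq⟩ := Finite.exists_ne_map_eq_of_infinite l
    rcases lt_or_gt_of_ne hne with h | h
    · exact ⟨n, m, h, heq⟩
    · exact ⟨m, n, h, heq.symm⟩
  refine ⟨m - n, by omega, mulVec_injective_pow hA n ?_⟩
  rw [Matrix.mulVec_mulVec, ← pow_add, Nat.add_sub_cancel' hnm.le, hl, hl, heq]

lemma mulVec_single_apply (i k : Fin q) : (A *ᵥ Pi.single k 1) i = A i k := by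
  simp

/-- The block of an injective nonnegative matrix on its non-periodic indices is nonsingular. -/
lemma det_nonPeriodic_ne_zero (hA : Function.Injective (A.map (Nat.cast : ℕ → ℤ)).mulVec) {p : ℕ}
    (e : Fin p ≃ {k // ¬ IsPeriodicIndex A k}) :
    ((Matrix.of fun i j => A (e i) (e j)).map (Nat.cast : ℕ → ℤ)).det ≠ 0 := by
  classical
  have hA' := mulVec_injective_of_cast hA
  have hdet : (A.map (Nat.cast : ℕ → ℤ)).det ≠ 0 := by
    intro h0
    obtain ⟨v, hv, h1⟩ := Matrix.exists_mulVec_eq_zero_iff.2 h0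
    exact hv (hA (h1.trans (Matrix.mulVec_zero _).symm))
  rw [Matrix.twoBlockTriangular_det _ (fun k => IsPeriodicIndex A k)] at hdet
  · have h2 := right_ne_zero_of_mul hdet
    rw [← Matrix.det_submatrix_equiv_self e] at h2
    exact h2
  -- Block triangularity: the only nonzero entry of a periodic column lies in a periodic row.
  · intro i hi j hj
    obtain ⟨l, hl, h1⟩ := IsPeriodicIndex.exists_mulVec_single hA' hj
    have h2 := congrFun h1 i
    rw [mulVec_single_apply, Pi.single_eq_of_ne (by rintro rfl; exact hi hl)] at h2
    simp [h2]

end NonnegativeMatrices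

/-! ### The internal action and the cotangent action -/

section InternalAction

open Matrix

variable {E : Type*} [NormedAddCommGroup E] [NormedSpace ℂ E] [FiniteDimensional ℂ E]
variable {q : ℕ} {f : E → E} {w : Fin q → E → ℂ}

omit [FiniteDimensional ℂ E] in
lemma IsSNC.isTransverse {S : Set E} (h : IsSNC S w) : IsTransverse w :=
  ⟨h.analytic, h.map_zero, h.transverse⟩

omit [FiniteDimensional ℂ E] in
lemma mem_critInf_of_map {x : E} (h : f x ∈ critInf f) : x ∈ critInf f := by
  obtain ⟨n, hn⟩ := h
  exact ⟨n + 1, hn⟩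

/-- The components pull back to monomials with the exponents of the internal action. -/
theorem IsContractingRigid.exists_comp_eq (h : IsContractingRigid f w) :
    ∃ U : Fin q → E → ℂ, (∀ k, AnalyticAt ℂ (U k) 0) ∧ (∀ k, U k 0 ≠ 0) ∧
      ∀ k, w k ∘ f =ᶠ[𝓝 0] fun x => U k x * ∏ l, w l x ^ internalAction f w l k := by
  have hw := h.rigid.isTransverse
  have hfa := h.contracting.analytic
  have h0 := h.contracting.map_zero
  have hft : Tendsto f (𝓝 0) (𝓝 0) := by simpa [h0] using hfa.continuousAt.tendsto
  have key : ∀ k, ∃ U : E → ℂ, AnalyticAt ℂ U 0 ∧ U 0 ≠ 0 ∧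
      w k ∘ f =ᶠ[𝓝 0] fun x => U x * ∏ l, w l x ^ internalAction f w l k := by
    intro k
    -- If `w k` vanishes at `f x`, then `f x`, hence `x`, lies in the generalized critical set: the
    -- zeros of `w k ∘ f` lie on the components.
    obtain ⟨n, u, hu, hu0, hn⟩ := hw.exists_unit_mul_prod (φ := w k ∘ f)
      (AnalyticAt.comp (by rw [h0]; exact hw.analytic k) hfa) (by
        filter_upwards [h.rigid.eq_union, hft.eventually h.rigid.eq_union] with x hx hfx h1
        exact hx.1 (mem_critInf_of_map (hfx.2 ⟨k, h1⟩)))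
    refine ⟨u, hu, hu0, ?_⟩
    have h2 : ∀ l, internalAction f w l k = n l := fun l => multAlong_eq hw hu hu0 hn l
    simpa only [h2] using hn
  choose U h1 h2 h3 using key
  exact ⟨U, h1, h2, h3⟩

omit [FiniteDimensional ℂ E] in
lemma fderiv_unit_mul_prod_single {u : E → ℂ} (hw : IsTransverse w)
    (hu : AnalyticAt ℂ u 0) (l : Fin q) :
    fderiv ℂ (fun x => u x * ∏ i, w i x ^ (Pi.single l 1 : Fin q → ℕ) i) 0 =
      u 0 • fderiv ℂ (w l) 0 := by
  have h1 : (fun x => u x * ∏ i, w i x ^ (Pi.single l 1 : Fin q → ℕ) i) = fun x => u x * w l x := by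
    ext x
    congr 1
    rw [Finset.prod_eq_single l]
    · simp
    · intro i _ hi; simp [hi]
    · simp
  rw [h1, fderiv_fun_mul hu.differentiableAt (hw.analytic l).differentiableAt]
  rw [hw.map_zero]
  ext v
  change u 0 * _ + 0 * _ = u 0 * _
  ring

omit [FiniteDimensional ℂ E] in
lemma fderiv_unit_mul_prod_eq_zero {u : E → ℂ} {n : Fin q → ℕ} (hw : IsTransverse w)
    (hu : AnalyticAt ℂ u 0) (hn : n ≠ 0) (hn' : ∀ l, n ≠ Pi.single l 1) :
    fderiv ℂ (fun x => u x * ∏ i, w i x ^ n i) 0 = 0 := by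
  obtain ⟨l, hl⟩ : ∃ l, n l ≠ 0 := by
    by_contra hno
    push Not at hno
    exact hn (funext hno)
  obtain ⟨m, rfl⟩ : ∃ m : Fin q → ℕ, n = m + Pi.single l 1 := by
    refine ⟨n - (Pi.single l 1 : Fin q → ℕ), ?_⟩
    ext i
    rcases eq_or_ne i l with rfl | hi
    · simp; omega
    · simp [hi]
  obtain ⟨j, hj⟩ : ∃ j, m j ≠ 0 := by
    by_contra hno
    push Not at hno
    refine hn' l ?_
    rw [show m = 0 from funext hno, zero_add]
  have h1 : (fun x => u x * ∏ i, w i x ^ (m + Pi.single l 1 : Fin q → ℕ) i) =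
      fun x => (u x * ∏ i, w i x ^ m i) * ∏ i, w i x ^ (Pi.single l 1 : Fin q → ℕ) i := by
    ext x
    rw [mul_assoc, ← Finset.prod_mul_distrib]
    simp only [Pi.add_apply, pow_add]
  have h2 : AnalyticAt ℂ (fun x => u x * ∏ i, w i x ^ m i) 0 :=
    hu.mul (Finset.analyticAt_fun_prod _ fun i _ => (hw.analytic i).pow _)
  rw [h1, fderiv_unit_mul_prod_single hw h2]
  rw [Finset.prod_eq_zero (Finset.mem_univ j) (by rw [hw.map_zero, zero_pow hj]), mul_zero]
  ext v
  exact zero_mul _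

/-- The action of `f` on linear forms, by the transpose of its differential. -/
noncomputable def dualDifferential (f : E → E) : Module.End ℂ (E →L[ℂ] ℂ) :=
  (ContinuousLinearMap.compL ℂ E E ℂ).flip (fderiv ℂ f 0)

omit [FiniteDimensional ℂ E] in
lemma dualDifferential_apply (f : E → E) (ℓ : E →L[ℂ] ℂ) :
    dualDifferential f ℓ = ℓ.comp (fderiv ℂ f 0) := rfl

omit [FiniteDimensional ℂ E] in
lemma dualDifferential_fderiv (hfa : AnalyticAt ℂ f 0) (h0 : f 0 = 0) {g : E → ℂ}
    (hg : AnalyticAt ℂ g 0) : dualDifferential f (fderiv ℂ g 0) = fderiv ℂ (g ∘ f) 0 := by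
  rw [dualDifferential_apply, fderiv_comp 0 (by rw [h0]; exact hg.differentiableAt)
    hfa.differentiableAt, h0]

/-- The differential of a component is sent to a multiple of that of another one, or killed. -/
lemma IsContractingRigid.dualDifferential_component (h : IsContractingRigid f w)
    (hA : HasInjectiveInternalAction f w) (k : Fin q) :
    (∃ (l : Fin q) (c : ℂ), internalAction f w *ᵥ Pi.single k 1 = Pi.single l 1 ∧
      dualDifferential f (fderiv ℂ (w k) 0) = c • fderiv ℂ (w l) 0) ∨
      dualDifferential f (fderiv ℂ (w k) 0) = 0 := by
  obtain ⟨U, hU, hU0, hUw⟩ := h.exists_comp_eq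
  have hw := h.rigid.isTransverse
  have hA' : Function.Injective (internalAction f w).mulVec := mulVec_injective_of_cast hA
  have hder : dualDifferential f (fderiv ℂ (w k) 0) =
      fderiv ℂ (fun x => U k x * ∏ i, w i x ^ (fun i => internalAction f w i k) i) 0 := by
    rw [dualDifferential_fderiv h.contracting.analytic h.contracting.map_zero (hw.analytic k)]
    exact (hUw k).fderiv_eq
  have hcol : internalAction f w *ᵥ Pi.single k 1 = fun i => internalAction f w i k := by
    ext i; simp
  by_cases hex : ∃ m, (fun i => internalAction f w i k) = Pi.single m 1
  · obtain ⟨m, hm⟩ := hex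
    exact Or.inl ⟨m, U k 0, by rw [hcol, hm],
      by rw [hder, hm, fderiv_unit_mul_prod_single hw (hU k)]⟩
  · push Not at hex
    refine Or.inr ?_
    rw [hder, fderiv_unit_mul_prod_eq_zero hw (hU k) ?_ hex]
    intro h0
    have h3 := hA' ((hcol.trans h0).trans (Matrix.mulVec_zero _).symm)
    simpa using congrFun h3 k

/-- The differential of a non-periodic component is killed by a power of `df₀`. -/
lemma IsContractingRigid.exists_dualDifferential_pow_eq_zero (h : IsContractingRigid f w)
    (hA : HasInjectiveInternalAction f w) {k : Fin q}
    (hk : ¬ IsPeriodicComponent f w k) :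
    ∃ n, (dualDifferential f ^ n) (fderiv ℂ (w k) 0) = 0 := by
  by_contra hno
  push Not at hno
  -- If no power kills the differential, its images stay nonzero multiples of differentials of
  -- components, and the index moves through basis vectors forever; it would then be periodic.
  refine hk (isPeriodicIndex_of_forall_single (mulVec_injective_of_cast hA) fun n => ?_)
  suffices hs : ∃ (l : Fin q) (c : ℂ), (internalAction f w ^ n) *ᵥ Pi.single k 1 =
      Pi.single l 1 ∧ (dualDifferential f ^ n) (fderiv ℂ (w k) 0) = c • fderiv ℂ (w l) 0 by
    obtain ⟨l, _, h1, _⟩ := hs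
    exact ⟨l, h1⟩
  induction n with
  | zero => exact ⟨k, 1, by rw [pow_zero, Matrix.one_mulVec], by simp⟩
  | succ n ih =>
    obtain ⟨l, c, h1, h2⟩ := ih
    have hstep : (dualDifferential f ^ (n + 1)) (fderiv ℂ (w k) 0) =
        c • dualDifferential f (fderiv ℂ (w l) 0) := by
      rw [pow_succ', Module.End.mul_apply, h2, map_smul]
    rcases h.dualDifferential_component hA l with ⟨m, b, hm, hb⟩ | h0
    · exact ⟨m, c * b, by rw [pow_succ', ← Matrix.mulVec_mulVec, h1, hm],
        by rw [hstep, hb, smul_smul]⟩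
    · refine absurd ?_ (hno (n + 1))
      rw [hstep, h0]
      ext v
      exact mul_zero c

end InternalAction

/-! ### Bases adapted to the generalized eigenspaces -/

section GeneralizedEigenspaces

open Module

variable {V : Type*} [AddCommGroup V] [Module ℂ V] [FiniteDimensional ℂ V] (L : Module.End ℂ V)

/-- The sum of the generalized eigenspaces with nonzero eigenvalue. -/
noncomputable def nonzeroGenEigenspace : Submodule ℂ V :=
  ⨆ (c : ℂ) (_ : c ≠ 0), L.maxGenEigenspace c

lemma isCompl_nonzeroGenEigenspace :
    IsCompl (L.maxGenEigenspace 0) (nonzeroGenEigenspace L) := by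
  constructor
  · exact L.independent_maxGenEigenspace 0
  · rw [codisjoint_iff, eq_top_iff, ← Module.End.iSup_maxGenEigenspace_eq_top L]
    refine iSup_le fun c => ?_
    by_cases hc : c = 0
    · rw [hc]; exact le_sup_left
    · exact le_sup_of_le_right (le_iSup₂_of_le c hc le_rfl)

variable {L}

omit [FiniteDimensional ℂ V] in
/-- A subspace extends by a generalized eigenvector, which is an eigenvector
modulo the subspace. -/
lemma exists_eigenvector_mod {M : Submodule ℂ V} (hlt : ¬ nonzeroGenEigenspace L ≤ M) :
    ∃ (c : ℂ) (v : V), c ≠ 0 ∧ v ∉ M ∧ v ∈ nonzeroGenEigenspace L ∧ L v - c • v ∈ M ∧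
      ∃ n, ((L - algebraMap ℂ (Module.End ℂ V) c) ^ n) v = 0 := by
  obtain ⟨c, hc, v, hv, hvM⟩ : ∃ c, c ≠ 0 ∧ ∃ v ∈ L.maxGenEigenspace c, v ∉ M := by
    by_contra hno
    push Not at hno
    exact hlt (iSup₂_le fun c hc v hv => hno c hc v hv)
  obtain ⟨n, hn⟩ := (Module.End.mem_maxGenEigenspace L c v).1 hv
  have hex : ∃ m, ((L - c • (1 : Module.End ℂ V)) ^ m) v ∈ M := ⟨n, by rw [hn]; exact M.zero_mem⟩
  classical
  -- The vector wanted is `(L - c) ^ m` applied to `v`, the last one before the iteration falls into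
  -- `M`.
  obtain ⟨m, hm⟩ : ∃ m, Nat.find hex = m + 1 := by
    refine Nat.exists_eq_succ_of_ne_zero fun h0 => hvM ?_
    have := Nat.find_spec hex
    rwa [h0, pow_zero] at this
  have h1 := Nat.find_spec hex
  have h2 := Nat.find_min hex (m := m) (by omega)
  rw [hm, pow_succ', Module.End.mul_apply] at h1
  have h3 : ((L - c • 1) ^ n) (((L - c • 1) ^ m) v) = 0 := by
    rw [← Module.End.mul_apply, ← pow_add, add_comm, pow_add, Module.End.mul_apply, hn, map_zero]
  refine ⟨c, ((L - c • 1) ^ m) v, hc, h2, ?_, by simpa using h1, n, ?_⟩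
  · exact (le_iSup₂_of_le c hc le_rfl : L.maxGenEigenspace c ≤ _)
      ((Module.End.mem_maxGenEigenspace L c _).2 ⟨n, h3⟩)
  · rw [Algebra.algebraMap_eq_smul_one]
    exact h3

/-- Greedy choice: while the span misses part of the sum of the nonzero generalized eigenspaces,
adjoin a vector that is an eigenvector modulo the span. Indexing by `ℕ` makes each extension a mere
update of the sequence. -/
lemma exists_triangular_sequence {r : ℕ} {a : Fin r → V} (ha : LinearIndependent ℂ a)
    (hmem : ∀ i, a i ∈ nonzeroGenEigenspace L) (n : ℕ)
    (hn : r + n ≤ finrank ℂ (nonzeroGenEigenspace L)) :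
    ∃ (x : ℕ → V) (c : ℕ → ℂ), (∀ i : Fin r, x i = a i) ∧
      LinearIndepOn ℂ x (Set.Iio (r + n)) ∧ (∀ j < r + n, x j ∈ nonzeroGenEigenspace L) ∧
      ∀ j, r ≤ j → j < r + n → c j ≠ 0 ∧ (∃ m, ((L - algebraMap ℂ (Module.End ℂ V) (c j)) ^ m) (x j) = 0) ∧
        L (x j) - c j • x j ∈ Submodule.span ℂ (x '' Set.Iio j) := by
  classical
  induction n with
  | zero =>
    have hx : ∀ i : Fin r, (fun i : ℕ => if h : i < r then a ⟨i, h⟩ else 0) i = a i := by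
      intro i; simp
    set x : ℕ → V := fun i => if h : i < r then a ⟨i, h⟩ else 0
    refine ⟨x, 0, hx, ?_, ?_, ?_⟩
    · rw [add_zero]
      have h1 : x ∘ ((↑) : Set.Iio r → ℕ) = a ∘ fun i => ⟨i.1, i.2⟩ := by
        ext i; exact hx ⟨i.1, i.2⟩
      change LinearIndependent ℂ (x ∘ ((↑) : Set.Iio r → ℕ))
      rw [h1]
      exact ha.comp _ fun i j hij => Subtype.ext (congrArg Fin.val hij)
    · intro j hj
      exact hx ⟨j, hj⟩ ▸ hmem ⟨j, hj⟩
    · intro j hj hj'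
      omega
  | succ n ih =>
    obtain ⟨x, c, h1, h2, h3, h5⟩ := ih (by omega)
    set N := r + n
    have hfin : finrank ℂ (Submodule.span ℂ (x '' Set.Iio N)) = N := by
      have h6 := finrank_span_eq_card (R := ℂ) h2
      rw [← Set.image_eq_range] at h6
      rw [h6]
      simp
    obtain ⟨μ, v, hμ, hvM, hv, hLv, m, hm⟩ := exists_eigenvector_mod (L := L)
      (M := Submodule.span ℂ (x '' Set.Iio N)) (fun hle => by
      have := Submodule.finrank_mono hle
      rw [hfin] at this
      omega)
    have himg : ∀ j ≤ N, Function.update x N v '' Set.Iio j = x '' Set.Iio j := by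
      intro j hj
      refine Set.image_congr fun i hi => ?_
      rw [Function.update_of_ne]
      have : i < j := hi
      omega
    have hins : Set.Iio (N + 1) = insert N (Set.Iio N) := by
      ext i; simp [le_iff_eq_or_lt]
    refine ⟨Function.update x N v, Function.update c N μ, ?_, ?_, ?_, ?_⟩
    · intro i
      rw [Function.update_of_ne (by omega), h1]
    · rw [show r + (n + 1) = N + 1 from rfl, hins, linearIndepOn_insert (by simp)]
      refine ⟨h2.congr fun i hi => ?_, ?_⟩
      · rw [Function.update_of_ne (ne_of_lt hi)]
      · rwa [himg N le_rfl, Function.update_self]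
    · intro j hj
      rcases eq_or_ne j N with rfl | hjN
      · rwa [Function.update_self]
      · rw [Function.update_of_ne hjN]
        exact h3 j (by omega)
    · intro j hj hj'
      rw [himg j (by omega)]
      rcases eq_or_ne j N with rfl | hjN
      · rw [Function.update_self, Function.update_self]
        exact ⟨hμ, ⟨m, hm⟩, hLv⟩
      · rw [Function.update_of_ne hjN, Function.update_of_ne hjN]
        exact h5 j hj (by omega)

/-- Modulo the span of `b`, the nilpotent part is a line, on which `L` acts by a nilpotent scalar,
that is, by zero. This is what later forces `(l, m) ≠ (0, 0)`. -/
lemma exists_nilpotent_complement {p : ℕ} {b : Fin p → V} (hbi : LinearIndependent ℂ b)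
    (hb : ∀ j, ∃ n, (L ^ n) (b j) = 0) (hinv : ∀ j, L (b j) ∈ Submodule.span ℂ (Set.range b))
    (h0 : finrank ℂ (L.maxGenEigenspace 0) = p + 1) :
    ∃ z, L z ∈ Submodule.span ℂ (Set.range b) ∧ (∃ n, (L ^ n) z = 0) ∧
      L.maxGenEigenspace 0 = Submodule.span ℂ (Set.range b) ⊔ Submodule.span ℂ {z} := by
  set W := Submodule.span ℂ (Set.range b)
  have hmem0 : ∀ v, v ∈ L.maxGenEigenspace 0 ↔ ∃ n, (L ^ n) v = 0 := by
    intro v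
    rw [Module.End.mem_maxGenEigenspace]
    simp
  have hW : finrank ℂ W = p := by
    rw [finrank_span_eq_card hbi, Fintype.card_fin]
  have hWle : W ≤ L.maxGenEigenspace 0 := by
    refine Submodule.span_le.2 ?_
    rintro _ ⟨j, rfl⟩
    exact (hmem0 _).2 (hb j)
  have hWinv : ∀ v ∈ W, L v ∈ W := by
    intro v hv
    have : W ≤ W.comap L := by
      refine Submodule.span_le.2 ?_
      rintro _ ⟨j, rfl⟩
      exact hinv j
    exact this hv
  obtain ⟨z, hz, hzW⟩ : ∃ z ∈ L.maxGenEigenspace 0, z ∉ W := by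
    by_contra hno
    push Not at hno
    have := Submodule.finrank_mono (show L.maxGenEigenspace 0 ≤ W from hno)
    omega
  have heq : L.maxGenEigenspace 0 = W ⊔ Submodule.span ℂ {z} := by
    refine (Submodule.eq_of_le_of_finrank_le (sup_le hWle (by simpa using hz)) ?_).symm
    have hlt : W < W ⊔ Submodule.span ℂ {z} := by
      refine lt_of_le_of_ne le_sup_left fun h => hzW ?_
      rw [h]
      exact le_sup_right (a := W) (Submodule.mem_span_singleton_self z)
    have := Submodule.finrank_lt_finrank_of_lt hlt
    omega
  obtain ⟨n, hn⟩ := (hmem0 z).1 hz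
  refine ⟨z, ?_, ⟨n, hn⟩, heq⟩
  have hLz : L z ∈ L.maxGenEigenspace 0 :=
    Module.End.mapsTo_maxGenEigenspace_of_comm (Commute.refl L) 0 hz
  rw [heq, Submodule.mem_sup] at hLz
  obtain ⟨y, hy, y', hy', hsum⟩ := hLz
  obtain ⟨a, rfl⟩ := Submodule.mem_span_singleton.1 hy'
  by_cases ha : a = 0
  · rw [ha, zero_smul, add_zero] at hsum
    rwa [← hsum]
  · exfalso
    -- A nonzero scalar `a` on the quotient line would contradict nilpotency of `L` at `z`.
    have hpow : ∀ m, (L ^ m) z - a ^ m • z ∈ W := by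
      intro m
      induction m with
      | zero => simp
      | succ m ih =>
        have h1 := W.add_mem (hWinv _ ih) (W.smul_mem (a ^ m) hy)
        convert h1 using 1
        rw [pow_succ', Module.End.mul_apply, map_sub, map_smul, ← hsum, smul_add, smul_smul,
          pow_succ]
        abel
    have h1 := hpow n
    rw [hn, zero_sub] at h1
    refine hzW ?_
    have h2 := W.smul_mem (a ^ n)⁻¹ (W.neg_mem h1)
    rwa [neg_neg, smul_smul, inv_mul_cancel₀ (pow_ne_zero _ ha), one_smul] at h2

/-- A basis adapted to the generalized eigenspaces and to given invariant families. -/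
theorem exists_adapted_basis {r p s : ℕ} {a : Fin r → V} {b : Fin p → V}
    (hai : LinearIndependent ℂ a) (hbi : LinearIndependent ℂ b)
    (ha' : ∀ i, a i ∈ nonzeroGenEigenspace L)
    (hb : ∀ j, ∃ n, (L ^ n) (b j) = 0) (hb' : ∀ j, L (b j) ∈ Submodule.span ℂ (Set.range b))
    (h0 : finrank ℂ (L.maxGenEigenspace 0) = p + 1) (hV : finrank ℂ V = s + p + 1) :
    ∃ (hr : r ≤ s) (x : Fin s → V) (c : Fin s → ℂ) (z : V), (∀ i, x (Fin.castLE hr i) = a i) ∧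
      Submodule.span ℂ (Set.range (Sum.elim x (Sum.elim b fun _ : Unit => z))) = ⊤ ∧
      (∃ n, (L ^ n) z = 0) ∧ L z ∈ Submodule.span ℂ (Set.range b) ∧
      ∀ j : Fin s, r ≤ j → c j ≠ 0 ∧
        (∃ m, ((L - algebraMap ℂ (Module.End ℂ V) (c j)) ^ m) (x j) = 0) ∧
        L (x j) - c j • x j ∈ Submodule.span ℂ (x '' Set.Iio j) := by
  have hcompl := isCompl_nonzeroGenEigenspace L
  have hdim : finrank ℂ (nonzeroGenEigenspace L) = s := by
    have := Submodule.finrank_add_eq_of_isCompl hcompl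
    omega
  have hr : r ≤ s := by
    have h1 : Submodule.span ℂ (Set.range a) ≤ nonzeroGenEigenspace L := by
      refine Submodule.span_le.2 ?_
      rintro _ ⟨i, rfl⟩
      exact ha' i
    have := Submodule.finrank_mono h1
    rw [finrank_span_eq_card hai, Fintype.card_fin, hdim] at this
    exact this
  obtain ⟨x, c, h1, h2, h3, h5⟩ := exists_triangular_sequence hai ha' (s - r) (by omega)
  rw [Nat.add_sub_cancel' hr] at h2 h3 h5
  obtain ⟨z, hz, hz', hz''⟩ := exists_nilpotent_complement hbi hb hb' h0
  refine ⟨hr, fun i => x i, fun i => c i, z, fun i => h1 i, ?_, hz', hz, ?_⟩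
  · have h6 : LinearIndependent ℂ fun i : Fin s => x i :=
      LinearIndependent.comp h2 (fun i : Fin s => (⟨i, i.2⟩ : Set.Iio s))
        fun i j hij => Fin.ext (congrArg (fun t : Set.Iio s => (t : ℕ)) hij)
    have h7 : Submodule.span ℂ (Set.range fun i : Fin s => x i) = nonzeroGenEigenspace L := by
      refine Submodule.eq_of_le_of_finrank_le (Submodule.span_le.2 ?_) ?_
      · rintro _ ⟨i, rfl⟩
        exact h3 i i.2
      · rw [finrank_span_eq_card h6, Fintype.card_fin, hdim]
    rw [Set.Sum.elim_range, Set.Sum.elim_range, Submodule.span_union, Submodule.span_union, h7,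
      Set.range_const, ← hz'', sup_comm, hcompl.sup_eq_top]
  · intro j hj
    obtain ⟨h6, h7, h8⟩ := h5 j hj j.2
    refine ⟨h6, h7, ?_⟩
    convert h8 using 2
    ext v
    constructor
    · rintro ⟨i, hi, rfl⟩
      exact ⟨i, hi, rfl⟩
    · rintro ⟨i, hi, rfl⟩
      exact ⟨⟨i, lt_trans hi j.2⟩, hi, rfl⟩

end GeneralizedEigenspaces

/-! ### Multiplicative cohomology of units -/

section Units

variable {E : Type*} [NormedAddCommGroup E] [NormedSpace ℂ E]

/-- A nonvanishing germ is a constant times an exponential. -/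
lemma exists_eq_mul_exp {U : E → ℂ} (hU : AnalyticAt ℂ U 0) (h0 : U 0 ≠ 0) :
    ∃ h : E → ℂ, AnalyticAt ℂ h 0 ∧ h 0 = 0 ∧ ∀ᶠ x in 𝓝 0, U x = U 0 * Complex.exp (h x) := by
  have h1 : AnalyticAt ℂ (fun x => U x / U 0) 0 := hU.div analyticAt_const h0
  refine ⟨fun x => Complex.log (U x / U 0), h1.clog ?_, ?_, ?_⟩
  · rw [div_self h0]; exact Complex.one_mem_slitPlane
  · simp [div_self h0]
  · filter_upwards [hU.continuousAt.eventually_ne h0] with x hx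
    rw [Complex.exp_log (div_ne_zero hx h0)]
    field_simp

lemma fderiv_mul_exp {w φ : E → ℂ} (hw : AnalyticAt ℂ w 0) (hw0 : w 0 = 0)
    (hφ : AnalyticAt ℂ φ 0) (hφ0 : φ 0 = 0) :
    fderiv ℂ (fun v => w v * Complex.exp (φ v)) 0 = fderiv ℂ w 0 := by
  have hE : AnalyticAt ℂ (fun v => Complex.exp (φ v)) 0 := hφ.cexp
  rw [fderiv_fun_mul hw.differentiableAt hE.differentiableAt, hw0, hφ0]
  ext v
  change 0 * _ + Complex.exp 0 * _ = _
  simp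

variable [FiniteDimensional ℂ E] {f : E → E} {C Λ : ℝ}

/-- Units can be made constant along a permutation, by a multiplicative change of variables. -/
theorem ContractsAtRate.exists_exp_cohomology (hf : ContractsAtRate f C Λ)
    (hfa : AnalyticAt ℂ f 0) {n : ℕ} (π : Equiv.Perm (Fin n)) {U : Fin n → E → ℂ}
    (hU : ∀ i, AnalyticAt ℂ (U i) 0) (hU0 : ∀ i, U i 0 ≠ 0) :
    ∃ φ : Fin n → E → ℂ, (∀ i, AnalyticAt ℂ (φ i) 0) ∧ (∀ i, φ i 0 = 0) ∧
      ∀ i, ∀ᶠ x in 𝓝 0, U i x * Complex.exp (φ i (f x)) = U i 0 * Complex.exp (φ (π i) x) := by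
  choose h hh hh0 hhU using fun i => exists_eq_mul_exp (hU i) (hU0 i)
  let M : (Fin n → ℂ) ≃L[ℂ] (Fin n → ℂ) :=
    (LinearEquiv.funCongrLeft ℂ ℂ π).toContinuousLinearEquiv
  have hM : ∀ v i, M v i = v (π i) := fun v i => rfl
  have hMs : ∀ v i, M.symm v i = v (π.symm i) := fun v i => rfl
  -- After taking logarithms, `M` permutes coordinates isometrically, so vanishing at `0` is enough
  -- to solve the equation: order `N = 1`.
  have hnorm : ‖(M.symm : (Fin n → ℂ) →L[ℂ] (Fin n → ℂ))‖ ≤ 1 := by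
    refine ContinuousLinearMap.opNorm_le_bound _ zero_le_one fun v => ?_
    rw [one_mul]
    refine (pi_norm_le_iff_of_nonneg (norm_nonneg v)).2 fun i => ?_
    exact norm_le_pi_norm v (π.symm i)
  have hR : AnalyticAt ℂ (fun x => fun i => -h i x) 0 := by
    rw [analyticAt_pi_iff]
    exact fun i => (hh i).neg
  obtain ⟨g, hg, hg0, hgf⟩ := hf.exists_comp_eq hfa M (N := 1) (by
      rw [pow_one]
      have h1 := hf.rate_pos
      have h2 := hf.rate_lt
      nlinarith) hR (by
      have h1 := hR.differentiableAt.isBigO_sub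
      simpa [hh0, ← Pi.zero_def] using h1.norm_right)
  refine ⟨fun i x => g x i, fun i => ?_, fun i => ?_, fun i => ?_⟩
  · exact (analyticAt_pi_iff.1 hg) i
  · have h1 : g 0 = 0 := by
      obtain ⟨c, hc⟩ := hg0.bound
      simpa using hc.self_of_nhds
    simp [h1]
  · filter_upwards [hgf, hhU i] with x hx hx'
    rw [hx, Pi.add_apply, hM, hx', mul_assoc, ← Complex.exp_add]
    congr 2
    ring

end Units

/-! ### Passing from germs to their differentials -/

section CotangentSpace

variable {E : Type*} [NormedAddCommGroup E] [NormedSpace ℂ E]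
variable {f : E → E} {hfa : AnalyticAt ℂ f 0} {h0 : f 0 = 0}

lemma fderiv_sub_algebraMap (c : ℂ) (g : analyticFun E) :
    fderiv ℂ (((pullback f hfa h0).toLinearMap - algebraMap ℂ (Module.End ℂ (analyticFun E)) c) g :
      E → ℂ) 0 =
      (dualDifferential f - algebraMap ℂ (Module.End ℂ (E →L[ℂ] ℂ)) c) (fderiv ℂ (g : E → ℂ) 0) := by
  have h1 : ((((pullback f hfa h0).toLinearMap -
      algebraMap ℂ (Module.End ℂ (analyticFun E)) c) g : analyticFun E) : E → ℂ) =
      ((g : E → ℂ) ∘ f) - c • (g : E → ℂ) := rfl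
  rw [h1, fderiv_sub, fderiv_const_smul g.2.differentiableAt, LinearMap.sub_apply,
    dualDifferential_fderiv hfa h0 g.2]
  · rfl
  · exact (AnalyticAt.comp (by rw [h0]; exact g.2) hfa).differentiableAt
  · exact (g.2.const_smul (c := c)).differentiableAt

/-- A germ whose differential is a generalized eigenvector is one modulo order two. -/
lemma isGenEig_of_fderiv {c : ℂ} {g : analyticFun E} (hg : (g : E → ℂ) 0 = 0)
    (h : IsGenEig (dualDifferential f) ⊥ c (fderiv ℂ (g : E → ℂ) 0)) :
    IsGenEig (pullback f hfa h0).toLinearMap (vanishingOrder E 2) c g := by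
  obtain ⟨n, hn⟩ := h
  refine ⟨n, ?_⟩
  rw [Submodule.mem_bot] at hn
  induction n generalizing g with
  | zero => exact mem_vanishingOrder_two.2 ⟨hg, by simpa using hn⟩
  | succ n ih =>
    rw [pow_succ, Module.End.mul_apply] at hn ⊢
    refine ih ?_ ?_
    · change (g : E → ℂ) (f 0) - c • (g : E → ℂ) 0 = 0
      rw [h0, hg, smul_zero, sub_zero]
    · rwa [fderiv_sub_algebraMap]

lemma dualDifferential_iterate {f : E → E} (hfa : AnalyticAt ℂ f 0) (h0 : f 0 = 0) (n : ℕ) : dualDifferential f^[n] = dualDifferential f ^ n := by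
  have h1 : ∀ n, fderiv ℂ f^[n] 0 = fderiv ℂ f 0 ^ n := fun n =>
    (hasFDerivAt_iterate_zero hfa.differentiableAt.hasFDerivAt h0 n).fderiv
  ext1 ℓ
  rw [dualDifferential_apply, h1]
  induction n generalizing ℓ with
  | zero => rfl
  | succ n ih =>
    rw [pow_succ (dualDifferential f), Module.End.mul_apply, ← ih, dualDifferential_apply, pow_succ']
    rfl

variable [FiniteDimensional ℂ E]

lemma charpoly_dualMap {V : Type*} [AddCommGroup V] [Module ℂ V] [FiniteDimensional ℂ V]
    (A : Module.End ℂ V) : LinearMap.charpoly (A.dualMap : Module.End ℂ (Module.Dual ℂ V)) =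
      A.charpoly := by
  let b := Module.finBasis ℂ V
  rw [← LinearMap.charpoly_toMatrix A.dualMap b.dualBasis, ← LinearMap.charpoly_toMatrix A b,
    ← Matrix.charpoly_transpose]
  congr 1
  exact (congrArg Matrix.transpose (LinearMap.toMatrix_transpose (B₁ := b) (B₂ := b) A)).trans
    (Matrix.transpose_transpose _)

lemma charpoly_dualDifferential (f : E → E) :
    (dualDifferential f).charpoly = (fderiv ℂ f 0 : E →ₗ[ℂ] E).charpoly := by
  let e : (E →ₗ[ℂ] ℂ) ≃ₗ[ℂ] (E →L[ℂ] ℂ) := LinearMap.toContinuousLinearMap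
  rw [← charpoly_dualMap (fderiv ℂ f 0 : E →ₗ[ℂ] E), ← LinearEquiv.charpoly_conj e]
  congr 1

/-- A linear map and its transpose have the same characteristic polynomial, in which the
multiplicity of the root `0` is the dimension of the nilpotent part. This turns `s + p + 1 = d` into
a nilpotent part of dimension `p + 1` in the cotangent space. -/
lemma card_nonzeroEigenvalues (f : E → E) :
    (nonzeroEigenvalues f).card + Module.finrank ℂ ((dualDifferential f).maxGenEigenspace 0) =
      Module.finrank ℂ E := by
  classical
  rw [LinearMap.finrank_maxGenEigenspace_zero_eq, charpoly_dualDifferential, nonzeroEigenvalues]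
  set P := (fderiv ℂ f 0 : E →ₗ[ℂ] E).charpoly with hP
  have h1 : P.roots.card = Module.finrank ℂ E :=
    IsAlgClosed.card_roots_eq_natDegree.trans (LinearMap.charpoly_natDegree _)
  rw [← h1, ← Polynomial.rootMultiplicity_eq_natTrailingDegree', ← Polynomial.count_roots,
    Multiset.count_eq_card_filter_eq, add_comm]
  conv_rhs => rw [← Multiset.filter_add_not (fun c => (0 : ℂ) = c) P.roots, Multiset.card_add]
  congr 2
  refine Multiset.filter_congr fun c _ => ?_
  rw [ne_comm]

lemma finrank_cotangent : Module.finrank ℂ (E →L[ℂ] ℂ) = Module.finrank ℂ E := by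
  rw [← LinearEquiv.finrank_eq (LinearMap.toContinuousLinearMap : (E →ₗ[ℂ] ℂ) ≃ₗ[ℂ] (E →L[ℂ] ℂ))]
  exact Subspace.dual_finrank_eq

end CotangentSpace

/-! ### Weighted permutations and the matrix `P` -/

section MonomialMatrices

/-- The coefficient of the `n`-th iterate of `u i ↦ γ i • u (π i)`. -/
noncomputable def permWeight {ι : Type*} (π : Equiv.Perm ι) (γ : ι → ℂ) (n : ℕ) (i : ι) : ℂ :=
  ∏ k ∈ Finset.range n, γ ((π ^ k) i)

variable {ι : Type*} {π : Equiv.Perm ι} {γ : ι → ℂ}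

lemma permWeight_succ (n : ℕ) (i : ι) :
    permWeight π γ (n + 1) i = γ i * permWeight π γ n (π i) := by
  rw [permWeight, Finset.prod_range_succ', mul_comm]
  simp [permWeight, pow_succ]

lemma permWeight_ne_zero (hγ : ∀ i, γ i ≠ 0) (n : ℕ) (i : ι) : permWeight π γ n i ≠ 0 :=
  Finset.prod_ne_zero_iff.2 fun _ _ => hγ _

lemma permWeight_of_fixed {i : ι} (hi : π i = i) (n : ℕ) : permWeight π γ n i = γ i ^ n := by
  induction n with
  | zero => simp [permWeight]
  | succ n ih => rw [permWeight_succ, hi, ih, pow_succ']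

/-- Stated modulo `B` to serve twice: for differentials with `B = ⊥`, and for functions with `B` the
null germs. -/
lemma pow_apply_sub_mem {R : Type*} [AddCommGroup R] [Module ℂ R] {T : Module.End ℂ R}
    {B : Submodule ℂ R} (hB : ∀ g ∈ B, T g ∈ B) {u : ι → R}
    (hu : ∀ i, T (u i) - γ i • u (π i) ∈ B) (n : ℕ) (i : ι) :
    (T ^ n) (u i) - permWeight π γ n i • u ((π ^ n) i) ∈ B := by
  induction n generalizing i with
  | zero => simp [permWeight]
  | succ n ih =>
    have hBn : ∀ m, ∀ g ∈ B, (T ^ m) g ∈ B := by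
      intro m
      induction m with
      | zero => intro g hg; simpa using hg
      | succ m ihm =>
        intro g hg
        rw [pow_succ, Module.End.mul_apply]
        exact ihm _ (hB g hg)
    have h1 := B.add_mem (hBn n _ (hu i)) (B.smul_mem (γ i) (ih (π i)))
    convert h1 using 1
    rw [permWeight_succ, pow_succ, pow_succ, Module.End.mul_apply, map_sub, map_smul, smul_sub,
      smul_smul, Equiv.Perm.mul_apply]
    abel

/-- The columns of `P` carry the exponents of the coordinates of `x^P`, so the rule `u_k ↦ γ_k u_{π
k}` is encoded by the permutation matrix of the inverse of `π`. -/
lemma permMatrix_inv_apply {s : ℕ} (π : Equiv.Perm (Fin s)) (i j : Fin s) :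
    (π⁻¹).permMatrix ℕ i j = if i = π j then 1 else 0 := by
  rw [Equiv.Perm.permMatrix, PEquiv.toMatrix_apply]
  simp only [Equiv.toPEquiv_apply, Option.mem_some_iff]
  have h : π⁻¹ i = j ↔ i = π j := Equiv.Perm.inv_eq_iff_eq
  simp only [h]

lemma AffineForm.linMatrix_apply {s p : ℕ} {N : AffineForm s p} {π : Equiv.Perm (Fin s)}
    (hP : N.P = (π⁻¹).permMatrix ℕ) (i j : Fin s) :
    N.linMatrix i j = if j = π i then N.γ i else 0 := by
  rw [AffineForm.linMatrix, Matrix.diagonal_mul, hP]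
  rw [Matrix.transpose_apply, Matrix.map_apply, permMatrix_inv_apply]
  split_ifs <;> simp

lemma AffineForm.linMatrix_pow_apply {s p : ℕ} {N : AffineForm s p} {π : Equiv.Perm (Fin s)}
    (hP : N.P = (π⁻¹).permMatrix ℕ) (n : ℕ) (i j : Fin s) :
    (N.linMatrix ^ n) i j = if j = (π ^ n) i then permWeight π N.γ n i else 0 := by
  induction n generalizing i with
  | zero => simp [permWeight, Matrix.one_apply, eq_comm]
  | succ n ih =>
    rw [pow_succ', Matrix.mul_apply]
    simp only [N.linMatrix_apply hP, ite_mul, zero_mul, Finset.sum_ite_eq', Finset.mem_univ, if_true]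
    rw [ih, permWeight_succ, pow_succ, Equiv.Perm.mul_apply, mul_ite, mul_zero]

lemma permMatrix_inv_pow {s : ℕ} (π : Equiv.Perm (Fin s)) (n : ℕ) :
    (π⁻¹).permMatrix ℕ ^ n = ((π ^ n)⁻¹).permMatrix ℕ :=
  (map_pow (Matrix.permMatrixHom (n := Fin s) (R := ℕ)) π n).symm

lemma AffineForm.eta_eq {s p : ℕ} {N : AffineForm s p} {π : Equiv.Perm (Fin s)}
    (hP : N.P = (π⁻¹).permMatrix ℕ) : N.η = orderOf π := by
  rw [AffineForm.η, hP]
  refine Nat.dvd_antisymm (orderOf_dvd_of_pow_eq_one ?_) (orderOf_dvd_of_pow_eq_one ?_)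
  · rw [permMatrix_inv_pow, pow_orderOf_eq_one]
    simp
  · have h1 := permMatrix_inv_pow π (orderOf ((π⁻¹).permMatrix ℕ))
    rw [pow_orderOf_eq_one] at h1
    ext i
    have h2 := congrFun (congrFun h1 ((π ^ orderOf ((π⁻¹).permMatrix ℕ)) i)) i
    rw [permMatrix_inv_apply, if_pos rfl] at h2
    by_contra hne
    have h3 : (π ^ orderOf ((π⁻¹).permMatrix ℕ)) i ≠ i := fun h => hne (congrArg Fin.val h)
    rw [Matrix.one_apply_ne h3] at h2
    exact zero_ne_one h2

lemma AffineForm.ev_eq {s p : ℕ} {N : AffineForm s p} {π : Equiv.Perm (Fin s)}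
    (hP : N.P = (π⁻¹).permMatrix ℕ) (i : Fin s) : N.ev i = permWeight π N.γ (orderOf π) i := by
  rw [AffineForm.ev, AffineForm.linMatrix_pow_apply hP, AffineForm.eta_eq hP, pow_orderOf_eq_one]
  simp

lemma monomialMap_permMatrix {s : ℕ} (π : Equiv.Perm (Fin s)) (x : Fin s → ℂ) (k : Fin s) :
    monomialMap ((π⁻¹).permMatrix ℕ) x k = x (π k) := by
  simp only [monomialMap, permMatrix_inv_apply]
  rw [Finset.prod_eq_single (π k)]
  · simp
  · intro l _ hl; simp [hl]
  · simp

/-- The nilpotent component `a₀` of `a` also satisfies `L ^ n a₀ = c • a₀`; iterating kills the left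
side but not the powers of `c`, so `a₀ = 0`. -/
lemma mem_nonzeroGenEigenspace {V : Type*} [AddCommGroup V] [Module ℂ V] [FiniteDimensional ℂ V]
    {L : Module.End ℂ V} {a : V} {n : ℕ} (hn : 0 < n) {c : ℂ} (hc : c ≠ 0)
    (h : (L ^ n) a = c • a) : a ∈ nonzeroGenEigenspace L := by
  have hcompl := isCompl_nonzeroGenEigenspace L
  have ha : a ∈ L.maxGenEigenspace 0 ⊔ nonzeroGenEigenspace L := by
    rw [hcompl.sup_eq_top]; trivial
  obtain ⟨a₀, ha₀, a₁, ha₁, rfl⟩ := Submodule.mem_sup.1 ha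
  have h0 : (L ^ n) a₀ ∈ L.maxGenEigenspace 0 :=
    Module.End.mapsTo_maxGenEigenspace_of_comm ((Commute.refl L).pow_right n) 0 ha₀
  have h1 : (L ^ n) a₁ ∈ nonzeroGenEigenspace L := by
    have hle : nonzeroGenEigenspace L ≤ (nonzeroGenEigenspace L).comap (L ^ n) :=
      iSup₂_le fun c hc v hv => (le_iSup₂_of_le c hc le_rfl :
        L.maxGenEigenspace c ≤ nonzeroGenEigenspace L)
        (Module.End.mapsTo_maxGenEigenspace_of_comm ((Commute.refl L).pow_right n) c hv)
    exact hle ha₁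
  have h2 : (L ^ n) a₀ = c • a₀ := by
    rw [map_add, smul_add] at h
    have h3 : (L ^ n) a₀ - c • a₀ = c • a₁ - (L ^ n) a₁ := by
      rw [sub_eq_sub_iff_add_eq_add, h, add_comm]
    have h4 := Submodule.disjoint_def.1 hcompl.disjoint _
      (Submodule.sub_mem _ h0 (Submodule.smul_mem _ c ha₀))
      (h3 ▸ Submodule.sub_mem _ (Submodule.smul_mem _ c ha₁) h1)
    exact sub_eq_zero.1 h4
  have h5 : ∀ m, (L ^ (n * m)) a₀ = c ^ m • a₀ := by
    intro m
    induction m with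
    | zero => simp
    | succ m ih =>
      rw [mul_add, mul_one, pow_add, Module.End.mul_apply, h2, map_smul, ih, smul_smul, pow_succ']
  obtain ⟨m, hm⟩ := (Module.End.mem_maxGenEigenspace L 0 a₀).1 ha₀
  rw [zero_smul, sub_zero] at hm
  have h6 : c ^ m • a₀ = 0 := by
    rw [← h5 m]
    obtain ⟨k, hk⟩ : ∃ k, n * m = k + m := ⟨n * m - m, by
      have := Nat.le_mul_of_pos_left m hn; omega⟩
    rw [hk, pow_add, Module.End.mul_apply, hm, map_zero]
  have h7 : a₀ = 0 := (smul_eq_zero.1 h6).resolve_left (pow_ne_zero _ hc)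
  rwa [h7, zero_add]

lemma isGenEig_zero_of_pow {V : Type*} [AddCommGroup V] [Module ℂ V] {L : Module.End ℂ V} {v : V}
    {B : Submodule ℂ V} (h : ∃ n, (L ^ n) v = 0) : IsGenEig L B 0 v := by
  obtain ⟨n, hn⟩ := h
  exact ⟨n, by rw [map_zero, sub_zero, hn]; exact B.zero_mem⟩

lemma IsGenEig.apply_of_commute {R : Type*} [AddCommGroup R] [Module ℂ R] {T S : Module.End ℂ R}
    {B : Submodule ℂ R} (hS : ∀ g ∈ B, S g ∈ B) (h : Commute T S) {a : ℂ} {g : R}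
    (hg : IsGenEig T B a g) : IsGenEig T B a (S g) := by
  obtain ⟨M, hM⟩ := hg
  have hc : Commute ((T - algebraMap ℂ _ a) ^ M) S :=
    (h.sub_left (Algebra.commute_algebraMap_left a S)).pow_left M
  refine ⟨M, ?_⟩
  rw [← Module.End.mul_apply, hc.eq, Module.End.mul_apply]
  exact hS _ hM

lemma apply_mem_bot {V : Type*} [AddCommGroup V] [Module ℂ V] {L : Module.End ℂ V} :
    ∀ v ∈ (⊥ : Submodule ℂ V), L v ∈ (⊥ : Submodule ℂ V) := by
  intro v hv
  rw [Submodule.mem_bot] at hv ⊢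
  rw [hv, map_zero]

end MonomialMatrices

/-! ### Equations of the periodic components -/

section Components

variable {E : Type*} [NormedAddCommGroup E] [NormedSpace ℂ E] [FiniteDimensional ℂ E]
variable {q : ℕ} {f : E → E} {w : Fin q → E → ℂ}

omit [FiniteDimensional ℂ E] in
/-- The internal action permutes the periodic components. -/
lemma exists_perm_periodic (hA : HasInjectiveInternalAction f w) {r : ℕ}
    (e : Fin r ≃ {k // IsPeriodicComponent f w k}) :
    ∃ π : Equiv.Perm (Fin r), ∀ i, (internalAction f w).mulVec (Pi.single (e i).1 1) =
      Pi.single (e (π i)).1 1 := by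
  have hA' := mulVec_injective_of_cast hA
  choose l hl hl' using fun i => IsPeriodicIndex.exists_mulVec_single hA' (e i).2
  let m : Fin r → Fin r := fun i => e.symm ⟨l i, hl i⟩
  have hm : ∀ i, (e (m i)).1 = l i := fun i => by simp [m]
  have hinj : Function.Injective m := by
    intro i j hij
    have h1 : l i = l j := by rw [← hm, ← hm, hij]
    have h2 := hA' ((hl' i).trans ((congrArg (fun t => Pi.single t 1) h1).trans (hl' j).symm))
    have h3 : (e i).1 = (e j).1 := by
      by_contra hne
      have h4 := congrFun h2 (e i).1
      rw [Pi.single_eq_same, Pi.single_eq_of_ne hne] at h4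
      exact one_ne_zero h4
    exact e.injective (Subtype.ext h3)
  exact ⟨Equiv.ofBijective m (Finite.injective_iff_bijective.1 hinj), fun i => by
    rw [hl' i, Equiv.ofBijective_apply, hm]⟩

/-- Equations of the periodic components which are permuted by `f` up to constants. -/
theorem IsContractingRigid.exists_periodic_coordinates (h : IsContractingRigid f w) {r : ℕ}
    {e : Fin r ≃ {k // IsPeriodicComponent f w k}} {π : Equiv.Perm (Fin r)}
    (hπ : ∀ i, (internalAction f w).mulVec (Pi.single (e i).1 1) = Pi.single (e (π i)).1 1) :
    ∃ (γ : Fin r → ℂ) (φ : Fin r → E → ℂ), (∀ i, γ i ≠ 0) ∧ (∀ i, AnalyticAt ℂ (φ i) 0) ∧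
      (∀ i, φ i 0 = 0) ∧ ∀ i, ∀ᶠ x in 𝓝 0, w (e i) (f x) * Complex.exp (φ i (f x)) =
        γ i * (w (e (π i)) x * Complex.exp (φ (π i) x)) := by
  obtain ⟨C, Λ, hf⟩ := h.contracting.exists_contractsAtRate
  obtain ⟨U, hU, hU0, hUw⟩ := h.exists_comp_eq
  obtain ⟨φ, hφ, hφ0, hφf⟩ := hf.exists_exp_cohomology h.contracting.analytic π
    (U := fun i => U (e i)) (fun i => hU _) (fun i => hU0 _)
  refine ⟨fun i => U (e i) 0, φ, fun i => hU0 _, hφ, hφ0, fun i => ?_⟩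
  filter_upwards [hφf i, hUw (e i)] with x hx hx'
  have h1 : ∏ l, w l x ^ internalAction f w l (e i) = w (e (π i)) x := by
    have h2 : ∀ l, internalAction f w l (e i) = (Pi.single (e (π i)).1 1 : Fin q → ℕ) l := by
      intro l
      rw [← hπ i, mulVec_single_apply]
    simp only [h2]
    rw [Finset.prod_eq_single (e (π i)).1]
    · simp
    · intro l _ hl; simp [hl]
    · simp
  rw [h1] at hx'
  have hx'' : w (e i) (f x) = U (e i) x * w (e (π i)) x := hx'
  rw [hx'']
  linear_combination w (e (π i)) x * hx

end Components

/-! ### Coordinates adapted to the germ -/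

section AdaptedCoordinates

variable {E : Type*} [NormedAddCommGroup E] [NormedSpace ℂ E] [FiniteDimensional ℂ E]
variable {q : ℕ} {f : E → E} {w : Fin q → E → ℂ}

/-- Coordinates adapted to a rigid germ: equations of the periodic components which are permuted
by the germ up to constants, and generalized eigenfunctions of its `η`-th iterate, to be completed
by the equations of the non-periodic components and one more coordinate. -/
structure AdaptedCoordinates (f : E → E) {q : ℕ} (w : Fin q → E → ℂ) (s p : ℕ) where
  analytic : AnalyticAt ℂ f 0
  map_zero : f 0 = 0
  r : ℕ
  r_le : r ≤ s
  per : Fin r ≃ {k // IsPeriodicComponent f w k}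
  nonper : Fin p ≃ {k // ¬ IsPeriodicComponent f w k}
  π : Equiv.Perm (Fin s)
  γ : Fin s → ℂ
  φ : Fin r → E → ℂ
  x : Fin s → analyticFun E
  z : E →L[ℂ] ℂ
  π_fix : ∀ i : Fin s, r ≤ i → π i = i
  γ_ne : ∀ i, γ i ≠ 0
  φ_analytic : ∀ i, AnalyticAt ℂ (φ i) 0
  φ_zero : ∀ i, φ i 0 = 0
  x_periodic : ∀ i : Fin r, (x (Fin.castLE r_le i) : E → ℂ) =
    fun v => w (per i) v * Complex.exp (φ i v)
  x_zero : ∀ i, (x i : E → ℂ) 0 = 0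
  x_comp : ∀ i : Fin s, (i : ℕ) < r → ∀ᶠ v in 𝓝 0,
    (x i : E → ℂ) (f v) = γ i * (x (π i) : E → ℂ) v
  span_eq : Submodule.span ℂ (Set.range (Sum.elim (fun i => fderiv ℂ (x i : E → ℂ) 0)
    (Sum.elim (fun j => fderiv ℂ (w (nonper j)) 0) fun _ : Unit => z))) = ⊤
  x_eig : ∀ i, IsGenEig ((pullback f analytic map_zero).toLinearMap ^ orderOf π) (nullGerms E)
    (permWeight π γ (orderOf π) i) (x i)
  z_nil : ∃ n, (dualDifferential f ^ n) z = 0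
  z_comp : dualDifferential f z ∈
    Submodule.span ℂ (Set.range fun j => fderiv ℂ (w (nonper j)) 0)
  triangular : ∀ j : Fin s, r ≤ j → dualDifferential f (fderiv ℂ (x j : E → ℂ) 0) -
    γ j • fderiv ℂ (x j : E → ℂ) 0 ∈
      Submodule.span ℂ ((fun i => fderiv ℂ (x i : E → ℂ) 0) '' Set.Iio j)

/-- A power of the transposed differential multiplies the differential of each periodic component by
a nonzero scalar, and some power kills that of each non-periodic one. Both families therefore extend
to a basis adapted to the generalized eigenspaces. Only the forms outside these families and `z`
have to be lifted to eigenfunctions; the periodic equations are kept. -/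
theorem IsContractingRigid.nonempty_adaptedCoordinates (h : IsContractingRigid f w)
    (hA : HasInjectiveInternalAction f w) {s p : ℕ} (hs : s = (nonzeroEigenvalues f).card)
    (hp : p = numNonPeriodic f w) (hd : Module.finrank ℂ E = s + p + 1) :
    Nonempty (AdaptedCoordinates f w s p) := by
  classical
  have hfa := h.contracting.analytic
  have h0 := h.contracting.map_zero
  have hw := h.rigid.isTransverse
  have hA' : Function.Injective (internalAction f w).mulVec := mulVec_injective_of_cast hA
  obtain ⟨C, Λ, hf⟩ := h.contracting.exists_contractsAtRate
  obtain ⟨r, hr⟩ : ∃ r, r = Nat.card {k : Fin q // IsPeriodicComponent f w k} := ⟨_, rfl⟩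
  let e : Fin r ≃ {k // IsPeriodicComponent f w k} := (Finite.equivFinOfCardEq hr.symm).symm
  let e' : Fin p ≃ {k // ¬ IsPeriodicComponent f w k} := (Finite.equivFinOfCardEq hp.symm).symm
  obtain ⟨π, hπ⟩ := exists_perm_periodic hA e
  obtain ⟨γ, φ, hγ, hφ, hφ0, hγφ⟩ := h.exists_periodic_coordinates hπ
  set L := dualDifferential f with hL
  set a : Fin r → (E →L[ℂ] ℂ) := fun i => fderiv ℂ (w (e i)) 0 with ha
  set b : Fin p → (E →L[ℂ] ℂ) := fun j => fderiv ℂ (w (e' j)) 0 with hb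
  have hai : LinearIndependent ℂ a :=
    hw.transverse.comp (fun i => (e i).1) (Subtype.val_injective.comp e.injective)
  have hbi : LinearIndependent ℂ b :=
    hw.transverse.comp (fun i => (e' i).1) (Subtype.val_injective.comp e'.injective)
  have hu : ∀ i, AnalyticAt ℂ (fun v => w (e i) v * Complex.exp (φ i v)) 0 := fun i =>
    (hw.analytic _).mul (hφ i).cexp
  have hda : ∀ i, fderiv ℂ (fun v => w (e i) v * Complex.exp (φ i v)) 0 = a i := fun i =>
    fderiv_mul_exp (hw.analytic _) (hw.map_zero _) (hφ i) (hφ0 i)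
  have hLa : ∀ i, L (a i) = γ i • a (π i) := by
    intro i
    rw [← hda, hL, dualDifferential_fderiv hfa h0 (hu i), ← hda]
    have h1 : (fun v => w (e i) v * Complex.exp (φ i v)) ∘ f =ᶠ[𝓝 0]
        γ i • (fun v => w (e (π i)) v * Complex.exp (φ (π i) v)) := hγφ i
    rw [h1.fderiv_eq, fderiv_const_smul (hu _).differentiableAt]
  have hLpow : ∀ n i, (L ^ n) (a i) = permWeight π γ n i • a ((π ^ n) i) := by
    intro n i
    have h1 := pow_apply_sub_mem (T := L) (B := ⊥) apply_mem_bot (u := a) (γ := γ) (π := π)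
      (fun i => by rw [Submodule.mem_bot, hLa, sub_self]) n i
    exact sub_eq_zero.1 ((Submodule.mem_bot ℂ).1 h1)
  have hanz : ∀ i, a i ∈ nonzeroGenEigenspace L := by
    intro i
    refine mem_nonzeroGenEigenspace (n := orderOf π) (orderOf_pos π)
      (permWeight_ne_zero (π := π) hγ (orderOf π) i) ?_
    rw [hLpow, pow_orderOf_eq_one, Equiv.Perm.one_apply]
  have hLb : ∀ j, L (b j) ∈ Submodule.span ℂ (Set.range b) := by
    intro j
    rcases h.dualDifferential_component hA (e' j) with ⟨l, c, h1, h2⟩ | h2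
    · have h3 : ¬ IsPeriodicComponent f w l := fun hl =>
        (e' j).2 ((isPeriodicIndex_of_mulVec_single hA' h1).2 hl)
      rw [hb, hL]
      rw [h2]
      refine Submodule.smul_mem _ _ (Submodule.subset_span ⟨e'.symm ⟨l, h3⟩, ?_⟩)
      simp
    · rw [hb, hL]
      rw [h2]
      exact Submodule.zero_mem _
  have hLb0 : ∀ j, ∃ n, (L ^ n) (b j) = 0 := fun j =>
    h.exists_dualDifferential_pow_eq_zero hA (e' j).2
  -- The dimension hypothesis enters here: beyond the `p` non-periodic differentials there is
  -- exactly one nilpotent direction.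
  have hfin0 : Module.finrank ℂ (L.maxGenEigenspace 0) = p + 1 := by
    have := card_nonzeroEigenvalues f
    rw [← hL] at this
    omega
  obtain ⟨hrs, x, c, z, hxa, hspan, hz, hz', hx⟩ := exists_adapted_basis hai hbi hanz hLb0 hLb
    hfin0 (finrank_cotangent.trans hd)
  -- extend the permutation
  set π' : Equiv.Perm (Fin s) := π.extendDomain (Fin.castLEquiv hrs) with hπ'
  have hπ'lt : ∀ i, π' (Fin.castLE hrs i) = Fin.castLE hrs (π i) := fun i =>
    Equiv.Perm.extendDomain_apply_image π (Fin.castLEquiv hrs) i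
  have hπ'ge : ∀ i : Fin s, r ≤ i → π' i = i := fun i hi =>
    Equiv.Perm.extendDomain_apply_not_subtype π (Fin.castLEquiv hrs) (by omega)
  set γ' : Fin s → ℂ := fun i => if hi : (i : ℕ) < r then γ ⟨i, hi⟩ else c i with hγ'
  have hγ'lt : ∀ i, γ' (Fin.castLE hrs i) = γ i := fun i => by simp [hγ']
  have hγ'ge : ∀ i : Fin s, r ≤ i → γ' i = c i := fun i hi => by simp [hγ', hi]
  have hγ'0 : ∀ i, γ' i ≠ 0 := by
    intro i
    by_cases hi : (i : ℕ) < r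
    · simpa [hγ', hi] using hγ ⟨i, hi⟩
    · rw [hγ'ge i (by omega)]
      exact (hx i (by omega)).1
  set η := orderOf π'
  have hη : 0 < η := orderOf_pos π'
  have hfη := analyticAt_iterate hfa h0 η
  have h0η : f^[η] 0 = 0 := Function.iterate_fixed h0 η
  have hLη : dualDifferential f^[η] = L ^ η := dualDifferential_iterate hfa h0 η
  have hTη := pullback_iterate hfa h0 η hfη h0η
  set τ := permWeight π' γ' η
  have hcases : ∀ P : Fin s → Prop, (∀ i : Fin r, P (Fin.castLE hrs i)) →
      (∀ i : Fin s, r ≤ i → P i) → ∀ i, P i := by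
    intro P h1 h2 i
    by_cases hi : (i : ℕ) < r
    · exact h1 ⟨i, hi⟩
    · exact h2 i (by omega)
  have hLη_eig : ∀ i, IsGenEig (L ^ η) ⊥ (τ i) (x i) := by
    refine hcases _ (fun i => ?_) (fun i hi => ?_)
    · refine ⟨1, ?_⟩
      have h1 := pow_apply_sub_mem (T := L) (B := ⊥) apply_mem_bot
        (u := fun i : Fin s => if hi : (i : ℕ) < r then a ⟨i, hi⟩ else 0) (γ := γ') (π := π')
        (hcases _ (fun i => by
          rw [hπ'lt, hγ'lt]
          simp [hLa]) (fun i hi => by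
          rw [hπ'ge i hi]
          simp only [dif_neg hi.not_gt]
          simp)) η (Fin.castLE hrs i)
      rw [pow_orderOf_eq_one] at h1
      rw [hxa]
      simpa [Module.algebraMap_end_apply] using h1
    · have h1 : τ i = c i ^ η := by
        rw [← hγ'ge i hi]
        exact permWeight_of_fixed (hπ'ge i hi) η
      rw [h1]
      obtain ⟨m, hm⟩ := (hx i hi).2.1
      exact IsGenEig.pow (B := ⊥) apply_mem_bot ⟨m, by rw [hm]; simp⟩ η
  have hLη_zero : ∀ v, (∃ n, (L ^ n) v = 0) → IsGenEig (L ^ η) ⊥ 0 v := by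
    intro v hv
    rw [← zero_pow hη.ne']
    exact IsGenEig.pow apply_mem_bot (isGenEig_zero_of_pow hv) η
  -- the linear coordinates
  let ξ : Fin s ⊕ (Fin p ⊕ Unit) → analyticFun E := fun i =>
    linearGerm (Sum.elim x (Sum.elim b fun _ => z) i)
  have hξ : IsCoordinateSystem ξ := by
    refine ⟨fun i => map_zero _, ?_⟩
    rw [← hspan]
    congr 2
    funext i
    exact ContinuousLinearMap.fderiv _
  have hlin : ∀ (ℓ : E →L[ℂ] ℂ) (μ : ℂ), IsGenEig (L ^ η) ⊥ μ ℓ →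
      IsGenEig (pullback f^[η] hfη h0η).toLinearMap (vanishingOrder E 2) μ (linearGerm ℓ) := by
    intro ℓ μ hℓ
    refine isGenEig_of_fderiv (map_zero ℓ) ?_
    rw [hLη]
    have : fderiv ℂ (linearGerm ℓ : E → ℂ) 0 = ℓ := ℓ.fderiv
    rwa [this]
  have hξe : ∀ i, IsGenEig (pullback f^[η] hfη h0η).toLinearMap (vanishingOrder E 2)
      (Sum.elim τ (fun _ => 0) i) (ξ i) := by
    rintro (i | j | j)
    · exact hlin _ _ (hLη_eig i)
    · exact hlin _ _ (hLη_zero _ (hLb0 j))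
    · exact hlin _ _ (hLη_zero _ hz)
  have hτ0 : ∀ i, τ i ≠ 0 := permWeight_ne_zero hγ'0 η
  choose v hv hv' using fun i => exists_generalized_eigenfunction (hf.iterate hη) hfη h0η hξ hξe
    (hτ0 i) (hlin _ _ (hLη_eig i))
  -- The first `r` coordinates must remain equations of the periodic components, so they are taken
  -- as they are, being exact eigenfunctions of the `η`-th iterate; the lifts `v` are used for the
  -- others.
  set X : Fin s → analyticFun E := fun i => if hi : (i : ℕ) < r then
    ⟨fun v => w (e ⟨i, hi⟩) v * Complex.exp (φ ⟨i, hi⟩ v), hu _⟩ else v i with hX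
  have hXlt : ∀ i : Fin r, X (Fin.castLE hrs i) =
      ⟨fun v => w (e i) v * Complex.exp (φ i v), hu i⟩ := fun i => by simp [hX]
  have hXge : ∀ i : Fin s, r ≤ i → X i = v i := fun i hi => by simp [hX, hi]
  have hdX : ∀ i, fderiv ℂ (X i : E → ℂ) 0 = x i := by
    refine hcases _ (fun i => ?_) (fun i hi => ?_)
    · rw [hXlt, hxa]; exact hda i
    · rw [hXge i hi]
      have h1 := (mem_vanishingOrder_two.1 (hv i)).2
      have h2 : fderiv ℂ ((v i : E → ℂ) - (x i : E → ℂ)) 0 = 0 := h1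
      rw [fderiv_sub (v i).2.differentiableAt (x i).differentiableAt, (x i).fderiv] at h2
      exact sub_eq_zero.1 h2
  have hXcomp : ∀ i : Fin s, (i : ℕ) < r → ∀ᶠ v in 𝓝 0,
      (X i : E → ℂ) (f v) = γ' i * (X (π' i) : E → ℂ) v := by
    refine hcases _ (fun i _ => ?_) (fun i hi hi' => by omega)
    rw [hπ'lt, hγ'lt, hXlt, hXlt]
    exact hγφ i
  refine ⟨{
    analytic := hfa, map_zero := h0, r := r, r_le := hrs, per := e, nonper := e', π := π', γ := γ'
    φ := φ, x := X, z := z, π_fix := hπ'ge, γ_ne := hγ'0, φ_analytic := hφ, φ_zero := hφ0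
    x_periodic := fun i => by rw [hXlt]
    x_zero := ?_, x_comp := hXcomp, span_eq := ?_, x_eig := ?_, z_nil := hz, z_comp := hz'
    triangular := ?_ }⟩
  · refine hcases _ (fun i => ?_) (fun i hi => ?_)
    · rw [hXlt]; simp [hw.map_zero]
    · rw [hXge i hi]
      have h1 : (v i : E → ℂ) 0 - x i 0 = 0 := (mem_vanishingOrder_two.1 (hv i)).1
      simpa using h1
  · simp only [hdX]
    exact hspan
  · change ∀ i, IsGenEig ((pullback f hfa h0).toLinearMap ^ η) (nullGerms E) (τ i) (X i)
    refine hcases _ (fun i => ?_) (fun i hi => ?_)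
    · refine ⟨1, ?_⟩
      have h1 := pow_apply_sub_mem (T := (pullback f hfa h0).toLinearMap) (B := nullGerms E)
        (pullback_isLocalEnd hfa h0).null
        -- Setting the family to zero beyond `r` makes the permutation relation hold there
        -- trivially.
        (u := fun i : Fin s => if (i : ℕ) < r then X i else 0) (γ := γ') (π := π')
        (hcases _ (fun i => by
          rw [hπ'lt]
          simp only [Fin.val_castLE, Fin.is_lt, if_true]
          rw [mem_nullGerms]
          filter_upwards [hXcomp (Fin.castLE hrs i) (by simp)] with v hv
          rw [hπ'lt] at hv
          exact sub_eq_zero.2 hv) (fun i hi => by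
          rw [hπ'ge i hi, if_neg (by omega)]; simp)) η (Fin.castLE hrs i)
      rw [pow_orderOf_eq_one] at h1
      simpa [Module.algebraMap_end_apply] using h1
    · rw [hXge i hi, ← hTη]
      exact hv' i
  · intro j hj
    simp only [hdX]
    rw [hγ'ge j hj]
    exact (hx j hj).2.2

end AdaptedCoordinates

/-! ### Normal form of the components along `x` and `y` -/

section SemiNormalForm

variable {E : Type*} [NormedAddCommGroup E] [NormedSpace ℂ E]

/-- Coordinates `(x, y, z)` in which the components along `x` and `y` of `f` are those of the
normal form `N`; nothing is required of the last component, except for its linear part. -/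
structure SemiNormalForm (f : E → E) (s p : ℕ) where
  analytic : AnalyticAt ℂ f 0
  map_zero : f 0 = 0
  N : AffineForm s p
  π : Equiv.Perm (Fin s)
  x : Fin s → analyticFun E
  y : Fin p → analyticFun E
  z : E →L[ℂ] ℂ
  x_zero : ∀ i, (x i : E → ℂ) 0 = 0
  y_zero : ∀ j, (y j : E → ℂ) 0 = 0
  span_eq : Submodule.span ℂ (Set.range (Sum.elim (fun i => fderiv ℂ (x i : E → ℂ) 0)
    (Sum.elim (fun j => fderiv ℂ (y j : E → ℂ) 0) fun _ : Unit => z))) = ⊤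
  r_le : N.r ≤ s
  γ_ne : ∀ k, N.γ k ≠ 0
  β_ne : ∀ k, N.β k ≠ 0
  P_eq : N.P = (π⁻¹).permMatrix ℕ
  π_fix : ∀ i : Fin s, N.r ≤ i → π i = i
  E_v : ∀ i : Fin s, N.r ≤ (i : ℕ) → ∀ k, N.E i k = 0
  det_D : (N.D.map (Nat.cast : ℕ → ℤ)).det ≠ 0
  σ_u : ∀ k : Fin s, (k : ℕ) < N.r → N.σ k = 0
  σ_zero : ∀ k, MvPolynomial.constantCoeff (N.σ k) = 0
  σ_resonant : ∀ k, ∀ n ∈ (N.σ k).support, N.IsPrimaryResonant k n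
  g_zero : ∀ k, MvPolynomial.constantCoeff (N.g k) = 0
  g_resonant : ∀ k, ∀ n ∈ (N.g k).support, N.IsSecondaryResonant n
  x_comp : ∀ k, ∀ᶠ v in 𝓝 0, (x k : E → ℂ) (f v) = N.γ k * (x (π k) : E → ℂ) v +
    MvPolynomial.eval (fun i => (x i : E → ℂ) v) (N.σ k)
  y_comp : ∀ k, ∀ᶠ v in 𝓝 0, (y k : E → ℂ) (f v) =
    N.β k * monomialMap N.E (fun i => (x i : E → ℂ) v) k *
      monomialMap N.D (fun j => (y j : E → ℂ) v) k *
      (1 + MvPolynomial.eval (fun i => (x i : E → ℂ) v) (N.g k))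
  z_comp : dualDifferential f z ∈
    Submodule.span ℂ (Set.range fun j => fderiv ℂ (y j : E → ℂ) 0)
  triangular : ∀ j : Fin s, N.r ≤ j → dualDifferential f (fderiv ℂ (x j : E → ℂ) 0) -
    N.γ j • fderiv ℂ (x j : E → ℂ) 0 ∈
      Submodule.span ℂ ((fun i => fderiv ℂ (x i : E → ℂ) 0) '' Set.Iio j)
  mem_critInf : ∀ᶠ v in 𝓝 0, v ∈ critInf f ↔
    (∃ i : Fin s, (i : ℕ) < N.r ∧ (x i : E → ℂ) v = 0) ∨ ∃ k, (y k : E → ℂ) v = 0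

variable [FiniteDimensional ℂ E]
variable {q : ℕ} {f : E → E} {w : Fin q → E → ℂ} {s p : ℕ}

omit [FiniteDimensional ℂ E] in
lemma prod_castLE {r s : ℕ} (hr : r ≤ s) (F : Fin s → ℂ) (hF : ∀ i : Fin s, r ≤ i → F i = 1) :
    ∏ i, F i = ∏ i : Fin r, F (Fin.castLE hr i) := by
  refine (Fintype.prod_of_injective (Fin.castLE hr) (Fin.castLE_injective hr) _ _ (fun i hi => ?_)
    fun i => rfl).symm
  refine hF i ?_
  by_contra hlt
  exact hi ⟨⟨i, by omega⟩, rfl⟩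

lemma prod_exp_neg_pow {ι : Type*} [Fintype ι] (φ : ι → ℂ) (n : ι → ℕ) :
    ∏ i, Complex.exp (-φ i) ^ n i = Complex.exp (-∑ i, (n i : ℂ) * φ i) := by
  rw [← Finset.sum_neg_distrib, Complex.exp_sum]
  refine Finset.prod_congr rfl fun i _ => ?_
  rw [← Complex.exp_nat_mul]
  ring_nf

namespace AdaptedCoordinates

variable (c : AdaptedCoordinates f w s p)

omit [FiniteDimensional ℂ E] in
lemma iterate_zero : f^[orderOf c.π] 0 = 0 := Function.iterate_fixed c.map_zero _

/-- The last coordinates, as germs. -/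
noncomputable def tail (hw : IsTransverse w) : Fin p ⊕ Unit → analyticFun E :=
  Sum.elim (fun j => ⟨w (c.nonper j), hw.analytic _⟩) fun _ => linearGerm c.z

omit [FiniteDimensional ℂ E] in
lemma isCoordinateSystem (hw : IsTransverse w) :
    IsCoordinateSystem (Sum.elim c.x (c.tail hw)) := by
  refine ⟨?_, ?_⟩
  · rintro (i | j | j)
    · exact c.x_zero i
    · exact hw.map_zero _
    · exact _root_.map_zero c.z
  · rw [← c.span_eq]
    congr 2
    funext i
    rcases i with i | j | j
    · rfl
    · rfl
    · exact c.z.fderiv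

/-- The differentials of these germs are nilpotent under the transpose, so they have eigenvalue `0`
modulo order two and cannot enter a resonant monomial with nonzero eigenvalue. -/
lemma tail_isGenEig (h : IsContractingRigid f w) (hA : HasInjectiveInternalAction f w) (i) :
    IsGenEig (pullback f^[orderOf c.π] (analyticAt_iterate c.analytic c.map_zero _)
      c.iterate_zero).toLinearMap (vanishingOrder E 2) 0 (c.tail h.rigid.isTransverse i) := by
  have key : ∀ v, (∃ n, (dualDifferential f ^ n) v = 0) →
      IsGenEig (dualDifferential f^[orderOf c.π]) ⊥ 0 v := by
    intro v hv
    rw [← zero_pow (orderOf_pos c.π).ne', dualDifferential_iterate c.analytic c.map_zero]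
    exact IsGenEig.pow apply_mem_bot (isGenEig_zero_of_pow hv) _
  rcases i with j | j
  · exact isGenEig_of_fderiv (h.rigid.isTransverse.map_zero _)
      (key _ (h.exists_dualDifferential_pow_eq_zero hA (c.nonper j).2))
  · refine isGenEig_of_fderiv (_root_.map_zero c.z) (key _ ?_)
    have : fderiv ℂ (linearGerm c.z : E → ℂ) 0 = c.z := c.z.fderiv
    exact this ▸ c.z_nil

omit [FiniteDimensional ℂ E] in
lemma x_isGenEig (i) :
    IsGenEig (pullback f^[orderOf c.π] (analyticAt_iterate c.analytic c.map_zero _)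
      c.iterate_zero).toLinearMap (nullGerms E) (permWeight c.π c.γ (orderOf c.π) i) (c.x i) := by
  rw [pullback_iterate c.analytic c.map_zero]
  exact c.x_eig i

/-- The components along the eigenfunctions are resonant polynomials. -/
lemma exists_primary (h : IsContractingRigid f w) (hA : HasInjectiveInternalAction f w)
    (k : Fin s) : ∃ Q : MvPolynomial (Fin s) ℂ, MvPolynomial.constantCoeff Q = 0 ∧
      (∀ n ∈ Q.support, ∏ i, permWeight c.π c.γ (orderOf c.π) i ^ n i =
        permWeight c.π c.γ (orderOf c.π) k) ∧
      ∀ᶠ v in 𝓝 0, (c.x k : E → ℂ) (f v) =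
        MvPolynomial.eval (fun i => (c.x i : E → ℂ) v) Q := by
  obtain ⟨C, Λ, hf⟩ := h.contracting.exists_contractsAtRate
  have hη := orderOf_pos c.π
  set T := pullback f c.analytic c.map_zero
  -- Composition with `f` commutes with its `η`-th power, so `x k ∘ f` is a generalized
  -- eigenfunction for the same eigenvalue as `x k`.
  obtain ⟨Q, hQ, hQx⟩ := exists_resonant_polynomial (hf.iterate hη)
    (analyticAt_iterate c.analytic c.map_zero _) c.iterate_zero
    (c.isCoordinateSystem h.rigid.isTransverse) c.x_isGenEig (c.tail_isGenEig h hA)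
    (permWeight_ne_zero (π := c.π) c.γ_ne (orderOf c.π) k) (g := T (c.x k)) (by
      rw [pullback_iterate c.analytic c.map_zero]
      exact IsGenEig.apply_of_commute (S := T.toLinearMap)
        (pullback_isLocalEnd c.analytic c.map_zero).null ((Commute.refl _).pow_left _) (c.x_eig k))
  have hev : ∀ᶠ v in 𝓝 0, (c.x k : E → ℂ) (f v) =
      MvPolynomial.eval (fun i => (c.x i : E → ℂ) v) Q := by
    filter_upwards [mem_nullGerms.1 hQx] with v hv
    have h1 : (c.x k : E → ℂ) (f v) - (MvPolynomial.aeval c.x Q : analyticFun E).1 v = 0 := hv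
    rw [aeval_analyticFun_apply] at h1
    exact sub_eq_zero.1 h1
  refine ⟨Q, ?_, hQ, hev⟩
  have h1 := hev.self_of_nhds
  rw [c.map_zero, c.x_zero] at h1
  simp only [c.x_zero] at h1
  exact ((congrFun (congrArg DFunLike.coe MvPolynomial.eval_zero) Q).symm.trans h1.symm)

/-- The exponents of the periodic components in the pullbacks of the others. -/
noncomputable def matrixE : Matrix (Fin s) (Fin p) ℕ := fun i k =>
  if hi : (i : ℕ) < c.r then internalAction f w (c.per ⟨i, hi⟩) (c.nonper k) else 0

/-- The exponents of the non-periodic components in their pullbacks. -/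
noncomputable def matrixD : Matrix (Fin p) (Fin p) ℕ :=
  Matrix.of fun i k => internalAction f w (c.nonper i) (c.nonper k)

omit [FiniteDimensional ℂ E] in
lemma monomialMap_matrixE (v : E) (k : Fin p) :
    monomialMap c.matrixE (fun i => (c.x i : E → ℂ) v) k =
      ∏ i : Fin c.r, (w (c.per i) v * Complex.exp (c.φ i v)) ^
        internalAction f w (c.per i) (c.nonper k) := by
  rw [monomialMap, prod_castLE c.r_le]
  · refine Finset.prod_congr rfl fun i _ => ?_
    rw [c.x_periodic]
    simp [matrixE]
  · intro i hi
    simp [matrixE, hi.not_gt]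

omit [FiniteDimensional ℂ E] in
lemma prod_components (F : Fin q → ℂ) :
    ∏ l, F l = (∏ i, F (c.per i)) * ∏ j, F (c.nonper j) := by
  classical
  rw [← Fintype.prod_subtype_mul_prod_subtype (IsPeriodicComponent f w) F,
    ← c.per.prod_comp fun i => F i, ← c.nonper.prod_comp fun i => F i]

/-- The pullbacks of the non-periodic components are units times monomials. -/
lemma exists_monomial (h : IsContractingRigid f w) :
    ∃ (β : Fin p → ℂ) (H : Fin p → analyticFun E), (∀ k, β k ≠ 0) ∧
      (∀ k, (H k : E → ℂ) 0 = 0) ∧ ∀ k, ∀ᶠ v in 𝓝 0, w (c.nonper k) (f v) =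
        β k * Complex.exp ((H k : E → ℂ) v) * monomialMap c.matrixE (fun i => (c.x i : E → ℂ) v) k *
          ∏ j, w (c.nonper j) v ^ c.matrixD j k := by
  obtain ⟨U, hU, hU0, hUw⟩ := h.exists_comp_eq
  -- The exponentials compensate for replacing the equations of the periodic components by the
  -- coordinates `x`, which differ from them by units.
  let V : Fin p → E → ℂ := fun k v => U (c.nonper k) v *
    ∏ i : Fin c.r, Complex.exp (-c.φ i v) ^ internalAction f w (c.per i) (c.nonper k)
  have hV : ∀ k, AnalyticAt ℂ (V k) 0 := fun k =>
    (hU _).mul (Finset.analyticAt_fun_prod _ fun i _ => ((c.φ_analytic i).neg.cexp).pow _)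
  have hV0 : ∀ k, V k 0 ≠ 0 := fun k =>
    mul_ne_zero (hU0 _) (Finset.prod_ne_zero_iff.2 fun i _ => pow_ne_zero _ (Complex.exp_ne_zero _))
  choose H hH hH0 hHV using fun k => exists_eq_mul_exp (hV k) (hV0 k)
  refine ⟨fun k => V k 0, fun k => ⟨H k, hH k⟩, hV0, hH0, fun k => ?_⟩
  filter_upwards [hUw (c.nonper k), hHV k] with v h1 h2
  have h3 : w (c.nonper k) (f v) = U (c.nonper k) v *
      ∏ l, w l v ^ internalAction f w l (c.nonper k) := h1
  rw [h3, ← h2, c.prod_components, c.monomialMap_matrixE]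
  have h4 : (∏ i : Fin c.r, Complex.exp (-c.φ i v) ^ internalAction f w (c.per i) (c.nonper k)) *
      (∏ i : Fin c.r, (w (c.per i) v * Complex.exp (c.φ i v)) ^
        internalAction f w (c.per i) (c.nonper k)) =
      ∏ i, w (c.per i) v ^ internalAction f w (c.per i) (c.nonper k) := by
    rw [← Finset.prod_mul_distrib]
    refine Finset.prod_congr rfl fun i _ => ?_
    rw [← mul_pow]
    congr 1
    rw [Complex.exp_neg]
    field_simp [Complex.exp_ne_zero]
  rw [← h4]
  simp only [V, matrixD, Matrix.of_apply]
  ring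

end AdaptedCoordinates

/-- Primary resonances give the polynomials `Q`, whence `σ`; the non-periodic equations are then
multiplied by `exp ψ`, where `ψ` solves the twisted equation for their units up to `log (1 + g(x))`.
The matrix of that equation is invertible because `D` is a diagonal block of a block triangular
nonsingular matrix. -/
theorem IsContractingRigid.nonempty_semiNormalForm (h : IsContractingRigid f w)
    (hA : HasInjectiveInternalAction f w) (hs : s = (nonzeroEigenvalues f).card)
    (hp : p = numNonPeriodic f w) (hd : Module.finrank ℂ E = s + p + 1) :
    Nonempty (SemiNormalForm f s p) := by
  obtain ⟨c⟩ := h.nonempty_adaptedCoordinates hA hs hp hd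
  obtain ⟨C, Λ, hf⟩ := h.contracting.exists_contractsAtRate
  have hw := h.rigid.isTransverse
  choose Q hQ0 hQ hQx using c.exists_primary h hA
  obtain ⟨β, H, hβ, hH0, hHw⟩ := c.exists_monomial h
  have hdet : (c.matrixD.map (Nat.cast : ℕ → ℤ)).det ≠ 0 := det_nonPeriodic_ne_zero hA c.nonper
  have hunit : IsUnit (c.matrixD.map (Nat.cast : ℕ → ℂ)) := by
    rw [Matrix.isUnit_iff_isUnit_det, isUnit_iff_ne_zero]
    have h1 : (c.matrixD.map (Nat.cast : ℕ → ℂ)).det =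
        ((c.matrixD.map (Nat.cast : ℕ → ℤ)).det : ℂ) := by
      refine Eq.trans ?_ ((Int.castRingHom ℂ).map_det _).symm
      congr 1
    rw [h1]
    exact_mod_cast hdet
  obtain ⟨ψ, hψ0, g, hg0, hg, hgψ⟩ := exists_secondary_normal_form hf c.analytic c.map_zero
    (analyticAt_iterate c.analytic c.map_zero _) c.iterate_zero hunit
    (c.isCoordinateSystem hw) (fun i => (c.x_isGenEig i).mono nullGerms_le)
    (c.tail_isGenEig h hA) H hH0
  -- The values of `ν`, `l`, `m` and `ω` are placeholders, replaced once the last coordinate is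
  -- known.
  let N : AffineForm s p :=
    { r := c.r, γ := c.γ, β := β, ν := 1, P := (c.π⁻¹).permMatrix ℕ, E := c.matrixE
      D := c.matrixD, l := 0, m := 0
      -- The subtracted term `γ k x k` is itself resonant, so the support of `σ k` stays resonant.
      σ := fun k => if (k : ℕ) < c.r then 0 else Q k - MvPolynomial.C (c.γ k) * MvPolynomial.X k
      g := g, ω := 0 }
  have hN : N.P = (c.π⁻¹).permMatrix ℕ := rfl
  have hev : ∀ i, N.ev i = permWeight c.π c.γ (orderOf c.π) i := fun i => AffineForm.ev_eq hN i
  let Y : Fin p → analyticFun E := fun j =>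
    ⟨fun v => w (c.nonper j) v * Complex.exp ((ψ j : E → ℂ) v), (hw.analytic _).mul (ψ j).2.cexp⟩
  have hdY : ∀ j, fderiv ℂ (Y j : E → ℂ) 0 = fderiv ℂ (w (c.nonper j)) 0 := fun j =>
    fderiv_mul_exp (hw.analytic _) (hw.map_zero _) (ψ j).2 (hψ0 j)
  refine ⟨{
    analytic := c.analytic, map_zero := c.map_zero, N := N, π := c.π, x := c.x, y := Y, z := c.z
    x_zero := c.x_zero
    y_zero := fun j => by simp [Y, hw.map_zero]
    span_eq := by simp only [hdY]; exact c.span_eq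
    r_le := c.r_le, γ_ne := c.γ_ne, β_ne := hβ, P_eq := rfl, π_fix := c.π_fix
    E_v := fun i hi k => by
      have : ¬ (i : ℕ) < c.r := hi.not_gt
      simp [N, AdaptedCoordinates.matrixE, this]
    det_D := hdet
    σ_u := fun k hk => if_pos hk
    σ_zero := fun k => ?_
    σ_resonant := fun k n hn => ?_
    g_zero := hg0
    g_resonant := fun k n hn => ?_
    x_comp := fun k => ?_
    y_comp := fun k => ?_
    z_comp := by simp only [hdY]; exact c.z_comp
    triangular := c.triangular
    mem_critInf := ?_ }⟩
  · change MvPolynomial.constantCoeff (if (k : ℕ) < c.r then 0 else _) = 0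
    split_ifs
    · simp
    · simp [hQ0]
  · change n ∈ (if (k : ℕ) < c.r then (0 : MvPolynomial (Fin s) ℂ) else _).support at hn
    rw [AffineForm.IsPrimaryResonant]
    simp only [hev]
    split_ifs at hn with hk
    · simp at hn
    · rcases Finset.mem_union.1 (MvPolynomial.support_sub _ _ _ hn) with h1 | h1
      · exact hQ k n h1
      · rw [MvPolynomial.C_mul_X_eq_monomial] at h1
        have h2 := Finset.mem_singleton.1 (MvPolynomial.support_monomial_subset h1)
        rw [h2, Finset.prod_eq_single k]
        · simp
        · intro i _ hi; simp [hi]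
        · simp
  · rw [AffineForm.IsSecondaryResonant, AffineForm.eta_eq hN]
    simp only [hev]
    have h1 : (N.D ^ orderOf c.π).map (Nat.cast : ℕ → ℂ) =
        (c.matrixD.map (Nat.cast : ℕ → ℂ)) ^ orderOf c.π :=
      map_pow (Nat.castRingHom ℂ).mapMatrix c.matrixD (orderOf c.π)
    rw [h1]
    exact hg k n hn
  · by_cases hk : (k : ℕ) < c.r
    · filter_upwards [c.x_comp k hk] with v hv
      rw [hv]
      simp [N, hk]
    · filter_upwards [hQx k] with v hv
      rw [hv, c.π_fix k (by omega)]
      simp [N, hk]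
  · filter_upwards [hHw k, hgψ k] with v h1 h2
    have h3 : (Y k : E → ℂ) (f v) = w (c.nonper k) (f v) * Complex.exp ((ψ k : E → ℂ) (f v)) := rfl
    have h4 : ∏ j, w (c.nonper j) v ^ c.matrixD j k =
        monomialMap c.matrixD (fun j => (Y j : E → ℂ) v) k *
          Complex.exp (-∑ j, (c.matrixD j k : ℂ) * (ψ j : E → ℂ) v) := by
      rw [← prod_exp_neg_pow, monomialMap, ← Finset.prod_mul_distrib]
      refine Finset.prod_congr rfl fun j _ => ?_
      rw [← mul_pow]
      congr 1
      simp only [Y]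
      rw [Complex.exp_neg]
      field_simp [Complex.exp_ne_zero]
    simp only [Matrix.map_apply] at h2
    rw [h3, h1, h4]
    change _ = β k * _ * _ * (1 + MvPolynomial.eval _ (g k))
    rw [← h2, sub_eq_add_neg, Complex.exp_add, Complex.exp_add]
    ring
  · filter_upwards [h.rigid.eq_union] with v hv
    rw [hv]
    constructor
    · rintro ⟨k, hk⟩
      by_cases hper : IsPeriodicComponent f w k
      · refine Or.inl ⟨Fin.castLE c.r_le (c.per.symm ⟨k, hper⟩), (c.per.symm ⟨k, hper⟩).is_lt, ?_⟩
        rw [c.x_periodic]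
        simp [hk]
      · refine Or.inr ⟨c.nonper.symm ⟨k, hper⟩, ?_⟩
        simp [Y, hk]
    · rintro (⟨i, hi, h1⟩ | ⟨k, h1⟩)
      · have h2 := congrFun (c.x_periodic ⟨i, hi⟩) v
        have h3 : Fin.castLE c.r_le ⟨i, hi⟩ = i := rfl
        rw [h3, h1] at h2
        exact ⟨_, (mul_eq_zero.1 h2.symm).resolve_right (Complex.exp_ne_zero _)⟩
      · exact ⟨_, (mul_eq_zero.1 h1).resolve_right (Complex.exp_ne_zero _)⟩

end SemiNormalForm

/-! ### Primitives of germs in a direction -/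

section Primitives

open Metric

variable {V : Type*} [NormedAddCommGroup V] [NormedSpace ℂ V] [FiniteDimensional ℂ V]

/-- Analytic germs have analytic primitives in a given direction. -/
theorem exists_primitive {ℓ : V →L[ℂ] ℂ} {e : V} (he : ℓ e = 1) {G : V → ℂ}
    (hG : AnalyticAt ℂ G 0) :
    ∃ I : V → ℂ, AnalyticAt ℂ I 0 ∧ I 0 = G 0 ∧
      ∀ᶠ v in 𝓝 0, fderiv ℂ (fun v => ℓ v * I v) v e = G v := by
  let L : ℝ → V →L[ℂ] V := fun t =>
    ContinuousLinearMap.id ℂ V - (1 - t : ℂ) • ℓ.smulRight e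
  have hL : Continuous L := by
    have h1 : Continuous fun t : ℝ => (1 - t : ℂ) := by fun_prop
    exact continuous_const.sub (h1.smul continuous_const)
  set I : V → ℂ := fun v => ∫ t in (0 : ℝ)..1, G (L t v) with hI
  have hIa : AnalyticAt ℂ I 0 := analyticAt_integral_comp_linear hG hL
  refine ⟨I, hIa, by simp [hI], ?_⟩
  obtain ⟨r, hr, hball⟩ := eventually_nhds_iff_ball.1 hG.eventually_analyticAt
  set R := r / 2 / (‖e‖ + 1)
  have hR : 0 < R := by positivity
  have ev1 : ∀ᶠ v in 𝓝 (0 : V), ‖v - ℓ v • e‖ < r / 2 := by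
    have h1 : Continuous fun v : V => ‖v - ℓ v • e‖ := by fun_prop
    exact h1.continuousAt.eventually (gt_mem_nhds (by simpa using hr))
  have ev2 : ∀ᶠ v in 𝓝 (0 : V), ‖ℓ v‖ < R := by
    have h1 : Continuous fun v : V => ‖ℓ v‖ := by fun_prop
    exact h1.continuousAt.eventually (gt_mem_nhds (by simpa using hR))
  filter_upwards [ev1, ev2, hIa.eventually_analyticAt] with v hv1 hv2 hv3
  set a := v - ℓ v • e
  have ha : ℓ a = 0 := by simp [a, he]
  have hmem : ∀ ζ ∈ ball (0 : ℂ) R, a + ζ • e ∈ ball (0 : V) r := by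
    intro ζ hζ
    rw [mem_ball_zero_iff] at hζ ⊢
    calc _ ≤ ‖a‖ + ‖ζ‖ * ‖e‖ := (norm_add_le _ _).trans (by rw [norm_smul])
      _ ≤ ‖a‖ + R * (‖e‖ + 1) := by gcongr; linarith
      _ = ‖a‖ + r / 2 := by simp only [R]; field_simp
      _ < r := by linarith
  have hg : DifferentiableOn ℂ (fun ζ : ℂ => G (a + ζ • e)) (ball 0 R) := fun ζ hζ =>
    (DifferentiableAt.comp ζ (hball _ (hmem ζ hζ)).differentiableAt
      (by fun_prop)).differentiableWithinAt
  obtain ⟨P, hP⟩ := hg.isExactOn_ball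
  -- On the line through `a` in the direction `e` the form `ℓ` is the parameter, and `ℓ · I` agrees
  -- with a one-variable primitive of `G`.
  have key : ∀ ζ ∈ ball (0 : ℂ) R, ℓ (a + ζ • e) * I (a + ζ • e) = P ζ - P 0 := by
    intro ζ hζ
    have hL' : ∀ t : ℝ, L t (a + ζ • e) = a + ((t : ℂ) * ζ) • e := by
      intro t
      simp only [L, sub_apply, ContinuousLinearMap.id_apply, smul_apply,
        ContinuousLinearMap.smulRight_apply, map_add, map_smul, ha, he]
      module
    have hin : ∀ t ∈ Set.uIcc (0 : ℝ) 1, (t : ℂ) * ζ ∈ ball (0 : ℂ) R := by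
      intro t ht
      rw [Set.uIcc_of_le zero_le_one] at ht
      rw [mem_ball_zero_iff] at hζ ⊢
      rw [norm_mul, Complex.norm_real, Real.norm_eq_abs, abs_of_nonneg ht.1]
      nlinarith [norm_nonneg ζ, ht.2]
    have hder : ∀ t ∈ Set.uIcc (0 : ℝ) 1,
        HasDerivAt (fun t : ℝ => P ((t : ℂ) * ζ)) (ζ * G (a + ((t : ℂ) * ζ) • e)) t := by
      intro t ht
      have h1 : HasDerivAt (fun t : ℝ => (t : ℂ) * ζ) ζ t := by
        simpa using (Complex.ofRealCLM.hasDerivAt (x := t)).mul_const ζ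
      have h2 := (hP _ (hin t ht)).scomp t h1
      simpa [Function.comp_def] using h2
    have hcont : ContinuousOn (fun t : ℝ => ζ * G (a + ((t : ℂ) * ζ) • e)) (Set.uIcc 0 1) := by
      refine continuousOn_const.mul ?_
      exact hg.continuousOn.comp (f := fun t : ℝ => (t : ℂ) * ζ) (by fun_prop) hin
    have h4 := intervalIntegral.integral_eq_sub_of_hasDerivAt hder hcont.intervalIntegrable
    rw [intervalIntegral.integral_const_mul] at h4
    simp only [hI, hL', map_add, map_smul, ha, he, smul_eq_mul, mul_one, zero_add]
    rw [h4]
    simp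
  have hζ0 : ℓ v ∈ ball (0 : ℂ) R := by simpa using hv2
  have hav : a + ℓ v • e = v := by simp [a]
  have hd : HasFDerivAt (fun v => ℓ v * I v) (fderiv ℂ (fun v => ℓ v * I v) v) (a + ℓ v • e) := by
    rw [hav]
    exact ((ℓ.analyticAt v).mul hv3).differentiableAt.hasFDerivAt
  have hline : HasDerivAt (fun ζ : ℂ => a + ζ • e) e (ℓ v) := by
    simpa using ((hasDerivAt_id (ℓ v)).smul_const e).const_add a
  have h1 := hd.comp_hasDerivAt (ℓ v) hline
  have h2 : HasDerivAt (fun ζ : ℂ => P ζ - P 0) (G (a + ℓ v • e)) (ℓ v) :=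
    (hP _ hζ0).sub_const _
  have h3 : (fun v => ℓ v * I v) ∘ (fun ζ : ℂ => a + ζ • e) =ᶠ[𝓝 (ℓ v)] fun ζ => P ζ - P 0 := by
    filter_upwards [isOpen_ball.mem_nhds hζ0] with ζ hζ using key ζ hζ
  have h5 := h1.unique (h2.congr_of_eventuallyEq h3)
  rw [h5, hav]

omit [FiniteDimensional ℂ V] in
/-- A germ with vanishing derivative in a direction only depends on the other coordinates. -/
lemma eventually_eq_of_fderiv_eq_zero {ℓ : V →L[ℂ] ℂ} {e : V} {G : V → ℂ}
    (hG : AnalyticAt ℂ G 0) (h : ∀ᶠ v in 𝓝 0, fderiv ℂ G v e = 0) :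
    ∀ᶠ v in 𝓝 0, G v = G (v - ℓ v • e) := by
  obtain ⟨r, hr, hball⟩ := eventually_nhds_iff_ball.1 (hG.eventually_analyticAt.and h)
  have ev1 : ∀ᶠ v in 𝓝 (0 : V), ‖v - ℓ v • e‖ < r := by
    have h1 : Continuous fun v : V => ‖v - ℓ v • e‖ := by fun_prop
    exact h1.continuousAt.eventually (gt_mem_nhds (by simpa using hr))
  filter_upwards [ev1, ball_mem_nhds (0 : V) hr] with v hv1 hv2
  let S : Set ℂ := (fun t : ℂ => v - t • e) ⁻¹' ball 0 r
  have hcont : Continuous fun t : ℂ => v - t • e := by fun_prop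
  have hS : IsOpen S := isOpen_ball.preimage hcont
  have hSc : Convex ℝ S := by
    intro s hs t ht a b ha hb hab
    have h1 := convex_ball (0 : V) r hs ht ha hb hab
    have h2 : a • (v - s • e) + b • (v - t • e) = v - (a • s + b • t) • e := by
      rw [smul_sub, smul_sub, add_smul, smul_assoc, smul_assoc]
      have : v = a • v + b • v := by rw [← add_smul, hab, one_smul]
      nth_rw 3 [this]
      abel
    rw [h2] at h1
    exact h1
  have hder : ∀ t ∈ S, HasDerivAt (fun t : ℂ => G (v - t • e)) 0 t := by
    intro t ht
    have h1 : HasDerivAt (fun t : ℂ => v - t • e) (-e) t := by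
      simpa using ((hasDerivAt_id t).smul_const e).const_sub v
    have h2 := (hball _ ht).1.differentiableAt.hasFDerivAt.comp_hasDerivAt t h1
    rwa [map_neg, (hball _ ht).2, neg_zero] at h2
  have h3 := hS.is_const_of_deriv_eq_zero hSc.isPreconnected
    (fun t ht => (hder t ht).differentiableAt.differentiableWithinAt)
    (fun t ht => (hder t ht).deriv) (show (0 : ℂ) ∈ S by simpa [S] using hv2)
    (show ℓ v ∈ S by simpa [S] using hv1)
  simpa using h3

end Primitives

/-! ### The chart and the last coordinate -/

namespace SemiNormalForm

variable {E : Type*} [NormedAddCommGroup E] [NormedSpace ℂ E]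
variable {f : E → E} {s p : ℕ} (c : SemiNormalForm f s p)

/-- The coordinates, as a map to the model space. -/
noncomputable def chart (v : E) : (Fin s → ℂ) × (Fin p → ℂ) × ℂ :=
  (fun i => (c.x i : E → ℂ) v, fun j => (c.y j : E → ℂ) v, c.z v)

lemma analyticAt_chart : AnalyticAt ℂ c.chart 0 := by
  refine AnalyticAt.prod ?_ (AnalyticAt.prod ?_ (c.z.analyticAt 0))
  · exact analyticAt_pi_iff.2 fun i => (c.x i).2
  · exact analyticAt_pi_iff.2 fun j => (c.y j).2

lemma chart_zero : c.chart 0 = 0 := by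
  simp only [chart, c.x_zero, c.y_zero, _root_.map_zero]
  rfl

lemma fderiv_chart_apply (u : E) : fderiv ℂ c.chart 0 u =
    (fun i => fderiv ℂ (c.x i : E → ℂ) 0 u, fun j => fderiv ℂ (c.y j : E → ℂ) 0 u, c.z u) := by
  have h1 : HasFDerivAt c.chart ((ContinuousLinearMap.pi fun i => fderiv ℂ (c.x i : E → ℂ) 0).prod
      ((ContinuousLinearMap.pi fun j => fderiv ℂ (c.y j : E → ℂ) 0).prod c.z)) 0 :=
    (hasFDerivAt_pi.2 fun i => (c.x i).2.differentiableAt.hasFDerivAt).prodMk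
      ((hasFDerivAt_pi.2 fun j => (c.y j).2.differentiableAt.hasFDerivAt).prodMk c.z.hasFDerivAt)
  rw [h1.fderiv]
  rfl

variable [FiniteDimensional ℂ E]

/-- A vector in the kernel is killed by a spanning set of linear forms, hence is zero; the
dimensions agree. -/
lemma bijective_fderiv_chart (hd : Module.finrank ℂ E = s + p + 1) :
    Function.Bijective (fderiv ℂ c.chart 0) := by
  have hinj : Function.Injective (fderiv ℂ c.chart 0 : E →ₗ[ℂ] (Fin s → ℂ) × (Fin p → ℂ) × ℂ) := by
    rw [← LinearMap.ker_eq_bot, LinearMap.ker_eq_bot']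
    intro u hu
    have hu' := (c.fderiv_chart_apply u).symm.trans hu
    have hall : ∀ ℓ : E →L[ℂ] ℂ, ℓ u = 0 := by
      intro ℓ
      have hℓ : ℓ ∈ (⊤ : Submodule ℂ (E →L[ℂ] ℂ)) := trivial
      rw [← c.span_eq] at hℓ
      induction hℓ using Submodule.span_induction with
      | mem ℓ h =>
        obtain ⟨i | j | j, rfl⟩ := h
        · exact congrFun (congrArg Prod.fst hu') i
        · exact congrFun (congrArg (fun t => t.2.1) hu') j
        · exact congrArg (fun t => t.2.2) hu'
      | zero => rfl
      | add a b _ _ ha hb => rw [add_apply, ha, hb, add_zero]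
      | smul a b _ hb => rw [smul_apply, hb, smul_zero]
    by_contra hne
    obtain ⟨g, -, hg⟩ := exists_dual_vector ℂ u (norm_ne_zero_iff.2 hne)
    rw [hall] at hg
    exact hne (by simpa using hg.symm)
  have hdim : Module.finrank ℂ E = Module.finrank ℂ ((Fin s → ℂ) × (Fin p → ℂ) × ℂ) := by
    rw [hd]
    simp [Module.finrank_prod, add_assoc]
  exact ⟨hinj, (LinearMap.injective_iff_surjective_of_finrank_eq_finrank hdim).1 hinj⟩

omit [FiniteDimensional ℂ E] in
lemma chart_comp : ∀ᶠ u in 𝓝 0, (c.chart (f u)).1 = (c.N.toMap (c.chart u)).1 ∧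
    (c.chart (f u)).2.1 = (c.N.toMap (c.chart u)).2.1 := by
  filter_upwards [eventually_all.2 c.x_comp, eventually_all.2 c.y_comp] with u h1 h2
  refine ⟨funext fun k => ?_, funext fun k => ?_⟩
  · have h3 : (c.N.toMap (c.chart u)).1 k = c.N.γ k *
        monomialMap c.N.P (fun i => (c.x i : E → ℂ) u) k +
          MvPolynomial.eval (fun i => (c.x i : E → ℂ) u) (c.N.σ k) := rfl
    rw [h3, c.P_eq, monomialMap_permMatrix]
    exact h1 k
  · exact h2 k

/-- There is a last coordinate along which the germ is affine. -/
theorem exists_last_coordinate {C Λ : ℝ} (hf : ContractsAtRate f C Λ)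
    (hd : Module.finrank ℂ E = s + p + 1) :
    ∃ (ν : ℂ) (l : Fin s → ℕ) (m : Fin p → ℕ) (ζ : (Fin s → ℂ) × (Fin p → ℂ) × ℂ → ℂ)
      (ω : (Fin s → ℂ) × (Fin p → ℂ) → ℂ), ν ≠ 0 ∧ (l, m) ≠ (0, 0) ∧ AnalyticAt ℂ ζ 0 ∧ ζ 0 = 0 ∧
      (∀ v, fderiv ℂ ζ 0 v = v.2.2) ∧ AnalyticAt ℂ ω 0 ∧ ω 0 = 0 ∧
      ∀ᶠ u in 𝓝 (0 : E), ζ (c.chart (f u)) =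
        ν * (∏ i, (c.chart u).1 i ^ l i) * (∏ j, (c.chart u).2.1 j ^ m j) * ζ (c.chart u) +
          ω ((c.chart u).1, (c.chart u).2.1) := by
  set e : (Fin s → ℂ) × (Fin p → ℂ) × ℂ := (0, 0, 1) with he
  set ℓ : (Fin s → ℂ) × (Fin p → ℂ) × ℂ →L[ℂ] ℂ :=
    (ContinuousLinearMap.snd ℂ (Fin p → ℂ) ℂ).comp
      (ContinuousLinearMap.snd ℂ (Fin s → ℂ) ((Fin p → ℂ) × ℂ)) with hℓ
  have hℓv : ∀ v, ℓ v = v.2.2 := fun v => rfl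
  have hℓe : ℓ e = 1 := rfl
  have hΦ := c.analyticAt_chart
  have hΦ0 := c.chart_zero
  have hb := c.bijective_fderiv_chart hd
  obtain ⟨Ψ, hΨ, hΨ0, hΨΦ, hΦΨ, -⟩ := exists_local_inverse hΦ hΦ0 hb
  have hfa := c.analytic
  have h0 := c.map_zero
  have hft : Tendsto f (𝓝 0) (𝓝 0) := by simpa [h0] using hfa.continuousAt.tendsto
  have hΦt : Tendsto c.chart (𝓝 0) (𝓝 0) := by simpa [hΦ0] using hΦ.continuousAt.tendsto
  have hΨt : Tendsto Ψ (𝓝 0) (𝓝 0) := by simpa [hΨ0] using hΨ.continuousAt.tendsto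
  -- the germ in the chart
  set F : (Fin s → ℂ) × (Fin p → ℂ) × ℂ → (Fin s → ℂ) × (Fin p → ℂ) × ℂ :=
    fun v => c.chart (f (Ψ v)) with hF
  have hF0 : F 0 = 0 := by simp [hF, hΨ0, h0, hΦ0]
  have hfΨ : AnalyticAt ℂ (fun v => f (Ψ v)) 0 :=
    AnalyticAt.comp (g := f) (by rwa [hΨ0]) hΨ
  have hFa : AnalyticAt ℂ F 0 :=
    AnalyticAt.comp (g := c.chart) (by rwa [hΨ0, h0]) hfΨ
  have hFt : Tendsto F (𝓝 0) (𝓝 0) := by simpa [hF0] using hFa.continuousAt.tendsto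
  have hFbase : ∀ᶠ v in 𝓝 0, (F v).1 = (c.N.toMap v).1 ∧ (F v).2.1 = (c.N.toMap v).2.1 := by
    filter_upwards [hΨt.eventually c.chart_comp, hΦΨ] with v h1 h2
    rw [h2] at h1
    exact h1
  set H : (Fin s → ℂ) × (Fin p → ℂ) × ℂ → ℂ := fun v => fderiv ℂ (fun v => (F v).2.2) v e with hH
  have hh : AnalyticAt ℂ (fun v => (F v).2.2) 0 := (ℓ.analyticAt _).comp hFa
  have hHa : AnalyticAt ℂ H 0 := ((ContinuousLinearMap.apply ℂ ℂ e).analyticAt _).comp hh.fderiv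
  -- The `x` and `y` components of `F` do not depend on `z`, so the derivative in the direction `e`
  -- is vertical.
  have hFe : ∀ᶠ v in 𝓝 0, fderiv ℂ F v e = H v • e := by
    filter_upwards [hFbase.eventually_nhds, hFa.eventually_analyticAt] with v h1 h2
    have hdF := h2.differentiableAt.hasFDerivAt
    have hline : HasDerivAt (fun t : ℂ => v + t • e) e 0 := by
      simpa using ((hasDerivAt_id (0 : ℂ)).smul_const e).const_add v
    have hdF' : HasFDerivAt F (fderiv ℂ F v) (v + (0 : ℂ) • e) := by simpa using hdF
    have hcomp := hdF'.comp_hasDerivAt (0 : ℂ) hline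
    have hcont : Tendsto (fun t : ℂ => v + t • e) (𝓝 0) (𝓝 v) := by
      have : Continuous fun t : ℂ => v + t • e := by fun_prop
      simpa using this.tendsto 0
    have h3 := hcont.eventually h1
    have hc1 : HasDerivAt (fun t : ℂ => (F (v + t • e)).1) (fderiv ℂ F v e).1 0 := hcomp.fst
    have hc2 : HasDerivAt (fun t : ℂ => (F (v + t • e)).2.1) (fderiv ℂ F v e).2.1 0 :=
      hcomp.snd.fst
    have hb1 : ∀ t : ℂ, (c.N.toMap (v + t • e)).1 = (c.N.toMap v).1 := by
      intro t; simp [AffineForm.toMap, he]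
    have hb2 : ∀ t : ℂ, (c.N.toMap (v + t • e)).2.1 = (c.N.toMap v).2.1 := by
      intro t; simp [AffineForm.toMap, he]
    have hd1 : (fderiv ℂ F v e).1 = 0 :=
      hc1.unique ((hasDerivAt_const (0 : ℂ) (c.N.toMap v).1).congr_of_eventuallyEq
        (h3.mono fun t ht => ht.1.trans (hb1 t)))
    have hd2 : (fderiv ℂ F v e).2.1 = 0 :=
      hc2.unique ((hasDerivAt_const (0 : ℂ) (c.N.toMap v).2.1).congr_of_eventuallyEq
        (h3.mono fun t ht => ht.2.trans (hb2 t)))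
    have hd3 : H v = (fderiv ℂ F v e).2.2 := by
      have : HasFDerivAt (fun v => (F v).2.2) (ℓ.comp (fderiv ℂ F v)) v :=
        ℓ.hasFDerivAt.comp v hdF
      rw [hH]
      dsimp only
      rw [this.fderiv]
      rfl
    refine Prod.ext ?_ (Prod.ext ?_ ?_)
    · rw [hd1]; simp [he]
    · rw [hd2]; simp [he]
    · rw [hd3]; simp [he]
  -- the vertical derivative is a unit times a monomial
  have hconj : c.chart ∘ f =ᶠ[𝓝 0] F ∘ c.chart := by
    filter_upwards [hΨΦ] with u hu
    simp [hF, hu]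
  have hcrit : ∀ᶠ v in 𝓝 0, v ∈ critInf F →
      (∃ i, v.1 i = 0) ∨ ∃ j, v.2.1 j = 0 := by
    filter_upwards [hΨt.eventually (hf.mem_critInf_iff hfa h0 hFa hΦ hΦ0 hb hconj),
      hΨt.eventually c.mem_critInf, hΦΨ] with v h1 h2 h3 hv
    have h4 : ∀ i, v.1 i = (c.x i : E → ℂ) (Ψ v) := fun i =>
      congrFun (congrArg Prod.fst h3.symm) i
    have h5 : ∀ j, v.2.1 j = (c.y j : E → ℂ) (Ψ v) := fun j =>
      congrFun (congrArg (fun t => t.2.1) h3.symm) j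
    rw [h3] at h1
    rcases h2.1 (h1.1 hv) with ⟨i, -, hi⟩ | ⟨j, hj⟩
    · exact Or.inl ⟨i, by rw [h4, hi]⟩
    · exact Or.inr ⟨j, by rw [h5, hj]⟩
  let κ : Fin s ⊕ Fin p → (Fin s → ℂ) × (Fin p → ℂ) × ℂ →L[ℂ] ℂ := Sum.elim
    (fun i => (ContinuousLinearMap.proj i).comp
      (ContinuousLinearMap.fst ℂ (Fin s → ℂ) ((Fin p → ℂ) × ℂ)))
    (fun j => (ContinuousLinearMap.proj j).comp ((ContinuousLinearMap.fst ℂ (Fin p → ℂ) ℂ).comp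
      (ContinuousLinearMap.snd ℂ (Fin s → ℂ) ((Fin p → ℂ) × ℂ))))
  have hκ : ∀ i, κ i ≠ 0 := by
    rintro (i | j) h
    · have h1 := congrFun (congrArg DFunLike.coe h) (Pi.single i 1, 0, 0)
      simp [κ] at h1
    · have h1 := congrFun (congrArg DFunLike.coe h) (0, Pi.single j 1, 0)
      simp [κ] at h1
  -- Where `H` vanishes, the differential of `F` kills `e` and the point is critical; so the zeros
  -- of `H` lie on coordinate hyperplanes in `x` and `y`.
  obtain ⟨n, U, hU, hU0, hHU⟩ := exists_unit_mul_prod_linear hκ hHa (by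
    filter_upwards [hcrit, hFe] with v h1 h2 h3
    have h4 : v ∈ critInf F := by
      refine ⟨0, mem_critSet_iff.2 fun hinj => ?_⟩
      have h5 : fderiv ℂ F v e = fderiv ℂ F v 0 := by rw [h2, h3, zero_smul, _root_.map_zero]
      have h6 := congrArg (fun t => t.2.2) (hinj h5)
      simp [he] at h6
    rcases h1 h4 with ⟨i, hi⟩ | ⟨j, hj⟩
    · exact ⟨Sum.inl i, hi⟩
    · exact ⟨Sum.inr j, hj⟩)
  set l : Fin s → ℕ := fun i => n (Sum.inl i)
  set m : Fin p → ℕ := fun j => n (Sum.inr j)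
  let μ : (Fin s → ℂ) × (Fin p → ℂ) × ℂ → ℂ := fun v => (∏ i, v.1 i ^ l i) * ∏ j, v.2.1 j ^ m j
  have hμ : AnalyticAt ℂ μ 0 :=
    (Finset.analyticAt_fun_prod _ fun i _ => ((κ (Sum.inl i)).analyticAt 0).pow _).mul
      (Finset.analyticAt_fun_prod _ fun j _ => ((κ (Sum.inr j)).analyticAt 0).pow _)
  have hHU' : ∀ᶠ v in 𝓝 0, H v = U v * μ v := by
    filter_upwards [hHU] with v hv
    rw [hv, Fintype.prod_sum_type]
    rfl
  -- The transpose sends the form `z` into the span of the `dy_j`, which vanish on the direction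
  -- `e`. This rules out a trivial monomial.
  have hH0 : H 0 = 0 := by
    have h1 : fderiv ℂ (fun v => (F v).2.2) 0 =
        (dualDifferential f c.z).comp (fderiv ℂ Ψ 0) := by
      have h2 : HasFDerivAt (fun v => f (Ψ v)) ((fderiv ℂ f 0).comp (fderiv ℂ Ψ 0)) 0 := by
        refine HasFDerivAt.comp (g := f) 0 ?_ hΨ.differentiableAt.hasFDerivAt
        rw [hΨ0]
        exact hfa.differentiableAt.hasFDerivAt
      exact (c.z.hasFDerivAt.comp 0 h2).fderiv
    have h3 : fderiv ℂ c.chart 0 (fderiv ℂ Ψ 0 e) = e := by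
      have h4 : HasFDerivAt (fun v => c.chart (Ψ v)) ((fderiv ℂ c.chart 0).comp (fderiv ℂ Ψ 0)) 0 := by
        refine HasFDerivAt.comp (g := c.chart) 0 ?_ hΨ.differentiableAt.hasFDerivAt
        rw [hΨ0]
        exact hΦ.differentiableAt.hasFDerivAt
      have h5 := h4.unique ((hasFDerivAt_id (𝕜 := ℂ) (0 : (Fin s → ℂ) × (Fin p → ℂ) × ℂ)).congr_of_eventuallyEq hΦΨ)
      exact congrFun (congrArg DFunLike.coe h5) e
    rw [c.fderiv_chart_apply] at h3
    have h6 : ∀ j, fderiv ℂ (c.y j : E → ℂ) 0 (fderiv ℂ Ψ 0 e) = 0 := fun j =>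
      congrFun (congrArg (fun t => t.2.1) h3) j
    have h7 : ∀ ℓ' ∈ Submodule.span ℂ (Set.range fun j => fderiv ℂ (c.y j : E → ℂ) 0),
        ℓ' (fderiv ℂ Ψ 0 e) = 0 := by
      intro ℓ' hℓ'
      induction hℓ' using Submodule.span_induction with
      | mem ℓ' h =>
        obtain ⟨j, rfl⟩ := h
        exact h6 j
      | zero => rfl
      | add a b _ _ ha hb => rw [add_apply, ha, hb, add_zero]
      | smul a b _ hb => rw [smul_apply, hb, smul_zero]
    rw [hH]
    dsimp only
    rw [h1]
    exact h7 _ c.z_comp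
  have hlm : (l, m) ≠ (0, 0) := by
    intro hlm
    have h1 := hHU'.self_of_nhds
    rw [hH0] at h1
    have hl : l = 0 := congrArg Prod.fst hlm
    have hm : m = 0 := congrArg Prod.snd hlm
    have h2 : μ 0 = 1 := by
      simp only [μ, hl, hm]
      simp
    rw [h2, mul_one] at h1
    exact hU0 h1.symm
  -- normalize the unit
  obtain ⟨φ, hφ, hφ0, hφf⟩ := hf.exists_exp_cohomology hfa (1 : Equiv.Perm (Fin 1))
    (U := fun _ u => U (c.chart u)) (fun _ => AnalyticAt.comp (g := U) (by rwa [hΦ0]) hΦ)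
    (fun _ => by simpa [hΦ0] using hU0)
  set G : (Fin s → ℂ) × (Fin p → ℂ) × ℂ → ℂ := fun v => Complex.exp (φ 0 (Ψ v)) with hG
  have hGa : AnalyticAt ℂ G 0 :=
    (AnalyticAt.comp (g := φ 0) (by rw [hΨ0]; exact hφ 0) hΨ).cexp
  have hG0 : G 0 = 1 := by simp [hG, hΨ0, hφ0]
  have hGF : ∀ᶠ v in 𝓝 0, U v * G (F v) = U 0 * G v := by
    filter_upwards [hΨt.eventually (hφf 0), hΦΨ, hΨt.eventually (hft.eventually hΨΦ)] with v h1 h2 h3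
    simp only [h2, hΦ0, Equiv.Perm.one_apply] at h1
    simp only [hG, hF, h3]
    exact h1
  obtain ⟨I, hI, hI0, hIG⟩ := exists_primitive hℓe hGa
  -- The primitive of `G` along `e` vanishing at `z = 0`; as `G 0 = 1`, its differential at `0` is
  -- that of `z`.
  set ζ : (Fin s → ℂ) × (Fin p → ℂ) × ℂ → ℂ := fun v => ℓ v * I v with hζ
  have hζa : AnalyticAt ℂ ζ 0 := (ℓ.analyticAt 0).mul hI
  have hζ0 : ζ 0 = 0 := by simp [hζ]
  have hζd : ∀ v, fderiv ℂ ζ 0 v = v.2.2 := by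
    intro v
    have h1 : HasFDerivAt ζ (ℓ 0 • fderiv ℂ I 0 + I 0 • ℓ) 0 :=
      ℓ.hasFDerivAt.mul hI.differentiableAt.hasFDerivAt
    rw [h1.fderiv, hI0, hG0]
    change ℓ 0 * _ + 1 * ℓ v = _
    rw [_root_.map_zero, zero_mul, zero_add, one_mul]
    rfl
  set W : (Fin s → ℂ) × (Fin p → ℂ) × ℂ → ℂ := fun v => ζ (F v) - U 0 * μ v * ζ v with hW
  have hWa : AnalyticAt ℂ W 0 :=
    (AnalyticAt.comp (g := ζ) (by rwa [hF0]) hFa).sub ((analyticAt_const.mul hμ).mul hζa)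
  -- The chain rule gives `H · (G ∘ F) - U 0 · μ · G`, which is `μ` times `U · (G ∘ F) - U 0 · G =
  -- 0`.
  have hWe : ∀ᶠ v in 𝓝 0, fderiv ℂ W v e = 0 := by
    filter_upwards [hIG, hFt.eventually hIG, hFe, hHU', hGF, hζa.eventually_analyticAt,
      hFt.eventually hζa.eventually_analyticAt, hFa.eventually_analyticAt,
      hμ.eventually_analyticAt] with v h1 h2 h3 h4 h5 h6 h7 h8 h9
    have hd1 : HasFDerivAt (fun v => ζ (F v)) ((fderiv ℂ ζ (F v)).comp (fderiv ℂ F v)) v :=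
      HasFDerivAt.comp (g := ζ) v h7.differentiableAt.hasFDerivAt
        h8.differentiableAt.hasFDerivAt
    have hμe : fderiv ℂ μ v e = 0 := by
      have hline : HasDerivAt (fun t : ℂ => v + t • e) e 0 := by
        simpa using ((hasDerivAt_id (0 : ℂ)).smul_const e).const_add v
      have hdμ : HasFDerivAt μ (fderiv ℂ μ v) (v + (0 : ℂ) • e) := by
        simpa using h9.differentiableAt.hasFDerivAt
      have hcomp := hdμ.comp_hasDerivAt (0 : ℂ) hline
      have hconst : μ ∘ (fun t : ℂ => v + t • e) = fun _ => μ v := by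
        funext t; simp [μ, he]
      rw [hconst] at hcomp
      exact hcomp.unique (hasDerivAt_const _ _)
    have hd2 : HasFDerivAt (fun v => U 0 * μ v * ζ v)
        ((U 0 * μ v) • fderiv ℂ ζ v + ζ v • (U 0 • fderiv ℂ μ v)) v :=
      (h9.differentiableAt.hasFDerivAt.const_mul (U 0)).mul h6.differentiableAt.hasFDerivAt
    have hdW : HasFDerivAt W ((fderiv ℂ ζ (F v)).comp (fderiv ℂ F v) -
        ((U 0 * μ v) • fderiv ℂ ζ v + ζ v • (U 0 • fderiv ℂ μ v))) v := hd1.sub hd2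
    rw [hdW.fderiv]
    change fderiv ℂ ζ (F v) (fderiv ℂ F v e) -
      ((U 0 * μ v) * fderiv ℂ ζ v e + ζ v * (U 0 * fderiv ℂ μ v e)) = 0
    rw [h3, map_smul, h2, h1, hμe, h4, smul_eq_mul]
    linear_combination μ v * h5
  have hWconst := eventually_eq_of_fderiv_eq_zero (ℓ := ℓ) hWa hWe
  let j : (Fin s → ℂ) × (Fin p → ℂ) → (Fin s → ℂ) × (Fin p → ℂ) × ℂ := fun t => (t.1, t.2, 0)
  have hj : AnalyticAt ℂ j 0 := analyticAt_fst.prod (analyticAt_snd.prod analyticAt_const)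
  refine ⟨U 0, l, m, ζ, fun t => W (j t), hU0, hlm, hζa, hζ0, hζd,
    AnalyticAt.comp (g := W) hWa hj, ?_, ?_⟩
  · change W 0 = 0
    simp [hW, hF0, hζ0]
  · filter_upwards [hΦt.eventually hWconst, hconj] with u h1 h2
    have h3 : c.chart u - ℓ (c.chart u) • e = j ((c.chart u).1, (c.chart u).2.1) := by
      refine Prod.ext ?_ (Prod.ext ?_ ?_)
      · simp [j, he]
      · simp [j, he]
      · simp [j, he, hℓv]
    rw [h3] at h1
    have h4 : c.chart (f u) = F (c.chart u) := h2
    rw [h4, ← h1]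
    simp only [hW, μ]
    ring

end SemiNormalForm

/-! ### Characteristic polynomials and conjugacy -/

lemma AffineForm.det_linMatrix_ne_zero {s p : ℕ} {N : AffineForm s p} {π : Equiv.Perm (Fin s)}
    (hP : N.P = (π⁻¹).permMatrix ℕ) (hγ : ∀ k, N.γ k ≠ 0) : N.linMatrix.det ≠ 0 := by
  have h1 : N.P.map (Nat.cast : ℕ → ℂ) = (π⁻¹).permMatrix ℂ := by
    rw [hP]
    ext i j
    rw [Matrix.map_apply, Equiv.Perm.permMatrix, Equiv.Perm.permMatrix,
      Equiv.toPEquiv, PEquiv.toMatrix_apply, PEquiv.toMatrix_apply]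
    split_ifs <;> simp
  rw [AffineForm.linMatrix, Matrix.det_mul, Matrix.det_diagonal, Matrix.det_transpose, h1,
    Matrix.det_permutation]
  refine mul_ne_zero (Finset.prod_ne_zero_iff.2 fun k _ => hγ k) ?_
  exact_mod_cast Units.ne_zero _

/-- If a polynomial has as many nonzero roots as the degree of a factor without zero root, then
its nonzero roots are the roots of that factor. -/
lemma filter_roots_eq_of_mul {A B : Polynomial ℂ} [DecidablePred fun c : ℂ => c ≠ 0] (hA : A ≠ 0)
    (hB : B ≠ 0) (hA0 : A.eval 0 ≠ 0)
    (hcard : ((A * B).roots.filter fun c => c ≠ 0).card = A.natDegree) :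
    (A * B).roots.filter (fun c => c ≠ 0) = A.roots := by
  have hAf : A.roots.filter (fun c => c ≠ 0) = A.roots := by
    rw [Multiset.filter_eq_self]
    rintro c hc rfl
    exact hA0 (Polynomial.isRoot_of_mem_roots hc)
  rw [Polynomial.roots_mul (mul_ne_zero hA hB), Multiset.filter_add, hAf] at hcard ⊢
  rw [Multiset.card_add, IsAlgClosed.card_roots_eq_natDegree] at hcard
  have h1 : (B.roots.filter fun c => c ≠ 0) = 0 := Multiset.card_eq_zero.1 (by omega)
  rw [h1, add_zero]

/-- A family inside an invariant part of a basis contributes a factor of the characteristic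
polynomial. -/
lemma charpoly_eq_mul_of_basis {V ι κ : Type*} [AddCommGroup V] [Module ℂ V] [Fintype ι]
    [Fintype κ] [DecidableEq ι] [DecidableEq κ] (b : Module.Basis (ι ⊕ κ) ℂ V)
    [Module.Finite ℂ V] (T : Module.End ℂ V)
    (hT : ∀ i k, b.repr (T (b (Sum.inl i))) (Sum.inr k) = 0) :
    ∃ B : Polynomial ℂ, B.Monic ∧ T.charpoly =
      (Matrix.of fun i j => b.repr (T (b (Sum.inl j))) (Sum.inl i)).charpoly * B := by
  rw [← LinearMap.charpoly_toMatrix T b, ← Matrix.fromBlocks_toBlocks (LinearMap.toMatrix b b T)]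
  have h0 : (LinearMap.toMatrix b b T).toBlocks₂₁ = 0 := by
    ext k i
    exact (LinearMap.toMatrix_apply b b T _ _).trans (hT i k)
  refine ⟨(LinearMap.toMatrix b b T).toBlocks₂₂.charpoly, Matrix.charpoly_monic _, ?_⟩
  rw [h0, Matrix.charpoly_fromBlocks_zero₂₁]
  congr 2
  ext i j
  exact LinearMap.toMatrix_apply b b T _ _

lemma AffineForm.analyticAt_toMap {s p : ℕ} (N : AffineForm s p) (hω : AnalyticAt ℂ N.ω 0) :
    AnalyticAt ℂ N.toMap 0 := by
  have hx : ∀ i, AnalyticAt ℂ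
      (fun v : (Fin s → ℂ) × (Fin p → ℂ) × ℂ => v.1 i) 0 := fun i =>
    ((ContinuousLinearMap.proj (R := ℂ) (φ := fun _ : Fin s => ℂ) i).comp
      (ContinuousLinearMap.fst ℂ (Fin s → ℂ) ((Fin p → ℂ) × ℂ))).analyticAt 0
  have hy : ∀ j, AnalyticAt ℂ
      (fun v : (Fin s → ℂ) × (Fin p → ℂ) × ℂ => v.2.1 j) 0 := fun j =>
    ((ContinuousLinearMap.proj (R := ℂ) (φ := fun _ : Fin p => ℂ) j).comp
      ((ContinuousLinearMap.fst ℂ (Fin p → ℂ) ℂ).comp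
        (ContinuousLinearMap.snd ℂ (Fin s → ℂ) ((Fin p → ℂ) × ℂ)))).analyticAt 0
  have hz : AnalyticAt ℂ (fun v : (Fin s → ℂ) × (Fin p → ℂ) × ℂ => v.2.2) 0 :=
    ((ContinuousLinearMap.snd ℂ (Fin p → ℂ) ℂ).comp
      (ContinuousLinearMap.snd ℂ (Fin s → ℂ) ((Fin p → ℂ) × ℂ))).analyticAt 0
  have hxm : ∀ {t : ℕ} (M : Matrix (Fin s) (Fin t) ℕ) k, AnalyticAt ℂ
      (fun v : (Fin s → ℂ) × (Fin p → ℂ) × ℂ => monomialMap M v.1 k) 0 := fun M k =>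
    Finset.analyticAt_fun_prod _ fun i _ => (hx i).pow _
  have hym : ∀ {t : ℕ} (M : Matrix (Fin p) (Fin t) ℕ) k, AnalyticAt ℂ
      (fun v : (Fin s → ℂ) × (Fin p → ℂ) × ℂ => monomialMap M v.2.1 k) 0 := fun M k =>
    Finset.analyticAt_fun_prod _ fun i _ => (hy i).pow _
  have hQ : ∀ Q : MvPolynomial (Fin s) ℂ, AnalyticAt ℂ
      (fun v : (Fin s → ℂ) × (Fin p → ℂ) × ℂ => MvPolynomial.eval v.1 Q) 0 := by
    intro Q
    have := AnalyticAt.aeval_mvPolynomial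
      (f := fun v : (Fin s → ℂ) × (Fin p → ℂ) × ℂ => v.1) hx Q
    simpa only [MvPolynomial.aeval_eq_eval] using! this
  have hxy : AnalyticAt ℂ (fun v : (Fin s → ℂ) × (Fin p → ℂ) × ℂ => (v.1, v.2.1)) 0 :=
    ((ContinuousLinearMap.fst ℂ (Fin s → ℂ) ((Fin p → ℂ) × ℂ)).prod
      ((ContinuousLinearMap.fst ℂ (Fin p → ℂ) ℂ).comp
        (ContinuousLinearMap.snd ℂ (Fin s → ℂ) ((Fin p → ℂ) × ℂ)))).analyticAt 0
  refine AnalyticAt.prod ?_ (AnalyticAt.prod ?_ ?_)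
  · exact analyticAt_pi_iff.2 fun k => (analyticAt_const.mul (hxm _ k)).add (hQ _)
  · exact analyticAt_pi_iff.2 fun k =>
      ((analyticAt_const.mul (hxm _ k)).mul (hym _ k)).mul (analyticAt_const.add (hQ _))
  · exact (((analyticAt_const.mul (Finset.analyticAt_fun_prod _ fun i _ => (hx i).pow _)).mul
      (Finset.analyticAt_fun_prod _ fun i _ => (hy i).pow _)).mul hz).add
        (AnalyticAt.comp (g := N.ω) hω hxy)

/-- Conjugate germs have the same nonzero eigenvalues. -/
lemma nonzeroEigenvalues_eq_of_conj {E E' : Type*} [NormedAddCommGroup E] [NormedSpace ℂ E]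
    [NormedAddCommGroup E'] [NormedSpace ℂ E'] [FiniteDimensional ℂ E] [FiniteDimensional ℂ E']
    {f : E → E} {F : E' → E'} {Φ : E → E'} (hf : AnalyticAt ℂ f 0) (h0 : f 0 = 0)
    (hF : AnalyticAt ℂ F 0) (hΦ : AnalyticAt ℂ Φ 0) (hΦ0 : Φ 0 = 0)
    (hb : Function.Bijective (fderiv ℂ Φ 0)) (hconj : Φ ∘ f =ᶠ[𝓝 0] F ∘ Φ) :
    nonzeroEigenvalues F = nonzeroEigenvalues f := by
  let e : E ≃ₗ[ℂ] E' := LinearEquiv.ofBijective (fderiv ℂ Φ 0 : E →ₗ[ℂ] E') hb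
  have h1 : HasFDerivAt (Φ ∘ f) ((fderiv ℂ Φ 0).comp (fderiv ℂ f 0)) 0 := by
    refine HasFDerivAt.comp 0 ?_ hf.differentiableAt.hasFDerivAt
    rw [h0]
    exact hΦ.differentiableAt.hasFDerivAt
  have h2 : HasFDerivAt (F ∘ Φ) ((fderiv ℂ F 0).comp (fderiv ℂ Φ 0)) 0 := by
    refine HasFDerivAt.comp 0 ?_ hΦ.differentiableAt.hasFDerivAt
    rw [hΦ0]
    exact hF.differentiableAt.hasFDerivAt
  have h3 := h1.unique (h2.congr_of_eventuallyEq hconj)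
  have h4 : (fderiv ℂ F 0 : E' →ₗ[ℂ] E') = e.conj (fderiv ℂ f 0 : E →ₗ[ℂ] E) := by
    ext v
    obtain ⟨u, rfl⟩ := e.surjective v
    rw [LinearEquiv.conj_apply_apply, e.symm_apply_apply]
    exact (congrFun (congrArg DFunLike.coe h3) u).symm
  rw [nonzeroEigenvalues, h4, LinearEquiv.charpoly_conj, nonzeroEigenvalues]

/-! ### Eigenvalues and assembly of the normal form -/

namespace SemiNormalForm

variable {E : Type*} [NormedAddCommGroup E] [NormedSpace ℂ E] [FiniteDimensional ℂ E]
variable {f : E → E} {s p : ℕ}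

omit [FiniteDimensional ℂ E] in
lemma dualDifferential_x_of_lt (c : SemiNormalForm f s p) (i : Fin s) (hi : (i : ℕ) < c.N.r) :
    dualDifferential f (fderiv ℂ (c.x i : E → ℂ) 0) =
      c.N.γ i • fderiv ℂ (c.x (c.π i) : E → ℂ) 0 := by
  rw [dualDifferential_fderiv c.analytic c.map_zero (c.x i).2]
  have h1 : (c.x i : E → ℂ) ∘ f =ᶠ[𝓝 0] fun v => c.N.γ i * (c.x (c.π i) : E → ℂ) v := by
    filter_upwards [c.x_comp i] with v hv
    rw [Function.comp_apply, hv, c.σ_u i hi, _root_.map_zero, add_zero]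
  rw [h1.fderiv_eq]
  exact ((c.x (c.π i)).2.differentiableAt.hasFDerivAt.const_mul _).fderiv

omit [FiniteDimensional ℂ E] in
lemma π_lt (c : SemiNormalForm f s p) {i : Fin s} (hi : (i : ℕ) < c.N.r) : (c.π i : ℕ) < c.N.r := by
  by_contra h
  have h1 := c.π.injective (c.π_fix _ (not_lt.1 h))
  rw [h1] at h
  exact h hi

/-- The transposed differential preserves the span of the `dx_i`. There it differs from the weighted
permutation by strictly triangular terms, which do not change the characteristic polynomial. That
factor has degree `s` and no zero root; as there are `s` nonzero eigenvalues, the complementary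
factor contributes none. -/
theorem nonzeroEigenvalues_eq (c : SemiNormalForm f s p) (hd : Module.finrank ℂ E = s + p + 1)
    (hs : s = (nonzeroEigenvalues f).card) :
    nonzeroEigenvalues f = c.N.linMatrix.charpoly.roots := by
  classical
  have hcard : Fintype.card (Fin s ⊕ (Fin p ⊕ Unit)) = Module.finrank ℂ (E →L[ℂ] ℂ) := by
    rw [finrank_cotangent, hd]
    simp [add_assoc]
  set b := basisOfTopLeSpanOfCardEqFinrank _ c.span_eq.ge hcard with hb
  have hbx : ∀ i, b (Sum.inl i) = fderiv ℂ (c.x i : E → ℂ) 0 := fun i => by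
    rw [hb, coe_basisOfTopLeSpanOfCardEqFinrank]; rfl
  have hspan : ∀ (S : Set (Fin s)) (ℓ : E →L[ℂ] ℂ),
      ℓ ∈ Submodule.span ℂ ((fun i => fderiv ℂ (c.x i : E → ℂ) 0) '' S) →
      ∀ k, k ∉ Sum.inl '' S → b.repr ℓ k = 0 := by
    intro S ℓ hℓ k hk
    induction hℓ using Submodule.span_induction with
    | mem ℓ h =>
      obtain ⟨i, hi, rfl⟩ := h
      simp only [← hbx, Module.Basis.repr_self]
      exact Finsupp.single_eq_of_ne fun h => hk ⟨i, hi, h.symm⟩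
    | zero => rw [_root_.map_zero]; rfl
    | add u v _ _ hu hv => rw [_root_.map_add, Finsupp.add_apply, hu, hv, add_zero]
    | smul a v _ hv => rw [_root_.map_smul, Finsupp.smul_apply, hv, smul_zero]
  have hrepr : ∀ j k, b.repr (dualDifferential f (b (Sum.inl j))) k =
      (if k = Sum.inl (c.π j) then c.N.γ j else 0) +
        if c.N.r ≤ j then b.repr (dualDifferential f (fderiv ℂ (c.x j : E → ℂ) 0) -
          c.N.γ j • fderiv ℂ (c.x j : E → ℂ) 0) k else 0 := by
    intro j k
    rw [hbx]
    split_ifs with h1 h2 h2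
    · rw [map_sub, Finsupp.sub_apply, _root_.map_smul, ← hbx, Module.Basis.repr_self, h1,
        c.π_fix j h2]
      simp
    · rw [c.dualDifferential_x_of_lt j (not_le.1 h2), _root_.map_smul, ← hbx,
        Module.Basis.repr_self, h1]
      simp
    · rw [map_sub, Finsupp.sub_apply, _root_.map_smul, ← hbx, Module.Basis.repr_self]
      rw [c.π_fix j h2] at h1
      simp [Finsupp.single_eq_of_ne h1]
    · rw [c.dualDifferential_x_of_lt j (not_le.1 h2), _root_.map_smul, ← hbx,
        Module.Basis.repr_self]
      simp [Finsupp.single_eq_of_ne h1]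
  have htri : ∀ (j : Fin s) (k), k ∉ Sum.inl '' Set.Iio j → (if c.N.r ≤ (j : ℕ) then
      b.repr (dualDifferential f (fderiv ℂ (c.x j : E → ℂ) 0) -
          c.N.γ j • fderiv ℂ (c.x j : E → ℂ) 0) k else 0) = 0 := by
    intro j k hk
    split_ifs with h
    · exact hspan _ _ (c.triangular j h) k hk
    · rfl
  obtain ⟨B, hBm, hB⟩ := charpoly_eq_mul_of_basis b (dualDifferential f) (by
    intro i k
    rw [hrepr, htri i _ (by simp), if_neg (by simp), add_zero])
  set A : Matrix (Fin s) (Fin s) ℂ :=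
    Matrix.of fun i j => b.repr (dualDifferential f (b (Sum.inl j))) (Sum.inl i) with hA
  have hAij : ∀ i j, A i j = (if i = c.π j then c.N.γ j else 0) +
        if c.N.r ≤ j then b.repr (dualDifferential f (fderiv ℂ (c.x j : E → ℂ) 0) -
          c.N.γ j • fderiv ℂ (c.x j : E → ℂ) 0) (Sum.inl i) else 0 := by
    intro i j
    rw [hA, Matrix.of_apply, hrepr]
    simp
  -- The periodic indices are mixed by the permutation, so they form one block; every other index is
  -- fixed by it and gets a block of its own.
  let lev : Fin s → ℕ := fun i => if (i : ℕ) < c.N.r then 0 else i + 1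
  have hLij : ∀ i j, c.N.linMatrix.transpose i j = if i = c.π j then c.N.γ j else 0 := fun i j =>
    AffineForm.linMatrix_apply c.P_eq j i
  have hperm : ∀ i j, lev j < lev i → i ≠ c.π j := by
    rintro i j h rfl
    simp only [lev] at h
    by_cases hj : (j : ℕ) < c.N.r
    · rw [if_pos hj, if_pos (c.π_lt hj)] at h
      exact lt_irrefl _ h
    · rw [c.π_fix j (not_lt.1 hj)] at h
      exact lt_irrefl _ h
  have hlev : ∀ i j : Fin s, c.N.r ≤ (j : ℕ) → lev j ≤ lev i → Sum.inl i ∉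
      (Sum.inl '' Set.Iio j : Set (Fin s ⊕ (Fin p ⊕ Unit))) := by
    rintro i j hj h ⟨i', hi', hii⟩
    obtain rfl := Sum.inl.inj hii
    have hlt : (i' : ℕ) < j := hi'
    simp only [lev, if_neg (not_lt.2 hj)] at h
    split_ifs at h <;> omega
  have hterm : ∀ i j : Fin s, lev j ≤ lev i → A i j = c.N.linMatrix.transpose i j := by
    intro i j h
    rw [hAij, hLij]
    by_cases hj : c.N.r ≤ (j : ℕ)
    · rw [htri j _ (hlev i j hj h), add_zero]
    · rw [if_neg hj, add_zero]
  have hLtri : c.N.linMatrix.transpose.BlockTriangular lev := fun i j h => by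
    rw [hLij, if_neg (hperm i j h)]
  have hAtri : A.BlockTriangular lev := fun i j h => by
    rw [hterm i j h.le]
    exact hLtri h
  have hAL : A.charpoly = c.N.linMatrix.charpoly := by
    rw [← Matrix.charpoly_transpose c.N.linMatrix, hAtri.charpoly, hLtri.charpoly]
    refine Finset.prod_congr rfl fun a _ => ?_
    congr 1
    ext i j
    exact hterm i j (by rw [i.2, j.2])
  have hL := c.N.det_linMatrix_ne_zero c.P_eq c.γ_ne
  have hfil : ((c.N.linMatrix.charpoly * B).roots.filter fun x => x ≠ 0) =
      nonzeroEigenvalues f := by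
    rw [nonzeroEigenvalues, ← charpoly_dualDifferential, hB, hAL]
  rw [← hfil]
  refine filter_roots_eq_of_mul (Matrix.charpoly_monic _).ne_zero hBm.ne_zero ?_ ?_
  · rw [Matrix.eval_charpoly]
    simpa [Matrix.det_neg] using hL
  · rw [hfil, ← hs, Matrix.charpoly_natDegree_eq_dim, Fintype.card_fin]

/-- Replacing the linear coordinate `z` by `ζ` does not change the differential of the chart at `0`,
so the new chart is still a local biholomorphism; the components along `x` and `y` do not involve
`z` and are unaffected. -/
theorem exists_normalForm (c : SemiNormalForm f s p) {C Λ : ℝ} (hf : ContractsAtRate f C Λ)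
    (hd : Module.finrank ℂ E = s + p + 1) (hs : s = (nonzeroEigenvalues f).card) :
    ∃ N : AffineForm s p, N.IsNormalForm ∧ AnalyticallyConjugate f N.toMap := by
  obtain ⟨ν, l, m, ζ, ω, hν, hlm, hζ, hζ0, hζd, hω, hω0, hlast⟩ := c.exists_last_coordinate hf hd
  let N : AffineForm s p := { c.N with ν := ν, l := l, m := m, ω := ω }
  let Φ : E → (Fin s → ℂ) × (Fin p → ℂ) × ℂ := fun u =>
    ((c.chart u).1, (c.chart u).2.1, ζ (c.chart u))
  have hch := c.analyticAt_chart
  have hch0 := c.chart_zero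
  have hζc : AnalyticAt ℂ (fun u => ζ (c.chart u)) 0 :=
    AnalyticAt.comp (g := ζ) (by rwa [hch0]) hch
  have hΦ : AnalyticAt ℂ Φ 0 := by
    refine AnalyticAt.prod ?_ (AnalyticAt.prod ?_ hζc)
    · exact ((ContinuousLinearMap.fst ℂ (Fin s → ℂ) ((Fin p → ℂ) × ℂ)).analyticAt _).comp hch
    · exact (((ContinuousLinearMap.fst ℂ (Fin p → ℂ) ℂ).comp
        (ContinuousLinearMap.snd ℂ (Fin s → ℂ) ((Fin p → ℂ) × ℂ))).analyticAt _).comp hch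
  have hΦ0 : Φ 0 = 0 := by
    simp only [Φ, hch0, hζ0]
    rfl
  have hΦd : fderiv ℂ Φ 0 = fderiv ℂ c.chart 0 := by
    have h1 := hch.differentiableAt.hasFDerivAt
    have h2 : HasFDerivAt (fun u => ζ (c.chart u))
        ((fderiv ℂ ζ 0).comp (fderiv ℂ c.chart 0)) 0 := by
      refine HasFDerivAt.comp (g := ζ) 0 ?_ h1
      rw [hch0]
      exact hζ.differentiableAt.hasFDerivAt
    have h3 := h1.fst.prodMk (h1.snd.fst.prodMk h2)
    have h4 : fderiv ℂ Φ 0 = _ := h3.fderiv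
    rw [h4]
    ext u : 1
    exact Prod.ext rfl (Prod.ext rfl (hζd _))
  have hb : Function.Bijective (fderiv ℂ Φ 0) := hΦd ▸ c.bijective_fderiv_chart hd
  have hconj : Φ ∘ f =ᶠ[𝓝 0] N.toMap ∘ Φ := by
    filter_upwards [c.chart_comp, hlast] with u h1 h2
    exact Prod.ext h1.1 (Prod.ext h1.2 h2)
  have hN := N.analyticAt_toMap hω
  obtain ⟨Ψ, hΨ, hΨ0, -, hΦΨ, -⟩ := exists_local_inverse hΦ hΦ0 hb
  have hΨt : Tendsto Ψ (𝓝 0) (𝓝 0) := by simpa [hΨ0] using hΨ.continuousAt.tendsto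
  refine ⟨N, ?_, Φ, hΦ, hΦ0, hb, hconj⟩
  exact
    { r_le := c.r_le
      γ_ne := c.γ_ne
      β_ne := c.β_ne
      ν_ne := hν
      P_perm := ⟨c.π⁻¹, c.P_eq⟩
      P_v := fun i hi => by
        change c.N.P i i = 1
        rw [c.P_eq, permMatrix_inv_apply, if_pos (c.π_fix i hi).symm]
      E_v := c.E_v
      det_D := c.det_D
      lm_ne := hlm
      eigenvalues := (nonzeroEigenvalues_eq_of_conj c.analytic c.map_zero hN hΦ hΦ0 hb hconj).trans
        (c.nonzeroEigenvalues_eq hd hs)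
      critInf_eq := by
        filter_upwards [hΦΨ, hΨt.eventually c.mem_critInf,
          hΨt.eventually (hf.mem_critInf_iff c.analytic c.map_zero hN hΦ hΦ0 hb hconj)]
          with v h1 h2 h3
        rw [h1] at h3
        rw [h3, h2]
        have h4 : ∀ i, (c.x i : E → ℂ) (Ψ v) = v.1 i := fun i => congrFun (congrArg Prod.fst h1) i
        have h5 : ∀ j, (c.y j : E → ℂ) (Ψ v) = v.2.1 j := fun j =>
          congrFun (congrArg (fun t => t.2.1) h1) j
        simp only [h4, h5]
        rfl
      σ_u := c.σ_u
      σ_zero := c.σ_zero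
      σ_resonant := c.σ_resonant
      g_zero := c.g_zero
      g_resonant := c.g_resonant
      ω_analytic := hω
      ω_zero := hω0 }

end SemiNormalForm

theorem IsContractingRigid.exists_normalForm {E : Type*} [NormedAddCommGroup E] [NormedSpace ℂ E]
    [FiniteDimensional ℂ E] {f : E → E} {q : ℕ} {w : Fin q → E → ℂ} {s p : ℕ}
    (h : IsContractingRigid f w) (hA : HasInjectiveInternalAction f w)
    (hs : s = (nonzeroEigenvalues f).card) (hp : p = numNonPeriodic f w)
    (hd : Module.finrank ℂ E = s + p + 1) :
    ∃ N : AffineForm s p, N.IsNormalForm ∧ AnalyticallyConjugate f N.toMap := by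
  obtain ⟨c⟩ := h.nonempty_semiNormalForm hA hs hp hd
  obtain ⟨C, Λ, hf⟩ := h.contracting.exists_contractsAtRate
  exact c.exists_normalForm hf hd hs

/-! ### The example with a non-polynomial tail: verification of the hypotheses -/

/-- The germ `(z, y) ↦ (y₁ z + y₂² sin y₂, y²)` on `ℂ × ℂⁿ⁺²`. -/
noncomputable def sineGerm (n : ℕ) (v : Fin (n + 3) → ℂ) : Fin (n + 3) → ℂ :=
  Fin.cons (v (Fin.succ 0) * v 0 + v (Fin.succ 1) ^ 2 * Complex.sin (v (Fin.succ 1)))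
    fun k : Fin (n + 2) => v k.succ ^ 2

namespace sineGerm

variable {n : ℕ}

lemma apply_zero (v : Fin (n + 3) → ℂ) : sineGerm n v 0 =
    v (Fin.succ 0) * v 0 + v (Fin.succ 1) ^ 2 * Complex.sin (v (Fin.succ 1)) := rfl

lemma apply_succ (v : Fin (n + 3) → ℂ) (k : Fin (n + 2)) : sineGerm n v k.succ = v k.succ ^ 2 := rfl

lemma map_zero : sineGerm n 0 = 0 := by
  funext i
  refine Fin.cases ?_ (fun k => ?_) i
  · simp [apply_zero]
  · simp [apply_succ]

lemma analyticAt (v : Fin (n + 3) → ℂ) : AnalyticAt ℂ (sineGerm n) v := by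
  have hp : ∀ i, AnalyticAt ℂ (fun v : Fin (n + 3) → ℂ => v i) v := fun i =>
    (ContinuousLinearMap.proj (R := ℂ) (φ := fun _ : Fin (n + 3) => ℂ) i).analyticAt v
  refine analyticAt_pi_iff.2 fun i => ?_
  refine Fin.cases ?_ (fun k => ?_) i
  · exact ((hp _).mul (hp _)).add (((hp _).pow 2).mul
      (AnalyticAt.comp (g := Complex.sin) (Complex.differentiable_sin.analyticAt _) (hp _)))
  · exact (hp _).pow 2

lemma hasFDerivAt_proj (v : Fin (n + 3) → ℂ) (i : Fin (n + 3)) :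
    HasFDerivAt (fun v : Fin (n + 3) → ℂ => v i)
      (ContinuousLinearMap.proj (R := ℂ) (φ := fun _ : Fin (n + 3) => ℂ) i) v :=
  (ContinuousLinearMap.proj (R := ℂ) (φ := fun _ : Fin (n + 3) => ℂ) i).hasFDerivAt

lemma fderiv_apply_succ (v u : Fin (n + 3) → ℂ) (k : Fin (n + 2)) :
    fderiv ℂ (sineGerm n) v u k.succ = 2 * v k.succ * u k.succ := by
  have h1 := hasFDerivAt_pi'.1 (analyticAt v).differentiableAt.hasFDerivAt k.succ
  have h2 := h1.unique ((hasFDerivAt_proj v k.succ).pow 2)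
  have h3 := congrFun (congrArg DFunLike.coe h2) u
  refine h3.trans ?_
  simp

lemma fderiv_apply_zero (v u : Fin (n + 3) → ℂ) : fderiv ℂ (sineGerm n) v u 0 =
    v (Fin.succ 0) * u 0 + u (Fin.succ 0) * v 0 + u (Fin.succ 1) *
      (2 * v (Fin.succ 1) * Complex.sin (v (Fin.succ 1)) +
        v (Fin.succ 1) ^ 2 * Complex.cos (v (Fin.succ 1))) := by
  have h1 := hasFDerivAt_pi'.1 (analyticAt v).differentiableAt.hasFDerivAt 0
  have h2 := h1.unique (((hasFDerivAt_proj v (Fin.succ 0)).mul (hasFDerivAt_proj v 0)).add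
    (((hasFDerivAt_proj v (Fin.succ 1)).pow 2).mul (hasFDerivAt_proj v (Fin.succ 1)).csin))
  have h3 := congrFun (congrArg DFunLike.coe h2) u
  refine h3.trans ?_
  simp
  ring

lemma mem_critSet (v : Fin (n + 3) → ℂ) :
    v ∈ critSet (sineGerm n) ↔ ∃ k : Fin (n + 2), v k.succ = 0 := by
  rw [mem_critSet_iff, ← not_iff_not, not_not]
  push Not
  constructor
  · intro hinj k hk
    have hsurj : Function.Surjective (fderiv ℂ (sineGerm n) v) :=
      LinearMap.injective_iff_surjective.1
        (show Function.Injective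
          (fderiv ℂ (sineGerm n) v : (Fin (n + 3) → ℂ) →ₗ[ℂ] (Fin (n + 3) → ℂ)) from hinj)
    obtain ⟨u, hu⟩ := hsurj (Pi.single k.succ 1)
    have h1 := congrFun hu k.succ
    rw [fderiv_apply_succ, hk] at h1
    simp at h1
  · intro hne
    refine (injective_iff_map_eq_zero _).2 fun u hu' => ?_
    have hs : ∀ k : Fin (n + 2), u k.succ = 0 := by
      intro k
      have h1 := congrFun hu' k.succ
      rw [fderiv_apply_succ] at h1
      simpa [hne k] using h1
    have h0 : u 0 = 0 := by
      have h1 := congrFun hu' 0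
      rw [fderiv_apply_zero, hs, hs, zero_mul, zero_mul, add_zero, add_zero] at h1
      exact (mul_eq_zero.1 h1).resolve_left (hne 0)
    funext i
    exact Fin.cases h0 hs i

lemma mem_critInf (v : Fin (n + 3) → ℂ) :
    v ∈ critInf (sineGerm n) ↔ ∃ k : Fin (n + 2), v k.succ = 0 := by
  have hit : ∀ (m : ℕ) (v : Fin (n + 3) → ℂ) (k : Fin (n + 2)),
      (sineGerm n)^[m] v k.succ = 0 ↔ v k.succ = 0 := by
    intro m
    induction m with
    | zero => intro v k; rfl
    | succ m ih =>
      intro v k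
      rw [Function.iterate_succ_apply, ih, apply_succ, pow_eq_zero_iff two_ne_zero]
  constructor
  · rintro ⟨m, hm⟩
    obtain ⟨k, hk⟩ := (mem_critSet _).1 hm
    exact ⟨k, (hit m v k).1 hk⟩
  · rintro ⟨k, hk⟩
    exact ⟨0, (mem_critSet _).2 ⟨k, hk⟩⟩

/-- The equation of a component of the generalized critical set. -/
def equation (n : ℕ) (k : Fin (n + 2)) (v : Fin (n + 3) → ℂ) : ℂ := v k.succ

lemma isTransverse_equation : IsTransverse (equation n) where
  analytic k := (ContinuousLinearMap.proj (R := ℂ) (φ := fun _ : Fin (n + 3) => ℂ) k.succ).analyticAt 0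
  map_zero _ := rfl
  transverse := by
    have h : (fun k => fderiv ℂ (equation n k) 0) = fun k : Fin (n + 2) =>
        ContinuousLinearMap.proj (R := ℂ) (φ := fun _ : Fin (n + 3) => ℂ) k.succ :=
      funext fun k => (hasFDerivAt_proj 0 k.succ).fderiv
    rw [h, Fintype.linearIndependent_iff]
    intro g hg i
    have h1 := congrFun (congrArg DFunLike.coe hg) (Pi.single i.succ 1)
    simpa [sum_apply, Pi.single_apply, Fin.succ_inj] using h1

lemma fderiv_zero : fderiv ℂ (sineGerm n) 0 = 0 := by
  ext u i
  refine Fin.cases ?_ (fun k => ?_) i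
  · rw [fderiv_apply_zero]
    simp
  · rw [fderiv_apply_succ]
    simp

lemma isContractingRigid : IsContractingRigid (sineGerm n) (equation n) where
  contracting :=
    { analytic := analyticAt 0
      map_zero := map_zero
      contracting := by
        intro c hc
        obtain ⟨v, hv⟩ := hc.exists_hasEigenvector
        have h1 := hv.apply_eq_smul
        rw [fderiv_zero] at h1
        have h2 : c = 0 := (smul_eq_zero.1 h1.symm).resolve_right hv.2
        simp [h2] }
  rigid :=
    { analytic := isTransverse_equation.analytic
      map_zero := isTransverse_equation.map_zero
      transverse := isTransverse_equation.transverse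
      eq_union := Eventually.of_forall mem_critInf }

lemma internalAction_eq :
    internalAction (sineGerm n) (equation n) = (2 : ℕ) • (1 : Matrix (Fin (n + 2)) (Fin (n + 2)) ℕ) := by
  ext l k
  refine (multAlong_eq isTransverse_equation (n := Pi.single k 2) (u := fun _ => 1) analyticAt_const
    one_ne_zero (Eventually.of_forall fun v => ?_) l).trans ?_
  · dsimp only
    rw [one_mul, Finset.prod_eq_single k (fun i _ hi => by simp [Pi.single_eq_of_ne hi])
      (by simp), Pi.single_eq_same]
    rfl
  · simp [Pi.single_apply, Matrix.one_apply]

lemma hasInjectiveInternalAction : HasInjectiveInternalAction (sineGerm n) (equation n) := by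
  intro v v' h
  have h1 : ∀ u : Fin (n + 2) → ℤ,
      ((internalAction (sineGerm n) (equation n)).map (Nat.cast : ℕ → ℤ)).mulVec u = 2 • u := by
    intro u
    have h2 : (internalAction (sineGerm n) (equation n)).map (Nat.cast : ℕ → ℤ) =
        (2 : ℤ) • (1 : Matrix (Fin (n + 2)) (Fin (n + 2)) ℤ) := by
      rw [internalAction_eq]
      ext i j
      rw [Matrix.map_apply, Matrix.smul_apply, Matrix.smul_apply, Matrix.one_apply, Matrix.one_apply]
      split_ifs <;> simp
    rw [h2, Matrix.smul_mulVec, Matrix.one_mulVec]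
    ext i
    simp
  simp only [h1] at h
  ext i
  have h3 := congrFun h i
  simpa using h3

lemma numNonPeriodic_eq : numNonPeriodic (sineGerm n) (equation n) = n + 2 := by
  have h1 : ∀ k, ¬ IsPeriodicComponent (sineGerm n) (equation n) k := by
    rintro k ⟨η, hη, h⟩
    rw [internalAction_eq, smul_pow, one_pow, Matrix.smul_mulVec, Matrix.one_mulVec] at h
    have h2 := congrFun h k
    simp only [Pi.smul_apply, Pi.single_eq_same, smul_eq_mul, mul_one] at h2
    exact (Nat.one_lt_two_pow hη.ne').ne' h2
  rw [numNonPeriodic, Nat.card_congr (Equiv.subtypeUnivEquiv h1), Nat.card_eq_fintype_card,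
    Fintype.card_fin]

lemma nonzeroEigenvalues_eq : nonzeroEigenvalues (sineGerm n) = 0 := by
  rw [nonzeroEigenvalues, fderiv_zero]
  have h1 : ((0 : (Fin (n + 3) → ℂ) →L[ℂ] (Fin (n + 3) → ℂ)) :
    (Fin (n + 3) → ℂ) →ₗ[ℂ] (Fin (n + 3) → ℂ)) = 0 := rfl
  rw [h1, LinearMap.charpoly_zero, Polynomial.roots_X_pow, Multiset.filter_eq_nil]
  intro c hc
  rw [Multiset.nsmul_singleton] at hc
  simp [Multiset.eq_of_mem_replicate hc]

end sineGerm

/-! ### Rigidity of units and of invariant germs -/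

section

variable {E : Type*} [NormedAddCommGroup E] [NormedSpace ℂ E] [FiniteDimensional ℂ E]
variable {f : E → E} {C Λ : ℝ}

omit [FiniteDimensional ℂ E] in
/-- A unit `U` with `U ∘ f = c U²` is constant. -/
lemma ContractsAtRate.eq_const_of_comp_eq_sq (hf : ContractsAtRate f C Λ) (hfa : AnalyticAt ℂ f 0)
    (h0 : f 0 = 0) {U : E → ℂ} (hU : AnalyticAt ℂ U 0) (hU0 : U 0 ≠ 0) {c : ℂ}
    (h : ∀ᶠ v in 𝓝 0, U (f v) = c * U v ^ 2) : ∀ᶠ v in 𝓝 0, U v = U 0 := by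
  have hft : Tendsto f (𝓝 0) (𝓝 0) := by simpa [h0] using hfa.continuousAt.tendsto
  obtain ⟨φ, hφ, hφ0, hφU⟩ := exists_eq_mul_exp hU hU0
  have hc : c * U 0 = 1 := by
    have h1 := h.self_of_nhds
    rw [h0] at h1
    apply mul_left_cancel₀ hU0
    linear_combination -h1
  have hsmall : ∀ᶠ v in 𝓝 (0 : E), |(φ v).im| < 1 := by
    have h1 : ContinuousAt (fun v => |(φ v).im|) 0 :=
      (Complex.continuous_im.continuousAt.comp hφ.continuousAt).abs
    exact h1.eventually (gt_mem_nhds (by simp [hφ0]))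
  -- With `φ` the logarithm of `U / U 0`, the equation for `U` gives this identity up to multiples
  -- of `2πi`; imaginary parts are too small for a nonzero multiple.
  have hφf : ∀ᶠ v in 𝓝 0, φ (f v) = 2 * φ v := by
    filter_upwards [h, hφU, hft.eventually hφU, hsmall, hft.eventually hsmall]
      with v h1 h2 h3 h4 h5
    rw [h2, h3] at h1
    have h6 : Complex.exp (φ (f v)) = Complex.exp (2 * φ v) := by
      rw [two_mul, Complex.exp_add]
      apply mul_left_cancel₀ hU0
      linear_combination h1 + U 0 * Complex.exp (φ v) ^ 2 * hc
    have hπ := Real.pi_gt_three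
    have h7 := abs_lt.1 h4
    have h8 := abs_lt.1 h5
    have h9 : (2 * φ v).im = 2 * (φ v).im := by simp
    exact Complex.exp_inj_of_neg_pi_lt_of_le_pi (by linarith) (by linarith)
      (by rw [h9]; linarith) (by rw [h9]; linarith) h6
  let M : ℂ ≃L[ℂ] ℂ := ContinuousLinearEquiv.unitsEquivAut ℂ (Units.mk0 2 two_ne_zero)
  have hM : ∀ x, M x = 2 * x := fun x => mul_comm _ _
  have hMs : ∀ x, M.symm x = 2⁻¹ * x := fun x => mul_comm _ _
  have h1 : φ =ᶠ[𝓝 0] 0 := by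
    -- Division by `2` is already contracting, so no vanishing at `0` is required.
    refine hf.eq_zero_of_comp_eq M (N := 0) ?_ ?_ (hφf.mono fun v hv => by rw [hv, hM])
    · rw [pow_zero, mul_one]
      refine lt_of_le_of_lt (ContinuousLinearMap.opNorm_le_bound _ (M := 2⁻¹) (by norm_num)
        fun x => ?_) (by norm_num)
      change ‖M.symm x‖ ≤ _
      rw [hMs]
      simp
    · simp only [pow_zero]
      exact hφ.continuousAt.tendsto.isBigO_one ℝ
  filter_upwards [h1, hφU] with v h2 h3
  rw [h3, h2]
  simp

omit [FiniteDimensional ℂ E] in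
/-- A germ invariant under a contracting germ is constant. -/
lemma ContractsAtRate.eq_const_of_comp_eq (hf : ContractsAtRate f C Λ) {H : E → ℂ}
    (hH : AnalyticAt ℂ H 0) (h : ∀ᶠ v in 𝓝 0, H (f v) = H v) : ∀ᶠ v in 𝓝 0, H v = H 0 := by
  have h1 : (fun v => H v - H 0) =ᶠ[𝓝 0] 0 := by
    refine hf.eq_zero_of_comp_eq (ContinuousLinearEquiv.refl ℂ ℂ) (N := 1) ?_ ?_
      (h.mono fun v hv => by rw [hv]; rfl)
    · have h2 : ‖((ContinuousLinearEquiv.refl ℂ ℂ).symm : ℂ →L[ℂ] ℂ)‖ ≤ 1 :=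
        ContinuousLinearMap.norm_id_le
      rw [pow_one]
      exact lt_of_le_of_lt (mul_le_of_le_one_left hf.rate_pos.le h2) hf.rate_lt
    · have h2 := hH.differentiableAt.hasFDerivAt.isBigO_sub
      simpa using h2.norm_right
  filter_upwards [h1] with v hv
  exact sub_eq_zero.1 hv

/-- A germ of nonzero differential at `0` whose zeros lie on hyperplanes is a unit times one of
their equations. -/
lemma exists_unit_mul_linear {ι : Type*} [Fintype ι] {ℓ : ι → E →L[ℂ] ℂ} (hℓ : ∀ i, ℓ i ≠ 0)
    {φ : E → ℂ} (hφ : AnalyticAt ℂ φ 0) (hφ0 : φ 0 = 0) (hd : fderiv ℂ φ 0 ≠ 0)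
    (hz : ∀ᶠ x in 𝓝 (0 : E), φ x = 0 → ∃ i, ℓ i x = 0) :
    ∃ (i : ι) (U : E → ℂ), AnalyticAt ℂ U 0 ∧ U 0 ≠ 0 ∧ φ =ᶠ[𝓝 0] (fun x => U x * ℓ i x) ∧
      fderiv ℂ φ 0 = U 0 • ℓ i := by
  classical
  obtain ⟨n, u, hu, hu0, h⟩ := exists_unit_mul_prod_linear hℓ hφ hz
  have hi : ∃ i, n i ≠ 0 := by
    by_contra hno
    push Not at hno
    have h1 := h.self_of_nhds
    simp only [hno, hφ0, pow_zero, Finset.prod_const_one, mul_one] at h1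
    exact hu0 h1.symm
  obtain ⟨i, hi⟩ := hi
  set U : E → ℂ := fun x => u x * (ℓ i x ^ (n i - 1) * ∏ j ∈ Finset.univ.erase i, ℓ j x ^ n j)
  have hU : AnalyticAt ℂ U 0 := hu.mul ((((ℓ i).analyticAt 0).pow _).mul
    (Finset.analyticAt_fun_prod _ fun j _ => ((ℓ j).analyticAt 0).pow _))
  have hφU : φ =ᶠ[𝓝 0] fun x => U x * ℓ i x := by
    filter_upwards [h] with x hx
    have h2 : ℓ i x ^ n i = ℓ i x ^ (n i - 1) * ℓ i x := by
      rw [← pow_succ, Nat.sub_add_cancel (Nat.one_le_iff_ne_zero.2 hi)]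
    rw [hx, ← Finset.mul_prod_erase _ _ (Finset.mem_univ i), h2]
    simp only [U]
    ring
  have hdU : fderiv ℂ φ 0 = U 0 • ℓ i := by
    have h1 : HasFDerivAt (fun x => U x * ℓ i x) (U 0 • ℓ i + ℓ i 0 • fderiv ℂ U 0) 0 :=
      hU.differentiableAt.hasFDerivAt.mul (ℓ i).hasFDerivAt
    rw [hφU.fderiv_eq, h1.fderiv]
    ext v
    change U 0 * ℓ i v + ℓ i 0 * fderiv ℂ U 0 v = U 0 * ℓ i v
    rw [_root_.map_zero, zero_mul, add_zero]
  refine ⟨i, U, hU, fun hU0 => hd ?_, hφU, hdU⟩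
  rw [hdU, hU0]
  ext v
  exact zero_mul _

omit [FiniteDimensional ℂ E] in
lemma eventually_eq_of_mul_right {g h φ : E → ℂ} (hg : AnalyticAt ℂ g 0) (hh : AnalyticAt ℂ h 0)
    (hφ : AnalyticAt ℂ φ 0) (hφ0 : ¬ φ =ᶠ[𝓝 0] 0) (he : ∀ᶠ v in 𝓝 0, g v * φ v = h v * φ v) :
    ∀ᶠ v in 𝓝 0, g v = h v := by
  have h1 := eventually_eq_zero_or_of_mul (hg.sub hh) hφ (he.mono fun v hv => by
    rw [Pi.sub_apply, sub_mul, hv, sub_self])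
  exact (h1.resolve_right hφ0).mono fun v hv => sub_eq_zero.1 hv

end

/-- The germ `t ^ 2 * sin t` is not a polynomial. -/
lemma not_eventually_eq_sq_mul_sin {K : ℂ} (hK : K ≠ 0) (P : Polynomial ℂ) :
    ¬ ∀ᶠ t : ℂ in 𝓝 0, P.eval t = K * (t ^ 2 * Complex.sin t) := by
  intro h
  have hP : AnalyticOnNhd ℂ (fun t => P.eval t) Set.univ := fun t _ =>
    P.differentiable.analyticAt t
  have hS : AnalyticOnNhd ℂ (fun t : ℂ => K * (t ^ 2 * Complex.sin t)) Set.univ := fun t _ =>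
    analyticAt_const.mul ((analyticAt_id.pow 2).mul Complex.analyticAt_sin)
  have heq := hP.eq_of_eventuallyEq hS h
  have hP0 : P = 0 := by
    refine Polynomial.eq_zero_of_infinite_isRoot P
      (Set.infinite_of_injective_forall_mem (f := fun k : ℕ => (k : ℂ) * Real.pi) ?_ ?_)
    · intro a b hab
      exact_mod_cast mul_right_cancel₀ (by exact_mod_cast Real.pi_ne_zero) hab
    · intro k
      have h1 := congrFun heq (k * Real.pi)
      rw [Complex.sin_nat_mul_pi, mul_zero, mul_zero] at h1
      exact h1
  have h2 := congrFun heq (Real.pi / 2)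
  rw [hP0, Polynomial.eval_zero, Complex.sin_pi_div_two] at h2
  have h3 : (Real.pi : ℂ) ≠ 0 := by exact_mod_cast Real.pi_ne_zero
  exact mul_ne_zero hK (mul_ne_zero (pow_ne_zero 2 (div_ne_zero h3 two_ne_zero)) one_ne_zero) h2.symm

lemma MvPolynomial.eval_aeval_polynomial {κ : Type*} (χ : κ → Polynomial ℂ) (Q : MvPolynomial κ ℂ)
    (t : ℂ) : (MvPolynomial.aeval χ Q).eval t = MvPolynomial.eval (fun i => (χ i).eval t) Q := by
  have h := MvPolynomial.comp_aeval_apply (φ := Polynomial.aeval (R := ℂ) t) χ Q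
  simpa [MvPolynomial.aeval_eq_eval, Polynomial.aeval_def] using! h

/-! ### Conjugacies from the example to a normal form -/

namespace sineGerm

variable {n : ℕ}

lemma prod_equation_single (k : Fin (n + 2)) (m : ℕ) (v : Fin (n + 3) → ℂ) :
    ∏ i, equation n i v ^ (Pi.single k m : Fin (n + 2) → ℕ) i = v k.succ ^ m := by
  rw [Finset.prod_eq_single k (fun i _ hi => by simp [Pi.single_eq_of_ne hi]) (by simp),
    Pi.single_eq_same]
  rfl

lemma prod_mul_pow (τ : Equiv.Perm (Fin (n + 2))) (a : Fin (n + 2) → ℂ) (m : Fin (n + 2) → ℕ)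
    (v : Fin (n + 3) → ℂ) : ∏ j, (a j * v (τ j).succ) ^ m j =
      (∏ j, a j ^ m j) * ∏ i, equation n i v ^ m (τ.symm i) := by
  simp only [mul_pow, Finset.prod_mul_distrib]
  congr 1
  refine Fintype.prod_equiv τ _ _ fun j => ?_
  rw [τ.symm_apply_apply]
  rfl

lemma proj_ne_zero (k : Fin (n + 3)) :
    ContinuousLinearMap.proj (R := ℂ) (φ := fun _ : Fin (n + 3) => ℂ) k ≠ 0 := by
  intro h
  have h1 := congrFun (congrArg DFunLike.coe h) (Pi.single k 1)
  simp at h1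

lemma not_eventually_coord_zero (k : Fin (n + 2)) :
    ¬ (fun v : Fin (n + 3) → ℂ => v k.succ) =ᶠ[𝓝 0] 0 :=
  isTransverse_equation.not_eventually_zero k

/-- The base coordinates of a conjugacy to a normal form are multiples of coordinates. -/
theorem exists_base_coordinates {N : AffineForm 0 (n + 2)} (hN : N.IsNormalForm)
    {Φ : (Fin (n + 3) → ℂ) → (Fin 0 → ℂ) × (Fin (n + 2) → ℂ) × ℂ} (hΦ : AnalyticAt ℂ Φ 0)
    (hΦ0 : Φ 0 = 0) (hb : Function.Bijective (fderiv ℂ Φ 0))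
    (hconj : Φ ∘ sineGerm n =ᶠ[𝓝 0] N.toMap ∘ Φ) :
    ∃ (τ : Equiv.Perm (Fin (n + 2))) (a : Fin (n + 2) → ℂ), (∀ k, a k ≠ 0) ∧
      (∀ᶠ v in 𝓝 0, ∀ k, (Φ v).2.1 k = a k * v (τ k).succ) ∧
      ∀ u k, (fderiv ℂ Φ 0 u).2.1 k = a k * u (τ k).succ := by
  obtain ⟨C, Λ, hf⟩ := (isContractingRigid (n := n)).contracting.exists_contractsAtRate
  have hΦt : Tendsto Φ (𝓝 0) (𝓝 0) := by simpa [hΦ0] using hΦ.continuousAt.tendsto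
  have hft : Tendsto (sineGerm n) (𝓝 0) (𝓝 0) := by
    simpa [map_zero] using (analyticAt (n := n) 0).continuousAt.tendsto
  let π (k : Fin (n + 2)) : (Fin 0 → ℂ) × (Fin (n + 2) → ℂ) × ℂ →L[ℂ] ℂ :=
    (ContinuousLinearMap.proj k).comp ((ContinuousLinearMap.fst ℂ (Fin (n + 2) → ℂ) ℂ).comp
      (ContinuousLinearMap.snd ℂ (Fin 0 → ℂ) ((Fin (n + 2) → ℂ) × ℂ)))
  set A : Fin (n + 2) → (Fin (n + 3) → ℂ) → ℂ := fun k v => (Φ v).2.1 k with hAdef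
  have hA : ∀ k, AnalyticAt ℂ (A k) 0 := fun k => ((π k).analyticAt _).comp hΦ
  have hA0 : ∀ k, A k 0 = 0 := fun k => by simp [hAdef, hΦ0]
  have hdA : ∀ k u, fderiv ℂ (A k) 0 u = (fderiv ℂ Φ 0 u).2.1 k := by
    intro k u
    have h1 : HasFDerivAt (A k) ((π k).comp (fderiv ℂ Φ 0)) 0 :=
      (π k).hasFDerivAt.comp 0 hΦ.differentiableAt.hasFDerivAt
    rw [h1.fderiv]
    rfl
  have hsurj : ∀ k, ∃ u, ∀ j, fderiv ℂ (A j) 0 u = (Pi.single k 1 : Fin (n + 2) → ℂ) j := by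
    intro k
    obtain ⟨u, hu⟩ := hb.2 (0, Pi.single k 1, 0)
    exact ⟨u, fun j => by rw [hdA, hu]⟩
  have hAcomp : ∀ k, ∀ᶠ v in 𝓝 0, A k (sineGerm n v) = N.β k * ∏ j, A j v ^ N.D j k := by
    intro k
    filter_upwards [hconj] with v hv
    have h1 : A k (sineGerm n v) = (N.toMap (Φ v)).2.1 k :=
      congrFun (congrArg (fun t => t.2.1) hv) k
    -- With `s = 0` there are no variables `x`: the polynomial is constant, and its constant term is
    -- zero.
    have hg : N.g k = 0 := by
      have h2 := hN.g_zero k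
      rw [MvPolynomial.eq_C_of_isEmpty (N.g k), MvPolynomial.constantCoeff_C] at h2
      rw [MvPolynomial.eq_C_of_isEmpty (N.g k), h2, _root_.map_zero]
    rw [h1]
    simp [AffineForm.toMap, monomialMap, hg, hAdef]
  have hzero : ∀ᶠ v in 𝓝 0, (∃ k, A k v = 0) → ∃ k : Fin (n + 2), v k.succ = 0 := by
    filter_upwards [hΦt.eventually hN.critInf_eq, hf.mem_critInf_iff (analyticAt 0) map_zero
      (N.analyticAt_toMap hN.ω_analytic) hΦ hΦ0 hb hconj] with v h1 h2 h3
    rw [← mem_critInf, ← h2, h1]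
    exact Or.inr h3
  -- Each base coordinate of the conjugacy vanishes only on the critical hyperplanes and has nonzero
  -- differential, so it is a unit times a single coordinate.
  choose τ U hU hU0 hAU hdU using fun k => exists_unit_mul_linear
    (ℓ := fun k : Fin (n + 2) =>
      ContinuousLinearMap.proj (R := ℂ) (φ := fun _ : Fin (n + 3) => ℂ) k.succ)
    (fun k => proj_ne_zero _) (hA k) (hA0 k) (fun h => by
      obtain ⟨u, hu⟩ := hsurj k
      have h1 := hu k
      rw [h, Pi.single_eq_same] at h1
      exact zero_ne_one h1) (hzero.mono fun v hv h => hv ⟨k, h⟩)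
  have hdU' : ∀ k u, fderiv ℂ (A k) 0 u = U k 0 * u (τ k).succ := fun k u => by
    rw [hdU k]; rfl
  have hτ : Function.Injective τ := by
    intro k k' hkk
    by_contra hne
    obtain ⟨u, hu⟩ := hsurj k
    have h1 := hu k
    have h2 := hu k'
    rw [hdU', Pi.single_eq_same] at h1
    rw [hdU', Pi.single_eq_of_ne (Ne.symm hne)] at h2
    have h3 := (mul_eq_zero.1 h2).resolve_left (hU0 k')
    rw [hkk, h3, mul_zero] at h1
    exact zero_ne_one h1
  let τ' : Equiv.Perm (Fin (n + 2)) := Equiv.ofBijective τ (Finite.injective_iff_bijective.1 hτ)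
  have hUf : ∀ k, AnalyticAt ℂ (fun v => U k (sineGerm n v)) 0 := fun k =>
    AnalyticAt.comp (g := U k) (by rw [map_zero]; exact hU k) (analyticAt 0)
  have hAU' := eventually_all.2 hAU
  -- The multiplicities of `A k ∘ f` along the hyperplanes are computed twice: from the squaring map
  -- on the source, and from the monomials of the normal form.
  have hD : ∀ j k, N.D j k = if j = k then 2 else 0 := by
    intro j k
    have h1 := multAlong_eq isTransverse_equation (n := Pi.single (τ k) 2)
      (φ := A k ∘ sineGerm n) (hUf k) (by rw [map_zero]; exact hU0 k) (by
        filter_upwards [hft.eventually (hAU k)] with v hv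
        rw [prod_equation_single]
        exact hv) (τ' j)
    have h2 := multAlong_eq isTransverse_equation (n := fun i => N.D (τ'.symm i) k)
      (φ := A k ∘ sineGerm n) (u := fun v => N.β k * ∏ j, U j v ^ N.D j k)
      (analyticAt_const.mul (Finset.analyticAt_fun_prod _ fun j _ => (hU j).pow _))
      (mul_ne_zero (hN.β_ne k) (Finset.prod_ne_zero_iff.2 fun j _ => pow_ne_zero _ (hU0 j))) (by
        filter_upwards [hAcomp k, hAU'] with v h3 h4
        rw [Function.comp_apply, h3, mul_assoc, ← prod_mul_pow τ' (fun j => U j v)]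
        simp only [h4]
        rfl) (τ' j)
    rw [h1, τ'.symm_apply_apply, Pi.single_apply] at h2
    rw [← h2]
    exact if_congr τ'.injective.eq_iff rfl rfl
  have hUsq : ∀ k, ∀ᶠ v in 𝓝 0, U k (sineGerm n v) = N.β k * U k v ^ 2 := by
    intro k
    have hy := (ContinuousLinearMap.proj (R := ℂ) (φ := fun _ : Fin (n + 3) => ℂ)
      (τ k).succ).analyticAt (0 : Fin (n + 3) → ℂ)
    refine eventually_eq_of_mul_right (φ := fun v => v (τ k).succ ^ 2) (hUf k)
      (analyticAt_const.mul ((hU k).pow 2)) (hy.pow 2) ?_ ?_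
    · intro h
      exact not_eventually_coord_zero (τ k) (h.mono fun v hv => pow_eq_zero_iff two_ne_zero |>.1 hv)
    · filter_upwards [hAcomp k, hft.eventually (hAU k), hAU k] with v h1 h2 h3
      rw [Finset.prod_eq_single k (fun j _ hj => by rw [hD, if_neg hj, pow_zero]) (by simp), hD,
        if_pos rfl, h3, h2] at h1
      change U k (sineGerm n v) * v (τ k).succ ^ 2 = N.β k * (U k v * v (τ k).succ) ^ 2 at h1
      rw [h1]
      ring
  have hconst := eventually_all.2 fun k =>
    hf.eq_const_of_comp_eq_sq (analyticAt 0) map_zero (hU k) (hU0 k) (hUsq k)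
  refine ⟨τ', fun k => U k 0, hU0, ?_, fun u k => by rw [← hdA, hdU']; rfl⟩
  filter_upwards [hAU', hconst] with v h1 h2 k
  rw [← h2 k]
  exact h1 k

/-- The last coordinate of a conjugacy to a normal form is affine in `z`. -/
theorem exists_last_coordinate {N : AffineForm 0 (n + 2)} (hN : N.IsNormalForm)
    {Φ : (Fin (n + 3) → ℂ) → (Fin 0 → ℂ) × (Fin (n + 2) → ℂ) × ℂ} (hΦ : AnalyticAt ℂ Φ 0)
    (hb : Function.Bijective (fderiv ℂ Φ 0))
    (hconj : Φ ∘ sineGerm n =ᶠ[𝓝 0] N.toMap ∘ Φ) {τ : Equiv.Perm (Fin (n + 2))}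
    {a : Fin (n + 2) → ℂ} (ha : ∀ k, a k ≠ 0)
    (hΦa : ∀ᶠ v in 𝓝 0, ∀ k, (Φ v).2.1 k = a k * v (τ k).succ)
    (hdΦ : ∀ u k, (fderiv ℂ Φ 0 u).2.1 k = a k * u (τ k).succ) :
    ∃ K : ℂ, K ≠ 0 ∧ (∀ᶠ v in 𝓝 0, (Φ v).2.2 = K * v 0 + (Φ (v - v 0 • Pi.single 0 1)).2.2) ∧
      ∀ᶠ v in 𝓝 0, v (Fin.succ 0) = 0 →
        (Φ (sineGerm n v)).2.2 = N.ω (0, fun k => a k * v (τ k).succ) := by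
  obtain ⟨C, Λ, hf⟩ := (isContractingRigid (n := n)).contracting.exists_contractsAtRate
  have hft : Tendsto (sineGerm n) (𝓝 0) (𝓝 0) := by
    simpa [map_zero] using (analyticAt (n := n) 0).continuousAt.tendsto
  set e : Fin (n + 3) → ℂ := Pi.single 0 1 with he
  have he0 : e 0 = 1 := Pi.single_eq_same _ _
  have hes : ∀ k : Fin (n + 2), e k.succ = 0 := fun k => Pi.single_eq_of_ne (Fin.succ_ne_zero k) _
  let ℓ : (Fin 0 → ℂ) × (Fin (n + 2) → ℂ) × ℂ →L[ℂ] ℂ :=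
    (ContinuousLinearMap.snd ℂ (Fin (n + 2) → ℂ) ℂ).comp
      (ContinuousLinearMap.snd ℂ (Fin 0 → ℂ) ((Fin (n + 2) → ℂ) × ℂ))
  set B : (Fin (n + 3) → ℂ) → ℂ := fun v => (Φ v).2.2 with hBdef
  have hB : AnalyticAt ℂ B 0 := (ℓ.analyticAt _).comp hΦ
  set H : (Fin (n + 3) → ℂ) → ℂ := fun v => fderiv ℂ B v e with hHdef
  have hH : AnalyticAt ℂ H 0 := ((ContinuousLinearMap.apply ℂ ℂ e).analyticAt _).comp hB.fderiv
  have hH0 : H 0 ≠ 0 := by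
    have h1 : HasFDerivAt B (ℓ.comp (fderiv ℂ Φ 0)) 0 :=
      ℓ.hasFDerivAt.comp 0 hΦ.differentiableAt.hasFDerivAt
    intro h2
    have h3 : (fderiv ℂ Φ 0 e).2.2 = 0 := by
      rw [hHdef] at h2
      dsimp only at h2
      rw [h1.fderiv] at h2
      exact h2
    have h4 : fderiv ℂ Φ 0 e = fderiv ℂ Φ 0 0 := by
      rw [_root_.map_zero]
      refine Prod.ext (Subsingleton.elim _ _) (Prod.ext (funext fun k => ?_) h3)
      rw [hdΦ, hes, mul_zero]
      rfl
    have h5 := congrFun (hb.1 h4) 0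
    rw [he0] at h5
    exact one_ne_zero h5
  set μ : (Fin (n + 3) → ℂ) → ℂ := fun v => N.ν * ∏ j, (a j * v (τ j).succ) ^ N.m j with hμdef
  have hBcomp : ∀ᶠ v in 𝓝 0, B (sineGerm n v) =
      μ v * B v + N.ω (0, fun k => a k * v (τ k).succ) := by
    filter_upwards [hconj, hΦa] with v h1 h2
    have h3 : B (sineGerm n v) = (N.toMap (Φ v)).2.2 := congrArg (fun t => t.2.2) h1
    have h4 : (Φ v).2.1 = fun k => a k * v (τ k).succ := funext h2
    have h5 : (Φ v).1 = 0 := Subsingleton.elim _ _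
    rw [h3]
    simp [AffineForm.toMap, h4, h5, hBdef, hμdef]
  -- Differentiation of the conjugacy equation along `z`, on which neither `μ` nor the term in `ω`
  -- depends.
  have hHcomp : ∀ᶠ v in 𝓝 0, v (Fin.succ 0) * H (sineGerm n v) = μ v * H v := by
    filter_upwards [hBcomp.eventually_nhds, hB.eventually_analyticAt,
      hft.eventually hB.eventually_analyticAt] with v h1 h2 h3
    have hline : HasDerivAt (fun t : ℂ => v + t • e) e 0 := by
      simpa using ((hasDerivAt_id (0 : ℂ)).smul_const e).const_add v
    have hv0 : v + (0 : ℂ) • e = v := by simp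
    have hfe : fderiv ℂ (sineGerm n) v e = v (Fin.succ 0) • e := by
      funext i
      refine Fin.cases ?_ (fun k => ?_) i
      · rw [fderiv_apply_zero, hes, hes, he0]
        simp [he0]
      · rw [fderiv_apply_succ, Pi.smul_apply, hes]
        simp
    have hd1 : HasDerivAt (fun t : ℂ => B (sineGerm n (v + t • e)))
        (v (Fin.succ 0) * H (sineGerm n v)) 0 := by
      have h4 : HasFDerivAt (fun v => B (sineGerm n v))
          ((fderiv ℂ B (sineGerm n v)).comp (fderiv ℂ (sineGerm n) v)) (v + (0 : ℂ) • e) := by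
        rw [hv0]
        exact HasFDerivAt.comp v h3.differentiableAt.hasFDerivAt
          (analyticAt v).differentiableAt.hasFDerivAt
      have h5 := h4.comp_hasDerivAt (0 : ℂ) hline
      have h6 : ((fderiv ℂ B (sineGerm n v)).comp (fderiv ℂ (sineGerm n) v)) e =
          v (Fin.succ 0) * H (sineGerm n v) := by
        rw [ContinuousLinearMap.comp_apply, hfe, _root_.map_smul]
        rfl
      rw [h6] at h5
      exact h5
    have hd2 : HasDerivAt (fun t : ℂ => μ v * B (v + t • e) +
        N.ω (0, fun k => a k * v (τ k).succ)) (μ v * H v) 0 := by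
      have h4 : HasFDerivAt B (fderiv ℂ B v) (v + (0 : ℂ) • e) := by
        rw [hv0]
        exact h2.differentiableAt.hasFDerivAt
      exact ((h4.comp_hasDerivAt (0 : ℂ) hline).const_mul (μ v)).add_const _
    refine hd1.unique (hd2.congr_of_eventuallyEq ?_)
    have hcont : Tendsto (fun t : ℂ => v + t • e) (𝓝 0) (𝓝 v) := by
      have : Continuous fun t : ℂ => v + t • e := by fun_prop
      simpa using this.tendsto 0
    filter_upwards [hcont.eventually h1] with t ht
    have h5 : ∀ k : Fin (n + 2), (v + t • e) k.succ = v k.succ := fun k => by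
      simp [hes]
    simp only [ht, hμdef, h5]
  set c : ℂ := N.ν * ∏ j, a j ^ N.m j with hc
  have hc0 : c ≠ 0 := mul_ne_zero hN.ν_ne (Finset.prod_ne_zero_iff.2 fun j _ => pow_ne_zero _ (ha j))
  have hμc : ∀ v, μ v = c * ∏ i, equation n i v ^ N.m (τ.symm i) := fun v => by
    rw [hμdef]
    dsimp only
    rw [prod_mul_pow, hc, mul_assoc]
  have hHf : AnalyticAt ℂ (fun v => H (sineGerm n v)) 0 :=
    AnalyticAt.comp (g := H) (by rw [map_zero]; exact hH) (analyticAt 0)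
  -- Comparing multiplicities on the two sides of the previous relation, where `H` and `H ∘ f` are
  -- units, shows that `μ` is a constant times the first `y` coordinate.
  have hm : ∀ i, N.m (τ.symm i) = (Pi.single 0 1 : Fin (n + 2) → ℕ) i := by
    intro i
    have h1 := multAlong_eq isTransverse_equation (n := Pi.single 0 1)
      (φ := fun v => μ v * H v) hHf (by rw [map_zero]; exact hH0) (by
        filter_upwards [hHcomp] with v hv
        rw [prod_equation_single, pow_one, ← hv, mul_comm]) i
    have h2 := multAlong_eq isTransverse_equation (n := fun i => N.m (τ.symm i))
      (φ := fun v => μ v * H v) (u := fun v => c * H v) (analyticAt_const.mul hH)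
      (mul_ne_zero hc0 hH0) (Eventually.of_forall fun v => by
        dsimp only
        rw [hμc]
        ring) i
    rw [← h1, h2]
  have hμ1 : ∀ v, μ v = c * v (Fin.succ 0) := fun v => by
    rw [hμc]
    simp only [hm]
    rw [prod_equation_single, pow_one]
  have hHc : ∀ᶠ v in 𝓝 0, H (sineGerm n v) = c * H v := by
    refine eventually_eq_of_mul_right (φ := fun v => v (Fin.succ 0)) hHf (analyticAt_const.mul hH)
      ((ContinuousLinearMap.proj (R := ℂ) (φ := fun _ : Fin (n + 3) => ℂ)
        (Fin.succ 0)).analyticAt 0) (not_eventually_coord_zero 0) ?_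
    filter_upwards [hHcomp] with v hv
    rw [hμ1] at hv
    linear_combination hv
  have hc1 : c = 1 := by
    have h1 := hHc.self_of_nhds
    rw [map_zero] at h1
    apply mul_right_cancel₀ hH0
    rw [← h1, one_mul]
  have hHconst := hf.eq_const_of_comp_eq hH (hHc.mono fun v hv => by rw [hv, hc1, one_mul])
  refine ⟨H 0, hH0, ?_, ?_⟩
  · let p : (Fin (n + 3) → ℂ) →L[ℂ] ℂ := ContinuousLinearMap.proj 0
    have hG : AnalyticAt ℂ (fun v => B v - H 0 * p v) 0 :=
      hB.sub (analyticAt_const.mul (p.analyticAt 0))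
    have h1 := eventually_eq_of_fderiv_eq_zero (ℓ := p) (e := e) hG (by
      filter_upwards [hHconst, hB.eventually_analyticAt] with v h1 h2
      have h3 : HasFDerivAt (fun v => B v - H 0 * p v) (fderiv ℂ B v - H 0 • p) v :=
        h2.differentiableAt.hasFDerivAt.sub (p.hasFDerivAt.const_mul _)
      rw [h3.fderiv]
      change H v - H 0 * e 0 = 0
      rw [he0, h1]
      ring)
    filter_upwards [h1] with v hv
    have h2 : p (v - p v • e) = 0 := by
      change v 0 - v 0 * e 0 = 0
      rw [he0]
      ring
    rw [h2, mul_zero, sub_zero] at hv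
    rw [← sub_eq_iff_eq_add']
    exact hv
  · filter_upwards [hBcomp] with v hv hv0
    rw [hμ1, hv0, mul_zero, zero_mul, zero_add] at hv
    exact hv

/-- On the axis of the second `y` coordinate the first one vanishes, so the monomial term drops out
and `ω`, restricted to a line, is `K t² sin t` plus a function of `t²`. -/
theorem not_conjugate_polynomialTail {N : AffineForm 0 (n + 2)} (hN : N.IsNormalForm)
    (hQ : N.PolynomialTail) : ¬ AnalyticallyConjugate (sineGerm n) N.toMap := by
  rintro ⟨Φ, hΦ, hΦ0, hb, hconj⟩
  obtain ⟨τ, a, ha, hΦa, hdΦ⟩ := exists_base_coordinates hN hΦ hΦ0 hb hconj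
  obtain ⟨K, hK, hK1, hK2⟩ := exists_last_coordinate hN hΦ hb hconj ha hΦa hdΦ
  obtain ⟨Q, hQ⟩ := hQ
  have hft : Tendsto (sineGerm n) (𝓝 0) (𝓝 0) := by
    simpa [map_zero] using (analyticAt (n := n) 0).continuousAt.tendsto
  let L : ℂ → Fin (n + 3) → ℂ := fun t => Pi.single (Fin.succ 1) t
  have hLs : ∀ t (k : Fin (n + 2)), L t k.succ = if k = 1 then t else 0 := fun t k =>
    (Pi.single_apply _ _ _).trans (if_congr Fin.succ_inj rfl rfl)
  have hLc : Continuous L :=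
    (ContinuousLinearMap.single ℂ (fun _ : Fin (n + 3) => ℂ) (Fin.succ 1)).continuous
  have hLt : Tendsto L (𝓝 0) (𝓝 0) := by
    simpa [L] using hLc.tendsto 0
  let P : Polynomial ℂ := MvPolynomial.aeval
    (Sum.elim (fun _ : Fin 0 => (0 : Polynomial ℂ))
      fun k => Polynomial.C (a k) * if τ k = 1 then Polynomial.X else 0) Q
  have hP : ∀ᶠ t in 𝓝 0, (Φ (sineGerm n (L t))).2.2 = P.eval t := by
    have hcont : Tendsto (fun t : ℂ => ((0 : Fin 0 → ℂ), fun k => a k * L t (τ k).succ))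
        (𝓝 0) (𝓝 0) := by
      have h1 : Continuous (fun t : ℂ => ((0 : Fin 0 → ℂ), fun k => a k * L t (τ k).succ)) := by
        fun_prop
      have h2 := h1.tendsto 0
      have h3 : ((0 : Fin 0 → ℂ), fun k => a k * L 0 (τ k).succ) = 0 := by
        refine Prod.ext rfl (funext fun k => ?_)
        simp [L]
      rwa [h3] at h2
    filter_upwards [hLt.eventually hK2, hcont.eventually hQ] with t h1 h2
    rw [h1 (by rw [hLs]; simp), h2]
    rw [MvPolynomial.eval_aeval_polynomial]
    congr 2
    funext i
    rcases i with i | k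
    · exact i.elim0
    · simp only [Sum.elim_inr, hLs]
      split_ifs <;> simp
  -- The unknown remainder of the last coordinate of `Φ` is evaluated at `t ^ 2`, hence even in `t`,
  -- and cancels from the odd part.
  have hodd : ∀ᶠ t in 𝓝 (0 : ℂ), (P - P.comp (-Polynomial.X)).eval t =
      2 * K * (t ^ 2 * Complex.sin t) := by
    have hneg : Tendsto (fun t : ℂ => -t) (𝓝 0) (𝓝 0) := by
      simpa using (continuous_neg (G := ℂ)).tendsto 0
    have hval : ∀ᶠ t in 𝓝 (0 : ℂ), P.eval t = K * (t ^ 2 * Complex.sin t) +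
        (Φ (Pi.single (Fin.succ 1) (t ^ 2))).2.2 := by
      filter_upwards [hP, (hft.comp hLt).eventually hK1] with t h1 h2
      rw [← h1]
      have h3 : sineGerm n (L t) 0 = t ^ 2 * Complex.sin t := by
        rw [apply_zero, hLs, hLs]
        simp
      have h4 : sineGerm n (L t) - sineGerm n (L t) 0 • Pi.single 0 1 =
          Pi.single (Fin.succ 1) (t ^ 2) := by
        funext i
        refine Fin.cases ?_ (fun k => ?_) i
        · rw [Pi.sub_apply, Pi.smul_apply, Pi.single_eq_same,
            Pi.single_eq_of_ne (Fin.succ_ne_zero 1).symm]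
          simp
        · rw [Pi.sub_apply, Pi.smul_apply, apply_succ, hLs,
            Pi.single_eq_of_ne (Fin.succ_ne_zero k), smul_zero, sub_zero, Pi.single_apply]
          simp only [Fin.succ_inj]
          split_ifs <;> simp
      simp only [Function.comp_apply] at h2
      rw [h4, h3] at h2
      exact h2
    filter_upwards [hval, hneg.eventually hval] with t h1 h2
    rw [Polynomial.eval_sub, Polynomial.eval_comp, Polynomial.eval_neg, Polynomial.eval_X, h1, h2,
      Complex.sin_neg, neg_sq]
    ring
  exact not_eventually_eq_sq_mul_sin (mul_ne_zero two_ne_zero hK) _ hodd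

end sineGerm

theorem mainTheorem4 :
    (∀ (d : ℕ) (f : (Fin d → ℂ) → (Fin d → ℂ)) (q : ℕ) (w : Fin q → (Fin d → ℂ) → ℂ) (s p : ℕ),
      IsContractingRigid f w →
      HasInjectiveInternalAction f w →
      s = (nonzeroEigenvalues f).card →
      p = numNonPeriodic f w →
      s + p + 1 = d →
      ∃ N : AffineForm s p, N.IsNormalForm ∧ AnalyticallyConjugate f N.toMap) ∧
    (∀ d : ℕ, 3 ≤ d →
      ∃ (f : (Fin d → ℂ) → (Fin d → ℂ)) (q : ℕ) (w : Fin q → (Fin d → ℂ) → ℂ) (s p : ℕ),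
        IsContractingRigid f w ∧
        HasInjectiveInternalAction f w ∧
        s = (nonzeroEigenvalues f).card ∧
        p = numNonPeriodic f w ∧
        s + p + 1 = d ∧
        ¬ ∃ N : AffineForm s p, N.IsNormalForm ∧ N.PolynomialTail ∧
          AnalyticallyConjugate f N.toMap) := by
  refine ⟨fun d f q w s p h hA hs hp hd =>
    h.exists_normalForm hA hs hp (by rw [Module.finrank_fin_fun, hd]), fun d hd => ?_⟩
  obtain ⟨n, rfl⟩ := Nat.exists_eq_add_of_le' hd
  -- Here `d = n + 3`: the differential at `0` is zero, so `s = 0`, and none of the `n + 2`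
  -- components is periodic.
  refine ⟨sineGerm n, n + 2, sineGerm.equation n, 0, n + 2, sineGerm.isContractingRigid,
    sineGerm.hasInjectiveInternalAction, ?_, sineGerm.numNonPeriodic_eq.symm, by omega, ?_⟩
  · rw [sineGerm.nonzeroEigenvalues_eq, Multiset.card_zero]
  · rintro ⟨N, hN, hQ, hconj⟩
    exact sineGerm.not_conjugate_polynomialTail hN hQ hconj
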